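/- **Setting.** Let $\Phi$ be an irreducible reduced (crystallographic) root system in a Euclidean space $E$, with Weyl group $W$, simple roots $\alpha_1,\dots,\alpha_\ell$ numbered as in Bourbaki, highest root $\tilde\alpha=\sum_{i=1}^{\ell} n_i\alpha_i$, and coweight lattice $Z=\{x\in E : (\alpha,x)\in\mathbb Z \text{ for all }\alpha\in\Phi\}$. Here $\Phi$ is of one of the types $A_\ell$ ($\ell\ge1$), $B_\ell$ ($\ell\ge2$), $C_\ell$ ($\ell\ge3$), $D_\ell$ ($\ell\ge4$), $E_6,E_7,E_8,F_4,G_2$. For an integer $q\ge1$ let $M(\Phi;q)=\{x+qZ\in Z/qZ : (\beta,x)\not\equiv0 \pmod q \text{ for all }\beta\in\Phi\}$, and let $\chi_{\Phi,q}$ be the permutation character of $W$ on $M(\Phi;q)$; thus $\chi_{\Phi,q}(w)$ is the number of points of $M(\Phi;q)$ fixed by $w$. For a set $S$ of vectors and a lattice $L$ such that $(\beta,x)\in\mathbb Z$ for all $\beta\in S$, $x\in L$, let $\chi^{\mathrm{quasi}}_{S,L}(q)=\#\{x+qL\in L/qL : (\beta,x)\not\equiv 0\pmod q\text{ for all }\beta\in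 S\}$. Let $A_\circ=\{x : (\alpha_i,x)>0 \text{ for } 1\le i\le\ell,\ (\tilde\alpha,x)<1\}$ be the fundamental alcove. The group $W$ acts on the torus $E/Z$, hence on $P^\diamond=\{x : 0<(\alpha_i,x)\le1 \text{ for } 1\le i\le\ell\}\supseteq A_\circ$, a set of representatives of $E/Z$; let $W_{A_\circ}$ be the stabilizer of $A_\circ$ under this action. Put $n_0=1$, $J=\{j\in\{0,\dots,\ell\} : n_j=1\}$, $\omega_0=1$, and $\omega_j=w_jw_0$ for $j\in J\setminus\{0\}$, where $w_0$ is the longest element of $W$ and $w_j$ the longest element of the subgroup generated by the reflections in the $\alpha_i$, $i\ne j$. For $\omega\in W_{A_\circ}$ of order $o(\omega)$ let $x^\omega=\frac1{o(\omega)}\sum_{t=1}^{o(\omega)}\omega^t(x)$, let $E^\omega$ be the space of fixed points of $\omega$, let $\Phi^\omega_{\mathrm{re}}=\{\beta^\omega : \beta\in\Phi,\ \beta^\omega\ne0\}$ be the folded root system, and let $M=\{x\in E^\omega : (\beta,x)\in\mathbb Z\text{ for all }\beta\in\Phi^\omega_{\mathrm{re}}\}$ be its coweight lattice. Let $c(q)=\varphi(o(\omega))$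 (Euler's totient) if $o(\omega)\mid q$, and $c(q)=0$ otherwise. **Theorem.** Every $\omega\in W_{A_\circ}$ is of the form $\omega=\omega_j$ with $j\in J$. If $j=0$ (that is, $\omega=1$), put $\Phi'=\Phi$ and $d=1$; if $j\ne0$, then $(\Phi,j)$ occurs in exactly one row of the following table, $\Phi^\omega_{\mathrm{re}}$ is of the type listed there, and we let $\Phi'$ and $d$ be as listed there. Then for all integers $q\ge1$ $$\chi_{\Phi,q}(\omega)=c(q)\cdot\chi^{\mathrm{quasi}}_{d\Phi',\,M}(q).$$ | $\Phi$ | $j$ | $\Phi^\omega_{\mathrm{re}}$ | $\Phi'$ | $d$ | |---|---|---|---|---| | $A_\ell$ | $1\le j\le\ell$, $\gcd(\ell+1,j)=1$ | $\varnothing$ | $\varnothing$ | $1$ | | $A_\ell$ | $1\le j\le\ell$, $g=\gcd(\ell+1,j)\ne1$ | $A_{g-1}$ | $A_{g-1}$ | $(\ell+1)/g$ | | $B_2$ | $1$ | $A_1$ | $A_1$ | $2$ | | $B_\ell$ ($\ell\ge3$) | $1$ | $B_{\ell-1}$ | $C_{\ell-1}$ | $1$ | | $C_\ell$ ($\ell\ge3$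 odd) | $\ell$ | $BC_{(\ell-1)/2}$ | $BC_{(\ell-1)/2}$ | $2$ | | $C_\ell$ ($\ell\ge4$ even) | $\ell$ | $C_{\ell/2}$ | $C_{\ell/2}$ | $2$ | | $D_\ell$ ($\ell\ge4$) | $1$ | $B_{\ell-2}$ | $C_{\ell-2}$ | $1$ | | $D_\ell$ ($\ell\ge4$ even) | $\ell-1,\ \ell$ | $C_{\ell/2}$ | $B_{\ell/2}$ | $2$ | | $D_\ell$ ($\ell\ge5$ odd) | $\ell-1,\ \ell$ | $BC_{(\ell-3)/2}$ | $C_{(\ell-3)/2}$ | $2$ | | $E_6$ | $1,\ 6$ | $G_2$ | $(\Phi^\omega_{\mathrm{re}})^\vee$ | $1$ | | $E_7$ | $7$ | $F_4$ | $(\Phi^\omega_{\mathrm{re}})^\vee$ | $1$ | Here $\Phi'$ lies in $E^\omega$ and is described in the same coordinates as $\Phi^\omega_{\mathrm{re}}$: if coordinates are chosen so that $\Phi^\omega_{\mathrm{re}}$ is the standard model of its type, then $\Phi'$ is the standard model of the listed type in these coordinates, where the standard models are $A_n=\{e_i-e_j : i\ne j\}$, $B_n=\{\pm e_i\pm e_j\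 (i\neq j),\ \pm e_k\}$, $C_n=\{\pm e_i\pm e_j\ (i\ne j),\ \pm2e_k\}$ and $BC_n=B_n\cup C_n$. In the last two rows $(\Phi^\omega_{\mathrm{re}})^\vee=\{2\beta/(\beta,\beta) : \beta\in\Phi^\omega_{\mathrm{re}}\}$ is formed with the inner product normalized so that the long roots of $\Phi^\omega_{\mathrm{re}}$ (equivalently, the roots of $\Phi$) have squared length $2$. -/

import Mathlib

/-! ### Standard coordinate models of root systems

The vectors `stdE n 1, …, stdE n n` are the standard basis of `ℝⁿ` (numbered from one). -/

/-- The standard basis vector `e_k` of `ℝⁿ`, for `1 ≤ k ≤ n`. -/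
def stdE (n k : ℕ) : Fin n → ℝ := fun i => if (i : ℕ) + 1 = k then 1 else 0

/-- A sign `±1`, as a real number. -/
def sgnR (s : ℤˣ) : ℝ := ((s : ℤ) : ℝ)

/-- The vectors `± e_i ± e_j` with `i ≠ j`. -/
def pairVectors (n : ℕ) : Set (Fin n → ℝ) :=
  {v | ∃ i j : Fin n, i ≠ j ∧ ∃ s t : ℤˣ, v = Pi.single i (sgnR s) + Pi.single j (sgnR t)}

/-- The vectors `± c e_i`. -/
def axisVectors (c : ℝ) (n : ℕ) : Set (Fin n → ℝ) :=
  {v | ∃ i : Fin n, ∃ s : ℤˣ, v = Pi.single i (sgnR s * c)}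

/-- `A_n` in `ℝⁿ⁺¹`: the vectors `e_i - e_j` with `i ≠ j`. In particular `A_0 = ∅`. -/
def rootsA (n : ℕ) : Set (Fin (n + 1) → ℝ) :=
  {v | ∃ i j : Fin (n + 1), i ≠ j ∧ v = Pi.single i 1 - Pi.single j 1}

/-- `B_n`: the vectors `± e_i ± e_j` with `i ≠ j`, and `± e_k`. -/
def rootsB (n : ℕ) : Set (Fin n → ℝ) := pairVectors n ∪ axisVectors 1 n

/-- `C_n`: the vectors `± e_i ± e_j` with `i ≠ j`, and `± 2 e_k`. -/
def rootsC (n : ℕ) : Set (Fin n → ℝ) := pairVectors n ∪ axisVectors 2 n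

/-- `BC_n`: the vectors `± e_i ± e_j` with `i ≠ j`, `± e_k` and `± 2 e_k`. -/
def rootsBC (n : ℕ) : Set (Fin n → ℝ) := pairVectors n ∪ axisVectors 1 n ∪ axisVectors 2 n

/-- `D_n`: the vectors `± e_i ± e_j` with `i ≠ j`. -/
def rootsD (n : ℕ) : Set (Fin n → ℝ) := pairVectors n

/-- `E_8`: the vectors `± e_i ± e_j` with `i ≠ j`, and `(± e_1 ± ⋯ ± e_8) / 2` with an even number
of minus signs. -/
def rootsE8 : Set (Fin 8 → ℝ) :=
  pairVectors 8 ∪ {v | ∃ ν : Fin 8 → ℤˣ, ∏ i, ν i = 1 ∧ v = fun i => sgnR (ν i) / 2}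

/-- `E_7`: the roots of `E_8` in the hyperplane `x_7 = - x_8`. -/
def rootsE7 : Set (Fin 8 → ℝ) := {v | v ∈ rootsE8 ∧ v 6 = - v 7}

/-- `E_6`: the roots of `E_8` in the subspace `x_6 = x_7 = - x_8`. -/
def rootsE6 : Set (Fin 8 → ℝ) := {v | v ∈ rootsE8 ∧ v 5 = v 6 ∧ v 6 = - v 7}

/-- `F_4`: the vectors `± e_i ± e_j` with `i ≠ j`, `± e_k` and `(± e_1 ± e_2 ± e_3 ± e_4) / 2`. -/
def rootsF4 : Set (Fin 4 → ℝ) :=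
  pairVectors 4 ∪ axisVectors 1 4 ∪ {v | ∃ ν : Fin 4 → ℤˣ, v = fun i => sgnR (ν i) / 2}

/-- `G_2` in `ℝ³`: the vectors `e_i - e_j` with `i ≠ j`, and
`± (2 e_i - e_j - e_k) = ± (3 e_i - (e_1 + e_2 + e_3))`. -/
def rootsG2 : Set (Fin 3 → ℝ) :=
  rootsA 2 ∪ {v | ∃ i : Fin 3, ∃ s : ℤˣ, v = sgnR s • (Pi.single i 3 - fun _ => (1 : ℝ))}

/-- The dual root system `{β^∨ = 2 β / (β, β)}` of `R`, formed with respect to the inner product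
that is the multiple of the standard one for which vectors of standard squared length `c` have
squared length two; so `β^∨ = (c / (β · β)) β`. -/
noncomputable def dualRoots {n : ℕ} (c : ℝ) (R : Set (Fin n → ℝ)) : Set (Fin n → ℝ) :=
  {v | ∃ β ∈ R, v = (c / (β ⬝ᵥ β)) • β}

/-- The types of irreducible reduced root systems. -/
inductive DynkinType : Type
  | A (l : ℕ) (h : 1 ≤ l)
  | B (l : ℕ) (h : 2 ≤ l)
  | C (l : ℕ) (h : 3 ≤ l)
  | D (l : ℕ) (h : 4 ≤ l)
  | E6
  | E7
  | E8
  | F4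
  | G2

namespace DynkinType

/-- The rank `ℓ`. -/
def rank : DynkinType → ℕ
  | A l _ => l
  | B l _ => l
  | C l _ => l
  | D l _ => l
  | E6 => 6
  | E7 => 7
  | E8 => 8
  | F4 => 4
  | G2 => 2

/-- The dimension of the coordinate space in which the model lives. -/
def dim : DynkinType → ℕ
  | A l _ => l + 1
  | B l _ => l
  | C l _ => l
  | D l _ => l
  | E6 => 8
  | E7 => 8
  | E8 => 8
  | F4 => 4
  | G2 => 3

/-- The roots of the model. -/
def roots : (X : DynkinType) → Set (Fin X.dim → ℝ)
  | A l _ => rootsA l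
  | B l _ => rootsB l
  | C l _ => rootsC l
  | D l _ => rootsD l
  | E6 => rootsE6
  | E7 => rootsE7
  | E8 => rootsE8
  | F4 => rootsF4
  | G2 => rootsG2

/-- The simple roots of `E_8`, the first `ℓ` of which are those of `E_ℓ`:
`α_1 = (e_1 - e_2 - ⋯ - e_7 + e_8) / 2`, `α_2 = e_1 + e_2` and `α_k = e_{k-1} - e_{k-2}` for
`3 ≤ k`. -/
noncomputable def simpleE (k : ℕ) : Fin 8 → ℝ :=
  if k = 1 then ![1/2, -1/2, -1/2, -1/2, -1/2, -1/2, -1/2, 1/2]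
  else if k = 2 then stdE 8 1 + stdE 8 2
  else stdE 8 (k - 1) - stdE 8 (k - 2)

/-- The simple roots `α_1, …, α_ℓ` of the model in the customary numbering; `X.simple k` is
`α_{k+1}`, for `k = 0, …, ℓ - 1`. -/
noncomputable def simple : (X : DynkinType) → Fin X.rank → (Fin X.dim → ℝ)
  | A l _ => fun k => stdE (l + 1) (k + 1) - stdE (l + 1) (k + 2)
  | B l _ => fun k =>
      if (k : ℕ) + 1 = l then stdE l l else stdE l (k + 1) - stdE l (k + 2)
  | C l _ => fun k =>
      if (k : ℕ) + 1 = l then (2 : ℝ) • stdE l l else stdE l (k + 1) - stdE l (k + 2)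
  | D l _ => fun k =>
      if (k : ℕ) + 1 = l then stdE l (l - 1) + stdE l l else stdE l (k + 1) - stdE l (k + 2)
  | E6 => fun k => simpleE (k + 1)
  | E7 => fun k => simpleE (k + 1)
  | E8 => fun k => simpleE (k + 1)
  | F4 => ![![0, 1, -1, 0], ![0, 0, 1, -1], ![0, 0, 0, 1], ![1/2, -1/2, -1/2, -1/2]]
  | G2 => ![![1, -1, 0], ![-2, 1, 1]]

end DynkinType

/-- The table. `FoldingTable X j R R' d` says that, for a root system `Φ` of type `X` and
`ω = ω_j`, the folded root system `Φ^ω_re` has the type of the model `R`, and that `Φ'` is the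
root system that `R'` describes in the same coordinates, with dilation factor `d`. The first
row is the case `ω = 1`, where `Φ' = Φ^ω_re = Φ`. -/
inductive FoldingTable :
    DynkinType → ℕ → {n : ℕ} → Set (Fin n → ℝ) → Set (Fin n → ℝ) → ℕ → Prop
  | one (X : DynkinType) : FoldingTable X 0 X.roots X.roots 1
  | A_coprime (l j : ℕ) (h : 1 ≤ l) (hj : 1 ≤ j) (hjl : j ≤ l) (hg : Nat.gcd (l + 1) j = 1) :
      FoldingTable (.A l h) j (∅ : Set (Fin 0 → ℝ)) ∅ 1
  | A_gcd (l j : ℕ) (h : 1 ≤ l) (hj : 1 ≤ j) (hjl : j ≤ l) (hg : Nat.gcd (l + 1) j ≠ 1) :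
      FoldingTable (.A l h) j (rootsA (Nat.gcd (l + 1) j - 1)) (rootsA (Nat.gcd (l + 1) j - 1))
        ((l + 1) / Nat.gcd (l + 1) j)
  | B_two (h : 2 ≤ 2) : FoldingTable (.B 2 h) 1 (rootsA 1) (rootsA 1) 2
  | B_ge_three (l : ℕ) (h : 2 ≤ l) (hl : 3 ≤ l) :
      FoldingTable (.B l h) 1 (rootsB (l - 1)) (rootsC (l - 1)) 1
  | C_odd (l : ℕ) (h : 3 ≤ l) (hl : Odd l) :
      FoldingTable (.C l h) l (rootsBC ((l - 1) / 2)) (rootsBC ((l - 1) / 2)) 2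
  | C_even (l : ℕ) (h : 3 ≤ l) (hl : Even l) :
      FoldingTable (.C l h) l (rootsC (l / 2)) (rootsC (l / 2)) 2
  | D_one (l : ℕ) (h : 4 ≤ l) :
      FoldingTable (.D l h) 1 (rootsB (l - 2)) (rootsC (l - 2)) 1
  | D_even (l j : ℕ) (h : 4 ≤ l) (hl : Even l) (hj : j = l - 1 ∨ j = l) :
      FoldingTable (.D l h) j (rootsC (l / 2)) (rootsB (l / 2)) 2
  | D_odd (l j : ℕ) (h : 4 ≤ l) (hl : Odd l) (hj : j = l - 1 ∨ j = l) :
      FoldingTable (.D l h) j (rootsBC ((l - 3) / 2)) (rootsC ((l - 3) / 2)) 2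
  | E6 (j : ℕ) (hj : j = 1 ∨ j = 6) :
      FoldingTable .E6 j rootsG2 (dualRoots 6 rootsG2) 1
  | E7 : FoldingTable .E7 7 rootsF4 (dualRoots 2 rootsF4) 1

/-! ### Root systems

`P : RootPairing ι ℝ V E` is a root system with roots in `V` and coroots in `E`; the perfect
pairing `V × E → ℝ` plays the role of the inner product `(β, x)` of a root and a vector. -/

namespace RootPairing

variable {ι V E : Type*} [AddCommGroup V] [Module ℝ V] [AddCommGroup E] [Module ℝ E]
  (P : RootPairing ι ℝ V E)

/-- The action of the Weyl group on `E`, contragredient to its action on `V`. -/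
noncomputable def coact (w : P.weylGroup) : E ≃ₗ[ℝ] E :=
  MulOpposite.unop (Equiv.coweightHom P ((w⁻¹ : P.weylGroup) : P.Aut))

theorem toLinearMap_coact (w : P.weylGroup) (v : V) (x : E) :
    P.toLinearMap v (P.coact w x) = P.toLinearMap (w⁻¹ • v) x := by
  exact (LinearMap.congr_fun (LinearMap.congr_fun
    ((w⁻¹ : P.weylGroup) : P.Aut).weight_coweight_transpose x) v).symm

/-- The vectors of `E` on which all elements of `S` take integral values. For the set of roots
this is the coweight lattice `Z`. -/
def integralPoints (S : Set V) : AddSubgroup E where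
  carrier := {x | ∀ β ∈ S, ∃ n : ℤ, P.toLinearMap β x = n}
  zero_mem' := fun _ _ => ⟨0, by simp⟩
  add_mem' := by
    intro x y hx hy β hβ
    obtain ⟨m, hm⟩ := hx β hβ
    obtain ⟨n, hn⟩ := hy β hβ
    exact ⟨m + n, by simp [hm, hn]⟩
  neg_mem' := by
    intro x hx β hβ
    obtain ⟨m, hm⟩ := hx β hβ
    exact ⟨-m, by simp [hm]⟩

/-- The coweight lattice `Z`. -/
def coweightLattice : AddSubgroup E := P.integralPoints (Set.range P.root)

/-- The subgroup `q L` of a lattice `L`. -/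
def qMultiples (L : AddSubgroup E) (q : ℕ) : AddSubgroup L := (nsmulAddMonoidHom (α := L) q).range

/-- The complement `M(S, L; q)` in `L / q L` of the hyperplanes `(β, x) ≡ 0 mod q`, `β ∈ S`. -/
def modComplement (S : Set V) (L : AddSubgroup E) (q : ℕ) : Set (L ⧸ qMultiples L q) :=
  {t | ∀ x : L, (QuotientAddGroup.mk x : L ⧸ qMultiples L q) = t →
    ∀ β ∈ S, ¬ ∃ n : ℤ, P.toLinearMap β (x : E) = (q : ℝ) * n}

/-- The characteristic quasi-polynomial `χ^quasi_{S, L}`. -/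
noncomputable def charQuasi (S : Set V) (L : AddSubgroup E) (q : ℕ) : ℕ :=
  Nat.card (P.modComplement S L q)

theorem coact_mem_coweightLattice (w : P.weylGroup) {x : E} (hx : x ∈ P.coweightLattice) :
    P.coact w x ∈ P.coweightLattice := by
  rintro _ ⟨i, rfl⟩
  rw [toLinearMap_coact, weylGroup_apply_root]
  exact hx _ ⟨_, rfl⟩

/-- The action of the Weyl group on the coweight lattice. -/
noncomputable def actCoweight (w : P.weylGroup) : P.coweightLattice →+ P.coweightLattice where
  toFun x := ⟨P.coact w x, P.coact_mem_coweightLattice w x.2⟩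
  map_zero' := by ext; simp
  map_add' x y := by ext; simp

/-- The induced action of the Weyl group on `Z / q Z`. -/
noncomputable def actMod (q : ℕ) (w : P.weylGroup) :
    (P.coweightLattice ⧸ qMultiples P.coweightLattice q) →+
      (P.coweightLattice ⧸ qMultiples P.coweightLattice q) :=
  QuotientAddGroup.map _ _ (P.actCoweight w) (by
    rintro _ ⟨y, rfl⟩
    exact ⟨P.actCoweight w y, by simp⟩)

/-- The equivariant characteristic quasi-polynomial `χ_{Φ, q}`: the character of the permutation
action of the Weyl group on `M(Φ; q)`, that is, the number of points fixed by `w`. -/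
noncomputable def equivChar (q : ℕ) (w : P.weylGroup) : ℕ :=
  Nat.card {t : P.coweightLattice ⧸ qMultiples P.coweightLattice q //
    t ∈ P.modComplement (Set.range P.root) P.coweightLattice q ∧ P.actMod q w t = t}

/-! #### The fundamental alcove and its stabilizer -/

section Alcove

variable {P} (b : P.Base)

/-- `θ` is the highest root: every root is obtained from it by subtracting simple roots. -/
def IsHighestRoot (θ : ι) : Prop :=
  ∀ i, P.root θ - P.root i ∈ AddSubmonoid.closure (P.root '' b.support)

/-- The fundamental alcove `A_∘`, where `θ` is the highest root. -/
def fundAlcove (θ : ι) : Set E :=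
  {x | (∀ i ∈ b.support, 0 < P.toLinearMap (P.root i) x) ∧ P.toLinearMap (P.root θ) x < 1}

/-- The fundamental parallelepiped `P^⋄` of the coweight lattice. -/
def fundParallelepiped : Set E :=
  {x | ∀ i ∈ b.support, 0 < P.toLinearMap (P.root i) x ∧ P.toLinearMap (P.root i) x ≤ 1}

/-- The image of `C ⊆ P^⋄` under the action `ρ^⋄(w)` that `w` induces on `P^⋄` through the
identification of `P^⋄` with the torus `E / Z`. -/
def torusImage (w : P.weylGroup) (C : Set E) : Set E :=
  {y | y ∈ fundParallelepiped b ∧ ∃ x ∈ C, y - P.coact w x ∈ P.coweightLattice}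

/-- The stabilizer `W_{A_∘}` of the fundamental alcove under the action `ρ^⋄`. -/
def alcoveStabilizer (θ : ι) : Set P.weylGroup :=
  {w | torusImage b w (fundAlcove b θ) = fundAlcove b θ}

/-- The subgroup of the Weyl group generated by the reflections in the roots of `S`. -/
noncomputable def parabolic (P : RootPairing ι ℝ V E) (S : Set ι) : Subgroup P.weylGroup :=
  Subgroup.closure (weylGroup.ofIdx P '' S)

/-- The length of an element of the Weyl group: the number of positive roots that it makes
negative. -/
noncomputable def weylLength (w : P.weylGroup) : ℕ :=
  Nat.card {i : ι // b.IsPos i ∧ ¬ b.IsPos (P.weylGroupToPerm w i)}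

/-- `w` is the longest element of the subgroup generated by the reflections in `S`, where `S`
consists of simple roots. -/
def IsLongest (S : Set ι) (w : P.weylGroup) : Prop :=
  w ∈ parabolic P S ∧ ∀ w' ∈ parabolic P S, weylLength b w' ≤ weylLength b w

/-- `ω = ω_j` with `j ∈ J`, where `e k` is (the index of) the simple root `α_{k+1}`: either
`j = 0` and `ω = 1`, or `j ≥ 1`, the coefficient `n_j` of `α_j` in the highest root is `1`, and
`ω = w_j w_0`, where `w_0` is the longest element of the Weyl group and `w_j` that of the subgroup
belonging to the simple roots other than `α_j`. -/
def IsOmega [P.IsRootSystem] (θ : ι) {l : ℕ} (e : Fin l ≃ b.support) (j : ℕ)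
    (ω : P.weylGroup) : Prop :=
  (j = 0 ∧ ω = 1) ∨
  ∃ k : Fin l, j = k + 1 ∧ b.toWeightBasis.repr (P.root θ) (e k) = 1 ∧
    ∃ w₀ wj : P.weylGroup, IsLongest b b.support w₀ ∧
      IsLongest b ((b.support : Set ι) \ {(e k : ι)}) wj ∧ ω = wj * w₀

/-- `Φ` is of type `X`, with the simple roots numbered by `e` as in the model: an injective linear
map takes the roots onto those of the model and respects the simple roots. -/
def IsOfType (X : DynkinType) (e : Fin X.rank ≃ b.support) : Prop :=
  ∃ f : V →ₗ[ℝ] (Fin X.dim → ℝ), Function.Injective f ∧ f '' Set.range P.root = X.roots ∧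
    ∀ k, f (P.root (e k)) = X.simple k

end Alcove

/-! #### Folding -/

/-- The average `v^ω` of the `ω`-orbit of `v`. -/
noncomputable def orbitAverage (ω : P.weylGroup) (v : V) : V :=
  (orderOf ω : ℝ)⁻¹ • ∑ t ∈ Finset.Icc 1 (orderOf ω), ω ^ t • v

/-- The folded root system `Φ^ω_re`. -/
def foldedRoots (ω : P.weylGroup) : Set V :=
  {v | (∃ i, v = P.orbitAverage ω (P.root i)) ∧ v ≠ 0}

/-- The fixed space `E^ω`. -/
def fixedSpace (ω : P.weylGroup) : AddSubgroup E where
  carrier := {x | P.coact ω x = x}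
  zero_mem' := by simp
  add_mem' := by
    intro x y hx hy
    simp_all
  neg_mem' := by
    intro x hx
    simp_all

/-- The lattice `M`: the coweight lattice, in `E^ω`, of the folded root system. -/
def foldedCoweightLattice (ω : P.weylGroup) : AddSubgroup E :=
  P.fixedSpace ω ⊓ P.integralPoints (P.foldedRoots ω)

end RootPairing

/-- `ψ` restricts to a linear isomorphism from the span of `R` onto the span of `S` that takes the
set `R` onto `S`. -/
def IsRealization {n : ℕ} {V : Type*} [AddCommGroup V] [Module ℝ V]
    (R : Set (Fin n → ℝ)) (S : Set V) (ψ : (Fin n → ℝ) →ₗ[ℝ] V) : Prop :=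
  Set.InjOn ψ (Submodule.span ℝ R) ∧ ψ '' R = S

/-- The function `c(q)` for `ω` of order `o`. -/
def cFun (o q : ℕ) : ℕ := if o ∣ q then Nat.totient o else 0

/-! ### The Weyl group and its action on roots. -/

namespace RootPairing

section WeylGroup

variable {ι V E : Type*} [AddCommGroup V] [Module ℝ V] [AddCommGroup E] [Module ℝ E]
  {P : RootPairing ι ℝ V E}

/-! Stabilizer. At the point of the alcove where every simple root equals 1/h, with h = 1 + ∑ n_i
the Coxeter number, each root takes the value height/h. If ω stabilizes the alcove, then modulo Z
this point goes to itself, so every ω⁻¹α_k has height congruent to 1 modulo h and is a simple root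
or the lowest root. Hence ω permutes the nodes of the extended diagram by some π
(`exists_node_perm`). Unless ω = 1, the lowest root goes to some α_j with n_j = 1. Then ω⁻¹w_jw₀
takes every simple root to a positive root, hence is trivial, and ω = w_jw₀
(`isOmega_of_node_perm`).

Fixed points. A point of Z is given by its integral values x_i at the nodes, subject only to ∑ n_i
x_i = 0, and ω permutes these values. If x is fixed modulo qZ, its values modulo q are π-invariant.
Let o be the order of ω. In every case the weighted sum ∑ n_i y_i of a π-invariant integral function
y is divisible by o, and some invariant I has weighted sum exactly o. Subtracting a multiple of I
writes x as m + aχ + qz with m ∈ M = Z^ω, z ∈ Z, q ∣ oa, and χ one fixed coweight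
(`isCocycle_of_nodes`). The fixed points thus form translates of M indexed by a.

Regularity. Put c_β = (β, χ). A root with β^ω = 0 vanishes on M, so it takes the value a c_β modulo
q on the translate. Among these roots c_β meets every nonzero class modulo o and never the zero
class. Regular points therefore exist only if o ∣ q and a = (q/o)k with k prime to o
(`IsFolding.exists_coprime`), which produces the factor c(q). On such a translate β takes the value
(β^ω, m) + (q/o)k c_β modulo q. If c runs through all multiples of o/s modulo o on the fibre of β^ω,
then some root of the fibre vanishes precisely when (sβ^ω, m) ≡ 0 mod q. So all these translates
carry the same arrangement on M/qM, given by the multiples sβ^ω, and up to redundant members this is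
dΦ' (`IsFolding.regular_iff`, `IsFolding.equivChar_eq`).

Cases. For each type there remain π, χ and the classes of c on the fibres. In the classical types
the Weyl group acts by signed permutations of coordinates, and the position of the nodes determines
ω. In the exceptional types everything is a finite computation with integral vectors. Since Φ'
arises from the folded system by operations that commute with linear isomorphisms (`rescale`,
`dropHalf`), the formula holds for every realization. -/

theorem weylGroup_smul_real (w : P.weylGroup) (c : ℝ) (v : V) : w • c • v = c • w • v :=
  map_smul (Equiv.weightHom P w) c v

theorem weylGroup_smul_sum {κ : Type*} (w : P.weylGroup) (s : Finset κ) (g : κ → V) :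
    w • ∑ i ∈ s, g i = ∑ i ∈ s, w • g i :=
  map_sum (Equiv.weightHom P w) g s

theorem weylGroup_smul_neg' (w : P.weylGroup) (v : V) : w • (-v) = -(w • v) :=
  map_neg (Equiv.weightHom P w) v

/-- The action of a Weyl group element on the root space, as a linear map. -/
noncomputable def actLin (w : P.weylGroup) : V →ₗ[ℝ] V := (Equiv.weightHom P w).toLinearMap

theorem actLin_apply (w : P.weylGroup) (v : V) : actLin w v = w • v := rfl

theorem weylGroup_ext {w w' : P.weylGroup} (h : ∀ v : V, w • v = w' • v) : w = w' := by
  apply Subtype.ext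
  apply Equiv.weightHom_injective P
  ext v
  exact h v

theorem weylGroup_ofIdx_smul (i : ι) (v : V) :
    weylGroup.ofIdx P i • v = v - P.toLinearMap v (P.coroot i) • P.root i := rfl

theorem weylGroupToPerm_ofIdx (i : ι) :
    P.weylGroupToPerm (weylGroup.ofIdx P i) = P.reflectionPerm i := rfl

theorem weylGroup_ofIdx_mul_self (i : ι) : weylGroup.ofIdx P i * weylGroup.ofIdx P i = 1 := by
  apply Subtype.ext
  change Equiv.reflection P i * Equiv.reflection P i = 1
  rw [mul_eq_one_iff_eq_inv, Equiv.reflection_inv]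

/-- The roots span, so an element is determined by its permutation of the finitely many roots. -/
theorem weylGroup_finite [Finite ι] [P.IsRootSystem] : Finite P.weylGroup := by
  apply Finite.of_injective (fun w : P.weylGroup => P.weylGroupToPerm w)
  intro w w' h
  apply weylGroup_ext
  intro v
  have hs : v ∈ Submodule.span ℝ (Set.range P.root) := by
    rw [IsRootSystem.span_root_eq_top (P := P)]; trivial
  induction hs using Submodule.span_induction with
  | mem x hx =>
    obtain ⟨i, rfl⟩ := hx
    rw [weylGroup_apply_root, weylGroup_apply_root]
    exact congrArg P.root (congrFun (congrArg DFunLike.coe h) i)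
  | zero => simp
  | add x y _ _ hx hy => rw [smul_add, smul_add, hx, hy]
  | smul c x _ hx => rw [weylGroup_smul_real, weylGroup_smul_real, hx]

theorem toLinearMap_coact_eq_iff {x : E} {w : P.weylGroup} (hw : P.coact w x = x) (v : V) :
    P.toLinearMap (w • v) x = P.toLinearMap v x := by
  conv_lhs => rw [← hw]
  rw [toLinearMap_coact, inv_smul_smul]

/-- Conjugating a reflection gives the reflection in the image root. -/
theorem mul_ofIdx_mul_inv [Finite ι] [P.IsRootSystem] (w : P.weylGroup) (i : ι) :
    w * weylGroup.ofIdx P i * w⁻¹ = weylGroup.ofIdx P (P.weylGroupToPerm w i) := by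
  -- A reflection that preserves a finite spanning set is determined by its root. Both functionals
  -- take the value 2 at the root of index `P.weylGroupToPerm w i` and preserve the roots, so they
  -- agree.
  have hc : P.toLinearMap.flip (P.coroot (P.weylGroupToPerm w i)) =
      (P.toLinearMap.flip (P.coroot i)).comp (actLin w⁻¹) := by
    have hspan : Submodule.span ℝ (Set.range P.root) = ⊤ := IsRootSystem.span_root_eq_top (P := P)
    refine Module.Dual.eq_of_preReflection_mapsTo (x := P.root (P.weylGroupToPerm w i))
      (Φ := Set.range P.root) (Set.finite_range _) hspan ?_ ?_ ?_ ?_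
    · exact P.root_coroot_two _
    · rintro _ ⟨k, rfl⟩
      exact ⟨P.reflectionPerm (P.weylGroupToPerm w i) k, by
        simp [Module.preReflection_apply, root_reflectionPerm, reflection_apply]⟩
    · rw [← weylGroup_apply_root, LinearMap.comp_apply, actLin_apply, inv_smul_smul]
      simp
    · rintro _ ⟨k, rfl⟩
      have : Module.preReflection (P.root (P.weylGroupToPerm w i))
          ((P.toLinearMap.flip (P.coroot i)).comp (actLin w⁻¹)) (P.root k) =
          (w * weylGroup.ofIdx P i * w⁻¹) • P.root k := by
        rw [mul_smul, mul_smul, weylGroup_ofIdx_smul, smul_sub, smul_inv_smul,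
          weylGroup_smul_real, weylGroup_apply_root P w i]
        rfl
      rw [this, weylGroup_apply_root]
      exact ⟨_, rfl⟩
  apply weylGroup_ext
  intro v
  rw [mul_smul, mul_smul, weylGroup_ofIdx_smul, weylGroup_ofIdx_smul, smul_sub, smul_inv_smul,
    weylGroup_smul_real, weylGroup_apply_root P w i]
  have := LinearMap.congr_fun hc v
  simp only [LinearMap.flip_apply, LinearMap.comp_apply, actLin_apply] at this
  rw [this]

end WeylGroup

/-! ### Simple reflections, exchange and longest elements. -/

section SimpleReflections

set_option linter.unusedSectionVars false

variable {ι V E : Type*} [Finite ι] [AddCommGroup V] [Module ℝ V] [AddCommGroup E] [Module ℝ E]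
  {P : RootPairing ι ℝ V E} [P.IsRootSystem] [P.IsCrystallographic] [P.IsReduced] (b : P.Base)

/-- `P.reflectionPerm i i` is the index of the negative of the root `i`; negation is written in this
way throughout. -/
theorem isPos_reflectionPerm_self {i : ι} :
    b.IsPos (P.reflectionPerm i i) ↔ ¬ b.IsPos i := Base.IsPos.neg_iff_not b i

/-- The Weyl group is generated by the simple reflections. -/
theorem exists_simple_word (w : P.weylGroup) :
    ∃ L : List ι, (∀ i ∈ L, i ∈ b.support) ∧ w = (L.map (weylGroup.ofIdx P)).prod := by
  let H : Subgroup P.weylGroup := parabolic P (b.support : Set ι)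
  -- Every root is reached from simple roots by simple reflections, and conjugation by a reflection
  -- turns the reflection in a root into that in its image.
  have hH : ∀ i, weylGroup.ofIdx P i ∈ H := by
    intro i
    refine b.induction_reflect i (p := fun i => weylGroup.ofIdx P i ∈ H) ?_ ?_ ?_
    · intro i hi
      have := mul_ofIdx_mul_inv (weylGroup.ofIdx P i) i
      rw [weylGroupToPerm_ofIdx] at this
      rw [← this]
      exact H.mul_mem (H.mul_mem hi hi) (H.inv_mem hi)
    · intro i hi
      exact Subgroup.subset_closure ⟨i, hi, rfl⟩
    · intro i j hi hj
      have := mul_ofIdx_mul_inv (weylGroup.ofIdx P j) i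
      rw [weylGroupToPerm_ofIdx] at this
      rw [← this]
      have hj' : weylGroup.ofIdx P j ∈ H := Subgroup.subset_closure ⟨j, hj, rfl⟩
      exact H.mul_mem (H.mul_mem hj' hi) (H.inv_mem hj')
  have hword : ∀ i, ∃ L : List ι, (∀ k ∈ L, k ∈ b.support) ∧
      weylGroup.ofIdx P i = (L.map (weylGroup.ofIdx P)).prod := by
    intro i
    have := hH i
    refine Subgroup.closure_induction'' (p := fun g _ => ∃ L : List ι, (∀ k ∈ L, k ∈ b.support) ∧
      g = (L.map (weylGroup.ofIdx P)).prod) ?_ ?_ ?_ ?_ this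
    · rintro _ ⟨k, hk, rfl⟩
      exact ⟨[k], by simpa using hk, by simp⟩
    · rintro _ ⟨k, hk, rfl⟩
      refine ⟨[k], by simpa using hk, ?_⟩
      simpa using inv_eq_of_mul_eq_one_left (weylGroup_ofIdx_mul_self k)
    · exact ⟨[], by simp, by simp⟩
    · rintro x y _ _ ⟨L, hL, rfl⟩ ⟨L', hL', rfl⟩
      refine ⟨L ++ L', ?_, by simp⟩
      intro k hk
      rcases List.mem_append.1 hk with h | h
      exacts [hL k h, hL' k h]
  obtain ⟨w, hw⟩ := w
  induction hw using weylGroup.induction with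
  | mem i => exact hword i
  | one => exact ⟨[], by simp, rfl⟩
  | mul x y hx hy ihx ihy =>
    obtain ⟨L, hL, h1⟩ := ihx
    obtain ⟨L', hL', h2⟩ := ihy
    refine ⟨L ++ L', ?_, ?_⟩
    · intro k hk
      rcases List.mem_append.1 hk with h | h
      exacts [hL k h, hL' k h]
    · rw [List.map_append, List.prod_append, ← h1, ← h2]
      rfl

/-- The exchange property. -/
theorem exchange (L : List ι) (hL : ∀ i ∈ L, i ∈ b.support) (k : ι) (hk : k ∈ b.support)
    (hneg : ¬ b.IsPos (P.weylGroupToPerm (L.map (weylGroup.ofIdx P)).prod k)) :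
    ∃ L' : List ι, (∀ i ∈ L', i ∈ b.support) ∧ L'.length < L.length ∧
      (L.map (weylGroup.ofIdx P)).prod * weylGroup.ofIdx P k =
        (L'.map (weylGroup.ofIdx P)).prod := by
  induction L with
  | nil => exact absurd (Base.isPos_of_mem_support hk) (by simpa using hneg)
  | cons i L ih =>
    have hi : i ∈ b.support := hL i (by simp)
    have hL1 : ∀ i ∈ L, i ∈ b.support := fun k hk => hL k (by simp [hk])
    set w := (L.map (weylGroup.ofIdx P)).prod with hw
    by_cases h : b.IsPos (P.weylGroupToPerm w k)
    -- The reflection in `i` makes no positive root negative except `i` itself, so the sign can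
    -- change at this letter only if `w` takes `k` to `i`. Then `w s_k = s_i w`, and the letter `i`
    -- cancels.
    · have hik : P.weylGroupToPerm w k = i := by
        by_contra hne
        apply hneg
        have := h.reflectionPerm hi hne
        rw [← weylGroupToPerm_ofIdx] at this
        rw [List.map_cons, List.prod_cons, ← hw, map_mul]
        exact this
      refine ⟨L, hL1, by simp, ?_⟩
      have h2 := mul_ofIdx_mul_inv w k
      rw [hik] at h2
      have h3 : w * weylGroup.ofIdx P k = weylGroup.ofIdx P i * w := by
        rw [← h2]; group
      rw [List.map_cons, List.prod_cons, ← hw, mul_assoc, h3, ← mul_assoc,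
        weylGroup_ofIdx_mul_self, one_mul]
    · obtain ⟨L', h1, h2, h3⟩ := ih hL1 h
      refine ⟨i :: L', ?_, by simpa using h2, ?_⟩
      · intro m hm
        rcases List.mem_cons.1 hm with rfl | hm
        exacts [hi, h1 m hm]
      · rw [List.map_cons, List.prod_cons, ← hw, mul_assoc, h3, List.map_cons, List.prod_cons]

/-- An element of the Weyl group that takes all simple roots to positive roots is trivial. -/
theorem eq_one_of_isPos (w : P.weylGroup)
    (hw : ∀ k ∈ b.support, b.IsPos (P.weylGroupToPerm w k)) : w = 1 := by
  classical
  have hex : ∃ n, ∃ L : List ι, L.length = n ∧ (∀ i ∈ L, i ∈ b.support) ∧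
      w = (L.map (weylGroup.ofIdx P)).prod := by
    obtain ⟨L, h1, h2⟩ := exists_simple_word b w
    exact ⟨_, L, rfl, h1, h2⟩
  -- In a shortest word ending in `k`, the word without its last letter makes `k` negative because
  -- `w` keeps it positive; exchange then yields a shorter word for `w`.
  obtain ⟨L, hlen, hL, hwL⟩ := Nat.find_spec hex
  rcases List.eq_nil_or_concat L with rfl | ⟨L₁, k, rfl⟩
  · simpa using hwL
  · exfalso
    have hk : k ∈ b.support := hL k (by simp)
    have hL₁ : ∀ i ∈ L₁, i ∈ b.support := fun i hi => hL i (by simp [hi])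
    have hw1 : w = (L₁.map (weylGroup.ofIdx P)).prod * weylGroup.ofIdx P k := by
      simpa using hwL
    have hw2 : (L₁.map (weylGroup.ofIdx P)).prod = w * weylGroup.ofIdx P k := by
      rw [hw1, mul_assoc, weylGroup_ofIdx_mul_self, mul_one]
    have hneg : ¬ b.IsPos (P.weylGroupToPerm (L₁.map (weylGroup.ofIdx P)).prod k) := by
      have hroot : P.root (P.weylGroupToPerm (L₁.map (weylGroup.ofIdx P)).prod k) =
          P.root (P.reflectionPerm (P.weylGroupToPerm w k) (P.weylGroupToPerm w k)) := by
        rw [← weylGroup_apply_root, hw2, mul_smul, weylGroup_ofIdx_smul]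
        simp only [root_reflectionPerm, reflection_apply_self]
        rw [root_coroot_two, two_smul, sub_add_cancel_left, weylGroup_smul_neg',
          weylGroup_apply_root]
      rw [P.root.injective hroot, isPos_reflectionPerm_self]
      exact not_not.2 (hw k hk)
    obtain ⟨L', h1, h2, h3⟩ := exchange b L₁ hL₁ k hk hneg
    refine Nat.find_min hex (m := L'.length) ?_ ⟨L', rfl, h1, by rw [hw1, h3]⟩
    rw [← hlen]
    simp
    omega

/-- If `w` is longest in the subgroup generated by the reflections in `S`, it makes the elements of
`S` negative. -/
theorem IsLongest.not_isPos {S : Set ι} (hS : S ⊆ b.support) {w : P.weylGroup}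
    (hw : IsLongest b S w) {k : ι} (hk : k ∈ S) : ¬ b.IsPos (P.weylGroupToPerm w k) := by
  intro hpos
  have hmem : w * weylGroup.ofIdx P k ∈ parabolic P S :=
    Subgroup.mul_mem _ hw.1 (Subgroup.subset_closure ⟨k, hk, rfl⟩)
  have hle := hw.2 _ hmem
  revert hle
  rw [imp_false, not_le]
  have hact : ∀ i, P.weylGroupToPerm (w * weylGroup.ofIdx P k) i =
      P.weylGroupToPerm w (P.reflectionPerm k i) := by
    intro i
    rw [map_mul, weylGroupToPerm_ofIdx]
    rfl
  have hself : ¬ b.IsPos (P.weylGroupToPerm w (P.reflectionPerm k k)) := by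
    have : P.weylGroupToPerm w (P.reflectionPerm k k) =
        P.reflectionPerm (P.weylGroupToPerm w k) (P.weylGroupToPerm w k) := by
      apply P.root.injective
      rw [← weylGroup_apply_root, root_reflectionPerm, root_reflectionPerm,
        reflection_apply_self, reflection_apply_self, weylGroup_smul_neg', weylGroup_apply_root]
    rw [this, isPos_reflectionPerm_self]
    exact not_not.2 hpos
  let A : Set ι := {i | b.IsPos i ∧ ¬ b.IsPos (P.weylGroupToPerm w i)}
  let B : Set ι := {i | b.IsPos i ∧ ¬ b.IsPos (P.weylGroupToPerm (w * weylGroup.ofIdx P k) i)}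
  change Nat.card A < Nat.card B
  rw [Nat.card_coe_set_eq, Nat.card_coe_set_eq]
  -- If `w` kept `k` positive, the reflection in `k` would inject the inversions of `w` into those
  -- of `w s_k`, missing the inversion `k`; so `w s_k` would be longer.
  have hA : (P.reflectionPerm k) '' A ⊆ B \ {k} := by
    rintro _ ⟨i, ⟨hi1, hi2⟩, rfl⟩
    have hik : i ≠ k := by
      rintro rfl
      exact hi2 hpos
    refine ⟨⟨hi1.reflectionPerm (hS hk) hik, ?_⟩, ?_⟩
    · rw [hact]
      simpa using hi2
    · intro h
      have h' : P.reflectionPerm k i = k := h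
      have hi : i = P.reflectionPerm k k := by
        rw [← _root_.Equiv.eq_symm_apply] at h'
        simpa using h'
      rw [hi, isPos_reflectionPerm_self] at hi1
      exact hi1 (Base.isPos_of_mem_support (hS hk))
  have hkB : k ∈ B := ⟨Base.isPos_of_mem_support (hS hk), by rw [hact]; exact hself⟩
  rw [← Set.ncard_image_of_injective A (P.reflectionPerm k).injective]
  calc _ ≤ (B \ {k}).ncard := Set.ncard_le_ncard hA (Set.toFinite _)
    _ < B.ncard := Set.ncard_sdiff_singleton_lt_of_mem hkB (Set.toFinite _)

theorem exists_isLongest (S : Set ι) : ∃ w, IsLongest b S w := by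
  have := weylGroup_finite (P := P)
  obtain ⟨w, hw, hmax⟩ := Set.exists_max_image (parabolic P S : Set P.weylGroup)
    (fun w => weylLength b w) (Set.toFinite _) ⟨1, Subgroup.one_mem _⟩
  exact ⟨w, hw, hmax⟩

end SimpleReflections

end RootPairing

/-! ### Coefficients in the simple roots, and points of `E` given by values. -/

namespace RootPairing

section Coefficients

set_option linter.unusedSectionVars false

variable {ι V E : Type*} [Finite ι] [AddCommGroup V] [Module ℝ V] [AddCommGroup E] [Module ℝ E]
  {P : RootPairing ι ℝ V E} [P.IsRootSystem] [P.IsCrystallographic] [P.IsReduced] (b : P.Base)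

/-- The coefficient of the simple root `k` in the root `i`. -/
noncomputable def coef (i : ι) (k : b.support) : ℤ := (b.exists_root_eq_sum_int i).choose k

theorem root_eq_sum_coef (i : ι) : P.root i = ∑ k : b.support, (coef b i k : ℝ) • P.root k := by
  have h := (b.exists_root_eq_sum_int i).choose_spec.2.2
  rw [← Finset.sum_coe_sort b.support] at h
  simpa [coef, Int.cast_smul_eq_zsmul] using h

theorem repr_sum_smul_root (c : b.support → ℝ) (k : b.support) :
    b.toWeightBasis.repr (∑ k : b.support, c k • P.root k) k = c k := by
  have := b.toWeightBasis.repr_sum_self c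
  simp only [Base.toWeightBasis_apply] at this
  rw [this]

theorem repr_root (i : ι) (k : b.support) :
    b.toWeightBasis.repr (P.root i) k = coef b i k := by
  conv_lhs => rw [root_eq_sum_coef b i]
  exact repr_sum_smul_root b _ k

theorem coef_eq_of_root_eq {i : ι} {c : b.support → ℝ}
    (h : P.root i = ∑ k : b.support, c k • P.root k) (k : b.support) : (coef b i k : ℝ) = c k := by
  rw [← repr_root, h]
  exact repr_sum_smul_root b _ k

theorem height_eq_sum_coef (i : ι) : b.height i = ∑ k : b.support, coef b i k := by
  have h := Base.height_eq_sum (b.exists_root_eq_sum_int i).choose_spec.2.2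
  rw [h, ← Finset.sum_coe_sort b.support]
  rfl

theorem coef_nonneg {i : ι} (hi : b.IsPos i) (k : b.support) : 0 ≤ coef b i k := by
  rcases (b.exists_root_eq_sum_int i).choose_spec.2.1 with h | h
  · exact h.le k
  · exfalso
    have : b.height i ≤ 0 := Finset.sum_nonpos fun j _ => h.le j
    exact absurd hi (not_lt.2 this)

theorem coef_nonpos {i : ι} (hi : ¬ b.IsPos i) (k : b.support) : coef b i k ≤ 0 := by
  rcases (b.exists_root_eq_sum_int i).choose_spec.2.1 with h | h
  · exfalso
    have : 0 ≤ b.height i := Finset.sum_nonneg fun j _ => h.le j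
    exact hi ((Base.isPos_iff' b).2 this)
  · exact h.le k

theorem coef_simple [DecidableEq b.support] (k m : b.support) :
    coef b k m = if k = m then 1 else 0 := by
  have := repr_root b k m
  rw [Base.toWeightBasis_repr_root, Finsupp.single_apply] at this
  have h2 : ((coef b k m : ℤ) : ℝ) = ((if k = m then 1 else 0 : ℤ) : ℝ) := by
    rw [← this]; push_cast; split_ifs <;> rfl
  exact_mod_cast h2

theorem toLinearMap_root_eq_sum (i : ι) (x : E) : P.toLinearMap (P.root i) x =
    ∑ k : b.support, (coef b i k : ℝ) * P.toLinearMap (P.root k) x := by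
  conv_lhs => rw [root_eq_sum_coef b i]
  simp

theorem exists_dual_point (φ : V →ₗ[ℝ] ℝ) : ∃ x : E, ∀ v, P.toLinearMap v x = φ v :=
  ⟨P.flip.toPerfPair.symm φ, fun v => by
    have := LinearMap.congr_fun (P.flip.toPerfPair.apply_symm_apply φ) v
    exact this⟩

/-- The simple roots form a basis of `V` and the pairing is perfect, so the values at the simple
roots are coordinates on `E`. -/
theorem exists_point_of_values (g : b.support → ℝ) :
    ∃ x : E, ∀ k : b.support, P.toLinearMap (P.root k) x = g k := by
  obtain ⟨x, hx⟩ := exists_dual_point (P := P) (b.toWeightBasis.constr ℝ g)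
  refine ⟨x, fun k => ?_⟩
  rw [hx, ← Base.toWeightBasis_apply, Module.Basis.constr_basis]

theorem point_ext {x y : E}
    (h : ∀ k : b.support, P.toLinearMap (P.root k) x = P.toLinearMap (P.root k) y) : x = y := by
  apply P.flip.toPerfPair.injective
  apply b.toWeightBasis.ext
  intro k
  rw [Base.toWeightBasis_apply]
  exact h k

theorem mem_coweightLattice_of_simple {x : E}
    (h : ∀ k : b.support, ∃ n : ℤ, P.toLinearMap (P.root k) x = n) : x ∈ P.coweightLattice := by
  rintro _ ⟨i, rfl⟩
  choose n hn using h
  refine ⟨∑ k, coef b i k * n k, ?_⟩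
  rw [toLinearMap_root_eq_sum b]
  push_cast
  simp [hn]

theorem toLinearMap_nonpos_of_not_isPos {x : E}
    (hx : ∀ k : b.support, 0 ≤ P.toLinearMap (P.root k) x)
    {i : ι} (hi : ¬ b.IsPos i) : P.toLinearMap (P.root i) x ≤ 0 := by
  rw [toLinearMap_root_eq_sum b]
  exact Finset.sum_nonpos fun k _ =>
    mul_nonpos_of_nonpos_of_nonneg (by exact_mod_cast coef_nonpos b hi k) (hx k)

theorem coact_mul (w w' : P.weylGroup) (x : E) :
    P.coact (w * w') x = P.coact w (P.coact w' x) := by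
  apply P.flip.toPerfPair.injective
  ext v
  change P.toLinearMap v _ = P.toLinearMap v _
  rw [toLinearMap_coact, toLinearMap_coact, toLinearMap_coact, mul_inv_rev, mul_smul]

theorem coact_one (x : E) : P.coact 1 x = x := by
  apply P.flip.toPerfPair.injective
  ext v
  change P.toLinearMap v _ = P.toLinearMap v _
  rw [toLinearMap_coact, inv_one, one_smul]

/-- A regular vector has trivial stabilizer. -/
theorem eq_one_of_coact_eq (b : P.Base) {x : E} (hreg : ∀ i, P.toLinearMap (P.root i) x ≠ 0)
    {w : P.weylGroup} (hw : P.coact w x = x) : w = 1 := by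
  -- Induction on the number of positive roots negative at `x`. If there is no negative simple root,
  -- `w` keeps the simple roots positive, since it preserves their values at `x` and `x` is regular.
  -- Otherwise a simple reflection whose root is negative at `x` lowers the number, and `w` is
  -- replaced by a conjugate.
  generalize hN : {i | b.IsPos i ∧ P.toLinearMap (P.root i) x < 0}.ncard = N
  induction N using Nat.strongRecOn generalizing x w with
  | ind N ih =>
    by_cases hdom : ∀ k : b.support, 0 ≤ P.toLinearMap (P.root k) x
    · apply eq_one_of_isPos b
      intro k hk
      by_contra hneg
      have h1 := toLinearMap_nonpos_of_not_isPos b hdom hneg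
      rw [← weylGroup_apply_root, toLinearMap_coact_eq_iff hw] at h1
      exact hreg k (le_antisymm h1 (hdom ⟨k, hk⟩))
    · push Not at hdom
      obtain ⟨⟨k, hk⟩, hneg⟩ := hdom
      simp only at hneg
      set s := weylGroup.ofIdx P k with hs
      have hss : s * s = 1 := weylGroup_ofIdx_mul_self k
      have hsinv : s⁻¹ = s := inv_eq_of_mul_eq_one_left hss
      have hval : ∀ i, P.toLinearMap (P.root i) (P.coact s x) =
          P.toLinearMap (P.root (P.reflectionPerm k i)) x := by
        intro i
        rw [toLinearMap_coact, hsinv, weylGroup_apply_root]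
        rfl
      have h1 : s * w * s = 1 := by
        refine ih _ ?_ (x := P.coact s x) (fun i => by rw [hval]; exact hreg _) ?_ rfl
        · rw [← hN, ← Set.ncard_image_of_injective _ (P.reflectionPerm k).injective]
          refine Set.ncard_lt_ncard ⟨?_, ?_⟩ (Set.toFinite _)
          · rintro _ ⟨i, ⟨hi1, hi2⟩, rfl⟩
            rw [hval] at hi2
            refine ⟨hi1.reflectionPerm hk ?_, hi2⟩
            rintro rfl
            rw [root_reflectionPerm, reflection_apply_self, map_neg, LinearMap.neg_apply] at hi2
            linarith
          · intro hsub
            obtain ⟨i, ⟨hi1, hi2⟩, hi3⟩ := hsub ⟨Base.isPos_of_mem_support hk, hneg⟩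
            have hi : i = P.reflectionPerm k k := by
              rw [← _root_.Equiv.eq_symm_apply] at hi3
              simpa using hi3
            rw [hi, isPos_reflectionPerm_self] at hi1
            exact hi1 (Base.isPos_of_mem_support hk)
        · rw [coact_mul, coact_mul, ← coact_mul s s, hss, coact_one, hw]
      calc w = s * (s * w * s) * s := by
            rw [mul_assoc s w s, ← mul_assoc s s, hss, one_mul, mul_assoc, hss, mul_one]
        _ = 1 := by rw [h1, mul_one, hss]

variable {b}

theorem IsHighestRoot.coef_le {θ : ι} (hθ : IsHighestRoot b θ) (i : ι) (k : b.support) :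
    coef b i k ≤ coef b θ k := by
  have hmem := hθ i
  have key : ∀ v ∈ AddSubmonoid.closure (P.root '' b.support), 0 ≤ b.toWeightBasis.repr v k := by
    intro v hv
    induction hv using AddSubmonoid.closure_induction with
    | mem x hx =>
      obtain ⟨m, hm, rfl⟩ := hx
      rw [repr_root b]
      exact_mod_cast coef_nonneg b (Base.isPos_of_mem_support hm) k
    | zero => simp
    | add x y _ _ hx hy => simpa using add_nonneg hx hy
  have := key _ hmem
  rw [map_sub, Finsupp.sub_apply, repr_root, repr_root] at this
  have h2 : (coef b i k : ℝ) ≤ coef b θ k := by linarith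
  exact_mod_cast h2

theorem coef_reflectionPerm_self (i : ι) (k : b.support) :
    coef b (P.reflectionPerm i i) k = - coef b i k := by
  have h1 := repr_root b (P.reflectionPerm i i) k
  rw [root_reflectionPerm, reflection_apply_self, map_neg, Finsupp.neg_apply, repr_root b] at h1
  exact_mod_cast h1.symm

theorem IsHighestRoot.neg_coef_le {θ : ι} (hθ : IsHighestRoot b θ) (i : ι) (k : b.support) :
    - coef b θ k ≤ coef b i k := by
  have := hθ.coef_le (P.reflectionPerm i i) k
  rw [coef_reflectionPerm_self] at this
  linarith

theorem IsHighestRoot.one_le_coef {θ : ι} (hθ : IsHighestRoot b θ) (k : b.support) :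
    1 ≤ coef b θ k := by
  classical
  have := hθ.coef_le k k
  rwa [coef_simple, if_pos rfl] at this

theorem eq_of_coef_eq {i j : ι} (h : ∀ k, coef b i k = coef b j k) : i = j := by
  apply P.root.injective
  rw [root_eq_sum_coef b i, root_eq_sum_coef b j]
  simp [h]

end Coefficients

end RootPairing

/-! ### The stabilizer of the alcove and the extended diagram. -/

namespace RootPairing

section Stabilizer

set_option linter.unusedSectionVars false

variable {ι V E : Type*} [Finite ι] [AddCommGroup V] [Module ℝ V] [AddCommGroup E] [Module ℝ E]
  {P : RootPairing ι ℝ V E} [P.IsRootSystem] [P.IsCrystallographic] [P.IsReduced] {b : P.Base}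

/-- Nonnegative integers with sum one consist of a single one and zeros. -/
theorem mem_support_of_height_eq_one {i : ι} (hi : b.height i = 1) : i ∈ b.support := by
  classical
  have hpos : b.IsPos i := by rw [Base.isPos_iff, hi]; exact one_pos
  have hsum := height_eq_sum_coef b i
  rw [hi] at hsum
  obtain ⟨k, hk⟩ : ∃ k, coef b i k ≠ 0 := by
    by_contra! h
    simp [h] at hsum
  have hk1 : 1 ≤ coef b i k := by have := coef_nonneg b hpos k; omega
  have hle : ∀ m, coef b i m ≤ coef b k m := by
    intro m
    rw [coef_simple]
    have hrest := Finset.add_sum_erase Finset.univ (fun k => coef b i k) (Finset.mem_univ k)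
    have hnn : 0 ≤ ∑ m ∈ Finset.univ.erase k, coef b i m :=
      Finset.sum_nonneg fun m _ => coef_nonneg b hpos m
    split_ifs with h
    · subst h; omega
    · have : coef b i m ≤ ∑ m ∈ Finset.univ.erase k, coef b i m :=
        Finset.single_le_sum (f := fun m => coef b i m) (fun m _ => coef_nonneg b hpos m)
          (Finset.mem_erase.2 ⟨fun h' => h h'.symm, Finset.mem_univ m⟩)
      omega
  have heq : ∀ m, coef b i m = coef b k m := by
    intro m
    have h1 := hle m
    have h2 := coef_simple b k m
    have h3 := coef_nonneg b hpos m
    split_ifs at h2 with h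
    · subst h; omega
    · omega
  rw [eq_of_coef_eq heq]
  exact k.2

theorem coef_weylGroup (w : P.weylGroup) (i : ι) (m : b.support) :
    coef b (P.weylGroupToPerm w i) m =
      ∑ k : b.support, coef b i k * coef b (P.weylGroupToPerm w k) m := by
  have h := repr_root b (P.weylGroupToPerm w i) m
  rw [← weylGroup_apply_root, root_eq_sum_coef b i, weylGroup_smul_sum] at h
  simp only [weylGroup_smul_real, weylGroup_apply_root] at h
  rw [map_sum, Finsupp.finsetSum_apply] at h
  simp only [map_smul, Finsupp.smul_apply, repr_root, smul_eq_mul] at h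
  exact_mod_cast h.symm

theorem height_weylGroup (w : P.weylGroup) (i : ι) :
    b.height (P.weylGroupToPerm w i) =
      ∑ k : b.support, coef b i k * b.height (P.weylGroupToPerm w k) := by
  simp only [height_eq_sum_coef, coef_weylGroup w i]
  rw [Finset.sum_comm]
  simp [Finset.mul_sum]

theorem weylGroupToPerm_reflectionPerm_self (w : P.weylGroup) (i : ι) :
    P.weylGroupToPerm w (P.reflectionPerm i i) =
      P.reflectionPerm (P.weylGroupToPerm w i) (P.weylGroupToPerm w i) := by
  apply P.root.injective
  rw [← weylGroup_apply_root, root_reflectionPerm, root_reflectionPerm, reflection_apply_self,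
    reflection_apply_self, weylGroup_smul_neg', weylGroup_apply_root]

/-- An element of the stabilizer of the fundamental alcove takes the simple roots to simple roots
or the lowest root. -/
theorem inv_simple_of_mem_alcoveStabilizer {θ : ι} (hθ : IsHighestRoot b θ) {ω : P.weylGroup}
    (hω : ω ∈ alcoveStabilizer b θ) (k : b.support) :
    P.weylGroupToPerm ω⁻¹ k ∈ b.support ∨ P.weylGroupToPerm ω⁻¹ k = P.reflectionPerm θ θ := by
  classical
  -- `h` is the Coxeter number. The point `y` at which all simple roots equal `1 / h` lies in the
  -- alcove, because the highest root equals `(h - 1) / h` there.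
  set h : ℤ := 1 + ∑ k : b.support, coef b θ k with hh
  have hn : ∀ k, 1 ≤ coef b θ k := hθ.one_le_coef
  have hpos : 2 ≤ h := by
    have : coef b θ k ≤ ∑ k : b.support, coef b θ k :=
      Finset.single_le_sum (f := fun m => coef b θ m)
        (fun m _ => by have := hn m; omega) (Finset.mem_univ k)
    have := hn k
    omega
  have hR : (0 : ℝ) < h := by exact_mod_cast (by omega : 0 < h)
  obtain ⟨y, hy⟩ := exists_point_of_values b (fun _ => 1 / (h : ℝ))
  have hval : ∀ i, P.toLinearMap (P.root i) y = b.height i / h := by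
    intro i
    rw [toLinearMap_root_eq_sum b, height_eq_sum_coef]
    simp only [hy]
    rw [← Finset.sum_mul]
    push_cast
    ring
  have hyA : y ∈ fundAlcove b θ := by
    refine ⟨fun i hi => ?_, ?_⟩
    · rw [hy ⟨i, hi⟩]; positivity
    · rw [hval, div_lt_one hR, height_eq_sum_coef]
      exact_mod_cast (by omega : ∑ k : b.support, coef b θ k < h)
  set t : b.support → ℤ := fun k => b.height (P.weylGroupToPerm ω⁻¹ k) with ht
  have htval : ∀ k : b.support, P.toLinearMap (P.root k) (P.coact ω y) = t k / h := by
    intro k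
    rw [toLinearMap_coact, weylGroup_apply_root, hval]
  -- Adding `1 - ⌈r⌉` brings a real `r` into the half-open interval `(0, 1]`, so this translation
  -- moves the image of `y` into the parallelepiped.
  obtain ⟨z, hz⟩ := exists_point_of_values (P := P) b
    (fun k => ((1 - ⌈(t k / h : ℝ)⌉ : ℤ) : ℝ))
  set c : b.support → ℤ := fun k => 1 - ⌈(t k / h : ℝ)⌉ with hc
  have hzmem : z ∈ P.coweightLattice := mem_coweightLattice_of_simple b fun k => ⟨_, hz k⟩
  have hyz : ∀ k : b.support, P.toLinearMap (P.root k) (P.coact ω y + z) = t k / h + c k := by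
    intro k
    rw [map_add, htval, hz]
  have hA : P.coact ω y + z ∈ fundAlcove b θ := by
    rw [← show torusImage b ω (fundAlcove b θ) = fundAlcove b θ from hω]
    refine ⟨fun i hi => ?_, y, hyA, by simpa using hzmem⟩
    have h1 := hyz ⟨i, hi⟩
    simp only at h1
    rw [h1]
    have h2 := Int.ceil_lt_add_one (t ⟨i, hi⟩ / h : ℝ)
    have h3 := Int.le_ceil (t ⟨i, hi⟩ / h : ℝ)
    simp only [hc, Int.cast_sub, Int.cast_one]
    constructor <;> linarith
  have hu1 : ∀ k, 1 ≤ t k + h * c k := by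
    intro k
    have h1 := hA.1 k k.2
    rw [hyz] at h1
    have h2 : (0 : ℝ) < t k + h * c k := by
      have : (t k + h * c k : ℝ) = (t k / h + c k) * h := by field_simp
      rw [this]; positivity
    have h3 : 0 < t k + h * c k := by exact_mod_cast h2
    omega
  have hu2 : ∑ k, coef b θ k * (t k + h * c k) < h := by
    have h1 := hA.2
    rw [toLinearMap_root_eq_sum b] at h1
    simp only [hyz] at h1
    have h2 : (∑ k, coef b θ k * (t k + h * c k) : ℝ) =
        (∑ k, (coef b θ k : ℝ) * (t k / h + c k)) * h := by
      rw [Finset.sum_mul]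
      refine Finset.sum_congr rfl fun k _ => ?_
      field_simp
    have h3 : (∑ k, coef b θ k * (t k + h * c k) : ℝ) < h := by
      rw [h2]; nlinarith
    exact_mod_cast h3
  -- The integers `t m + h * c m` are at least one, while their sum weighted by the marks is less
  -- than `h`, one more than the sum of the marks. Hence all of them are one: the point returns to
  -- `y`.
  have hu : t k + h * c k = 1 := by
    have hterm : ∀ m, 0 ≤ coef b θ m * (t m + h * c m - 1) := fun m =>
      mul_nonneg (by have := hn m; omega) (by have := hu1 m; omega)
    have h1 : ∑ m, coef b θ m * (t m + h * c m - 1) < 1 := by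
      simp only [mul_sub, Finset.sum_sub_distrib, mul_one]
      omega
    have h2 := Finset.single_le_sum (fun m _ => hterm m) (Finset.mem_univ k)
    have h3 := hu1 k
    have h4 := hn k
    nlinarith
  have hb1 : t k ≤ h - 1 := by
    have : t k ≤ ∑ k : b.support, coef b θ k := by
      simp only [ht, height_eq_sum_coef]
      exact Finset.sum_le_sum fun m _ => hθ.coef_le _ m
    omega
  have hb2 : -(h - 1) ≤ t k := by
    have : ∑ k : b.support, -coef b θ k ≤ t k := by
      simp only [ht, height_eq_sum_coef]
      exact Finset.sum_le_sum fun m _ => hθ.neg_coef_le _ m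
    rw [Finset.sum_neg_distrib] at this
    omega
  -- Heights of roots lie between `-(h - 1)` and `h - 1`, which leaves the heights `1` and `1 - h`.
  have hc01 : c k = 0 ∨ c k = 1 := by
    have h1 : c k < 2 := by nlinarith
    have h2 : -1 < c k := by nlinarith
    omega
  rcases hc01 with h0 | h1
  · left
    apply mem_support_of_height_eq_one
    rw [h0] at hu
    change t k = 1
    omega
  · right
    rw [h1] at hu
    -- Height `1 - h` is that of the lowest root, whose coefficients are minimal one by one; equal
    -- sums force equal coefficients.
    have hsum : ∑ m : b.support, (coef b (P.weylGroupToPerm ω⁻¹ k) m + coef b θ m) = 0 := by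
      rw [Finset.sum_add_distrib, ← height_eq_sum_coef]
      change t k + _ = 0
      omega
    rw [Finset.sum_eq_zero_iff_of_nonneg
      (fun m _ => by have := hθ.neg_coef_le (P.weylGroupToPerm ω⁻¹ k) m; omega)] at hsum
    apply eq_of_coef_eq (b := b)
    intro m
    rw [coef_reflectionPerm_self]
    have := hsum m (Finset.mem_univ m)
    omega

/-- The nodes of the extended diagram: the lowest root and the simple roots. -/
noncomputable def node {l : ℕ} (θ : ι) (e : Fin l ≃ b.support) : Fin (l + 1) → ι :=
  Fin.cons (P.reflectionPerm θ θ) (fun k => (e k : ι))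

/-- The marks of the extended diagram. -/
noncomputable def mark {l : ℕ} (θ : ι) (e : Fin l ≃ b.support) : Fin (l + 1) → ℤ :=
  Fin.cons 1 (fun k => coef b θ (e k))

variable {l : ℕ} {θ : ι} {e : Fin l ≃ b.support}

@[simp] theorem node_zero : node θ e 0 = P.reflectionPerm θ θ := rfl

@[simp] theorem node_succ (k : Fin l) : node θ e k.succ = e k := rfl

@[simp] theorem mark_zero : mark θ e 0 = 1 := rfl

@[simp] theorem mark_succ (k : Fin l) : mark θ e k.succ = coef b θ (e k) := rfl

theorem root_node_zero : P.root (node θ e 0) = -P.root θ := by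
  rw [node_zero, root_reflectionPerm, reflection_apply_self]

theorem root_eq_sum_coef_fin (e : Fin l ≃ b.support) (i : ι) :
    P.root i = ∑ k, (coef b i (e k) : ℝ) • P.root (e k) := by
  rw [root_eq_sum_coef b i]
  exact (_root_.Equiv.sum_comp e (fun k => (coef b i k : ℝ) • P.root k)).symm

theorem sum_mark_smul_node : ∑ i, (mark θ e i : ℝ) • P.root (node θ e i) = 0 := by
  rw [Fin.sum_univ_succ, root_node_zero]
  simp only [mark_zero, mark_succ, node_succ]
  rw [← root_eq_sum_coef_fin e θ]
  simp

theorem isPos_of_isHighestRoot (hθ : IsHighestRoot b θ) : b.IsPos θ := by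
  rw [Base.isPos_iff', height_eq_sum_coef]
  exact Finset.sum_nonneg fun k _ => by have := hθ.one_le_coef k; omega

theorem node_injective (hθ : IsHighestRoot b θ) : Function.Injective (node θ e) := by
  have hneg : ¬ b.IsPos (P.reflectionPerm θ θ) := by
    rw [isPos_reflectionPerm_self, not_not]
    exact isPos_of_isHighestRoot hθ
  have hne : ∀ k : Fin l, node θ e 0 ≠ node θ e k.succ := by
    intro k h
    apply hneg
    rw [← node_zero (e := e), h, node_succ]
    exact Base.isPos_of_mem_support (e k).2
  intro i j hij
  induction i using Fin.cases with
  | zero =>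
    induction j using Fin.cases with
    | zero => rfl
    | succ j => exact absurd hij (hne j)
  | succ i =>
    induction j using Fin.cases with
    | zero => exact absurd hij.symm (hne i)
    | succ j =>
      rw [node_succ, node_succ] at hij
      rw [e.injective (Subtype.ext hij)]

/-- An element of the stabilizer of the fundamental alcove permutes the nodes of the extended
diagram. -/
theorem exists_node_perm (hθ : IsHighestRoot b θ) (e : Fin l ≃ b.support) {ω : P.weylGroup}
    (hω : ω ∈ alcoveStabilizer b θ) :
    ∃ π : Equiv.Perm (Fin (l + 1)), (∀ i, P.weylGroupToPerm ω (node θ e i) = node θ e (π i)) ∧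
      (π 0 = 0 → ω = 1) ∧ ∀ k : Fin l, π 0 = k.succ → coef b θ (e k) = 1 := by
  classical
  have hcase := inv_simple_of_mem_alcoveStabilizer hθ hω
  set p := P.weylGroupToPerm ω⁻¹ with hp
  have hpω : ∀ i j, p i = j → P.weylGroupToPerm ω j = i := by
    rintro i _ rfl
    rw [hp, ← _root_.Equiv.Perm.mul_apply, ← map_mul, mul_inv_cancel, map_one]
    rfl
  have hnode : ∀ i ∈ b.support, ∃ k : Fin l, node θ e k.succ = i := fun i hi =>
    ⟨e.symm ⟨i, hi⟩, by simp⟩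
  have hn : ∀ k, 1 ≤ coef b θ k := hθ.one_le_coef
  -- If `ω⁻¹` keeps the simple roots simple, it is trivial. Otherwise exactly one of them, called
  -- `j` below, goes to the lowest root.
  by_cases hall : ∀ k : b.support, p k ∈ b.support
  · have h1 : ω = 1 := by
      rw [← inv_eq_one]
      exact eq_one_of_isPos b _ fun k hk => Base.isPos_of_mem_support (hall ⟨k, hk⟩)
    refine ⟨1, ?_, fun _ => h1, ?_⟩
    · intro i
      rw [h1]
      simp
    · intro k hk
      exact absurd hk (Fin.succ_ne_zero k).symm
  · push Not at hall
    obtain ⟨j, hj⟩ := hall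
    have hj0 : p j = P.reflectionPerm θ θ := (hcase j).resolve_left hj
    have hother : ∀ k, k ≠ j → p k ∈ b.support := by
      intro k hk
      refine (hcase k).resolve_right fun h => hk ?_
      exact Subtype.ext (p.injective (h.trans hj0.symm))
    have hheight : ∀ k, k ≠ j → b.height (p k) = 1 := fun k hk =>
      Base.height_one_of_mem_support (hother k hk)
    have hj1 : b.height (p j) = -b.height θ := by
      rw [hj0, height_eq_sum_coef, height_eq_sum_coef, ← Finset.sum_neg_distrib]
      exact Finset.sum_congr rfl fun k _ => coef_reflectionPerm_self θ k
    have hθh : b.height θ = ∑ k, coef b θ k := height_eq_sum_coef b θ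
    -- Only the coefficient at `j` contributes differently from the height of `θ`. Since no root is
    -- lower than `-θ`, the formula leaves no room for a mark at `j` greater than one.
    have hpθ : b.height (p θ) = -(coef b θ j) * b.height θ + (b.height θ - coef b θ j) := by
      rw [hp, height_weylGroup, ← hp, ← Finset.add_sum_erase _ _ (Finset.mem_univ j), hj1, hθh,
        ← Finset.add_sum_erase (f := fun k => coef b θ k) _ (Finset.mem_univ j)]
      have hrest : ∑ k ∈ Finset.univ.erase j, coef b θ k * b.height (p k) =
          ∑ k ∈ Finset.univ.erase j, coef b θ k := Finset.sum_congr rfl fun k hk => by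
        rw [hheight k (Finset.ne_of_mem_erase hk), mul_one]
      rw [hrest]
      ring
    have hlow : -b.height θ ≤ b.height (p θ) := by
      rw [hθh, height_eq_sum_coef, ← Finset.sum_neg_distrib]
      exact Finset.sum_le_sum fun m _ => hθ.neg_coef_le _ m
    have hθpos : 0 < b.height θ := isPos_of_isHighestRoot hθ
    have hmj : coef b θ j = 1 := by
      have h1 := hn j
      by_contra hne
      have h2 : 2 ≤ coef b θ j := by omega
      nlinarith
    -- Once the mark at `j` is one, the formula gives height `-1` to the image of `θ`, so the lowest
    -- root goes to a simple root.
    have hp0 : p (P.reflectionPerm θ θ) ∈ b.support := by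
      apply mem_support_of_height_eq_one
      have : b.height (p (P.reflectionPerm θ θ)) = -b.height (p θ) := by
        rw [hp, weylGroupToPerm_reflectionPerm_self]
        exact Base.height_reflectionPerm_self b _
      rw [this, hpθ, hmj]
      ring
    have hex : ∀ i : Fin (l + 1), ∃ m, p (node θ e i) = node θ e m := by
      intro i
      induction i using Fin.cases with
      | zero =>
        obtain ⟨m, hm⟩ := hnode _ hp0
        exact ⟨m.succ, hm.symm⟩
      | succ i =>
        rcases hcase (e i) with h | h
        · obtain ⟨m, hm⟩ := hnode _ h
          exact ⟨m.succ, hm.symm⟩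
        · exact ⟨0, h⟩
    choose σ hσ using hex
    have hinj : Function.Injective σ := by
      intro i i' h
      apply node_injective (e := e) hθ
      apply p.injective
      rw [hσ, hσ, h]
    -- The map `σ` describes `ω⁻¹` on the nodes, so the permutation belonging to `ω` is its inverse.
    let σ' : Equiv.Perm (Fin (l + 1)) := Equiv.ofBijective σ hinj.bijective_of_finite
    have hσ' : ∀ i, P.weylGroupToPerm ω (node θ e i) = node θ e (σ'.symm i) := by
      intro i
      apply hpω
      rw [hσ]
      congr 1
      exact σ'.apply_symm_apply i
    have hj' : σ'.symm 0 = (e.symm j).succ := by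
      apply node_injective (e := e) hθ
      rw [← hσ', node_succ, e.apply_symm_apply]
      exact hpω _ _ hj0
    refine ⟨σ'.symm, hσ', ?_, ?_⟩
    · intro h
      rw [hj'] at h
      exact absurd h (Fin.succ_ne_zero _)
    · intro k hk
      rw [hj'] at hk
      rw [← Fin.succ_injective _ hk, e.apply_symm_apply]
      exact hmj

/-- A reflection in an element of `S` only subtracts a multiple of that simple root, so the other
coefficients do not change. -/
theorem repr_parabolic_smul {S : Set ι} {w : P.weylGroup} (hS : S ⊆ b.support)
    (hw : w ∈ parabolic P S) (j : b.support) (hj : (j : ι) ∉ S) (v : V) :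
    b.toWeightBasis.repr (w • v) j = b.toWeightBasis.repr v j := by
  classical
  induction hw using Subgroup.closure_induction generalizing v with
  | mem x hx =>
    obtain ⟨k, hk, rfl⟩ := hx
    rw [weylGroup_ofIdx_smul, map_sub, map_smul, Finsupp.sub_apply, Finsupp.smul_apply, repr_root]
    have hkj : (⟨k, hS hk⟩ : b.support) ≠ j := by
      rintro rfl
      exact hj hk
    have := coef_simple b ⟨k, hS hk⟩ j
    rw [if_neg hkj] at this
    simp only at this
    rw [this]
    simp
  | one => rw [one_smul]
  | mul x y _ _ hx hy => rw [mul_smul, hx, hy]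
  | inv x _ hx =>
    have := hx (x⁻¹ • v)
    rw [smul_inv_smul] at this
    exact this.symm

theorem coef_parabolic {S : Set ι} {w : P.weylGroup} (hS : S ⊆ b.support)
    (hw : w ∈ parabolic P S) (j : b.support) (hj : (j : ι) ∉ S) (i : ι) :
    coef b (P.weylGroupToPerm w i) j = coef b i j := by
  have := repr_parabolic_smul hS hw j hj (P.root i)
  rw [weylGroup_apply_root, repr_root, repr_root] at this
  exact_mod_cast this

theorem isPos_of_coef_nonneg {i : ι} (h : ∀ k, 0 ≤ coef b i k) : b.IsPos i := by
  rw [Base.isPos_iff', height_eq_sum_coef]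
  exact Finset.sum_nonneg fun k _ => h k

/-- A permutation of the extended diagram induced by the Weyl group is given by longest
elements. -/
theorem isOmega_of_node_perm (hθ : IsHighestRoot b θ) {ω : P.weylGroup}
    {π : Equiv.Perm (Fin (l + 1))}
    (hπ : ∀ i, P.weylGroupToPerm ω (node θ e i) = node θ e (π i)) {k : Fin l} (hk : π 0 = k.succ)
    (hmark : coef b θ (e k) = 1) : IsOmega b θ e (k + 1) ω := by
  classical
  right
  refine ⟨k, rfl, by rw [repr_root, hmark]; simp, ?_⟩
  obtain ⟨w₀, hw₀⟩ := exists_isLongest b (b.support : Set ι)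
  set S : Set ι := (b.support : Set ι) \ {(e k : ι)} with hSdef
  have hS : S ⊆ b.support := Set.sdiff_subset
  obtain ⟨wj, hwj⟩ := exists_isLongest b S
  refine ⟨w₀, wj, hw₀, hwj, ?_⟩
  have hkS : (e k : ι) ∉ S := fun h => h.2 rfl
  -- It is enough that this product takes every simple root to a positive root.
  suffices ω⁻¹ * (wj * w₀) = 1 by
    rw [inv_mul_eq_one] at this
    exact this
  have hinv : ∀ i, P.weylGroupToPerm ω⁻¹ (node θ e (π i)) = node θ e i := by
    intro i
    rw [← hπ, ← _root_.Equiv.Perm.mul_apply, ← map_mul, inv_mul_cancel, map_one]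
    rfl
  -- the simple root that `ω` takes to the lowest root
  obtain ⟨m, hm⟩ : ∃ m : Fin l, π m.succ = 0 := by
    have : π.symm 0 ≠ 0 := by
      intro h
      have := π.apply_symm_apply 0
      rw [h, hk] at this
      exact Fin.succ_ne_zero _ this
    obtain ⟨m, hm⟩ := Fin.exists_succ_eq.2 this
    exact ⟨m, by rw [hm, π.apply_symm_apply]⟩
  have hk0 : P.weylGroupToPerm ω⁻¹ (e k) = P.reflectionPerm θ θ := by
    have := hinv 0
    rwa [hk] at this
  have hother : ∀ i : Fin l, i ≠ k → ∃ r : Fin l, r ≠ m ∧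
      P.weylGroupToPerm ω⁻¹ (e i) = e r := by
    intro i hi
    have h1 := hinv (π.symm i.succ)
    rw [π.apply_symm_apply] at h1
    have h2 : π.symm i.succ ≠ 0 := by
      intro h
      rw [_root_.Equiv.symm_apply_eq, hk] at h
      exact hi (Fin.succ_injective _ h)
    obtain ⟨r, hr⟩ := Fin.exists_succ_eq.2 h2
    refine ⟨r, ?_, by rw [← node_succ (θ := θ), ← node_succ (θ := θ), h1, hr]⟩
    rintro rfl
    rw [← _root_.Equiv.apply_eq_iff_eq π, π.apply_symm_apply, hm] at hr
    exact Fin.succ_ne_zero _ hr.symm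
  apply eq_one_of_isPos b
  intro i hi
  have hact : P.weylGroupToPerm (ω⁻¹ * (wj * w₀)) i =
      P.weylGroupToPerm ω⁻¹ (P.weylGroupToPerm wj (P.weylGroupToPerm w₀ i)) := by
    rw [map_mul, map_mul]
    rfl
  rw [hact]
  set i₀ := P.weylGroupToPerm w₀ i with hi₀
  set r := P.weylGroupToPerm wj i₀ with hr
  have hi₀neg : ¬ b.IsPos i₀ := hw₀.not_isPos b subset_rfl hi
  -- Both `i₀` and `r` have the same coefficient at `e k`, which `wj` cannot change and which is at
  -- most zero because `i₀` is negative.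
  have hd : coef b r (e k) = coef b i₀ (e k) := coef_parabolic hS hwj.1 _ hkS _
  have hd0 : coef b i₀ (e k) ≤ 0 := coef_nonpos b hi₀neg _
  have hmpos : 1 ≤ coef b θ (e m) := hθ.one_le_coef _
  -- Under `ω⁻¹` the root `e k` becomes the lowest root and the other simple roots become simple
  -- roots different from `e m`, so `e m` can only come from `e k`.
  have hcoefm : coef b (P.weylGroupToPerm ω⁻¹ r) (e m) = -(coef b r (e k) * coef b θ (e m)) := by
    rw [coef_weylGroup, Finset.sum_eq_single (e k)]
    · rw [hk0, coef_reflectionPerm_self]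
      ring
    · intro x _ hx
      obtain ⟨x, rfl⟩ := e.surjective x
      obtain ⟨s, hs1, hs2⟩ := hother x (fun h => hx (by rw [h]))
      rw [hs2, coef_simple, if_neg (fun h => hs1 (e.injective h)), mul_zero]
    · intro h
      exact absurd (Finset.mem_univ _) h
  -- A negative coefficient at `e k` gives a positive coefficient at `e m`, hence a positive root. A
  -- zero coefficient puts `i₀` in the subsystem of `S`, where `wj` makes it positive and `ω⁻¹`
  -- takes simple roots to simple roots.
  rcases hd0.lt_or_eq with hlt | heq
  · by_contra hneg
    have := coef_nonpos b hneg (e m)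
    rw [hcoefm, hd] at this
    nlinarith
  · have hrcoef : ∀ x, 0 ≤ coef b r x := by
      intro x
      rw [hr, coef_weylGroup]
      refine Finset.sum_nonneg fun y _ => ?_
      by_cases hy : y = e k
      · rw [hy, heq, zero_mul]
      · refine mul_nonneg_of_nonpos_of_nonpos (coef_nonpos b hi₀neg y) (coef_nonpos b ?_ x)
        exact hwj.not_isPos b hS ⟨y.2, fun h => hy (Subtype.ext h)⟩
    apply isPos_of_coef_nonneg
    intro x
    rw [coef_weylGroup]
    refine Finset.sum_nonneg fun y _ => ?_
    obtain ⟨y, rfl⟩ := e.surjective y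
    by_cases hy : y = k
    · rw [hy, hd, heq, zero_mul]
    · obtain ⟨s, -, hs2⟩ := hother y hy
      rw [hs2]
      exact mul_nonneg (hrcoef _) (coef_nonneg b (Base.isPos_of_mem_support (e s).2) x)

/-- The marks are invariant under the permutation of the nodes. -/
theorem mark_perm (hθ : IsHighestRoot b θ) {ω : P.weylGroup} {π : Equiv.Perm (Fin (l + 1))}
    (hπ : ∀ i, P.weylGroupToPerm ω (node θ e i) = node θ e (π i)) (i : Fin (l + 1)) :
    mark θ e (π i) = mark θ e i := by
  set c : Fin (l + 1) → ℤ := fun i => mark θ e (π.symm i) with hc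
  -- Applying `ω` to the relation between the nodes gives the relation with permuted marks. The
  -- simple roots are independent, so there is only one relation up to a factor.
  have h0 : ∑ i, (c i : ℝ) • P.root (node θ e i) = 0 := by
    have h1 := congrArg (fun v => ω • v) (sum_mark_smul_node (θ := θ) (e := e))
    simp only [weylGroup_smul_sum, weylGroup_smul_real, weylGroup_apply_root, hπ, smul_zero] at h1
    rw [← h1, ← _root_.Equiv.sum_comp π]
    simp [hc]
  have h2 : ∀ k : Fin l, c k.succ = c 0 * mark θ e k.succ := by
    rw [Fin.sum_univ_succ, root_node_zero, root_eq_sum_coef_fin e θ, smul_neg, Finset.smul_sum,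
      neg_add_eq_zero] at h0
    intro k
    have h3 := congrArg (fun v => b.toWeightBasis.repr v (e k)) h0
    simp only [smul_smul, node_succ] at h3
    rw [_root_.Equiv.sum_comp e (fun k => ((c 0 : ℝ) * (coef b θ k)) • P.root k),
      repr_sum_smul_root] at h3
    rw [← _root_.Equiv.sum_comp e.symm] at h3
    simp only [_root_.Equiv.apply_symm_apply] at h3
    rw [repr_sum_smul_root, e.symm_apply_apply] at h3
    exact_mod_cast h3.symm
  have h2' : ∀ i, c i = c 0 * mark θ e i := by
    intro i
    induction i using Fin.cases with
    | zero => simp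
    | succ k => exact h2 k
  -- Permuting the marks does not change their positive sum, so the factor is one.
  have hsum : ∑ i, c i = ∑ i, mark θ e i := _root_.Equiv.sum_comp π.symm (mark θ e)
  have hpos : 0 < ∑ i, mark θ e i := by
    rw [Fin.sum_univ_succ, mark_zero]
    have : 0 ≤ ∑ k : Fin l, mark θ e k.succ :=
      Finset.sum_nonneg fun k _ => by have := hθ.one_le_coef (e k); rw [mark_succ]; omega
    omega
  have hc0 : c 0 = 1 := by
    rw [Finset.sum_congr rfl (fun i _ => h2' i), ← Finset.mul_sum] at hsum
    nlinarith [mul_right_cancel₀ hpos.ne' (hsum.trans (one_mul _).symm)]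
  have := h2' (π i)
  rw [hc0, one_mul] at this
  rw [← this]
  simp [hc]

end Stabilizer

end RootPairing

/-! ### Counting the fixed points off the arrangement. -/

namespace RootPairing

section Counting

set_option linter.unusedSectionVars false

variable {ι V E : Type*} [AddCommGroup V] [Module ℝ V] [AddCommGroup E] [Module ℝ E]
  {P : RootPairing ι ℝ V E}

theorem mk_eq_mk_iff {L : AddSubgroup E} {q : ℕ} (x y : L) :
    (QuotientAddGroup.mk x : L ⧸ qMultiples L q) = QuotientAddGroup.mk y ↔
      ∃ z ∈ L, (x : E) = y + (q : ℝ) • z := by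
  rw [eq_comm, QuotientAddGroup.eq]
  constructor
  · rintro ⟨z, hz⟩
    refine ⟨z, z.2, ?_⟩
    have := congrArg (Subtype.val) hz
    simp only [nsmulAddMonoidHom_apply, AddSubgroup.coe_nsmul, AddSubgroup.coe_add,
      AddSubgroup.coe_neg] at this
    rw [Nat.cast_smul_eq_nsmul, this]
    abel
  · rintro ⟨z, hz, h⟩
    refine ⟨⟨z, hz⟩, ?_⟩
    apply Subtype.ext
    simp only [nsmulAddMonoidHom_apply, AddSubgroup.coe_nsmul, AddSubgroup.coe_add,
      AddSubgroup.coe_neg]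
    rw [h, Nat.cast_smul_eq_nsmul]
    abel

/-- Elements of `S` are integral on `L`, so the condition modulo `q` is the same for all
representatives. -/
theorem mk_mem_modComplement_iff {S : Set V} {L : AddSubgroup E} {q : ℕ}
    (hS : L ≤ P.integralPoints S) (x : L) :
    (QuotientAddGroup.mk x : L ⧸ qMultiples L q) ∈ P.modComplement S L q ↔
      ∀ β ∈ S, ¬ ∃ n : ℤ, P.toLinearMap β (x : E) = (q : ℝ) * n := by
  refine ⟨fun h => h x rfl, fun h y hy β hβ => ?_⟩
  obtain ⟨z, hz, hyz⟩ := (mk_eq_mk_iff y x).1 hy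
  rintro ⟨n, hn⟩
  obtain ⟨r, hr⟩ := hS hz β hβ
  refine h β hβ ⟨n - r, ?_⟩
  rw [hyz, map_add, map_smul, hr, smul_eq_mul] at hn
  push_cast
  linarith

theorem actMod_mk_eq_iff {q : ℕ} (w : P.weylGroup) (x : P.coweightLattice) :
    P.actMod q w (QuotientAddGroup.mk x) = QuotientAddGroup.mk x ↔
      ∃ z ∈ P.coweightLattice, P.coact w x = x + (q : ℝ) • z :=
  mk_eq_mk_iff _ x

/-! #### Orbit averages -/

theorem smul_orbitAverage (ω : P.weylGroup) (hω : 0 < orderOf ω) (v : V) :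
    ω • P.orbitAverage ω v = P.orbitAverage ω v := by
  unfold orbitAverage
  rw [weylGroup_smul_real, weylGroup_smul_sum]
  congr 1
  simp only [← mul_smul, ← pow_succ']
  rw [← Finset.Ico_add_one_right_eq_Icc, Finset.sum_Ico_add' (fun t => ω ^ t • v) 1 _ 1,
    Finset.sum_Ico_succ_top (by omega), Finset.sum_eq_sum_Ico_succ_bot (by omega : 1 < _)]
  rw [pow_succ, pow_orderOf_eq_one, one_mul, pow_one, add_comm]

theorem map_orbitAverage {F : Type*} [AddCommGroup F] [Module ℝ F] (ω : P.weylGroup)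
    (hω : 0 < orderOf ω) (η : V →ₗ[ℝ] F) (hη : ∀ v, η (ω • v) = η v) (v : V) :
    η (P.orbitAverage ω v) = η v := by
  have hpow : ∀ t : ℕ, η (ω ^ t • v) = η v := by
    intro t
    induction t with
    | zero => simp
    | succ t ih => rw [pow_succ', mul_smul, hη, ih]
  unfold orbitAverage
  rw [map_smul, map_sum, Finset.sum_congr rfl (fun t _ => hpow t), Finset.sum_const,
    Nat.card_Icc, Nat.add_sub_cancel, ← Nat.cast_smul_eq_nsmul ℝ, smul_smul, inv_mul_cancel₀,
    one_smul]
  exact_mod_cast hω.ne'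

/-- The orbit average as a linear map. -/
noncomputable def averageLin (ω : P.weylGroup) : V →ₗ[ℝ] V where
  toFun := P.orbitAverage ω
  map_add' x y := by simp [orbitAverage, Finset.sum_add_distrib]
  map_smul' c x := by
    simp only [orbitAverage, weylGroup_smul_real, RingHom.id_apply]
    rw [← Finset.smul_sum, smul_comm]

theorem averageLin_apply (ω : P.weylGroup) (v : V) : averageLin ω v = P.orbitAverage ω v := rfl

theorem toLinearMap_orbitAverage (ω : P.weylGroup) (hω : 0 < orderOf ω) {x : E}
    (hx : P.coact ω x = x) (v : V) :
    P.toLinearMap (P.orbitAverage ω v) x = P.toLinearMap v x :=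
  map_orbitAverage ω hω (P.toLinearMap.flip x) (fun v => toLinearMap_coact_eq_iff hx v) v

/-- A root and its orbit average agree on a fixed vector, and averages equal to zero impose no
condition. So `M` is the lattice of fixed vectors of `Z`. -/
theorem mem_foldedCoweightLattice_iff (ω : P.weylGroup) (hω : 0 < orderOf ω) {x : E} :
    x ∈ P.foldedCoweightLattice ω ↔ P.coact ω x = x ∧ x ∈ P.coweightLattice := by
  refine ⟨fun ⟨h1, h2⟩ => ⟨h1, ?_⟩, fun ⟨h1, h2⟩ => ⟨h1, ?_⟩⟩
  · rintro _ ⟨i, rfl⟩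
    rw [← toLinearMap_orbitAverage ω hω h1]
    by_cases h0 : P.orbitAverage ω (P.root i) = 0
    · exact ⟨0, by simp [h0]⟩
    · exact h2 _ ⟨⟨i, rfl⟩, h0⟩
  · rintro _ ⟨⟨i, rfl⟩, -⟩
    rw [toLinearMap_orbitAverage ω hω h1]
    exact h2 _ ⟨i, rfl⟩

/-- `χ` represents a generator of the first cohomology of `ω` in the coweight lattice. -/
structure IsCocycle (ω : P.weylGroup) (χ : E) (o : ℕ) : Prop where
  mem : χ ∈ P.coweightLattice
  coact_eq : ∃ z ∈ P.coweightLattice, P.coact ω χ = χ + (o : ℝ) • z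
  generates : ∀ q : ℕ, 0 < q → ∀ x ∈ P.coweightLattice,
    (∃ z ∈ P.coweightLattice, P.coact ω x = x + (q : ℝ) • z) →
    ∃ m ∈ P.coweightLattice, P.coact ω m = m ∧ ∃ a : ℤ, (q : ℤ) ∣ o * a ∧
      ∃ z ∈ P.coweightLattice, x = m + (a : ℝ) • χ + (q : ℝ) • z

/-- The data of a folding: `η` describes the orbit averages of the roots in coordinates, with
folded roots `R`; the function `c` on the roots is their pairing with a cocycle, and the set `T`
describes the arrangement on the components of the fixed points. -/
structure IsFolding (P : RootPairing ι ℝ V E) (ω : P.weylGroup) {n : ℕ}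
    (η : V →ₗ[ℝ] (Fin n → ℝ)) (c : ι → ℤ) (o : ℕ) (R T : Set (Fin n → ℝ)) : Prop where
  invariant : ∀ v, η (ω • v) = η v
  faithful : ∀ v, ω • v = v → η v = 0 → v = 0
  range_eq : R = {r | (∃ i, η (P.root i) = r) ∧ r ≠ 0}
  not_dvd : ∀ i, η (P.root i) = 0 → ¬ (o : ℤ) ∣ c i
  exists_residue : ∀ r : ℤ, 0 < r → r < o → ∃ i, η (P.root i) = 0 ∧ (o : ℤ) ∣ c i - r
  exists_lift : ∀ γ ∈ T, ∃ (i₀ : ι) (s : ℕ), s ∣ o ∧ γ = (s : ℝ) • η (P.root i₀) ∧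
    ∀ t : ℤ, ∃ i, η (P.root i) = η (P.root i₀) ∧ (o : ℤ) ∣ c i - (o / s : ℕ) * t
  exists_target : ∀ i, η (P.root i) ≠ 0 → ∃ γ ∈ T, ∃ s : ℤ, γ = (s : ℝ) • η (P.root i) ∧
    (o : ℤ) ∣ s * c i

namespace IsFolding

variable {ω : P.weylGroup} {n : ℕ} {η : V →ₗ[ℝ] (Fin n → ℝ)} {c : ι → ℤ} {o : ℕ}
  {R T : Set (Fin n → ℝ)}

/-- An invariant map sees only the average, and the average is a fixed vector, on which `η` is
faithful. So `η` and averaging have the same kernel. -/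
theorem orbitAverage_eq_zero_iff (h : IsFolding P ω η c o R T) (hω : 0 < orderOf ω) (v : V) :
    P.orbitAverage ω v = 0 ↔ η v = 0 := by
  rw [← map_orbitAverage ω hω η h.invariant v]
  exact ⟨fun h0 => by rw [h0, map_zero], h.faithful _ (smul_orbitAverage ω hω v)⟩

theorem orbitAverage_eq_iff (h : IsFolding P ω η c o R T) (hω : 0 < orderOf ω) (v v' : V) :
    P.orbitAverage ω v = P.orbitAverage ω v' ↔ η v = η v' := by
  rw [← sub_eq_zero, ← averageLin_apply, ← averageLin_apply, ← map_sub, averageLin_apply,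
    h.orbitAverage_eq_zero_iff hω, map_sub, sub_eq_zero]

/-- Averaging factors through the range of `η` because the kernels agree. The map is built from a
section over that range and extended arbitrarily to the coordinate space. -/
theorem exists_realization (h : IsFolding P ω η c o R T) (hω : 0 < orderOf ω) :
    ∃ ψ : (Fin n → ℝ) →ₗ[ℝ] V, (∀ v, ψ (η v) = P.orbitAverage ω v) ∧
      IsRealization R (P.foldedRoots ω) ψ := by
  obtain ⟨s, hs⟩ := LinearMap.exists_rightInverse_of_surjective η.rangeRestrict
    (LinearMap.range_eq_top.2 η.surjective_rangeRestrict)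
  obtain ⟨ψ, hψ⟩ := LinearMap.exists_extend ((averageLin ω).comp s)
  have key : ∀ v, ψ (η v) = P.orbitAverage ω v := by
    intro v
    have h1 := LinearMap.congr_fun hψ (η.rangeRestrict v)
    have h2 := congrArg Subtype.val (LinearMap.congr_fun hs (η.rangeRestrict v))
    simp only [LinearMap.comp_apply, Submodule.subtype_apply, LinearMap.id_apply] at h1 h2
    change ψ (η v) = _ at h1
    rw [h1, averageLin_apply, h.orbitAverage_eq_iff hω]
    exact h2
  refine ⟨ψ, key, ?_, ?_⟩
  · have hspan : Submodule.span ℝ R ≤ LinearMap.range η := by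
      rw [Submodule.span_le, h.range_eq]
      rintro _ ⟨⟨i, rfl⟩, -⟩
      exact ⟨_, rfl⟩
    intro x hx y hy hxy
    obtain ⟨v, rfl⟩ := hspan hx
    obtain ⟨v', rfl⟩ := hspan hy
    rw [key, key] at hxy
    exact (h.orbitAverage_eq_iff hω v v').1 hxy
  · rw [h.range_eq]
    ext v
    constructor
    · rintro ⟨_, ⟨⟨i, rfl⟩, h0⟩, rfl⟩
      rw [key]
      exact ⟨⟨i, rfl⟩, fun h1 => h0 ((h.orbitAverage_eq_zero_iff hω _).1 h1)⟩
    · rintro ⟨⟨i, rfl⟩, h0⟩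
      exact ⟨η (P.root i), ⟨⟨i, rfl⟩, fun h1 => h0 ((h.orbitAverage_eq_zero_iff hω _).2 h1)⟩,
        key _⟩

variable {χ : E}

theorem toLinearMap_eq (hc : ∀ i, P.toLinearMap (P.root i) χ = c i) {m z : E}
    (hz : z ∈ P.coweightLattice) (a : ℤ) (q : ℕ) (i : ι) :
    ∃ r : ℤ, P.toLinearMap (P.root i) (m + (a : ℝ) • χ + (q : ℝ) • z) =
      P.toLinearMap (P.root i) m + ((a * c i : ℤ) : ℝ) + (q : ℝ) * r := by
  obtain ⟨r, hr⟩ := hz _ ⟨i, rfl⟩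
  refine ⟨r, ?_⟩
  rw [map_add, map_add, map_smul, map_smul, hc, hr]
  push_cast
  simp only [smul_eq_mul]

theorem toLinearMap_eq_zero (h : IsFolding P ω η c o R T) (hω : 0 < orderOf ω) {m : E}
    (hm : P.coact ω m = m) {i : ι} (hi : η (P.root i) = 0) : P.toLinearMap (P.root i) m = 0 := by
  rw [← toLinearMap_orbitAverage ω hω hm, (h.orbitAverage_eq_zero_iff hω _).2 hi]
  simp

/-- A fixed point off the arrangement lies on a component that generates. -/
theorem exists_coprime (h : IsFolding P ω η c o R T) (hω : 0 < orderOf ω) (ho : 0 < o)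
    (hc : ∀ i, P.toLinearMap (P.root i) χ = c i) {q : ℕ} (hq : 0 < q) {m z : E} {a : ℤ}
    (hm : P.coact ω m = m) (hz : z ∈ P.coweightLattice) (ha : (q : ℤ) ∣ o * a)
    (hreg : ∀ i, ¬ ∃ r : ℤ,
      P.toLinearMap (P.root i) (m + (a : ℝ) • χ + (q : ℝ) • z) = (q : ℝ) * r) :
    o ∣ q ∧ ∃ k : ℤ, a = (q / o : ℕ) * k ∧ IsCoprime k (o : ℤ) := by
  -- With `a = g k` and `q = g c₀` in lowest terms, `q ∣ o a` says that `c₀` divides `o`. The claim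
  -- is that `c₀ = o`.
  set g := Int.gcd a q with hg
  have hgpos : 0 < g := Int.gcd_pos_of_ne_zero_right _ (by exact_mod_cast hq.ne')
  obtain ⟨k, hk⟩ : (g : ℤ) ∣ a := Int.gcd_dvd_left _ _
  obtain ⟨c₀, hc₀⟩ : g ∣ q := by exact_mod_cast Int.gcd_dvd_right a (q : ℤ)
  have hcop : IsCoprime k (c₀ : ℤ) := by
    rw [Int.isCoprime_iff_gcd_eq_one]
    have h1 : Int.gcd a q = g * Int.gcd k c₀ := by
      conv_lhs => rw [hk, hc₀]
      push_cast
      rw [Int.gcd_mul_left]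
      simp
    rw [← hg] at h1
    exact Nat.eq_of_mul_eq_mul_left hgpos (by rw [← h1, mul_one])
  have hc₀pos : 0 < c₀ := Nat.pos_of_ne_zero (by rintro rfl; omega)
  have hdvd : (c₀ : ℤ) ∣ o := by
    apply hcop.symm.dvd_of_dvd_mul_right
    rw [hk, hc₀] at ha
    push_cast at ha
    rw [show (o : ℤ) * (g * k) = g * (o * k) by ring] at ha
    exact Int.dvd_of_mul_dvd_mul_left (by exact_mod_cast hgpos.ne') ha
  have hle : c₀ ≤ o := Nat.le_of_dvd ho (by exact_mod_cast hdvd)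
  -- Otherwise there is a root with zero average whose class is `c₀`. Its value on the component is
  -- `a c₀ = k q` up to multiples of `q`, and this contradicts regularity.
  have heq : c₀ = o := by
    by_contra hne
    obtain ⟨i, hi0, y, hy⟩ := h.exists_residue c₀ (by exact_mod_cast hc₀pos)
      (by exact_mod_cast lt_of_le_of_ne hle hne)
    obtain ⟨r, hr⟩ := toLinearMap_eq hc hz a q i (m := m)
    obtain ⟨t, ht⟩ := ha
    apply hreg i
    refine ⟨k + t * y + r, ?_⟩
    rw [hr, h.toLinearMap_eq_zero hω hm hi0]
    have : a * c i = q * (k + t * y) := by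
      have hci : c i = c₀ + o * y := by linarith
      rw [hci, mul_add, ← mul_assoc, mul_comm a o, ht, hk, hc₀]
      push_cast
      ring
    rw [this]
    push_cast
    ring
  subst heq
  refine ⟨⟨g, by rw [hc₀, mul_comm]⟩, k, ?_, hcop⟩
  rw [hk, hc₀, Nat.mul_div_cancel _ hc₀pos]

/-- On a generating component the arrangement is described by `T`. -/
theorem regular_iff (h : IsFolding P ω η c o R T) (hω : 0 < orderOf ω) (ho : 0 < o)
    (hc : ∀ i, P.toLinearMap (P.root i) χ = c i) {q : ℕ} (hoq : o ∣ q) {m z : E} {k : ℤ}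
    (hm : P.coact ω m = m) (hmZ : m ∈ P.coweightLattice) (hz : z ∈ P.coweightLattice)
    (hk : IsCoprime k (o : ℤ)) (hq : 0 < q)
    {ψ : (Fin n → ℝ) →ₗ[ℝ] V} (hψ : ∀ v, ψ (η v) = P.orbitAverage ω v) :
    (∀ i, ¬ ∃ r : ℤ, P.toLinearMap (P.root i)
      (m + (((q / o : ℕ) * k : ℤ) : ℝ) • χ + (q : ℝ) • z) = (q : ℝ) * r) ↔
    ∀ γ ∈ T, ¬ ∃ r : ℤ, P.toLinearMap (ψ γ) m = (q : ℝ) * r := by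
  obtain ⟨g, hg⟩ := hoq
  have hgo : q / o = g := by rw [hg, Nat.mul_div_cancel_left _ ho]
  rw [hgo]
  have hgpos : 0 < g := Nat.pos_of_ne_zero (by rintro rfl; omega)
  have hpsi : ∀ i, P.toLinearMap (ψ (η (P.root i))) m = P.toLinearMap (P.root i) m := fun i => by
    rw [hψ, toLinearMap_orbitAverage ω hω hm]
  choose val hval using fun i => hmZ _ ⟨i, rfl⟩
  have hreg : ∀ i, (∃ r : ℤ, P.toLinearMap (P.root i)
      (m + ((g * k : ℤ) : ℝ) • χ + (q : ℝ) • z) = (q : ℝ) * r) ↔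
      (q : ℤ) ∣ val i + g * k * c i := by
    intro i
    obtain ⟨r, hr⟩ := toLinearMap_eq hc hz (g * k) q i (m := m)
    rw [hr, hval]
    constructor
    · rintro ⟨s, hs⟩
      refine ⟨s - r, ?_⟩
      have : ((val i + g * k * c i : ℤ) : ℝ) = ((q * (s - r) : ℤ) : ℝ) := by
        push_cast
        push_cast at hs
        linarith
      exact_mod_cast this
    · rintro ⟨s, hs⟩
      refine ⟨s + r, ?_⟩
      have : ((val i + g * k * c i : ℤ) : ℝ) = ((q * s : ℤ) : ℝ) := by rw [hs]
      push_cast at this ⊢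
      linarith
  simp only [hreg]
  constructor
  · rintro h1 γ hγ ⟨r, hr⟩
    obtain ⟨i₀, s, ⟨u, hu⟩, rfl, hlift⟩ := h.exists_lift γ hγ
    rw [map_smul, map_smul, LinearMap.smul_apply, hpsi, hval, smul_eq_mul] at hr
    have hr' : (s : ℤ) * val i₀ = q * r := by exact_mod_cast hr
    have hspos : 0 < s := Nat.pos_of_ne_zero (by rintro rfl; omega)
    have hus : o / s = u := by rw [hu, Nat.mul_div_cancel_left _ hspos]
    have hval0 : val i₀ = g * u * r := by
      apply mul_left_cancel₀ (a := (s : ℤ)) (by exact_mod_cast hspos.ne')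
      rw [hr', hg, hu]
      push_cast
      ring
    -- Here `k'` inverts `k` modulo `o`, and `val i₀ = g u r` with `u = o / s`. The root of the
    -- fibre with class `-u k' r` has the value `g u r (1 - k k')`, which is divisible by `g o = q`.
    obtain ⟨k', y, hky⟩ := hk
    obtain ⟨i, hi, w, hw⟩ := hlift (-(k' * r))
    rw [hus] at hw
    have hvi : val i = val i₀ := by
      have : (val i : ℝ) = val i₀ := by rw [← hval, ← hval, ← hpsi, ← hpsi, hi]
      exact_mod_cast this
    apply h1 i
    refine ⟨k * w + y * u * r, ?_⟩
    have hci : c i = o * w - u * (k' * r) := by linarith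
    rw [hvi, hval0, hci, hg]
    push_cast
    linear_combination (g * u * r : ℤ) * (-hky)
  · rintro h1 i ⟨r, hr⟩
    by_cases hi : η (P.root i) = 0
    · have hv0 : val i = 0 := by
        have : (val i : ℝ) = 0 := by rw [← hval, h.toLinearMap_eq_zero hω hm hi]
        exact_mod_cast this
      apply h.not_dvd i hi
      apply hk.symm.dvd_of_dvd_mul_left
      refine ⟨r, ?_⟩
      apply mul_left_cancel₀ (a := (g : ℤ)) (by exact_mod_cast hgpos.ne')
      rw [hv0, hg] at hr
      push_cast at hr
      linarith
    -- Multiplying by `s` removes the contribution of the cocycle, since `o ∣ s * c i` and therefore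
    -- `q ∣ g k s c i`.
    · obtain ⟨γ, hγ, s, rfl, w, hw⟩ := h.exists_target i hi
      apply h1 _ hγ
      refine ⟨s * r - k * w, ?_⟩
      rw [map_smul, map_smul, LinearMap.smul_apply, hpsi, hval, smul_eq_mul]
      have : s * val i = q * (s * r - k * w) := by
        have h2 : s * val i = s * (q * r) - g * k * (s * c i) := by
          rw [← hr]; ring
        rw [h2, hw, hg]
        push_cast
        ring
      exact_mod_cast this

/-- The number of fixed points off the arrangement. -/
theorem equivChar_eq (h : IsFolding P ω η c o R T) (horder : orderOf ω = o) (ho : 0 < o)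
    (hχ : IsCocycle ω χ o) (hc : ∀ i, P.toLinearMap (P.root i) χ = c i)
    {ψ : (Fin n → ℝ) →ₗ[ℝ] V} (hψ : ∀ v, ψ (η v) = P.orbitAverage ω v) {q : ℕ} (hq : 0 < q) :
    P.equivChar q ω = cFun o q * P.charQuasi (ψ '' T) (P.foldedCoweightLattice ω) q := by
  have hω : 0 < orderOf ω := by rw [horder]; exact ho
  set Z := P.coweightLattice with hZ
  set M := P.foldedCoweightLattice ω with hM
  have hMmem : ∀ {x : E}, x ∈ M ↔ P.coact ω x = x ∧ x ∈ Z := mem_foldedCoweightLattice_iff ω hω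
  have hZint : Z ≤ P.integralPoints (Set.range P.root) := le_rfl
  have hqR : (q : ℝ) ≠ 0 := by exact_mod_cast hq.ne'
  have hMint : M ≤ P.integralPoints (ψ '' T) := by
    rintro x hx _ ⟨γ, hγ, rfl⟩
    obtain ⟨i₀, s, -, rfl, -⟩ := h.exists_lift γ hγ
    obtain ⟨hx1, hx2⟩ := hMmem.1 hx
    obtain ⟨r, hr⟩ := hx2 _ ⟨i₀, rfl⟩
    refine ⟨s * r, ?_⟩
    rw [map_smul, map_smul, LinearMap.smul_apply, hψ, toLinearMap_orbitAverage ω hω hx1, hr]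
    push_cast
    rfl
  -- Every regular fixed point lies on a translate of `M` by a multiple of `(q / o) χ` that is prime
  -- to `o`.
  have hdecomp : ∀ x : Z, (QuotientAddGroup.mk x : Z ⧸ qMultiples Z q) ∈
      P.modComplement (Set.range P.root) Z q →
      P.actMod q ω (QuotientAddGroup.mk x) = QuotientAddGroup.mk x →
      o ∣ q ∧ ∃ m : M, ∃ z ∈ Z, ∃ k : ℤ, IsCoprime k (o : ℤ) ∧
        (x : E) = m + (((q / o : ℕ) * k : ℤ) : ℝ) • χ + (q : ℝ) • z := by
    intro x hx hfix
    rw [actMod_mk_eq_iff] at hfix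
    rw [mk_mem_modComplement_iff hZint] at hx
    obtain ⟨m, hmZ, hm, a, ha, z, hz, hxeq⟩ := hχ.generates q hq x x.2 hfix
    obtain ⟨h1, k, rfl, hk⟩ := h.exists_coprime hω ho hc hq hm hz ha (fun i => by
      rw [← hxeq]; exact hx _ ⟨i, rfl⟩)
    exact ⟨h1, ⟨m, hMmem.2 ⟨hm, hmZ⟩⟩, z, hz, k, hk, hxeq⟩
  by_cases hoq : o ∣ q
  swap
  · rw [cFun, if_neg hoq, zero_mul, equivChar, Nat.card_eq_zero]
    left
    constructor
    rintro ⟨t, ht1, ht2⟩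
    induction t using QuotientAddGroup.induction_on with
    | H x => exact hoq (hdecomp x ht1 ht2).1
  have : NeZero o := ⟨ho.ne'⟩
  rw [cFun, if_pos hoq, ← ZMod.card_units_eq_totient, ← Nat.card_eq_fintype_card, charQuasi,
    ← Nat.card_prod]
  symm
  have hMZ : M ≤ Z := fun x hx => (hMmem.1 hx).2
  let j : (M ⧸ qMultiples M q) →+ (Z ⧸ qMultiples Z q) :=
    QuotientAddGroup.map _ _ (AddSubgroup.inclusion hMZ) (by
      rintro _ ⟨y, rfl⟩
      exact ⟨AddSubgroup.inclusion hMZ y, by simp⟩)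
  let χ' : Z := ⟨χ, hχ.mem⟩
  have hFrep : ∀ (u : (ZMod o)ˣ) (m : M),
      j (QuotientAddGroup.mk m) + ((q / o) * (u : ZMod o).val) •
        (QuotientAddGroup.mk χ' : Z ⧸ qMultiples Z q) =
      QuotientAddGroup.mk (AddSubgroup.inclusion hMZ m + ((q / o) * (u : ZMod o).val) • χ') :=
    fun u m => rfl
  have hcoe : ∀ (u : (ZMod o)ˣ) (m : M),
      ((AddSubgroup.inclusion hMZ m + ((q / o) * (u : ZMod o).val) • χ' : Z) : E) =
      m + (((q / o : ℕ) * ((u : ZMod o).val : ℤ) : ℤ) : ℝ) • χ + (q : ℝ) • (0 : E) := by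
    intro u m
    rw [smul_zero, add_zero]
    rw [← Nat.cast_mul, Int.cast_natCast, Nat.cast_smul_eq_nsmul]
    rfl
  have hunit : ∀ u : (ZMod o)ˣ, IsCoprime ((u : ZMod o).val : ℤ) (o : ℤ) := fun u =>
    Nat.isCoprime_iff_coprime.2 (ZMod.val_coe_unit_coprime u)
  have hmemF : ∀ (u : (ZMod o)ˣ) (m : M),
      (QuotientAddGroup.mk (AddSubgroup.inclusion hMZ m + ((q / o) * (u : ZMod o).val) • χ') :
        Z ⧸ qMultiples Z q) ∈ P.modComplement (Set.range P.root) Z q ↔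
      (QuotientAddGroup.mk m : M ⧸ qMultiples M q) ∈ P.modComplement (ψ '' T) M q := by
    intro u m
    rw [mk_mem_modComplement_iff hZint, mk_mem_modComplement_iff hMint]
    have := h.regular_iff hω ho hc hoq (hMmem.1 m.2).1 (hMmem.1 m.2).2 Z.zero_mem (hunit u) hq hψ
    rw [hcoe]
    simp only [Set.forall_mem_range, Set.forall_mem_image]
    exact this
  have hfixF : ∀ (u : (ZMod o)ˣ) (m : M),
      P.actMod q ω (QuotientAddGroup.mk
        (AddSubgroup.inclusion hMZ m + ((q / o) * (u : ZMod o).val) • χ')) =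
      QuotientAddGroup.mk (AddSubgroup.inclusion hMZ m + ((q / o) * (u : ZMod o).val) • χ') := by
    intro u m
    rw [actMod_mk_eq_iff, hcoe]
    -- Since `ω χ` differs from `χ` by `o z`, the multiple by `(q / o) u` moves by `q u z`, which
    -- vanishes modulo `q`.
    obtain ⟨z, hz, hz2⟩ := hχ.coact_eq
    refine ⟨((u : ZMod o).val) • z, Z.nsmul_mem hz _, ?_⟩
    simp only [smul_zero, add_zero]
    rw [map_add, (hMmem.1 m.2).1, map_smul, hz2, smul_add, add_assoc]
    congr 2
    rw [← Nat.cast_smul_eq_nsmul ℝ, smul_smul, smul_smul]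
    congr 1
    obtain ⟨g, hg⟩ := hoq
    rw [hg, Nat.mul_div_cancel_left _ ho]
    push_cast
    ring
  -- The bijection sends a unit `u` and a point `m` of the complement in `M / qM` to `m + (q / o) u
  -- χ`.
  let F : (ZMod o)ˣ × P.modComplement (ψ '' T) M q →
      {t : Z ⧸ qMultiples Z q // t ∈ P.modComplement (Set.range P.root) Z q ∧
        P.actMod q ω t = t} := fun us =>
    ⟨j us.2 + ((q / o) * (us.1 : ZMod o).val) • (QuotientAddGroup.mk χ' : Z ⧸ qMultiples Z q), by
      obtain ⟨u, s, hs⟩ := us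
      induction s using QuotientAddGroup.induction_on with
      | H m =>
        simp only [hFrep]
        exact ⟨(hmemF u m).2 hs, hfixF u m⟩⟩
  refine Nat.card_congr (Equiv.ofBijective F ⟨?_, ?_⟩)
  · rintro ⟨u, s, hs⟩ ⟨u', s', hs'⟩ heq
    induction s using QuotientAddGroup.induction_on with
    | H m =>
    induction s' using QuotientAddGroup.induction_on with
    | H m' =>
    have h1 := congrArg Subtype.val heq
    simp only [F, hFrep] at h1
    rw [mk_eq_mk_iff, hcoe, hcoe] at h1
    obtain ⟨z, hz, hzeq⟩ := h1
    simp only [smul_zero, add_zero] at hzeq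
    obtain ⟨g, hg⟩ := hoq
    rw [hg, Nat.mul_div_cancel_left _ ho] at hzeq
    have hgpos : 0 < g := Nat.pos_of_ne_zero (by rintro rfl; omega)
    -- A root with zero average and class one vanishes on `M` and recovers `u` modulo `o`. For `o =
    -- 1` such a root need not exist, but there is only one unit.
    have huu : u = u' := by
      by_cases ho1 : o = 1
      · subst ho1
        exact Subsingleton.elim _ _
      obtain ⟨i, hi0, y, hy⟩ := h.exists_residue 1 one_pos (by exact_mod_cast (by omega : 1 < o))
      obtain ⟨r, hr⟩ := hz _ ⟨i, rfl⟩
      have h2 := congrArg (P.toLinearMap (P.root i)) hzeq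
      simp only [map_add, map_smul, hc, hr,
        h.toLinearMap_eq_zero hω (hMmem.1 m.2).1 hi0,
        h.toLinearMap_eq_zero hω (hMmem.1 m'.2).1 hi0, smul_eq_mul, zero_add] at h2
      have h3 : ((g : ℤ) * ((u : ZMod o).val : ℤ)) * c i =
          ((g : ℤ) * ((u' : ZMod o).val : ℤ)) * c i + ((o * g : ℕ) : ℤ) * r := by
        exact_mod_cast h2
      have h4 : (((u : ZMod o).val : ℤ) - ((u' : ZMod o).val : ℤ)) * c i = o * r := by
        apply mul_left_cancel₀ (a := (g : ℤ)) (by exact_mod_cast hgpos.ne')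
        push_cast at h3
        linear_combination h3
      have hci : c i = 1 + o * y := by linarith
      have h5 : (o : ℤ) ∣ ((u : ZMod o).val : ℤ) - ((u' : ZMod o).val : ℤ) := by
        refine ⟨r - (((u : ZMod o).val : ℤ) - ((u' : ZMod o).val : ℤ)) * y, ?_⟩
        rw [hci] at h4
        linear_combination h4
      apply Units.ext
      have h6 := (ZMod.intCast_eq_intCast_iff_dvd_sub ((u' : ZMod o).val : ℤ)
        ((u : ZMod o).val : ℤ) o).2 h5
      simpa using h6.symm
    subst huu
    rw [add_right_comm, add_left_inj] at hzeq
    -- Both `m` and `m'` are fixed, so their difference `q z` is fixed, and so is `z`: a coincidence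
    -- modulo `qZ` is one modulo `qM`.
    have hzM : z ∈ M := by
      refine hMmem.2 ⟨?_, hz⟩
      have h2 := congrArg (P.coact ω) hzeq
      rw [map_add, map_smul, (hMmem.1 m.2).1, (hMmem.1 m'.2).1, hzeq, add_right_inj] at h2
      rw [← hg] at h2
      exact (smul_right_injective E hqR h2).symm
    have hss : (QuotientAddGroup.mk m : M ⧸ qMultiples M q) = QuotientAddGroup.mk m' :=
      (mk_eq_mk_iff m m').2 ⟨z, hzM, by rw [hg]; exact hzeq⟩
    exact Prod.ext rfl (Subtype.ext hss)
  · rintro ⟨t, ht1, ht2⟩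
    induction t using QuotientAddGroup.induction_on with
    | H x =>
    obtain ⟨-, m, z, hz, k, hk, hx⟩ := hdecomp x ht1 ht2
    let u : (ZMod o)ˣ := ZMod.unitOfIsCoprime k hk
    have hu : (o : ℤ) ∣ k - ((u : ZMod o).val : ℤ) := by
      rw [← ZMod.intCast_eq_intCast_iff_dvd_sub]
      simp [u]
    obtain ⟨y, hy⟩ := hu
    have hmk : (QuotientAddGroup.mk x : Z ⧸ qMultiples Z q) =
        QuotientAddGroup.mk (AddSubgroup.inclusion hMZ m + ((q / o) * (u : ZMod o).val) • χ') := by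
      rw [mk_eq_mk_iff, hcoe, hx]
      -- Replacing `k` by its representative modulo `o` changes `(q / o) k χ` by the multiple `q y
      -- χ`.
      refine ⟨y • χ + z, Z.add_mem (Z.zsmul_mem hχ.mem y) hz, ?_⟩
      have hk' : k = ((u : ZMod o).val : ℤ) + o * y := by linarith
      obtain ⟨g, hg⟩ := hoq
      rw [hg, Nat.mul_div_cancel_left _ ho, hk', ← Int.cast_smul_eq_zsmul ℝ]
      push_cast
      module
    rw [hmk] at ht1
    refine ⟨⟨u, QuotientAddGroup.mk m, (hmemF u m).1 ht1⟩, ?_⟩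
    apply Subtype.ext
    simp only [F, hFrep]
    exact hmk.symm

end IsFolding

end Counting

end RootPairing

/-! ### Cocycles in node coordinates. -/

namespace RootPairing

section Nodes

set_option linter.unusedSectionVars false

variable {ι V E : Type*} [Finite ι] [AddCommGroup V] [Module ℝ V] [AddCommGroup E] [Module ℝ E]
  {P : RootPairing ι ℝ V E} [P.IsRootSystem] [P.IsCrystallographic] [P.IsReduced] {b : P.Base}
  {l : ℕ} {θ : ι} {e : Fin l ≃ b.support}

theorem sum_mark_mul_node (x : E) :
    ∑ i, (mark θ e i : ℝ) * P.toLinearMap (P.root (node θ e i)) x = 0 := by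
  have := congrArg (fun v => P.toLinearMap v x) (sum_mark_smul_node (θ := θ) (e := e))
  simpa using this

theorem node_coact {ω : P.weylGroup} {π : Equiv.Perm (Fin (l + 1))}
    (hπ : ∀ i, P.weylGroupToPerm ω (node θ e i) = node θ e (π i)) (x : E) (i : Fin (l + 1)) :
    P.toLinearMap (P.root (node θ e (π i))) (P.coact ω x) =
      P.toLinearMap (P.root (node θ e i)) x := by
  rw [toLinearMap_coact, ← hπ, ← weylGroup_apply_root, inv_smul_smul]

theorem point_ext_node (e : Fin l ≃ b.support) (θ : ι) {x y : E}
    (h : ∀ i, P.toLinearMap (P.root (node θ e i)) x = P.toLinearMap (P.root (node θ e i)) y) :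
    x = y := by
  apply point_ext b
  intro k
  have := h (e.symm k).succ
  rwa [node_succ, e.apply_symm_apply] at this

/-- The values at the simple roots are free; the relation then determines the value at the node
zero, because its mark is one. -/
theorem exists_point_of_node_values (hmark : mark θ e 0 = 1) (g : Fin (l + 1) → ℤ)
    (hg : ∑ i, mark θ e i * g i = 0) :
    ∃ x ∈ P.coweightLattice, ∀ i, P.toLinearMap (P.root (node θ e i)) x = g i := by
  obtain ⟨x, hx⟩ := exists_point_of_values (P := P) b (fun k => (g (e.symm k).succ : ℝ))
  have hsucc : ∀ k : Fin l, P.toLinearMap (P.root (node θ e k.succ)) x = g k.succ := by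
    intro k
    rw [node_succ, hx, e.symm_apply_apply]
  refine ⟨x, mem_coweightLattice_of_simple b fun k => ⟨_, hx k⟩, fun i => ?_⟩
  induction i using Fin.cases with
  | succ k => exact hsucc k
  | zero =>
    have h1 := sum_mark_mul_node (θ := θ) (e := e) x
    have h2 : (∑ i, (mark θ e i : ℝ) * g i) = 0 := by exact_mod_cast hg
    rw [Fin.sum_univ_succ] at h1 h2
    simp only [hsucc] at h1
    rw [hmark] at h1 h2
    push_cast at h1 h2
    linarith

/-- A function on the nodes that is invariant under `ω` and whose sum, weighted by the marks, is the
order of `ω`, defines a cocycle. -/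
theorem isCocycle_of_nodes {ω : P.weylGroup} {π : Equiv.Perm (Fin (l + 1))}
    (hπ : ∀ i, P.weylGroupToPerm ω (node θ e i) = node θ e (π i)) {o : ℕ} (ho : 0 < o)
    (I : Fin (l + 1) → ℤ) (hI : ∀ i, I (π i) = I i) (hsum : ∑ i, mark θ e i * I i = o)
    (hdiv : ∀ y : Fin (l + 1) → ℤ, (∀ i, y (π i) = y i) → (o : ℤ) ∣ ∑ i, mark θ e i * y i)
    {χ : E} (hχ : ∀ k, P.toLinearMap (P.root (e k)) χ = I k.succ) : IsCocycle ω χ o := by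
  classical
  have hmem : χ ∈ P.coweightLattice := mem_coweightLattice_of_simple b fun k =>
    ⟨I (e.symm k).succ, by rw [← hχ, e.apply_symm_apply]⟩
  -- The values `I` violate the relation by `o`, and the defect is put on the node of mark one.
  have hχ0 : P.toLinearMap (P.root (node θ e 0)) χ = I 0 - o := by
    have h1 := sum_mark_mul_node (θ := θ) (e := e) χ
    have h2 : (∑ i, (mark θ e i : ℝ) * I i) = o := by exact_mod_cast hsum
    rw [Fin.sum_univ_succ] at h1 h2
    simp only [node_succ, hχ] at h1
    rw [mark_zero] at h1 h2
    push_cast at h1 h2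
    linarith
  have hχi : ∀ i, P.toLinearMap (P.root (node θ e i)) χ = I i - if i = 0 then (o : ℝ) else 0 := by
    intro i
    induction i using Fin.cases with
    | zero => rw [if_pos rfl, hχ0]
    | succ k => rw [if_neg (Fin.succ_ne_zero k), node_succ, hχ, sub_zero]
  refine ⟨hmem, ?_, ?_⟩
  -- Because `I` is invariant, `ω χ - χ` is `o` times the indicator of the node zero minus that of
  -- its image. Comparing the relations for `χ` and `ω χ` shows that these two nodes have equal
  -- marks, so the difference of the indicators is a point of the lattice.
  · obtain ⟨z, hz, hzv⟩ := exists_point_of_node_values (e := e) (θ := θ) (mark_zero)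
      (fun i => (if i = 0 then 1 else 0) - (if π.symm i = 0 then 1 else 0)) (by
        have hdiff := hdiv I hI
        have hcoact := sum_mark_mul_node (θ := θ) (e := e) (P.coact ω χ)
        rw [← _root_.Equiv.sum_comp π] at hcoact
        simp only [node_coact hπ, hχi] at hcoact
        have h0 := sum_mark_mul_node (θ := θ) (e := e) χ
        simp only [hχi] at h0
        simp only [mul_sub, Finset.sum_sub_distrib, mul_ite, mul_one, mul_zero,
          Finset.sum_ite_eq', Finset.mem_univ, if_true] at h0 hcoact ⊢
        rw [← _root_.Equiv.sum_comp π (fun x => if π.symm x = 0 then mark θ e x else 0)]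
        simp only [π.symm_apply_apply, Finset.sum_ite_eq', Finset.mem_univ, if_true]
        have h1 : ∑ i, (mark θ e (π i) : ℝ) * I i = ∑ i, (mark θ e i : ℝ) * I i := by
          conv_rhs => rw [← _root_.Equiv.sum_comp π]
          simp only [hI]
        rw [h1] at hcoact
        have h2 : (mark θ e 0 : ℝ) * o = mark θ e (π 0) * o := by linarith
        have h3 : (mark θ e 0 : ℝ) = mark θ e (π 0) :=
          mul_right_cancel₀ (by exact_mod_cast ho.ne') h2
        have h4 : mark θ e 0 = mark θ e (π 0) := by exact_mod_cast h3
        rw [h4, sub_self])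
    refine ⟨z, hz, ?_⟩
    apply point_ext_node e θ
    intro i
    obtain ⟨i, rfl⟩ := π.surjective i
    rw [node_coact hπ, map_add, map_smul, hzv, hχi, hχi, hI]
    simp only [π.symm_apply_apply, smul_eq_mul]
    push_cast
    split_ifs <;> ring
  · rintro q hq x hx ⟨w, hw, hxw⟩
    choose a ha using fun i => hx _ ⟨node θ e i, rfl⟩
    choose c hc using fun i => hw _ ⟨node θ e i, rfl⟩
    have hqZ : (q : ℤ) ≠ 0 := by exact_mod_cast hq.ne'
    have hac : ∀ i, a i = a (π i) + q * c (π i) := by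
      intro i
      have h1 := node_coact hπ x i
      rw [hxw, map_add, map_smul, ha, hc, ha, smul_eq_mul] at h1
      exact_mod_cast h1.symm
    -- The residues of the values of `x` are invariant, and their weighted sum is `o s`. Subtracting
    -- `s I` makes the sum zero and gives a fixed lattice point `m`.
    set y : Fin (l + 1) → ℤ := fun i => a i % q with hy
    have hyinv : ∀ i, y (π i) = y i := by
      intro i
      simp only [hy]
      rw [hac i, Int.add_mul_emod_self_left]
    obtain ⟨s, hs⟩ := hdiv y hyinv
    have hasum : ∑ i, mark θ e i * a i = 0 := by
      have := sum_mark_mul_node (θ := θ) (e := e) x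
      simp only [ha] at this
      exact_mod_cast this
    have hya : ∀ i, a i = y i + q * (a i / q) := fun i => (Int.emod_add_mul_ediv _ _).symm
    obtain ⟨m, hm, hmv⟩ := exists_point_of_node_values (e := e) (θ := θ) (mark_zero)
      (fun i => y i - s * I i) (by
        simp only [mul_sub, Finset.sum_sub_distrib]
        rw [hs, show ∑ i, mark θ e i * (s * I i) = s * ∑ i, mark θ e i * I i by
          rw [Finset.mul_sum]; exact Finset.sum_congr rfl fun i _ => by ring, hsum]
        ring)
    refine ⟨m, hm, ?_, s, ?_, ?_⟩
    · apply point_ext_node e θ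
      intro i
      obtain ⟨i, rfl⟩ := π.surjective i
      rw [node_coact hπ, hmv, hmv, hyinv, hI]
    -- The values of `x` itself have weighted sum zero, so replacing them by residues modulo `q`
    -- changes the sum by a multiple of `q`; this makes `o s` divisible by `q`.
    · refine ⟨-∑ i, mark θ e i * (a i / q), ?_⟩
      rw [← hs, mul_neg, Finset.mul_sum, eq_neg_iff_add_eq_zero, ← Finset.sum_add_distrib, ← hasum]
      refine Finset.sum_congr rfl fun i _ => ?_
      conv_rhs => rw [hya i]
      ring
    -- At the simple roots `m + s χ` takes the residues, so the remainder of `x` is `q` times the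
    -- vector of quotients.
    · obtain ⟨z, hz⟩ := exists_point_of_values (P := P) b
        (fun k => ((a (e.symm k).succ / q : ℤ) : ℝ))
      refine ⟨z, mem_coweightLattice_of_simple b fun k => ⟨_, hz k⟩, ?_⟩
      apply point_ext b
      intro k
      have h1 := ha (e.symm k).succ
      have h2 := hmv (e.symm k).succ
      have h3 := hχ (e.symm k)
      rw [node_succ, e.apply_symm_apply] at h1 h2
      rw [e.apply_symm_apply] at h3
      rw [map_add, map_add, map_smul, map_smul, h1, h2, h3, hz, smul_eq_mul, smul_eq_mul]
      conv_lhs => rw [hya]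
      push_cast
      ring

end Nodes

/-! #### Constructions on root systems that commute with linear isomorphisms -/

/-- `R'` is determined by `R`, up to linear isomorphism. -/
def Determines (V : Type*) [AddCommGroup V] [Module ℝ V] {n : ℕ} (R R' : Set (Fin n → ℝ)) : Prop :=
  ∀ ψ φ : (Fin n → ℝ) →ₗ[ℝ] V, Set.InjOn ψ (Submodule.span ℝ R) →
    Set.InjOn φ (Submodule.span ℝ R) → ψ '' R = φ '' R → ψ '' R' = φ '' R'

theorem Determines.refl {V : Type*} [AddCommGroup V] [Module ℝ V] {n : ℕ} (R : Set (Fin n → ℝ)) :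
    Determines V R R := fun _ _ _ _ h => h

/-- The root `x` is orthogonal to another one in a subsystem of rank two with two root lengths, or
is a short root of a system of type `G_2`: a criterion for short roots. -/
def IsShort {W : Type*} [AddCommGroup W] (R : Set W) (x : W) : Prop :=
  ∃ y ∈ R, x + y ∈ R ∧ x - y ∈ R

/-- Multiply the long roots by `a` and the short roots by `c`. -/
def rescale {W : Type*} [AddCommGroup W] [Module ℝ W] (R : Set W) (a c : ℝ) : Set W :=
  {v | ∃ x ∈ R, (¬ IsShort R x ∧ v = a • x) ∨ (IsShort R x ∧ v = c • x)}

/-- Remove the roots half of a root. -/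
def dropHalf {W : Type*} [AddCommGroup W] [Module ℝ W] (R : Set W) : Set W :=
  {x | x ∈ R ∧ (2 : ℝ) • x ∉ R}

section Image

variable {W W' : Type*} [AddCommGroup W] [Module ℝ W] [AddCommGroup W'] [Module ℝ W']
  {R : Set W} {ψ : W →ₗ[ℝ] W'}

theorem mem_image_iff_of_injOn_span (hψ : Set.InjOn ψ (Submodule.span ℝ R)) {x : W}
    (hx : x ∈ Submodule.span ℝ R) : ψ x ∈ ψ '' R ↔ x ∈ R := by
  refine ⟨?_, fun h => ⟨x, h, rfl⟩⟩
  rintro ⟨y, hy, hxy⟩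
  rwa [← hψ (Submodule.subset_span hy) hx hxy]

/-- The test only asks whether sums and differences of elements of `R` lie in `R`; these stay in the
span, where `ψ` is injective. -/
theorem isShort_image_iff (hψ : Set.InjOn ψ (Submodule.span ℝ R)) {x : W} (hx : x ∈ R) :
    IsShort (ψ '' R) (ψ x) ↔ IsShort R x := by
  have hx' := Submodule.subset_span (R := ℝ) hx
  constructor
  · rintro ⟨_, ⟨y, hy, rfl⟩, h1, h2⟩
    have hy' := Submodule.subset_span (R := ℝ) hy
    rw [← map_add, mem_image_iff_of_injOn_span hψ (Submodule.add_mem _ hx' hy')] at h1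
    rw [← map_sub, mem_image_iff_of_injOn_span hψ (Submodule.sub_mem _ hx' hy')] at h2
    exact ⟨y, hy, h1, h2⟩
  · rintro ⟨y, hy, h1, h2⟩
    exact ⟨ψ y, ⟨y, hy, rfl⟩, ⟨_, h1, map_add ψ x y⟩, ⟨_, h2, map_sub ψ x y⟩⟩

theorem image_rescale (hψ : Set.InjOn ψ (Submodule.span ℝ R)) (a c : ℝ) :
    ψ '' rescale R a c = rescale (ψ '' R) a c := by
  ext v
  constructor
  · rintro ⟨_, ⟨x, hx, ⟨hs, rfl⟩ | ⟨hs, rfl⟩⟩, rfl⟩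
    · exact ⟨ψ x, ⟨x, hx, rfl⟩, Or.inl ⟨by rwa [isShort_image_iff hψ hx], map_smul ψ _ _⟩⟩
    · exact ⟨ψ x, ⟨x, hx, rfl⟩, Or.inr ⟨by rwa [isShort_image_iff hψ hx], map_smul ψ _ _⟩⟩
  · rintro ⟨_, ⟨x, hx, rfl⟩, ⟨hs, rfl⟩ | ⟨hs, rfl⟩⟩
    · rw [isShort_image_iff hψ hx] at hs
      exact ⟨a • x, ⟨x, hx, Or.inl ⟨hs, rfl⟩⟩, map_smul ψ _ _⟩
    · rw [isShort_image_iff hψ hx] at hs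
      exact ⟨c • x, ⟨x, hx, Or.inr ⟨hs, rfl⟩⟩, map_smul ψ _ _⟩

theorem image_dropHalf (hψ : Set.InjOn ψ (Submodule.span ℝ R)) :
    ψ '' dropHalf R = dropHalf (ψ '' R) := by
  have key : ∀ x ∈ R, ((2 : ℝ) • ψ x ∈ ψ '' R ↔ (2 : ℝ) • x ∈ R) := fun x hx => by
    rw [← map_smul, mem_image_iff_of_injOn_span hψ
      (Submodule.smul_mem _ _ (Submodule.subset_span hx))]
  ext v
  constructor
  · rintro ⟨x, ⟨hx, h2⟩, rfl⟩
    exact ⟨⟨x, hx, rfl⟩, by rwa [key x hx]⟩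
  · rintro ⟨⟨x, hx, rfl⟩, h2⟩
    rw [key x hx] at h2
    exact ⟨x, ⟨hx, h2⟩, rfl⟩

end Image

theorem determines_rescale {V : Type*} [AddCommGroup V] [Module ℝ V] {n : ℕ}
    (R : Set (Fin n → ℝ)) (a c : ℝ) : Determines V R (rescale R a c) := by
  intro ψ φ h1 h2 h
  rw [image_rescale h1, image_rescale h2, h]

theorem determines_dropHalf {V : Type*} [AddCommGroup V] [Module ℝ V] {n : ℕ}
    (R : Set (Fin n → ℝ)) : Determines V R (dropHalf R) := by
  intro ψ φ h1 h2 h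
  rw [image_dropHalf h1, image_dropHalf h2, h]

/-- The formula for the equivariant characteristic quasi-polynomial, for all realizations. -/
def FoldingFormula {ι V E : Type*} [AddCommGroup V] [Module ℝ V] [AddCommGroup E] [Module ℝ E]
    (P : RootPairing ι ℝ V E) (ω : P.weylGroup) {n : ℕ} (R R' : Set (Fin n → ℝ)) (d : ℕ) : Prop :=
  (∃ ψ : (Fin n → ℝ) →ₗ[ℝ] V, IsRealization R (P.foldedRoots ω) ψ) ∧
    ∀ ψ : (Fin n → ℝ) →ₗ[ℝ] V, IsRealization R (P.foldedRoots ω) ψ → ∀ q : ℕ, 0 < q →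
      P.equivChar q ω = cFun (orderOf ω) q *
        P.charQuasi ((fun β : V => (d : ℝ) • β) '' (ψ '' R')) (P.foldedCoweightLattice ω) q

section Conclusion

variable {ι V E : Type*} [AddCommGroup V] [Module ℝ V] [AddCommGroup E] [Module ℝ E]
  {P : RootPairing ι ℝ V E}

/-- The count is made for the realization that comes from `η`. Any other realization maps `R` onto
the same set, and `hdet` carries this over to `R'`. -/
theorem IsFolding.foldingFormula {ω : P.weylGroup} {n : ℕ} {η : V →ₗ[ℝ] (Fin n → ℝ)} {c : ι → ℤ}
    {o d : ℕ} {R R' : Set (Fin n → ℝ)}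
    (h : IsFolding P ω η c o R ((fun r => (d : ℝ) • r) '' R')) (hdet : Determines V R R')
    (horder : orderOf ω = o) (ho : 0 < o) {χ : E} (hχ : IsCocycle ω χ o)
    (hc : ∀ i, P.toLinearMap (P.root i) χ = c i) : FoldingFormula P ω R R' d := by
  obtain ⟨ψ₀, hψ₀, hreal⟩ := h.exists_realization (by rw [horder]; exact ho)
  refine ⟨⟨ψ₀, hreal⟩, fun ψ hψ q hq => ?_⟩
  rw [h.equivChar_eq horder ho hχ hc hψ₀ hq, horder,
    hdet ψ ψ₀ hψ.1 hreal.1 (hψ.2.trans hreal.2.symm), Set.image_image, Set.image_image]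
  simp only [map_smul]

/-- The formula, from data in a coordinate model. -/
theorem foldingFormula_of_model {ω : P.weylGroup} {N n : ℕ} {f : V →ₗ[ℝ] (Fin N → ℝ)}
    {Φ : Set (Fin N → ℝ)} (hΦ : f '' Set.range P.root = Φ)
    (H : (Fin N → ℝ) →ₗ[ℝ] (Fin n → ℝ)) (X : (Fin N → ℝ) →ₗ[ℝ] ℝ) {o d : ℕ}
    {R R' : Set (Fin n → ℝ)} (hdet : Determines V R R') (horder : orderOf ω = o) (ho : 0 < o)
    (hχ : ∀ χ : E, (∀ v, P.toLinearMap v χ = X (f v)) → IsCocycle ω χ o)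
    (hdual : ∀ φ : V →ₗ[ℝ] ℝ, ∃ x : E, ∀ v, P.toLinearMap v x = φ v)
    (hinv : ∀ v, H (f (ω • v)) = H (f v)) (hfaith : ∀ v, ω • v = v → H (f v) = 0 → v = 0)
    (hR : ∀ r, r ∈ R ↔ (∃ β ∈ Φ, H β = r) ∧ r ≠ 0)
    (h1 : ∀ β ∈ Φ, H β = 0 → ¬ ∃ k : ℤ, X β = o * k)
    (h2 : ∀ r : ℤ, 0 < r → r < o → ∃ β ∈ Φ, H β = 0 ∧ ∃ k : ℤ, X β = r + o * k)
    (h3 : ∀ γ ∈ R', ∃ β₀ ∈ Φ, ∃ s : ℕ, s ∣ o ∧ (d : ℝ) • γ = (s : ℝ) • H β₀ ∧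
      ∀ t : ℤ, ∃ β ∈ Φ, H β = H β₀ ∧ ∃ k : ℤ, X β = (o / s : ℕ) * t + o * k)
    (h4 : ∀ β ∈ Φ, H β ≠ 0 → ∃ γ ∈ R', ∃ s : ℤ, (d : ℝ) • γ = (s : ℝ) • H β ∧
      ∃ k : ℤ, s * X β = o * k) : FoldingFormula P ω R R' d := by
  obtain ⟨χ, hχv⟩ := hdual (X.comp f)
  have hcoc := hχ χ hχv
  -- The vector `χ` represents the form `X`, and its membership in the coweight lattice supplies the
  -- integrality of `X` on the roots.
  choose c hc using fun i => hcoc.mem _ ⟨i, rfl⟩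
  have hX : ∀ i, X (f (P.root i)) = c i := fun i => by rw [← hc, hχv]; rfl
  have hmem : ∀ i, f (P.root i) ∈ Φ := fun i => by rw [← hΦ]; exact ⟨_, ⟨i, rfl⟩, rfl⟩
  have hex : ∀ β ∈ Φ, ∃ i, f (P.root i) = β := by
    intro β hβ
    rw [← hΦ] at hβ
    obtain ⟨_, ⟨i, rfl⟩, rfl⟩ := hβ
    exact ⟨i, rfl⟩
  refine IsFolding.foldingFormula (η := H.comp f) (c := c) ?_ hdet horder ho hcoc hc
  refine ⟨hinv, hfaith, ?_, ?_, ?_, ?_, ?_⟩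
  · ext r
    rw [hR]
    refine and_congr_left fun _ => ⟨?_, ?_⟩
    · rintro ⟨β, hβ, rfl⟩
      obtain ⟨i, rfl⟩ := hex β hβ
      exact ⟨i, rfl⟩
    · rintro ⟨i, rfl⟩
      exact ⟨_, hmem i, rfl⟩
  · rintro i hi ⟨k, hk⟩
    refine h1 _ (hmem i) hi ⟨k, ?_⟩
    rw [hX, hk]
    push_cast
    rfl
  · intro r hr1 hr2
    obtain ⟨β, hβ, hβ0, k, hk⟩ := h2 r hr1 hr2
    obtain ⟨i, rfl⟩ := hex β hβ
    refine ⟨i, hβ0, k, ?_⟩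
    rw [hX] at hk
    have : c i = r + o * k := by exact_mod_cast hk
    rw [this]
    ring
  · rintro _ ⟨γ, hγ, rfl⟩
    obtain ⟨β₀, hβ₀, s, hs, heq, hlift⟩ := h3 γ hγ
    obtain ⟨i₀, rfl⟩ := hex β₀ hβ₀
    refine ⟨i₀, s, hs, heq, fun t => ?_⟩
    obtain ⟨β, hβ, hβ0, k, hk⟩ := hlift t
    obtain ⟨i, rfl⟩ := hex β hβ
    refine ⟨i, hβ0, k, ?_⟩
    rw [hX] at hk
    generalize o / s = u at hk ⊢
    have : c i = u * t + o * k := by exact_mod_cast hk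
    rw [this]
    ring
  · intro i hi
    obtain ⟨γ, hγ, s, heq, k, hk⟩ := h4 _ (hmem i) hi
    refine ⟨_, ⟨γ, hγ, rfl⟩, s, heq, k, ?_⟩
    rw [hX] at hk
    exact_mod_cast hk

end Conclusion

end RootPairing

/-! ### Signed permutations and reflections in coordinates. -/

theorem sgnR_mul (s t : ℤˣ) : sgnR (s * t) = sgnR s * sgnR t := by
  simp [sgnR]

theorem sgnR_one : sgnR 1 = 1 := by simp [sgnR]

theorem sgnR_neg (s : ℤˣ) : sgnR (-s) = -sgnR s := by simp [sgnR]

theorem sgnR_mul_self (s : ℤˣ) : sgnR s * sgnR s = 1 := by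
  rw [← sgnR_mul, Int.units_mul_self, sgnR_one]

theorem sgnR_eq (s : ℤˣ) : sgnR s = 1 ∨ sgnR s = -1 := by
  rcases Int.units_eq_one_or s with rfl | rfl <;> simp [sgnR]

theorem sgnR_ne_zero (s : ℤˣ) : sgnR s ≠ 0 := by
  rcases sgnR_eq s with h | h <;> rw [h] <;> norm_num

/-- The action of a signed permutation on a vector. -/
def IsSignedImage {N : ℕ} (τ : Equiv.Perm (Fin N)) (δ : Fin N → ℤˣ) (v v' : Fin N → ℝ) : Prop :=
  ∀ a, v' (τ a) = sgnR (δ a) * v a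

/-- The reflection in `β` for the standard inner product. -/
noncomputable def dotReflection {N : ℕ} (β v : Fin N → ℝ) : Fin N → ℝ :=
  v - (2 * (v ⬝ᵥ β) / (β ⬝ᵥ β)) • β

theorem IsSignedImage.single {N : ℕ} {τ : Equiv.Perm (Fin N)} {δ : Fin N → ℤˣ} {i : Fin N} {c : ℝ}
    {v : Fin N → ℝ} (h : IsSignedImage τ δ (Pi.single i c) v) :
    v = Pi.single (τ i) (sgnR (δ i) * c) := by
  ext a
  obtain ⟨a, rfl⟩ := τ.surjective a
  rw [h a]
  by_cases hai : a = i
  · subst hai; simp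
  · rw [Pi.single_eq_of_ne hai, Pi.single_eq_of_ne (fun h => hai (τ.injective h)), mul_zero]

theorem IsSignedImage.add_single {N : ℕ} {τ : Equiv.Perm (Fin N)} {δ : Fin N → ℤˣ} {i j : Fin N}
    {c d : ℝ} {v : Fin N → ℝ} (h : IsSignedImage τ δ (Pi.single i c + Pi.single j d) v) :
    v = Pi.single (τ i) (sgnR (δ i) * c) + Pi.single (τ j) (sgnR (δ j) * d) := by
  ext a
  obtain ⟨a, rfl⟩ := τ.surjective a
  rw [h a, Pi.add_apply, Pi.add_apply, mul_add]
  congr 1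
  · by_cases hai : a = i
    · subst hai; simp
    · rw [Pi.single_eq_of_ne hai, Pi.single_eq_of_ne (fun h => hai (τ.injective h)), mul_zero]
  · by_cases haj : a = j
    · subst haj; simp
    · rw [Pi.single_eq_of_ne haj, Pi.single_eq_of_ne (fun h => haj (τ.injective h)), mul_zero]

theorem IsSignedImage.mem_pairVectors {N : ℕ} {τ : Equiv.Perm (Fin N)} {δ : Fin N → ℤˣ}
    {v v' : Fin N → ℝ} (h : IsSignedImage τ δ v v') (hv : v ∈ pairVectors N) :
    v' ∈ pairVectors N := by
  obtain ⟨i, j, hij, s, t, rfl⟩ := hv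
  exact ⟨τ i, τ j, fun h => hij (τ.injective h), δ i * s, δ j * t, by
    rw [sgnR_mul, sgnR_mul, h.add_single]⟩

theorem IsSignedImage.mem_axisVectors {N : ℕ} {τ : Equiv.Perm (Fin N)} {δ : Fin N → ℤˣ} {c : ℝ}
    {v v' : Fin N → ℝ} (h : IsSignedImage τ δ v v') (hv : v ∈ axisVectors c N) :
    v' ∈ axisVectors c N := by
  obtain ⟨i, s, rfl⟩ := hv
  exact ⟨τ i, δ i * s, by rw [sgnR_mul, h.single, mul_assoc]⟩

theorem pair_dotProduct {N : ℕ} (v : Fin N → ℝ) (i j : Fin N) (c d : ℝ) :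
    v ⬝ᵥ (Pi.single i c + Pi.single j d) = v i * c + v j * d := by
  rw [dotProduct_add, dotProduct_single, dotProduct_single]

theorem pair_dotProduct_self {N : ℕ} {i j : Fin N} (hij : i ≠ j) (s t : ℤˣ) :
    (Pi.single i (sgnR s) + Pi.single j (sgnR t) : Fin N → ℝ) ⬝ᵥ
      (Pi.single i (sgnR s) + Pi.single j (sgnR t)) = 2 := by
  rw [pair_dotProduct, Pi.add_apply, Pi.add_apply, Pi.single_eq_same, Pi.single_eq_same,
    Pi.single_eq_of_ne hij, Pi.single_eq_of_ne hij.symm, add_zero, zero_add, sgnR_mul_self,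
    sgnR_mul_self]
  norm_num

/-- The reflection in `± e_i ± e_j` is a signed permutation. -/
theorem isSignedImage_dotReflection_pair {N : ℕ} {i j : Fin N} (hij : i ≠ j) (s t : ℤˣ)
    (v : Fin N → ℝ) :
    IsSignedImage (Equiv.swap i j) (fun a => if a = i ∨ a = j then -(s * t) else 1) v
      (dotReflection (Pi.single i (sgnR s) + Pi.single j (sgnR t)) v) := by
  intro a
  rw [dotReflection, pair_dotProduct_self hij, pair_dotProduct]
  simp only [Pi.sub_apply, Pi.smul_apply, Pi.add_apply, smul_eq_mul]
  have hs := sgnR_mul_self s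
  have ht := sgnR_mul_self t
  by_cases hai : a = i
  · subst hai
    rw [Equiv.swap_apply_left, if_pos (Or.inl rfl), Pi.single_eq_same,
      Pi.single_eq_of_ne hij.symm, sgnR_neg, sgnR_mul]
    linear_combination (-(v j)) * ht
  · by_cases haj : a = j
    · subst haj
      rw [Equiv.swap_apply_right, if_pos (Or.inr rfl), Pi.single_eq_same,
        Pi.single_eq_of_ne hij, sgnR_neg, sgnR_mul]
      linear_combination (-(v i)) * hs
    · rw [Equiv.swap_apply_of_ne_of_ne hai haj, if_neg (by tauto), Pi.single_eq_of_ne hai,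
        Pi.single_eq_of_ne haj, sgnR_one]
      ring

/-- The reflection in a multiple of `e_i` is a sign change. -/
theorem isSignedImage_dotReflection_axis {N : ℕ} (i : Fin N) (s : ℤˣ) {c : ℝ} (hc : c ≠ 0)
    (v : Fin N → ℝ) :
    IsSignedImage 1 (fun a => if a = i then -1 else 1) v
      (dotReflection (Pi.single i (sgnR s * c)) v) := by
  intro a
  have h0 : sgnR s ≠ 0 := sgnR_ne_zero s
  rw [dotReflection, dotProduct_single, dotProduct_single, Pi.single_eq_same]
  simp only [Pi.sub_apply, Pi.smul_apply, smul_eq_mul, Equiv.Perm.one_apply]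
  by_cases hai : a = i
  · subst hai
    rw [if_pos rfl, Pi.single_eq_same, sgnR_neg, sgnR_one]
    field_simp
    ring
  · rw [if_neg hai, Pi.single_eq_of_ne hai, sgnR_one]
    ring

/-! ### Transfer between a root system and its coordinate model. -/

namespace RootPairing

section Model

set_option linter.unusedSectionVars false

variable {ι V E : Type*} [Finite ι] [AddCommGroup V] [Module ℝ V] [AddCommGroup E] [Module ℝ E]
  {P : RootPairing ι ℝ V E} [P.IsRootSystem] [P.IsCrystallographic] [P.IsReduced] {b : P.Base}
  {l : ℕ} {θ : ι} {e : Fin l ≃ b.support} {N : ℕ} {f : V →ₗ[ℝ] (Fin N → ℝ)}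
  {Φ : Set (Fin N → ℝ)} {S : Fin l → (Fin N → ℝ)}

/-- A dominant root of maximal length is the highest root. -/
theorem map_highestRoot (hθ : IsHighestRoot b θ) (hΦ : f '' Set.range P.root = Φ)
    (hS : ∀ k, f (P.root (e k)) = S k) {t : Fin N → ℝ} (ht : t ∈ Φ) (hdom : ∀ k, 0 ≤ S k ⬝ᵥ t)
    (hmax : ∀ β ∈ Φ, β ⬝ᵥ β ≤ t ⬝ᵥ t) : f (P.root θ) = t := by
  have hθΦ : f (P.root θ) ∈ Φ := by rw [← hΦ]; exact ⟨_, ⟨θ, rfl⟩, rfl⟩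
  have h1 := hmax _ hθΦ
  rw [← hΦ] at ht
  obtain ⟨_, ⟨i, rfl⟩, rfl⟩ := ht
  have key : ∀ v ∈ AddSubmonoid.closure (P.root '' b.support), 0 ≤ f v ⬝ᵥ f (P.root i) := by
    intro v hv
    induction hv using AddSubmonoid.closure_induction with
    | mem x hx =>
      obtain ⟨m, hm, rfl⟩ := hx
      have := hdom (e.symm ⟨m, hm⟩)
      rwa [← hS, e.apply_symm_apply] at this
    | zero => simp
    | add x y _ _ hx hy => rw [map_add, add_dotProduct]; exact add_nonneg hx hy
  have h2 := key _ (hθ i)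
  rw [map_sub, sub_dotProduct] at h2
  -- As `θ - t` is a sum of simple roots and `t` is dominant, `t · t ≤ θ · t`; together with `θ · θ
  -- ≤ t · t` this bounds the squared distance by zero.
  have h3 : (f (P.root θ) - f (P.root i)) ⬝ᵥ (f (P.root θ) - f (P.root i)) ≤ 0 := by
    rw [sub_dotProduct, dotProduct_sub, dotProduct_sub, dotProduct_comm (f (P.root i))]
    linarith
  have h4 : f (P.root θ) - f (P.root i) = 0 := by
    rw [← dotProduct_self_eq_zero]
    refine le_antisymm h3 ?_
    simp only [dotProduct]
    exact Finset.sum_nonneg fun i _ => mul_self_nonneg _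
  exact sub_eq_zero.1 h4

theorem coef_highestRoot_of_model (hf : Function.Injective f) (hS : ∀ k, f (P.root (e k)) = S k)
    {c : Fin l → ℤ} (h : f (P.root θ) = ∑ k, (c k : ℝ) • S k) (k : Fin l) :
    coef b θ (e k) = c k := by
  have h1 : P.root θ = ∑ k : b.support, (c (e.symm k) : ℝ) • P.root k := by
    apply hf
    rw [h, map_sum, ← _root_.Equiv.sum_comp e]
    refine Finset.sum_congr rfl fun k _ => ?_
    rw [map_smul, hS, e.symm_apply_apply]
  have h2 := coef_eq_of_root_eq b h1 (e k)
  rw [e.symm_apply_apply] at h2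
  exact_mod_cast h2

/-- The reflections of the root system are those of the model. -/
theorem map_ofIdx_smul (hf : Function.Injective f) (hΦ : f '' Set.range P.root = Φ) (i : ι)
    (hinv : ∀ γ ∈ Φ, dotReflection (f (P.root i)) γ ∈ Φ) (v : V) :
    f (weylGroup.ofIdx P i • v) = dotReflection (f (P.root i)) (f v) := by
  set α := f (P.root i) with hα
  have hα0 : α ⬝ᵥ α ≠ 0 := by
    rw [Ne, dotProduct_self_eq_zero, hα]
    exact fun h => P.ne_zero i (hf (by rw [h, map_zero]))
  let φ : V →ₗ[ℝ] ℝ := (2 / (α ⬝ᵥ α)) •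
    { toFun := fun v => f v ⬝ᵥ α
      map_add' := fun x y => by rw [map_add, add_dotProduct]
      map_smul' := fun c x => by rw [map_smul, smul_dotProduct, RingHom.id_apply] }
  have hφ : ∀ v, φ v = 2 * (f v ⬝ᵥ α) / (α ⬝ᵥ α) := fun v => by
    change 2 / (α ⬝ᵥ α) * (f v ⬝ᵥ α) = _
    ring
  -- By uniqueness of the reflection that preserves the roots, the coroot is the functional `2 (· ,
  -- α) / (α, α)` of the standard inner product.
  have heq : P.toLinearMap.flip (P.coroot i) = φ := by
    refine Module.Dual.eq_of_preReflection_mapsTo (x := P.root i) (Φ := Set.range P.root)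
      (Set.finite_range _) (IsRootSystem.span_root_eq_top (P := P)) ?_ ?_ ?_ ?_
    · exact P.root_coroot_two i
    · rintro _ ⟨k, rfl⟩
      exact ⟨P.reflectionPerm i k, by
        simp [Module.preReflection_apply, root_reflectionPerm, reflection_apply]⟩
    · rw [hφ, ← hα]
      field_simp
    · rintro _ ⟨k, rfl⟩
      have h1 : f (P.root k) ∈ Φ := by rw [← hΦ]; exact ⟨_, ⟨k, rfl⟩, rfl⟩
      have h2 := hinv _ h1
      rw [← hΦ] at h2
      obtain ⟨_, ⟨m, rfl⟩, hm⟩ := h2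
      refine ⟨m, hf ?_⟩
      rw [hm, Module.preReflection_apply, map_sub, map_smul, hφ]
      rfl
  rw [weylGroup_ofIdx_smul, map_sub, map_smul]
  have := LinearMap.congr_fun heq v
  rw [hφ, LinearMap.flip_apply] at this
  rw [this]
  rfl

/-- If all reflections are signed permutations of the coordinates, so are all elements of the Weyl
group. The predicate `Q` restricts the signs. -/
theorem exists_signed_perm (hf : Function.Injective f) (hΦ : f '' Set.range P.root = Φ)
    (Q : (Fin N → ℤˣ) → Prop) (hQ1 : Q 1)
    (hQmul : ∀ (τ : Equiv.Perm (Fin N)) (δ δ' : Fin N → ℤˣ), Q δ → Q δ' →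
      Q (fun a => δ (τ a) * δ' a))
    (hrefl : ∀ β ∈ Φ, ∃ (τ : Equiv.Perm (Fin N)) (δ : Fin N → ℤˣ), Q δ ∧
      ∀ v, IsSignedImage τ δ v (dotReflection β v))
    (hinv : ∀ (τ : Equiv.Perm (Fin N)) (δ : Fin N → ℤˣ), Q δ → ∀ v v', IsSignedImage τ δ v v' →
      v ∈ Φ → v' ∈ Φ) (w : P.weylGroup) :
    ∃ (τ : Equiv.Perm (Fin N)) (δ : Fin N → ℤˣ), Q δ ∧
      ∀ v, IsSignedImage τ δ (f v) (f (w • v)) := by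
  obtain ⟨w, hw⟩ := w
  induction hw using weylGroup.induction with
  | mem i =>
    have hi : f (P.root i) ∈ Φ := by rw [← hΦ]; exact ⟨_, ⟨i, rfl⟩, rfl⟩
    obtain ⟨τ, δ, hQ, h⟩ := hrefl _ hi
    refine ⟨τ, δ, hQ, fun v => ?_⟩
    have := map_ofIdx_smul hf hΦ i (fun γ hγ => hinv τ δ hQ γ _ (h γ) hγ) v
    change IsSignedImage τ δ (f v) (f (weylGroup.ofIdx P i • v))
    rw [this]
    exact h _
  | one =>
    refine ⟨1, 1, hQ1, fun v a => ?_⟩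
    change f v a = _
    simp [sgnR_one]
  | mul x y hx hy ihx ihy =>
    obtain ⟨τ, δ, hQ, h⟩ := ihx
    obtain ⟨τ', δ', hQ', h'⟩ := ihy
    refine ⟨τ * τ', _, hQmul τ' δ δ' hQ hQ', fun v a => ?_⟩
    have h1 := h ((⟨y, hy⟩ : P.weylGroup) • v) (τ' a)
    rw [h' v a, ← mul_assoc, ← sgnR_mul] at h1
    exact h1

theorem isSignedImage_node {τ : Equiv.Perm (Fin N)} {δ : Fin N → ℤˣ} {ω : P.weylGroup}
    (h : ∀ v, IsSignedImage τ δ (f v) (f (ω • v))) {π : Equiv.Perm (Fin (l + 1))}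
    (hπ : ∀ i, P.weylGroupToPerm ω (node θ e i) = node θ e (π i)) (i : Fin (l + 1)) :
    IsSignedImage τ δ (f (P.root (node θ e i))) (f (P.root (node θ e (π i)))) := by
  have := h (P.root (node θ e i))
  rwa [weylGroup_apply_root, hπ] at this

/-- The case of the identity. -/
theorem foldingFormula_one (θ : ι) (e : Fin l ≃ b.support) (hf : Function.Injective f)
    (hΦ : f '' Set.range P.root = Φ) :
    FoldingFormula P 1 Φ Φ 1 := by
  have h0 : ∀ β ∈ Φ, β ≠ 0 := by
    rw [← hΦ]
    rintro _ ⟨_, ⟨i, rfl⟩, rfl⟩ h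
    exact P.ne_zero i (hf (by rw [h, map_zero]))
  refine foldingFormula_of_model hΦ LinearMap.id 0 (Determines.refl Φ) orderOf_one one_pos ?_
    exists_dual_point (fun v => by rw [one_smul]) ?_ ?_ ?_ ?_ ?_ ?_
  · intro χ hχ
    -- For order one take `χ = 0`: the function `I` is the indicator of the node zero, so it
    -- vanishes on the simple roots.
    refine isCocycle_of_nodes (θ := θ) (e := e) (π := 1) (fun i => by simp) one_pos
      (Pi.single 0 1) (fun i => rfl) ?_ (fun y _ => by simp) ?_
    · simp [Pi.single_apply]
    · intro k
      rw [hχ, Pi.single_eq_of_ne (Fin.succ_ne_zero k)]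
      simp
  · intro v _ hv
    exact hf (by rw [map_zero]; exact hv)
  · intro r
    exact ⟨fun hr => ⟨⟨r, hr, rfl⟩, h0 r hr⟩, by rintro ⟨⟨β, hβ, rfl⟩, -⟩; exact hβ⟩
  · intro β hβ hβ0
    exact absurd hβ0 (h0 β hβ)
  · intro r hr1 hr2
    exfalso
    push_cast at hr2
    omega
  · intro γ hγ
    refine ⟨γ, hγ, 1, one_dvd _, by simp, fun t => ⟨γ, hγ, rfl, -t, by simp⟩⟩
  · intro β hβ _
    exact ⟨β, hβ, 1, by simp, 0, by simp⟩

end Model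

end RootPairing

/-! ### Auxiliary sums, and type `A`. -/

theorem sum_fin_ite {l : ℕ} (c : ℕ → ℝ) (a : ℕ) :
    ∑ k : Fin l, (if (k : ℕ) = a then c k else 0) = if a < l then c a else 0 := by
  rw [Fin.sum_univ_eq_sum_range (fun k => if k = a then c k else 0) l, Finset.sum_ite_eq']
  simp

theorem sum_range_mul_of_periodic {g : ℕ} (o : ℕ) {y : ℕ → ℤ} (hy : ∀ i, y (i + g) = y i) :
    ∑ i ∈ Finset.range (o * g), y i = o * ∑ i ∈ Finset.range g, y i := by
  have hper : ∀ o i, y (o * g + i) = y i := by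
    intro o
    induction o with
    | zero => simp
    | succ o ih => intro i; rw [add_mul, one_mul, add_right_comm, hy, ih]
  induction o with
  | zero => simp
  | succ o ih =>
    rw [add_mul, one_mul, Finset.sum_range_add, ih]
    simp only [hper]
    push_cast
    ring

/-- Gives the order of translation by `j` on the integers modulo `n`. -/
theorem dvd_mul_iff_div_gcd_dvd {n j k : ℕ} (hn : 0 < n) : n ∣ k * j ↔ n / Nat.gcd n j ∣ k := by
  have hg : 0 < Nat.gcd n j := Nat.gcd_pos_of_pos_left _ hn
  have hcop := Nat.coprime_div_gcd_div_gcd hg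
  obtain ⟨m, hm⟩ := Nat.gcd_dvd_left n j
  obtain ⟨i, hi⟩ := Nat.gcd_dvd_right n j
  generalize Nat.gcd n j = g at *
  subst hm hi
  rw [Nat.mul_div_cancel_left _ hg, Nat.mul_div_cancel_left _ hg] at hcop
  rw [Nat.mul_div_cancel_left _ hg, mul_left_comm, Nat.mul_dvd_mul_iff_left hg]
  exact hcop.dvd_mul_right

namespace RootPairing

section TypeA

set_option linter.unusedSectionVars false

open scoped Fin.NatCast Fin.CommRing

variable {ι V E : Type*} [Finite ι] [AddCommGroup V] [Module ℝ V] [AddCommGroup E] [Module ℝ E]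
  {P : RootPairing ι ℝ V E} [P.IsRootSystem] [P.IsCrystallographic] [P.IsReduced] {b : P.Base}
  {l : ℕ} {θ : ι} {e : Fin l ≃ b.support} {f : V →ₗ[ℝ] (Fin (l + 1) → ℝ)}

theorem single_sub_single_mem_rootsA {n : ℕ} {i j : Fin (n + 1)} (h : i ≠ j) :
    (Pi.single i 1 - Pi.single j 1 : Fin (n + 1) → ℝ) ∈ rootsA n := ⟨i, j, h, rfl⟩

theorem single_sub_eq (n : ℕ) (i j : Fin n) :
    (Pi.single i 1 - Pi.single j 1 : Fin n → ℝ) =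
      Pi.single i (sgnR 1) + Pi.single j (sgnR (-1)) := by
  rw [sgnR_neg, sgnR_one, Pi.single_neg, sub_eq_add_neg]

/-- The reflection in `e_i - e_j` is the transposition without a sign, so `Q` may demand that all
signs be trivial. -/
theorem exists_perm_typeA (hf : Function.Injective f)
    (hΦ : f '' Set.range P.root = rootsA l) (w : P.weylGroup) :
    ∃ τ : Equiv.Perm (Fin (l + 1)), ∀ v a, f (w • v) (τ a) = f v a := by
  obtain ⟨τ, δ, rfl, h⟩ := exists_signed_perm hf hΦ (fun δ => δ = 1) rfl
    (by rintro τ _ _ rfl rfl; rfl) (by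
      rintro _ ⟨i, j, hij, rfl⟩
      rw [single_sub_eq]
      refine ⟨_, _, ?_, isSignedImage_dotReflection_pair hij 1 (-1)⟩
      ext a
      simp) (by
      rintro τ _ rfl _ v h ⟨i, j, hij, rfl⟩
      rw [single_sub_eq] at h
      refine ⟨τ i, τ j, fun h => hij (τ.injective h), ?_⟩
      rw [h.add_single, single_sub_eq]
      simp [sgnR_one]) w
  exact ⟨τ, fun v a => by rw [h v a, Pi.one_apply, sgnR_one, one_mul]⟩

theorem stdE_apply (n k : ℕ) (i : Fin n) : stdE n k i = if (i : ℕ) + 1 = k then 1 else 0 := rfl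

theorem map_highestRoot_typeA (hl : 1 ≤ l) (hθ : IsHighestRoot b θ)
    (hΦ : f '' Set.range P.root = rootsA l)
    (hS : ∀ k, f (P.root (e k)) = stdE (l + 1) (k + 1) - stdE (l + 1) (k + 2)) :
    f (P.root θ) = Pi.single 0 1 - Pi.single (Fin.last l) 1 := by
  have h0 : (0 : Fin (l + 1)) ≠ Fin.last l := by
    intro h
    have := congrArg Fin.val h
    simp at this
    omega
  refine map_highestRoot hθ hΦ hS (single_sub_single_mem_rootsA h0) ?_ ?_
  · intro k
    rw [dotProduct_sub, dotProduct_single, dotProduct_single]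
    simp only [Pi.sub_apply, stdE_apply, Fin.val_zero, Fin.val_last]
    have := k.2
    grind
  · rintro _ ⟨i, j, hij, rfl⟩
    rw [single_sub_eq, single_sub_eq, pair_dotProduct_self hij, pair_dotProduct_self h0]

theorem coef_typeA (hl : 1 ≤ l) (hf : Function.Injective f) (hθ : IsHighestRoot b θ)
    (hΦ : f '' Set.range P.root = rootsA l)
    (hS : ∀ k, f (P.root (e k)) = stdE (l + 1) (k + 1) - stdE (l + 1) (k + 2)) (k : Fin l) :
    coef b θ (e k) = 1 := by
  refine coef_highestRoot_of_model hf hS (c := fun _ => 1) ?_ k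
  rw [map_highestRoot_typeA hl hθ hΦ hS]
  ext a
  rw [Finset.sum_apply]
  simp only [Int.cast_one, one_smul, Pi.sub_apply, stdE_apply, Pi.single_apply,
    Finset.sum_sub_distrib]
  have h1 := sum_fin_ite (l := l) (fun _ => 1) a
  have h2 := sum_fin_ite (l := l) (fun _ => 1) (a - 1)
  have h3 : ∑ x : Fin l, (if (a : ℕ) + 1 = (x : ℕ) + 1 then (1 : ℝ) else 0) =
      if (a : ℕ) < l then 1 else 0 := by
    exact (Finset.sum_congr rfl fun x _ => if_congr (by omega) rfl rfl).trans h1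
  have h4 : ∑ x : Fin l, (if (a : ℕ) + 1 = (x : ℕ) + 2 then (1 : ℝ) else 0) =
      if 1 ≤ (a : ℕ) then 1 else 0 := by
    by_cases ha : 1 ≤ (a : ℕ)
    · rw [if_pos ha]
      rw [if_pos (by have := a.2; omega)] at h2
      exact (Finset.sum_congr rfl fun x _ => if_congr (by omega) rfl rfl).trans h2
    · rw [if_neg ha]
      exact Finset.sum_eq_zero fun x _ => if_neg (by omega)
  rw [h3, h4]
  simp only [Fin.ext_iff, Fin.val_zero, Fin.val_last]
  have := a.2
  split_ifs <;> first | omega | norm_num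

/-- With indices modulo `l + 1` and starting from zero, the node `i` is `e_{i-1} - e_i`, the lowest
root included. This cyclic form makes the rotations visible. -/
theorem map_node_typeA (hl : 1 ≤ l) (hθ : IsHighestRoot b θ)
    (hΦ : f '' Set.range P.root = rootsA l)
    (hS : ∀ k, f (P.root (e k)) = stdE (l + 1) (k + 1) - stdE (l + 1) (k + 2))
    (i a : Fin (l + 1)) : f (P.root (node θ e i)) a =
      (if a + 1 = i then 1 else 0) - (if a = i then 1 else 0) := by
  have hval : ∀ k : Fin l, a + 1 = k.succ ↔ (a : ℕ) = k := by
    intro k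
    rw [Fin.ext_iff, Fin.val_add_one, Fin.val_succ]
    have := k.2
    split_ifs with h
    · have h' : (a : ℕ) = l := by rw [h, Fin.val_last]
      constructor
      · intro h
        exact absurd h (by simp)
      · intro h
        omega
    · omega
  have hlast : a + 1 = 0 ↔ a = Fin.last l := by
    rw [Fin.ext_iff, Fin.val_add_one]
    split_ifs with h <;> simp [h]
  induction i using Fin.cases with
  | zero =>
    rw [root_node_zero, map_neg, map_highestRoot_typeA hl hθ hΦ hS]
    simp only [Pi.neg_apply, Pi.sub_apply, Pi.single_apply, hlast]
    ring
  | succ k =>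
    rw [node_succ, hS, Pi.sub_apply, stdE_apply, stdE_apply]
    congr 1
    · exact if_congr (by rw [hval]; omega) rfl rfl
    · exact if_congr (by rw [Fin.ext_iff, Fin.val_succ]; omega) rfl rfl

/-- In type `A` the stabilizer of the alcove acts by rotations. -/
theorem rotation_typeA (hl : 1 ≤ l) (hf : Function.Injective f) (hθ : IsHighestRoot b θ)
    (hΦ : f '' Set.range P.root = rootsA l)
    (hS : ∀ k, f (P.root (e k)) = stdE (l + 1) (k + 1) - stdE (l + 1) (k + 2))
    {ω : P.weylGroup} {π : Equiv.Perm (Fin (l + 1))}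
    (hπ : ∀ i, P.weylGroupToPerm ω (node θ e i) = node θ e (π i)) :
    (∀ v a, f (ω • v) (a + π 0) = f v a) ∧ ∀ i, π i = i + π 0 := by
  obtain ⟨τ, hτ⟩ := exists_perm_typeA hf hΦ ω
  have hnode : ∀ i a, f (P.root (node θ e (π i))) (τ a) = f (P.root (node θ e i)) a := by
    intro i a
    have := hτ (P.root (node θ e i)) a
    rwa [weylGroup_apply_root, hπ] at this
  simp only [map_node_typeA hl hθ hΦ hS] at hnode
  have hne : ∀ a : Fin (l + 1), a + 1 ≠ a := by
    intro a h
    rw [add_eq_left] at h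
    have := congrArg Fin.val h
    rw [Fin.val_one', Nat.mod_eq_of_lt (by omega)] at this
    simp at this
  -- The entry `-1` of the node `i` sits at the position `i`, so the coordinates and the nodes are
  -- permuted alike; the entry `+1` then shows that `τ` commutes with the shift.
  have h1 : ∀ i, τ i = π i := by
    intro i
    have := hnode i i
    rw [if_neg (hne i), if_pos rfl] at this
    by_contra h
    rw [if_neg h] at this
    split_ifs at this <;> norm_num at this
  have h2 : ∀ a, τ (a + 1) = τ a + 1 := by
    intro a
    have := hnode (a + 1) a
    rw [if_pos rfl, if_neg (hne a).symm, ← h1] at this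
    by_contra h
    rw [if_neg (fun h' => h h'.symm)] at this
    split_ifs at this <;> norm_num at this
  have h3 : ∀ n : ℕ, τ (n : Fin (l + 1)) = n + τ 0 := by
    intro n
    induction n with
    | zero => simp
    | succ n ih => rw [Nat.cast_succ, h2, ih]; ring
  have h4 : ∀ i, τ i = i + π 0 := by
    intro i
    have := h3 i
    rwa [Fin.cast_val_eq_self, h1 0] at this
  exact ⟨fun v a => by rw [← h4, hτ], fun i => by rw [← h1, h4]⟩

/-- Functions invariant under the rotation by `j` are periodic modulo `gcd (l + 1) j`. -/
theorem periodic_of_rotation {α : Type*} {y : Fin (l + 1) → α} {j : Fin (l + 1)} (hj : j ≠ 0)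
    (hy : ∀ i, y (i + j) = y i) (n : ℕ) :
    y ((n + Nat.gcd (l + 1) j : ℕ) : Fin (l + 1)) = y (n : Fin (l + 1)) := by
  have hj0 : 0 < (j : ℕ) := Nat.pos_of_ne_zero fun h => hj (Fin.ext h)
  have hlt : Nat.gcd (j : ℕ) (l + 1) < l + 1 :=
    lt_of_le_of_lt (Nat.gcd_le_left _ hj0) j.2
  -- By Bézout the greatest common divisor is a multiple of `j` modulo `l + 1`.
  obtain ⟨m, -, hm⟩ := Nat.exists_mul_mod_eq_gcd hlt
  have hper : ∀ (m : ℕ) (i : Fin (l + 1)), y (i + m * j) = y i := by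
    intro m
    induction m with
    | zero => simp
    | succ m ih =>
      intro i
      rw [Nat.cast_succ, add_mul, one_mul, ← add_assoc, hy, ih]
  have hcast : ((Nat.gcd (l + 1) j : ℕ) : Fin (l + 1)) = m * j := by
    rw [Nat.gcd_comm, ← hm]
    apply Fin.ext
    rw [Fin.val_natCast, Nat.mod_mod, Fin.val_mul, Fin.val_natCast]
    simp [mul_comm]
  rw [Nat.cast_add, hcast, hper]

variable {ω : P.weylGroup} {j : Fin (l + 1)}

/-- The power `ω ^ k` is the rotation by `k j`. If `k j` is nonzero modulo `l + 1`, the root `e_0 -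
e_{kj}` shows that the rotation is not the identity. -/
theorem orderOf_typeA (hf : Function.Injective f) (hΦ : f '' Set.range P.root = rootsA l)
    (hrot : ∀ v a, f (ω • v) (a + j) = f v a) :
    orderOf ω = (l + 1) / Nat.gcd (l + 1) j := by
  have hpow : ∀ (k : ℕ) v a, f (ω ^ k • v) (a + k * j) = f v a := by
    intro k
    induction k with
    | zero => simp
    | succ k ih =>
      intro v a
      rw [pow_succ', mul_smul, Nat.cast_succ, add_mul, one_mul, ← add_assoc, hrot, ih]
  have hone : ∀ k : ℕ, ω ^ k = 1 ↔ (l + 1) ∣ k * j := by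
    intro k
    have hcast : ((k : Fin (l + 1)) * j = 0) ↔ (l + 1) ∣ k * j := by
      rw [Fin.ext_iff, Fin.val_mul, Fin.val_natCast, Nat.mod_mul_mod, Nat.dvd_iff_mod_eq_zero]
      rfl
    rw [← hcast]
    constructor
    · intro h
      by_contra hne
      have hr := single_sub_single_mem_rootsA (n := l) (i := 0) (j := k * j) (fun h => hne h.symm)
      rw [← hΦ] at hr
      obtain ⟨v, -, hv⟩ := hr
      have := hpow k v 0
      rw [h, one_smul, hv, zero_add] at this
      simp only [Pi.sub_apply, Pi.single_eq_same, Pi.single_eq_of_ne hne,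
        Pi.single_eq_of_ne (Ne.symm hne)] at this
      norm_num at this
    · intro h
      apply weylGroup_ext
      intro v
      apply hf
      ext a
      have := hpow k v a
      rwa [h, add_zero] at this
  apply Nat.dvd_antisymm
  · rw [orderOf_dvd_iff_pow_eq_one, hone, dvd_mul_iff_div_gcd_dvd (Nat.succ_pos l)]
  · rw [← dvd_mul_iff_div_gcd_dvd (Nat.succ_pos l), ← hone]
    exact pow_orderOf_eq_one ω

/-- The functional that takes `e_k` to `- k / g`, rounded. -/
noncomputable def blockFunctional (N g : ℕ) : (Fin N → ℝ) →ₗ[ℝ] ℝ :=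
  -∑ a : Fin N, (((a : ℕ) / g : ℕ) : ℝ) • LinearMap.proj a

theorem blockFunctional_single (N g : ℕ) (a : Fin N) (c : ℝ) :
    blockFunctional N g (Pi.single a c) = -((((a : ℕ) / g : ℕ) : ℝ) * c) := by
  simp only [blockFunctional, LinearMap.neg_apply, LinearMap.sum_apply, LinearMap.smul_apply,
    LinearMap.proj_apply, smul_eq_mul]
  rw [Finset.sum_eq_single a]
  · simp
  · intro x _ hx
    rw [Pi.single_eq_of_ne hx, mul_zero]
  · simp

theorem blockFunctional_sub (N g : ℕ) (a a' : Fin N) :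
    blockFunctional N g (Pi.single a 1 - Pi.single a' 1) =
      (((a' : ℕ) / g : ℕ) : ℝ) - (((a : ℕ) / g : ℕ) : ℝ) := by
  rw [map_sub, blockFunctional_single, blockFunctional_single]
  ring

/-- All marks are one and invariant functions have period `g`, so their sums are `o` times a sum
over one period. The indicator of the multiples of `g` has sum `o`. The functional takes `α_i` to
`⌊i/g⌋ - ⌊(i-1)/g⌋`, which is that indicator. -/
theorem isCocycle_typeA (hl : 1 ≤ l) (hf : Function.Injective f) (hθ : IsHighestRoot b θ)
    (hΦ : f '' Set.range P.root = rootsA l)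
    (hS : ∀ k, f (P.root (e k)) = stdE (l + 1) (k + 1) - stdE (l + 1) (k + 2))
    {π : Equiv.Perm (Fin (l + 1))}
    (hπ : ∀ i, P.weylGroupToPerm ω (node θ e i) = node θ e (π i)) (hπ0 : π 0 ≠ 0)
    (χ : E) (hχ : ∀ v, P.toLinearMap v χ =
      blockFunctional (l + 1) (Nat.gcd (l + 1) (π 0)) (f v)) :
    IsCocycle ω χ ((l + 1) / Nat.gcd (l + 1) (π 0)) := by
  obtain ⟨-, hrot⟩ := rotation_typeA hl hf hθ hΦ hS hπ
  set g := Nat.gcd (l + 1) (π 0) with hg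
  have hgpos : 0 < g := Nat.gcd_pos_of_pos_left _ (Nat.succ_pos l)
  obtain ⟨o, ho⟩ : g ∣ l + 1 := Nat.gcd_dvd_left _ _
  have hgj : g ∣ (π 0 : ℕ) := Nat.gcd_dvd_right _ _
  have ho' : (l + 1) / g = o := by rw [ho, Nat.mul_div_cancel_left _ hgpos]
  have hopos : 0 < o := Nat.pos_of_ne_zero (by rintro rfl; omega)
  rw [ho']
  have hmark : ∀ i, mark θ e i = 1 := by
    intro i
    induction i using Fin.cases with
    | zero => rfl
    | succ k => exact coef_typeA hl hf hθ hΦ hS k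
  have hsum : ∀ y : Fin (l + 1) → ℤ, (∀ i, y (π i) = y i) → ∑ i, mark θ e i * y i =
      o * ∑ i ∈ Finset.range g, y (i : Fin (l + 1)) := by
    intro y hy
    have hper : ∀ n : ℕ, y ((n + g : ℕ) : Fin (l + 1)) = y (n : Fin (l + 1)) :=
      periodic_of_rotation hπ0 (fun i => by rw [← hrot, hy])
    rw [← sum_range_mul_of_periodic o (y := fun n => y (n : Fin (l + 1))) hper, mul_comm o g, ← ho,
      ← Fin.sum_univ_eq_sum_range]
    simp [hmark]
  refine isCocycle_of_nodes hπ hopos (fun i => if g ∣ (i : ℕ) then 1 else 0) ?_ ?_ ?_ ?_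
  · intro i
    refine if_congr ?_ rfl rfl
    rw [hrot, Fin.val_add, Nat.dvd_mod_iff ⟨o, ho⟩]
    exact (Nat.dvd_add_iff_left hgj).symm
  · rw [hsum]
    · rw [Finset.sum_eq_single 0]
      · simp
      · intro i hi hi0
        rw [Finset.mem_range] at hi
        have hil : i < l + 1 := lt_of_lt_of_le hi (Nat.le_of_dvd (Nat.succ_pos l) ⟨o, ho⟩)
        rw [Fin.val_natCast, Nat.mod_eq_of_lt hil]
        exact if_neg fun h => absurd (Nat.le_of_dvd (Nat.pos_of_ne_zero hi0) h) (by omega)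
      · intro h
        exact absurd (Finset.mem_range.2 hgpos) h
    · intro i
      refine if_congr ?_ rfl rfl
      rw [hrot, Fin.val_add, Nat.dvd_mod_iff ⟨o, ho⟩]
      exact (Nat.dvd_add_iff_left hgj).symm
  · intro y hy
    rw [hsum y hy]
    exact dvd_mul_right _ _
  · intro k
    have hk : f (P.root (e k)) = Pi.single k.castSucc 1 - Pi.single k.succ 1 := by
      rw [hS]
      ext a
      simp only [Pi.sub_apply, stdE_apply, Pi.single_apply, Fin.ext_iff, Fin.val_castSucc,
        Fin.val_succ]
      congr 1 <;> exact if_congr (by omega) rfl rfl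
    rw [hχ, hk, blockFunctional_sub, Fin.val_castSucc, Fin.val_succ, Nat.succ_div]
    split_ifs <;> push_cast <;> ring

end TypeA

end RootPairing

/-- The map that takes `e_a` to `e_r`, where `r` is the remainder of `a` modulo `n + 1`. -/
noncomputable def foldMod (N n : ℕ) : (Fin N → ℝ) →ₗ[ℝ] (Fin (n + 1) → ℝ) :=
  ∑ a : Fin N, (LinearMap.single ℝ (fun _ => ℝ) (Fin.ofNat (n + 1) a)).comp (LinearMap.proj a)

theorem foldMod_eq_sum (N n : ℕ) (v : Fin N → ℝ) :
    foldMod N n v = ∑ a : Fin N, Pi.single (Fin.ofNat (n + 1) a) (v a) := by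
  simp [foldMod, LinearMap.sum_apply]

theorem foldMod_single (N n : ℕ) (a : Fin N) (c : ℝ) :
    foldMod N n (Pi.single a c) = Pi.single (Fin.ofNat (n + 1) a) c := by
  rw [foldMod_eq_sum, Finset.sum_eq_single a]
  · simp
  · intro x _ hx
    rw [Pi.single_eq_of_ne hx, Pi.single_zero]
  · simp

theorem single_sub_single_eq_zero_iff {n : ℕ} {i j : Fin n} :
    (Pi.single i 1 - Pi.single j 1 : Fin n → ℝ) = 0 ↔ i = j := by
  constructor
  · intro h
    by_contra hij
    have := congrFun h i
    rw [Pi.sub_apply, Pi.single_eq_same, Pi.single_eq_of_ne hij] at this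
    norm_num at this
  · rintro rfl
    exact sub_self _

theorem rootsA_zero : rootsA 0 = ∅ := by
  ext v
  simp only [Set.mem_empty_iff_false, iff_false]
  rintro ⟨i, j, hij, -⟩
  exact hij (Fin.ext (by omega))

namespace RootPairing

section TypeA

set_option linter.unusedSectionVars false

open scoped Fin.NatCast Fin.CommRing

/-- An empty arrangement makes the coordinate space and the factor immaterial; this matches `rootsA
0` in `ℝ¹` with the empty set in `ℝ⁰`. -/
theorem FoldingFormula.congr_empty {ι V E : Type*} [AddCommGroup V] [Module ℝ V] [AddCommGroup E]
    [Module ℝ E] {P : RootPairing ι ℝ V E} {ω : P.weylGroup} {m n d d' : ℕ}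
    (h : FoldingFormula P ω (∅ : Set (Fin m → ℝ)) ∅ d) :
    FoldingFormula P ω (∅ : Set (Fin n → ℝ)) ∅ d' := by
  obtain ⟨⟨ψ, h1, h2⟩, h3⟩ := h
  refine ⟨⟨0, ?_, ?_⟩, fun ψ' hψ' q hq => ?_⟩
  · intro x hx y hy _
    simp only [Submodule.span_empty, Submodule.bot_coe, Set.mem_singleton_iff] at hx hy
    rw [hx, hy]
  · rw [← h2, Set.image_empty, Set.image_empty]
  · have := h3 ψ ⟨h1, h2⟩ q hq
    simp only [Set.image_empty] at this ⊢
    exact this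

variable {ι V E : Type*} [Finite ι] [AddCommGroup V] [Module ℝ V] [AddCommGroup E] [Module ℝ E]
  {P : RootPairing ι ℝ V E} [P.IsRootSystem] [P.IsCrystallographic] [P.IsReduced] {b : P.Base}
  {l : ℕ} {θ : ι} {e : Fin l ≃ b.support} {f : V →ₗ[ℝ] (Fin (l + 1) → ℝ)}

theorem ofNat_val_add {n : ℕ} (h : n + 1 ∣ l + 1) {j : Fin (l + 1)} (hj : n + 1 ∣ (j : ℕ))
    (a : Fin (l + 1)) :
    Fin.ofNat (n + 1) ((a + j : Fin (l + 1)) : ℕ) = Fin.ofNat (n + 1) (a : ℕ) := by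
  apply Fin.ext
  simp only [Fin.val_ofNat]
  rw [Fin.val_add, Nat.mod_mod_of_dvd _ h, Nat.add_mod, Nat.mod_eq_zero_of_dvd hj, add_zero,
    Nat.mod_mod]

theorem foldMod_rotation {n : ℕ} (h : n + 1 ∣ l + 1) {j : Fin (l + 1)} (hj : n + 1 ∣ (j : ℕ))
    {u v : Fin (l + 1) → ℝ} (huv : ∀ a, u (a + j) = v a) :
    foldMod (l + 1) n u = foldMod (l + 1) n v := by
  rw [foldMod_eq_sum, foldMod_eq_sum, ← _root_.Equiv.sum_comp (Equiv.addRight j)]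
  refine Finset.sum_congr rfl fun a _ => ?_
  rw [Equiv.coe_addRight, huv, ofNat_val_add h hj]

/-- For a periodic vector the entry `r` of the fold is a positive multiple of the entry `r` of the
vector. -/
theorem eq_zero_of_foldMod_eq_zero {n : ℕ} {y : Fin (l + 1) → ℝ} (h : n + 1 ∣ l + 1)
    (hy : ∀ i : ℕ, y ((i + (n + 1) : ℕ) : Fin (l + 1)) = y (i : Fin (l + 1)))
    (h0 : foldMod (l + 1) n y = 0) : y = 0 := by
  have hnl : n + 1 ≤ l + 1 := Nat.le_of_dvd (Nat.succ_pos l) h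
  have hper : ∀ i k : ℕ, y ((i + (n + 1) * k : ℕ) : Fin (l + 1)) = y (i : Fin (l + 1)) := by
    intro i k
    induction k with
    | zero => simp
    | succ k ih => rw [mul_add, mul_one, ← add_assoc, hy, ih]
  have hmod : ∀ a : Fin (l + 1), y a = y (((a : ℕ) % (n + 1) : ℕ) : Fin (l + 1)) := by
    intro a
    have := hper ((a : ℕ) % (n + 1)) (a / (n + 1))
    rwa [Nat.mod_add_div, Fin.cast_val_eq_self] at this
  have hzero : ∀ r : Fin (n + 1), y ((r : ℕ) : Fin (l + 1)) = 0 := by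
    intro r
    have h1 := congrFun h0 r
    rw [foldMod_eq_sum, Finset.sum_apply] at h1
    have h2 : ∀ a : Fin (l + 1), (Pi.single (Fin.ofNat (n + 1) a) (y a) : Fin (n + 1) → ℝ) r =
        if (a : ℕ) % (n + 1) = r then y ((r : ℕ) : Fin (l + 1)) else 0 := by
      intro a
      rw [Pi.single_apply]
      by_cases har : (a : ℕ) % (n + 1) = r
      · rw [if_pos har, if_pos (Fin.ext (by simp [har])), hmod, har]
      · rw [if_neg har, if_neg (fun h => har (by rw [h]; simp))]
    rw [Finset.sum_congr rfl fun a _ => h2 a, ← Finset.sum_filter, Finset.sum_const, nsmul_eq_mul]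
      at h1
    refine (mul_eq_zero.1 h1).resolve_left ?_
    have : 0 < (Finset.univ.filter fun a : Fin (l + 1) => (a : ℕ) % (n + 1) = r).card := by
      rw [Finset.card_pos]
      refine ⟨⟨r, lt_of_lt_of_le r.2 hnl⟩, ?_⟩
      simp [Nat.mod_eq_of_lt r.2]
    exact_mod_cast this.ne'
  ext a
  rw [hmod a]
  exact hzero ⟨_, Nat.mod_lt _ (Nat.succ_pos n)⟩

/-- Write `a = g u + i` with `0 ≤ i < g`: the fold keeps the remainder `i` and the functional sees
the quotient `u < o`. A root with zero fold has equal remainders and different quotients, so its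
class is nonzero, and all nonzero classes occur. Over `e_i - e_j` with `i ≠ j` the quotients vary
freely, so every class occurs and the factor is `o` throughout. -/
theorem foldingFormula_typeA (hl : 1 ≤ l) (hf : Function.Injective f) (hθ : IsHighestRoot b θ)
    (hΦ : f '' Set.range P.root = rootsA l)
    (hS : ∀ k, f (P.root (e k)) = stdE (l + 1) (k + 1) - stdE (l + 1) (k + 2))
    {ω : P.weylGroup} {π : Equiv.Perm (Fin (l + 1))}
    (hπ : ∀ i, P.weylGroupToPerm ω (node θ e i) = node θ e (π i)) (hπ0 : π 0 ≠ 0) :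
    FoldingFormula P ω (rootsA (Nat.gcd (l + 1) (π 0) - 1)) (rootsA (Nat.gcd (l + 1) (π 0) - 1))
      ((l + 1) / Nat.gcd (l + 1) (π 0)) := by
  obtain ⟨hrot, -⟩ := rotation_typeA hl hf hθ hΦ hS hπ
  have hcoc := isCocycle_typeA hl hf hθ hΦ hS hπ hπ0
  have horder := orderOf_typeA hf hΦ hrot
  have hper := fun (y : Fin (l + 1) → ℝ) => periodic_of_rotation (y := y) hπ0
  have hgl : Nat.gcd (l + 1) (π 0) ∣ l + 1 := Nat.gcd_dvd_left _ _
  have hgj : Nat.gcd (l + 1) (π 0) ∣ (π 0 : ℕ) := Nat.gcd_dvd_right _ _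
  have hgpos : 0 < Nat.gcd (l + 1) (π 0) := Nat.gcd_pos_of_pos_left _ (Nat.succ_pos l)
  generalize Nat.gcd (l + 1) (π 0) = g at *
  obtain ⟨n, rfl⟩ : ∃ n, g = n + 1 := ⟨g - 1, by omega⟩
  rw [Nat.add_sub_cancel]
  obtain ⟨o, ho⟩ := id hgl
  have ho' : (l + 1) / (n + 1) = o := by rw [ho, Nat.mul_div_cancel_left _ hgpos]
  have hopos : 0 < o := Nat.pos_of_ne_zero (by rintro rfl; omega)
  rw [ho'] at hcoc horder ⊢
  have hdiv : ∀ a : Fin (l + 1), (a : ℕ) / (n + 1) < o := fun a =>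
    Nat.div_lt_of_lt_mul (lt_of_lt_of_eq a.2 ho)
  have hHroot : ∀ a a' : Fin (l + 1), foldMod (l + 1) n (Pi.single a 1 - Pi.single a' 1) =
      Pi.single (Fin.ofNat (n + 1) a) 1 - Pi.single (Fin.ofNat (n + 1) a') 1 := fun a a' => by
    rw [map_sub, foldMod_single, foldMod_single]
  have hlift : ∀ i : Fin (n + 1), ∀ u < o, (n + 1) * u + (i : ℕ) < l + 1 := by
    intro i u hu
    have h1 : (n + 1) * (u + 1) ≤ (n + 1) * o := Nat.mul_le_mul_left _ hu
    have h2 := i.2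
    rw [ho]
    linarith
  have hmod : ∀ (i : Fin (n + 1)) (u : ℕ), Fin.ofNat (n + 1) ((n + 1) * u + i) = i := by
    intro i u
    apply Fin.ext
    rw [Fin.val_ofNat, Nat.mul_add_mod, Nat.mod_eq_of_lt i.2]
  have hquot : ∀ (i : Fin (n + 1)) (u : ℕ), ((n + 1) * u + i) / (n + 1) = u := by
    intro i u
    rw [Nat.mul_add_div hgpos, Nat.div_eq_of_lt i.2, add_zero]
  refine foldingFormula_of_model hΦ (foldMod (l + 1) n) (blockFunctional (l + 1) (n + 1))
    (Determines.refl _) horder hopos hcoc exists_dual_point ?_ ?_ ?_ ?_ ?_ ?_ ?_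
  · intro v
    exact foldMod_rotation hgl hgj (hrot v)
  · intro v hv h0
    apply hf
    rw [map_zero]
    refine eq_zero_of_foldMod_eq_zero hgl (hper _ fun i => ?_) h0
    conv_lhs => rw [← hv]
    exact hrot v i
  · intro r
    constructor
    · rintro ⟨i, j, hij, rfl⟩
      refine ⟨⟨_, single_sub_single_mem_rootsA (i := ⟨_, hlift i 0 hopos⟩)
        (j := ⟨_, hlift j 0 hopos⟩) ?_, ?_⟩, ?_⟩
      · intro h
        apply hij
        simpa [Fin.ext_iff] using h
      · rw [hHroot]
        simp only [hmod]
      · rwa [Ne, single_sub_single_eq_zero_iff]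
    · rintro ⟨⟨_, ⟨a, a', haa, rfl⟩, rfl⟩, h0⟩
      rw [hHroot] at h0 ⊢
      exact single_sub_single_mem_rootsA fun h => h0 (by rw [h, sub_self])
  · rintro _ ⟨a, a', haa, rfl⟩ h0 ⟨k, hk⟩
    rw [hHroot, single_sub_single_eq_zero_iff, Fin.ext_iff, Fin.val_ofNat, Fin.val_ofNat] at h0
    rw [blockFunctional_sub] at hk
    have h1 := hdiv a
    have h2 := hdiv a'
    have h3 := Nat.div_add_mod a (n + 1)
    have h4 := Nat.div_add_mod a' (n + 1)
    generalize (a : ℕ) / (n + 1) = x at hk h1 h3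
    generalize (a' : ℕ) / (n + 1) = x' at hk h2 h4
    have hk' : (x' : ℤ) - x = o * k := by exact_mod_cast hk
    have hk0 : k = 0 := by
      rcases lt_trichotomy k 0 with h | h | h
      · have : (o : ℤ) * k ≤ o * (-1) := by gcongr; omega
        omega
      · exact h
      · have : (o : ℤ) * 1 ≤ o * k := by gcongr; omega
        omega
    rw [hk0, mul_zero] at hk'
    have h5 : x' = x := by omega
    apply haa
    apply Fin.ext
    rw [← h3, ← h4, h5, h0]
  · intro r hr1 hr2
    obtain ⟨u, rfl⟩ : ∃ u : ℕ, r = u := ⟨r.toNat, by omega⟩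
    refine ⟨_, single_sub_single_mem_rootsA (i := ⟨_, hlift 0 0 hopos⟩)
      (j := ⟨_, hlift 0 u (by omega)⟩) ?_, ?_, 0, ?_⟩
    · intro h
      have := congrArg Fin.val h
      simp at this
      omega
    · rw [hHroot, single_sub_single_eq_zero_iff]
      simp only [hmod]
    · rw [blockFunctional_sub]
      simp only [hquot]
      simp
  · rintro _ ⟨i, j, hij, rfl⟩
    have hne : ∀ u : ℕ, (n + 1) * 0 + (i : ℕ) ≠ (n + 1) * u + j := by
      intro u h
      apply hij
      have := congrArg (Fin.ofNat (n + 1)) h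
      rwa [hmod, hmod] at this
    refine ⟨_, single_sub_single_mem_rootsA (i := ⟨_, hlift i 0 hopos⟩)
      (j := ⟨_, hlift j 0 hopos⟩) (fun h => hne 0 (congrArg Fin.val h)), o, dvd_rfl, ?_, ?_⟩
    · rw [hHroot]
      simp only [hmod]
    · intro t
      have ht := Int.emod_nonneg t (b := o) (by omega)
      have ht' := Int.emod_lt_of_pos t (b := o) (by omega)
      obtain ⟨u, hu⟩ : ∃ u : ℕ, t % o = u := ⟨(t % o).toNat, by omega⟩
      -- The first index stays in the block zero; the second moves to the block numbered by the
      -- residue of `t`.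
      refine ⟨_, single_sub_single_mem_rootsA (i := ⟨_, hlift i 0 hopos⟩)
        (j := ⟨_, hlift j u (by omega)⟩) (fun h => hne u (congrArg Fin.val h)), ?_, -(t / o), ?_⟩
      · rw [hHroot, hHroot]
        simp only [hmod]
      · rw [blockFunctional_sub]
        simp only [hquot]
        rw [Nat.div_self hopos]
        have h1 := Int.mul_ediv_add_emod t o
        have h2 : ((u : ℕ) : ℤ) = t + o * (-(t / o)) := by linarith
        have h3 : ((u : ℕ) : ℝ) = t + o * ((-(t / o) : ℤ) : ℝ) := by exact_mod_cast h2
        rw [h3]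
        simp
  · rintro _ ⟨a, a', haa, rfl⟩ h0
    rw [hHroot] at h0
    refine ⟨_, single_sub_single_mem_rootsA (i := Fin.ofNat (n + 1) a) (j := Fin.ofNat (n + 1) a')
      (fun h => h0 (by rw [h, sub_self])), o, ?_, ?_⟩
    · rw [hHroot]
      simp
    · rw [blockFunctional_sub]
      generalize (a : ℕ) / (n + 1) = x
      generalize (a' : ℕ) / (n + 1) = x'
      exact ⟨x' - x, by push_cast; ring⟩

theorem exists_row_typeA (hl : 1 ≤ l) (hf : Function.Injective f) (hθ : IsHighestRoot b θ)
    (hΦ : f '' Set.range P.root = rootsA l)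
    (hS : ∀ k, f (P.root (e k)) = stdE (l + 1) (k + 1) - stdE (l + 1) (k + 2))
    {ω : P.weylGroup} {π : Equiv.Perm (Fin (l + 1))}
    (hπ : ∀ i, P.weylGroupToPerm ω (node θ e i) = node θ e (π i)) (hπ0 : π 0 ≠ 0) :
    ∃ (n : ℕ) (R R' : Set (Fin n → ℝ)) (d : ℕ), FoldingTable (.A l hl) (π 0) R R' d ∧
      FoldingFormula P ω R R' d := by
  have h := foldingFormula_typeA hl hf hθ hΦ hS hπ hπ0
  have h0 : 1 ≤ (π 0 : ℕ) := Nat.pos_of_ne_zero fun h => hπ0 (Fin.ext h)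
  have h1 : (π 0 : ℕ) ≤ l := Nat.lt_succ_iff.1 (π 0).2
  by_cases hg : Nat.gcd (l + 1) (π 0) = 1
  · refine ⟨_, _, _, _, .A_coprime l _ hl h0 h1 hg, ?_⟩
    rw [hg, Nat.sub_self, rootsA_zero] at h
    exact h.congr_empty
  · exact ⟨_, _, _, _, .A_gcd l _ hl h0 h1 hg, h⟩

end TypeA

end RootPairing

/-! ### Tools common to types `B`, `C` and `D`. -/

/-- A linear combination of the simple roots in a model of type `B`, `C` or `D`, at the entry `a`;
`u` is the correction for the last simple root. -/
theorem sum_chain {l : ℕ} (c : ℕ → ℝ) (u : ℝ) {a : ℕ} (ha : a < l) :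
    ∑ k : Fin l, c k * ((if a = k then 1 else 0) - (if a = k + 1 then 1 else 0) +
      (if (k : ℕ) + 1 = l then u else 0)) =
      c a - (if a = 0 then 0 else c (a - 1)) + c (l - 1) * u := by
  simp only [mul_add, mul_sub, Finset.sum_add_distrib, Finset.sum_sub_distrib, mul_ite, mul_one,
    mul_zero]
  congr 1
  · congr 1
    · have := sum_fin_ite (l := l) c a
      rw [if_pos ha] at this
      rw [← this]
      exact Finset.sum_congr rfl fun k _ => if_congr eq_comm rfl rfl
    · by_cases h0 : a = 0
      · rw [if_pos h0]
        exact Finset.sum_eq_zero fun k _ => if_neg (by omega)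
      · have := sum_fin_ite (l := l) c (a - 1)
        rw [if_pos (by omega)] at this
        rw [if_neg h0, ← this]
        exact Finset.sum_congr rfl fun k _ => if_congr (by omega) rfl rfl
  · have := sum_fin_ite (l := l) (fun k => c k * u) (l - 1)
    rw [if_pos (by omega)] at this
    rw [← this]
    exact Finset.sum_congr rfl fun k _ => if_congr (by omega) rfl rfl

theorem axis_dotProduct_self {N : ℕ} (i : Fin N) (s : ℤˣ) (c : ℝ) :
    (Pi.single i (sgnR s * c) : Fin N → ℝ) ⬝ᵥ Pi.single i (sgnR s * c) = c * c := by
  rw [dotProduct_single, Pi.single_eq_same, mul_mul_mul_comm, sgnR_mul_self, one_mul]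

theorem single_sgnR_eq_zero_iff {n : ℕ} {i : Fin n} {s : ℤˣ} :
    (Pi.single i (sgnR s) : Fin n → ℝ) = 0 ↔ False := by
  rw [Pi.single_eq_zero_iff]
  exact iff_false_intro (sgnR_ne_zero s)

theorem pair_ne_zero {n : ℕ} {i j : Fin n} (hij : i ≠ j) (s t : ℤˣ) :
    (Pi.single i (sgnR s) + Pi.single j (sgnR t) : Fin n → ℝ) ≠ 0 := by
  intro h
  have := congrFun h i
  rw [Pi.add_apply, Pi.single_eq_same, Pi.single_eq_of_ne hij, add_zero] at this
  exact sgnR_ne_zero s this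

theorem pair_mem {n : ℕ} {i j : Fin n} (hij : i ≠ j) (s t : ℤˣ) :
    (Pi.single i (sgnR s) + Pi.single j (sgnR t) : Fin n → ℝ) ∈ pairVectors n :=
  ⟨i, j, hij, s, t, rfl⟩

theorem axis_mem {n : ℕ} (i : Fin n) (s : ℤˣ) (c : ℝ) :
    (Pi.single i (sgnR s * c) : Fin n → ℝ) ∈ axisVectors c n := ⟨i, s, rfl⟩

theorem axis_one_mem {n : ℕ} (i : Fin n) (s : ℤˣ) :
    (Pi.single i (sgnR s) : Fin n → ℝ) ∈ axisVectors 1 n := ⟨i, s, by rw [mul_one]⟩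

namespace RootPairing

section Classical

set_option linter.unusedSectionVars false

variable {ι V E : Type*} [Finite ι] [AddCommGroup V] [Module ℝ V] [AddCommGroup E] [Module ℝ E]
  {P : RootPairing ι ℝ V E} [P.IsRootSystem] [P.IsCrystallographic] [P.IsReduced] {b : P.Base}
  {l : ℕ} {θ : ι} {e : Fin l ≃ b.support} {N : ℕ} {f : V →ₗ[ℝ] (Fin N → ℝ)}
  {ω : P.weylGroup} {π : Equiv.Perm (Fin (l + 1))}

theorem ne_one_of_node_perm (hθ : IsHighestRoot b θ)
    (hπ : ∀ i, P.weylGroupToPerm ω (node θ e i) = node θ e (π i)) (hπ0 : π 0 ≠ 0) : ω ≠ 1 := by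
  rintro rfl
  have := hπ 0
  rw [map_one, Equiv.Perm.one_apply] at this
  exact hπ0 (node_injective hθ this).symm

/-- The images of the nodes under a signed permutation, in integral form. -/
theorem nodeEntry_eq {τ : Equiv.Perm (Fin N)} {δ : Fin N → ℤˣ}
    (h : ∀ v, IsSignedImage τ δ (f v) (f (ω • v)))
    (hπ : ∀ i, P.weylGroupToPerm ω (node θ e i) = node θ e (π i)) {m : ℕ → ℕ → ℤ}
    (hm : ∀ i a, f (P.root (node θ e i)) a = m i a) (i : Fin (l + 1)) (a : Fin N) :
    m (π i) (τ a) = δ a * m i a := by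
  have := isSignedImage_node h hπ i a
  rw [hm, hm, sgnR] at this
  exact_mod_cast this

theorem orderOf_eq_two_of_signed (hf : Function.Injective f) {τ : Equiv.Perm (Fin N)}
    {δ : Fin N → ℤˣ} (h : ∀ v, IsSignedImage τ δ (f v) (f (ω • v))) (hω : ω ≠ 1)
    (hτ : ∀ a, τ (τ a) = a) (hδ : ∀ a, δ (τ a) * δ a = 1) : orderOf ω = 2 := by
  refine orderOf_eq_prime ?_ hω
  apply weylGroup_ext
  intro v
  apply hf
  ext a
  have h1 := h (ω • v) (τ a)
  rw [h v a, hτ, ← mul_assoc, ← sgnR_mul, hδ, sgnR_one, one_mul] at h1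
  rw [pow_two, mul_smul, h1, one_smul]

theorem exists_signed_perm_BC {c : ℝ} (hc : c ≠ 0) (hf : Function.Injective f)
    (hΦ : f '' Set.range P.root = pairVectors N ∪ axisVectors c N) (w : P.weylGroup) :
    ∃ (τ : Equiv.Perm (Fin N)) (δ : Fin N → ℤˣ), ∀ v, IsSignedImage τ δ (f v) (f (w • v)) := by
  obtain ⟨τ, δ, -, h⟩ := exists_signed_perm hf hΦ (fun _ => True) trivial (by intros; trivial) (by
    rintro _ (⟨i, j, hij, s, t, rfl⟩ | ⟨i, s, rfl⟩)
    · exact ⟨_, _, trivial, isSignedImage_dotReflection_pair hij s t⟩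
    · exact ⟨_, _, trivial, isSignedImage_dotReflection_axis i s hc⟩) (by
    rintro τ δ - v v' h (hv | hv)
    · exact Or.inl (h.mem_pairVectors hv)
    · exact Or.inr (h.mem_axisVectors hv)) w
  exact ⟨τ, δ, h⟩

/-- A reflection in `± e_i ± e_j` multiplies two signs by the same unit, so the product of all signs
stays one. -/
theorem exists_signed_perm_D (hf : Function.Injective f)
    (hΦ : f '' Set.range P.root = pairVectors N) (w : P.weylGroup) :
    ∃ (τ : Equiv.Perm (Fin N)) (δ : Fin N → ℤˣ), ∏ a, δ a = 1 ∧
      ∀ v, IsSignedImage τ δ (f v) (f (w • v)) := by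
  refine exists_signed_perm hf hΦ (fun δ => ∏ a, δ a = 1) (by simp) ?_ ?_ ?_ w
  · intro τ δ δ' h h'
    rw [Finset.prod_mul_distrib, _root_.Equiv.prod_comp τ δ, h, h', one_mul]
  · rintro _ ⟨i, j, hij, s, t, rfl⟩
    refine ⟨_, _, ?_, isSignedImage_dotReflection_pair hij s t⟩
    rw [← Finset.prod_filter]
    have : (Finset.univ.filter fun a => a = i ∨ a = j) = {i, j} := by
      ext a
      simp
    rw [this, Finset.prod_pair hij, Int.units_mul_self]
  · intro τ δ _ v v' h hv
    exact h.mem_pairVectors hv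

end Classical

end RootPairing

/-! ### Type `B`: the action of the stabilizer. -/

/-- The entry at `a` of the node `i` of the extended diagram of type `B`. -/
def nodeB (i a : ℕ) : ℤ :=
  if i = 0 then (if a ≤ 1 then -1 else 0) else (if a + 1 = i then 1 else 0) - (if a = i then 1 else 0)

namespace RootPairing

section TypeB

set_option linter.unusedSectionVars false

variable {ι V E : Type*} [Finite ι] [AddCommGroup V] [Module ℝ V] [AddCommGroup E] [Module ℝ E]
  {P : RootPairing ι ℝ V E} [P.IsRootSystem] [P.IsCrystallographic] [P.IsReduced] {b : P.Base}
  {l : ℕ} {θ : ι} {e : Fin l ≃ b.support} {f : V →ₗ[ℝ] (Fin l → ℝ)}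
  {ω : P.weylGroup} {π : Equiv.Perm (Fin (l + 1))} {S : Fin l → Fin l → ℝ}

/-- The vanishing last summand gives the simple roots the shape that `sum_chain` expects, with
correction zero. -/
theorem simple_typeB (k a : Fin l) :
    (if (k : ℕ) + 1 = l then stdE l l else stdE l (k + 1) - stdE l (k + 2)) a =
      (if (a : ℕ) = k then 1 else 0) - (if (a : ℕ) = k + 1 then 1 else 0) +
        (if (k : ℕ) + 1 = l then 0 else 0) := by
  have := a.2
  have := k.2
  split_ifs <;> simp only [stdE_apply, Pi.sub_apply] <;> grind

theorem map_highestRoot_typeB (hl : 2 ≤ l) (hθ : IsHighestRoot b θ)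
    (hΦ : f '' Set.range P.root = rootsB l) (hS : ∀ k, f (P.root (e k)) = S k)
    (hSv : ∀ k a : Fin l, S k a = (if (a : ℕ) = k then 1 else 0) -
      (if (a : ℕ) = k + 1 then 1 else 0) + (if (k : ℕ) + 1 = l then 0 else 0)) (a : Fin l) :
    f (P.root θ) a = if (a : ℕ) ≤ 1 then 1 else 0 := by
  have h0 : (⟨0, by omega⟩ : Fin l) ≠ ⟨1, by omega⟩ := by simp
  rw [map_highestRoot hθ hΦ hS (t := Pi.single ⟨0, by omega⟩ (sgnR 1) +
    Pi.single ⟨1, by omega⟩ (sgnR 1)) (Or.inl (pair_mem h0 1 1)) ?_ ?_]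
  · simp only [Pi.add_apply, Pi.single_apply, Fin.ext_iff, sgnR_one]
    grind
  · intro k
    rw [pair_dotProduct, hSv, hSv, sgnR_one]
    grind
  · rintro _ (⟨i, j, hij, s, t, rfl⟩ | ⟨i, s, rfl⟩)
    · rw [pair_dotProduct_self hij, pair_dotProduct_self h0]
    · rw [axis_dotProduct_self, pair_dotProduct_self h0]
      norm_num

theorem coef_typeB (hl : 2 ≤ l) (hf : Function.Injective f) (hθ : IsHighestRoot b θ)
    (hΦ : f '' Set.range P.root = rootsB l) (hS : ∀ k, f (P.root (e k)) = S k)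
    (hSv : ∀ k a : Fin l, S k a = (if (a : ℕ) = k then 1 else 0) -
      (if (a : ℕ) = k + 1 then 1 else 0) + (if (k : ℕ) + 1 = l then 0 else 0)) (k : Fin l) :
    coef b θ (e k) = if (k : ℕ) = 0 then 1 else 2 := by
  refine coef_highestRoot_of_model hf hS (c := fun k => if (k : ℕ) = 0 then 1 else 2) ?_ k
  ext a
  rw [map_highestRoot_typeB hl hθ hΦ hS hSv, Finset.sum_apply]
  simp only [Pi.smul_apply, smul_eq_mul, hSv]
  have := sum_chain (l := l) (fun k => (((if k = 0 then 1 else 2 : ℤ)) : ℝ)) 0 a.2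
  rw [this]
  push_cast
  grind

theorem map_node_typeB (hl : 2 ≤ l) (hθ : IsHighestRoot b θ)
    (hΦ : f '' Set.range P.root = rootsB l) (hS : ∀ k, f (P.root (e k)) = S k)
    (hSv : ∀ k a : Fin l, S k a = (if (a : ℕ) = k then 1 else 0) -
      (if (a : ℕ) = k + 1 then 1 else 0) + (if (k : ℕ) + 1 = l then 0 else 0))
    (i : Fin (l + 1)) (a : Fin l) : f (P.root (node θ e i)) a = nodeB i a := by
  have := a.2
  induction i using Fin.cases with
  | zero =>
    rw [root_node_zero, map_neg, Pi.neg_apply, map_highestRoot_typeB hl hθ hΦ hS hSv, nodeB]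
    simp only [Fin.val_zero, if_true]
    split_ifs <;> simp
  | succ k =>
    rw [node_succ, hS, hSv, nodeB, Fin.val_succ]
    push_cast
    grind

/-- The nodes zero and one are `-e_1 - e_2` and `e_1 - e_2`; their exchange forces `e_1 ↦ -e_1` and
`e_2 ↦ e_2`. Each further node `e_i - e_{i+1}` then forces the next vector to be fixed. -/
theorem signs_typeB (hl : 2 ≤ l) {τ : Equiv.Perm (Fin l)} {δ : Fin l → ℤˣ}
    (hn : ∀ i a, nodeB (π i) (τ a) = δ a * nodeB i a) (h0 : (π 0 : ℕ) = 1)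
    (h1 : (π ⟨1, by omega⟩ : ℕ) = 0) (a : Fin l) :
    τ a = a ∧ δ a = if (a : ℕ) = 0 then -1 else 1 := by
  have hd : ∀ a, (δ a : ℤ) = 1 ∨ (δ a : ℤ) = -1 := fun a => by
    rcases Int.units_eq_one_or (δ a) with h | h <;> simp [h]
  have key : ∀ k, ∀ hk : k < l, (τ ⟨k, hk⟩ : ℕ) = k ∧
      (δ ⟨k, hk⟩ : ℤ) = if k = 0 then -1 else 1 := by
    intro k
    induction k with
    | zero =>
      intro hk
      have e0 := hn 0 ⟨0, hk⟩
      have e1 := hn ⟨1, by omega⟩ ⟨0, hk⟩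
      rw [h0] at e0
      rw [h1] at e1
      simp only [nodeB, Fin.val_zero] at e0 e1
      rcases hd ⟨0, hk⟩ with h | h <;> rw [h] at e0 e1 ⊢ <;> grind
    | succ k ih =>
      intro hk
      have hτne : (τ ⟨k + 1, hk⟩ : ℕ) ≠ τ ⟨k, by omega⟩ := by
        intro h
        have := congrArg Fin.val (τ.injective (Fin.ext h))
        simp at this
      obtain ⟨i1, i2⟩ := ih (by omega)
      rcases Nat.eq_zero_or_pos k with rfl | hkpos
      · have e0 := hn 0 ⟨1, hk⟩
        have e1 := hn ⟨1, by omega⟩ ⟨1, hk⟩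
        rw [h0] at e0
        rw [h1] at e1
        simp only [nodeB, Fin.val_zero] at e0 e1
        rcases hd ⟨1, hk⟩ with h | h <;> rw [h] at e0 e1 <;> simp only [h, zero_add] <;> grind
      · have e1 := hn ⟨k + 1, by omega⟩ ⟨k, by omega⟩
        rw [i1, i2] at e1
        have hπk : (π ⟨k + 1, by omega⟩ : ℕ) = k + 1 := by
          simp only [nodeB] at e1
          grind
        have e2 := hn ⟨k + 1, by omega⟩ ⟨k + 1, hk⟩
        rw [hπk] at e2
        simp only [nodeB] at e2
        rcases hd ⟨k + 1, hk⟩ with h | h <;> rw [h] at e2 ⊢ <;> grind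
  obtain ⟨k1, k2⟩ := key a a.2
  refine ⟨Fin.ext k1, ?_⟩
  rw [← Units.val_inj, k2]
  split_ifs <;> rfl

/-- The marks are `1, 1, 2, …, 2`, so `π` exchanges the first two nodes. An invariant `y` has
weighted sum `2 ∑ y_i - 2 y_0`, which is even, and the indicator of the first two nodes has weighted
sum two. The corresponding coweight is the first coordinate. -/
theorem exists_signs_typeB (hl : 2 ≤ l) (hf : Function.Injective f) (hθ : IsHighestRoot b θ)
    (hΦ : f '' Set.range P.root = rootsB l) (hS : ∀ k, f (P.root (e k)) = S k)
    (hSv : ∀ k a : Fin l, S k a = (if (a : ℕ) = k then 1 else 0) -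
      (if (a : ℕ) = k + 1 then 1 else 0) + (if (k : ℕ) + 1 = l then 0 else 0))
    (hπ : ∀ i, P.weylGroupToPerm ω (node θ e i) = node θ e (π i)) (hπ0 : π 0 ≠ 0) :
    (π 0 : ℕ) = 1 ∧ orderOf ω = 2 ∧
      (∀ v a, f (ω • v) a = (if (a : ℕ) = 0 then -1 else 1) * f v a) ∧
      ∀ χ : E, (∀ v, P.toLinearMap v χ = f v ⟨0, by omega⟩) → IsCocycle ω χ 2 := by
  have hmark : ∀ i : Fin (l + 1), mark θ e i = if (i : ℕ) ≤ 1 then 1 else 2 := by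
    intro i
    induction i using Fin.cases with
    | zero => rw [mark_zero]; simp
    | succ k => rw [mark_succ, coef_typeB hl hf hθ hΦ hS hSv, Fin.val_succ]; grind
  have hmp := fun i => mark_perm hθ hπ i
  simp only [hmark] at hmp
  have h0 : (π 0 : ℕ) = 1 := by
    have h := hmp 0
    have h' : (π 0 : ℕ) ≠ 0 := fun h => hπ0 (Fin.ext h)
    simp only [Fin.val_zero] at h
    grind
  have h1 : (π ⟨1, by omega⟩ : ℕ) = 0 := by
    have h := hmp ⟨1, by omega⟩
    have h' : (π ⟨1, by omega⟩ : ℕ) ≠ π 0 := by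
      intro h
      have := congrArg Fin.val (π.injective (Fin.ext h))
      simp at this
    grind
  obtain ⟨τ, δ, hτ⟩ := exists_signed_perm_BC one_ne_zero hf hΦ ω
  have hsig := signs_typeB hl (nodeEntry_eq hτ hπ (map_node_typeB hl hθ hΦ hS hSv)) h0 h1
  refine ⟨h0, ?_, ?_, ?_⟩
  · refine orderOf_eq_two_of_signed hf hτ (ne_one_of_node_perm hθ hπ hπ0) ?_ ?_
    · intro a
      rw [(hsig a).1, (hsig a).1]
    · intro a
      rw [(hsig a).1, Int.units_mul_self]
  · intro v a
    have := hτ v a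
    rw [(hsig a).1, (hsig a).2] at this
    rw [this]
    split_ifs <;> simp [sgnR]
  · intro χ hχ
    have hsum : ∀ y : Fin (l + 1) → ℤ, ∑ i, mark θ e i * y i =
        2 * ∑ i, y i - (y 0 + y ⟨1, by omega⟩) := by
      intro y
      have : ∀ i, mark θ e i * y i = 2 * y i -
          ((if i = 0 then y i else 0) + (if i = ⟨1, by omega⟩ then y i else 0)) := by
        intro i
        rw [hmark]
        simp only [Fin.ext_iff, Fin.val_zero]
        grind
      rw [Finset.sum_congr rfl fun i _ => this i]
      simp [Finset.sum_sub_distrib, Finset.sum_add_distrib, Finset.mul_sum]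
    refine isCocycle_of_nodes hπ two_pos (fun i => if (i : ℕ) ≤ 1 then 1 else 0) ?_ ?_ ?_ ?_
    · intro i
      have := hmp i
      grind
    · have : ∀ i : Fin (l + 1), mark θ e i * (if (i : ℕ) ≤ 1 then 1 else 0) =
          (if i = 0 then 1 else 0) + (if i = ⟨1, by omega⟩ then 1 else 0) := by
        intro i
        rw [hmark]
        simp only [Fin.ext_iff, Fin.val_zero]
        grind
      rw [Finset.sum_congr rfl fun i _ => this i]
      simp [Finset.sum_add_distrib]
    · intro y hy
      rw [hsum]
      have := hy 0
      rw [show π 0 = ⟨1, by omega⟩ from Fin.ext h0] at this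
      rw [this]
      exact ⟨∑ i, y i - y 0, by push_cast; ring⟩
    · intro k
      rw [hχ, hS, hSv, Fin.val_succ]
      push_cast
      clear * -
      grind

end TypeB

end RootPairing

/-! ### Fibre patterns, and the root lengths in `B`, `C` and `BC`. -/

namespace RootPairing

section General

variable {ι V E : Type*} [AddCommGroup V] [Module ℝ V] [AddCommGroup E] [Module ℝ E]
  {P : RootPairing ι ℝ V E}

/-- The formula, if the fibres over short folded roots take all residues and those over long ones
only the residue zero. -/
theorem foldingFormula_rescale {ω : P.weylGroup} {N n : ℕ} {f : V →ₗ[ℝ] (Fin N → ℝ)}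
    {Φ : Set (Fin N → ℝ)} (hΦ : f '' Set.range P.root = Φ)
    (H : (Fin N → ℝ) →ₗ[ℝ] (Fin n → ℝ)) (X : (Fin N → ℝ) →ₗ[ℝ] ℝ) {o d : ℕ} {a c : ℝ}
    {R : Set (Fin n → ℝ)} (hda : (d : ℝ) * a = 1) (hdc : (d : ℝ) * c = o)
    (horder : orderOf ω = o) (ho : 0 < o)
    (hχ : ∀ χ : E, (∀ v, P.toLinearMap v χ = X (f v)) → IsCocycle ω χ o)
    (hdual : ∀ φ : V →ₗ[ℝ] ℝ, ∃ x : E, ∀ v, P.toLinearMap v x = φ v)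
    (hinv : ∀ v, H (f (ω • v)) = H (f v)) (hfaith : ∀ v, ω • v = v → H (f v) = 0 → v = 0)
    (hR0 : (0 : Fin n → ℝ) ∉ R)
    (hzero : ∀ β ∈ Φ, H β = 0 → ¬ ∃ k : ℤ, X β = o * k)
    (hzero' : ∀ r : ℤ, 0 < r → r < o → ∃ β ∈ Φ, H β = 0 ∧ ∃ k : ℤ, X β = r + o * k)
    (hmap : ∀ β ∈ Φ, H β ≠ 0 → H β ∈ R ∧ (∃ k : ℤ, X β = k) ∧
      (¬ IsShort R (H β) → ∃ k : ℤ, X β = o * k))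
    (hlift : ∀ γ ∈ R, ∃ β ∈ Φ, H β = γ)
    (hshort : ∀ γ ∈ R, IsShort R γ → ∀ t : ℤ, ∃ β ∈ Φ, H β = γ ∧ ∃ k : ℤ, X β = t + o * k) :
    FoldingFormula P ω R (rescale R a c) d := by
  refine foldingFormula_of_model hΦ H X (determines_rescale R a c) horder ho hχ hdual hinv hfaith
    ?_ hzero hzero' ?_ ?_
  · intro r
    constructor
    · intro hr
      exact ⟨hlift r hr, fun h => hR0 (h ▸ hr)⟩
    · rintro ⟨⟨β, hβ, rfl⟩, h0⟩
      exact (hmap β hβ h0).1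
  · rintro _ ⟨x, hx, ⟨hs, rfl⟩ | ⟨hs, rfl⟩⟩
    -- Long roots have only the class zero, which is the case `s = 1`; short roots have all classes,
    -- the case `s = o`. The factors `a` and `c` absorb the common dilation `d`.
    · obtain ⟨β, hβ, rfl⟩ := hlift x hx
      obtain ⟨k, hk⟩ := (hmap β hβ fun h => hR0 (h ▸ hx)).2.2 hs
      refine ⟨β, hβ, 1, one_dvd _, by rw [smul_smul, hda, Nat.cast_one], fun t => ?_⟩
      refine ⟨β, hβ, rfl, k - t, ?_⟩
      rw [hk, Nat.div_one]
      push_cast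
      ring
    · obtain ⟨β, hβ, rfl⟩ := hlift x hx
      refine ⟨β, hβ, o, dvd_rfl, by rw [smul_smul, hdc], fun t => ?_⟩
      obtain ⟨β', hβ', h1, k, hk⟩ := hshort _ hx hs t
      refine ⟨β', hβ', h1, k, ?_⟩
      rw [hk, Nat.div_self ho, Nat.cast_one, one_mul]
  · intro β hβ h0
    obtain ⟨h1, ⟨k, hk⟩, h2⟩ := hmap β hβ h0
    by_cases hs : IsShort R (H β)
    · refine ⟨c • H β, ⟨H β, h1, Or.inr ⟨hs, rfl⟩⟩, o, ?_, k, ?_⟩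
      · rw [smul_smul, hdc, Int.cast_natCast]
      · rw [hk, Int.cast_natCast]
    · refine ⟨a • H β, ⟨H β, h1, Or.inl ⟨hs, rfl⟩⟩, 1, ?_, ?_⟩
      · rw [smul_smul, hda, Int.cast_one]
      · rw [Int.cast_one, one_mul]
        exact h2 hs

/-- The formula, if the fibres over all folded roots take all residues. -/
theorem foldingFormula_uniform {ω : P.weylGroup} {N n : ℕ} {f : V →ₗ[ℝ] (Fin N → ℝ)}
    {Φ : Set (Fin N → ℝ)} (hΦ : f '' Set.range P.root = Φ)
    (H : (Fin N → ℝ) →ₗ[ℝ] (Fin n → ℝ)) (X : (Fin N → ℝ) →ₗ[ℝ] ℝ) {o : ℕ}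
    {R : Set (Fin n → ℝ)} (horder : orderOf ω = o) (ho : 0 < o)
    (hχ : ∀ χ : E, (∀ v, P.toLinearMap v χ = X (f v)) → IsCocycle ω χ o)
    (hdual : ∀ φ : V →ₗ[ℝ] ℝ, ∃ x : E, ∀ v, P.toLinearMap v x = φ v)
    (hinv : ∀ v, H (f (ω • v)) = H (f v)) (hfaith : ∀ v, ω • v = v → H (f v) = 0 → v = 0)
    (hR0 : (0 : Fin n → ℝ) ∉ R)
    (hzero : ∀ β ∈ Φ, H β = 0 → ¬ ∃ k : ℤ, X β = o * k)
    (hzero' : ∀ r : ℤ, 0 < r → r < o → ∃ β ∈ Φ, H β = 0 ∧ ∃ k : ℤ, X β = r + o * k)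
    (hmap : ∀ β ∈ Φ, H β ≠ 0 → H β ∈ R ∧ ∃ k : ℤ, X β = k)
    (hlift : ∀ γ ∈ R, ∀ t : ℤ, ∃ β ∈ Φ, H β = γ ∧ ∃ k : ℤ, X β = t + o * k) :
    FoldingFormula P ω R R o := by
  refine foldingFormula_of_model hΦ H X (Determines.refl R) horder ho hχ hdual hinv hfaith
    ?_ hzero hzero' ?_ ?_
  · intro r
    constructor
    · intro hr
      obtain ⟨β, hβ, h, -⟩ := hlift r hr 0
      exact ⟨⟨β, hβ, h⟩, fun h => hR0 (h ▸ hr)⟩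
    · rintro ⟨⟨β, hβ, rfl⟩, h0⟩
      exact (hmap β hβ h0).1
  · intro γ hγ
    obtain ⟨β₀, hβ₀, rfl, -⟩ := hlift γ hγ 0
    refine ⟨β₀, hβ₀, o, dvd_rfl, rfl, fun t => ?_⟩
    obtain ⟨β', hβ', h1, k, hk⟩ := hlift _ hγ t
    refine ⟨β', hβ', h1, k, ?_⟩
    rw [hk, Nat.div_self ho, Nat.cast_one, one_mul]
  · intro β hβ h0
    obtain ⟨h1, k, hk⟩ := hmap β hβ h0
    exact ⟨H β, h1, o, by rw [Int.cast_natCast], k, by rw [hk, Int.cast_natCast]⟩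

end General

theorem zero_notMem_pairVectors (n : ℕ) : (0 : Fin n → ℝ) ∉ pairVectors n := by
  rintro ⟨i, j, hij, s, t, h⟩
  exact pair_ne_zero hij s t h.symm

theorem zero_notMem_axisVectors {c : ℝ} (hc : c ≠ 0) (n : ℕ) : (0 : Fin n → ℝ) ∉ axisVectors c n := by
  rintro ⟨i, s, h⟩
  have := congrFun h i
  rw [Pi.single_eq_same, Pi.zero_apply] at this
  exact mul_ne_zero (sgnR_ne_zero s) hc this.symm

theorem zero_notMem_rootsB (n : ℕ) : (0 : Fin n → ℝ) ∉ rootsB n := by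
  rintro (h | h)
  exacts [zero_notMem_pairVectors n h, zero_notMem_axisVectors one_ne_zero n h]

theorem zero_notMem_rootsC (n : ℕ) : (0 : Fin n → ℝ) ∉ rootsC n := by
  rintro (h | h)
  exacts [zero_notMem_pairVectors n h, zero_notMem_axisVectors two_ne_zero n h]

theorem zero_notMem_rootsBC (n : ℕ) : (0 : Fin n → ℝ) ∉ rootsBC n := by
  rintro ((h | h) | h)
  exacts [zero_notMem_pairVectors n h, zero_notMem_axisVectors one_ne_zero n h,
    zero_notMem_axisVectors two_ne_zero n h]

/-- The squared lengths of `x + y` and `x - y` add up to twice those of `x` and `y`; if neither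
exceeds that of `x`, then `y = 0`. -/
theorem not_isShort_of_maximal {n : ℕ} {R : Set (Fin n → ℝ)} (h0 : (0 : Fin n → ℝ) ∉ R)
    {x : Fin n → ℝ} (hmax : ∀ y ∈ R, y ⬝ᵥ y ≤ x ⬝ᵥ x) : ¬ IsShort R x := by
  rintro ⟨y, hy, h1, h2⟩
  have e1 := hmax _ h1
  have e2 := hmax _ h2
  simp only [add_dotProduct, dotProduct_add, sub_dotProduct, dotProduct_sub] at e1 e2
  have e3 : y ⬝ᵥ y ≤ 0 := by linarith
  apply h0
  have e4 : y = 0 := by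
    rw [← dotProduct_self_eq_zero]
    refine le_antisymm e3 ?_
    simp only [dotProduct]
    exact Finset.sum_nonneg fun i _ => mul_self_nonneg _
  rwa [← e4]

theorem exists_ne_of_two_le {n : ℕ} (hn : 2 ≤ n) (i : Fin n) : ∃ j, j ≠ i := by
  have : Nontrivial (Fin n) := Fin.nontrivial_iff_two_le.2 hn
  exact exists_ne i

theorem isShort_rootsB_axis {n : ℕ} (hn : 2 ≤ n) {x : Fin n → ℝ} (hx : x ∈ axisVectors 1 n) :
    IsShort (rootsB n) x := by
  obtain ⟨i, s, rfl⟩ := hx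
  obtain ⟨j, hj⟩ := exists_ne_of_two_le hn i
  refine ⟨Pi.single j (sgnR 1), Or.inr (axis_one_mem j 1), Or.inl ?_, Or.inl ?_⟩
  · rw [mul_one]
    exact pair_mem hj.symm s 1
  · rw [mul_one, sub_eq_add_neg, ← Pi.single_neg, ← sgnR_neg]
    exact pair_mem hj.symm s (-1)

theorem not_isShort_rootsB_pair {n : ℕ} {x : Fin n → ℝ} (hx : x ∈ pairVectors n) :
    ¬ IsShort (rootsB n) x := by
  obtain ⟨i, j, hij, s, t, rfl⟩ := hx
  refine not_isShort_of_maximal (zero_notMem_rootsB n) ?_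
  rw [pair_dotProduct_self hij]
  rintro _ (⟨i, j, hij, s, t, rfl⟩ | ⟨i, s, rfl⟩)
  · rw [pair_dotProduct_self hij]
  · rw [axis_dotProduct_self]
    norm_num

theorem isShort_rootsC_pair {n : ℕ} {x : Fin n → ℝ} (hx : x ∈ pairVectors n) :
    IsShort (rootsC n) x := by
  obtain ⟨i, j, hij, s, t, rfl⟩ := hx
  refine ⟨Pi.single i (sgnR s) + Pi.single j (sgnR (-t)), Or.inl (pair_mem hij s _), Or.inr ?_,
    Or.inr ?_⟩
  · convert axis_mem i s 2 using 1
    rw [add_add_add_comm, ← Pi.single_add, ← Pi.single_add, sgnR_neg, add_neg_cancel,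
      Pi.single_zero, add_zero, mul_two]
  · convert axis_mem j t 2 using 1
    rw [add_sub_add_comm, ← Pi.single_sub, ← Pi.single_sub, sgnR_neg, sub_self,
      Pi.single_zero, zero_add, mul_two, sub_neg_eq_add]

theorem not_isShort_rootsC_axis {n : ℕ} {x : Fin n → ℝ} (hx : x ∈ axisVectors 2 n) :
    ¬ IsShort (rootsC n) x := by
  obtain ⟨i, s, rfl⟩ := hx
  refine not_isShort_of_maximal (zero_notMem_rootsC n) ?_
  rw [axis_dotProduct_self]
  rintro _ (⟨i, j, hij, s, t, rfl⟩ | ⟨i, s, rfl⟩)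
  · rw [pair_dotProduct_self hij]
    norm_num
  · rw [axis_dotProduct_self]

theorem smul_axis {n : ℕ} (c d : ℝ) (i : Fin n) (s : ℤˣ) :
    d • (Pi.single i (sgnR s * c) : Fin n → ℝ) = Pi.single i (sgnR s * (d * c)) := by
  rw [← Pi.single_smul, smul_eq_mul]
  congr 1
  ring

/-- Two coordinates are needed: in `B_1` no root passes the test `IsShort`, which is why `B_2`,
folding onto one coordinate, is treated separately. -/
theorem rescale_rootsB {n : ℕ} (hn : 2 ≤ n) : rescale (rootsB n) 1 2 = rootsC n := by
  ext v
  constructor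
  · rintro ⟨x, hx | hx, ⟨hs, rfl⟩ | ⟨hs, rfl⟩⟩
    · rw [one_smul]
      exact Or.inl hx
    · exact absurd hs (not_isShort_rootsB_pair hx)
    · exact absurd (isShort_rootsB_axis hn hx) hs
    · obtain ⟨i, s, rfl⟩ := hx
      rw [smul_axis, mul_one]
      exact Or.inr (axis_mem i s 2)
  · rintro (hv | ⟨i, s, rfl⟩)
    · exact ⟨v, Or.inl hv, Or.inl ⟨not_isShort_rootsB_pair hv, (one_smul _ _).symm⟩⟩
    · refine ⟨_, Or.inr (axis_mem i s 1), Or.inr ⟨isShort_rootsB_axis hn (axis_mem i s 1), ?_⟩⟩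
      rw [smul_axis, mul_one]

theorem rescale_rootsC (n : ℕ) : rescale (rootsC n) (1 / 2) 1 = rootsB n := by
  ext v
  constructor
  · rintro ⟨x, hx | hx, ⟨hs, rfl⟩ | ⟨hs, rfl⟩⟩
    · exact absurd (isShort_rootsC_pair hx) hs
    · rw [one_smul]
      exact Or.inl hx
    · obtain ⟨i, s, rfl⟩ := hx
      rw [smul_axis]
      norm_num
      exact Or.inr (axis_one_mem i s)
    · exact absurd hs (not_isShort_rootsC_axis hx)
  · rintro (hv | ⟨i, s, rfl⟩)
    · exact ⟨v, Or.inl hv, Or.inr ⟨isShort_rootsC_pair hv, (one_smul _ _).symm⟩⟩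
    · refine ⟨_, Or.inr (axis_mem i s 2), Or.inl ⟨not_isShort_rootsC_axis (axis_mem i s 2), ?_⟩⟩
      rw [smul_axis]
      norm_num

/-- The squared lengths are 1, 2 and 4, and doubling multiplies them by four, so only the vectors `±
e_k` have their double in the system. -/
theorem dropHalf_rootsBC (n : ℕ) : dropHalf (rootsBC n) = rootsC n := by
  have hp : ∀ v ∈ pairVectors n, ∀ w ∈ rootsBC n,
      w ⬝ᵥ w = v ⬝ᵥ v * 4 → False := by
    rintro _ ⟨i, j, hij, s, t, rfl⟩ _ ((⟨i', j', hij', s', t', rfl⟩ | ⟨i', s', rfl⟩) |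
      ⟨i', s', rfl⟩) h
    · rw [pair_dotProduct_self hij, pair_dotProduct_self hij'] at h
      norm_num at h
    · rw [pair_dotProduct_self hij, axis_dotProduct_self] at h
      norm_num at h
    · rw [pair_dotProduct_self hij, axis_dotProduct_self] at h
      norm_num at h
  have ha : ∀ v ∈ axisVectors 2 n, ∀ w ∈ rootsBC n, w ⬝ᵥ w = v ⬝ᵥ v * 4 → False := by
    rintro _ ⟨i, s, rfl⟩ _ ((⟨i', j', hij', s', t', rfl⟩ | ⟨i', s', rfl⟩) | ⟨i', s', rfl⟩) h
    · rw [pair_dotProduct_self hij', axis_dotProduct_self] at h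
      norm_num at h
    · rw [axis_dotProduct_self, axis_dotProduct_self] at h
      norm_num at h
    · rw [axis_dotProduct_self, axis_dotProduct_self] at h
      norm_num at h
  have hd : ∀ v : Fin n → ℝ, ((2 : ℝ) • v) ⬝ᵥ ((2 : ℝ) • v) = v ⬝ᵥ v * 4 := by
    intro v
    rw [smul_dotProduct, dotProduct_smul, smul_eq_mul, smul_eq_mul]
    ring
  ext v
  constructor
  · rintro ⟨(hv | ⟨i, s, rfl⟩) | hv, h2⟩
    · exact Or.inl hv
    · exfalso
      apply h2
      rw [smul_axis, mul_one]
      exact Or.inr (axis_mem i s 2)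
    · exact Or.inr hv
  · rintro (hv | hv)
    · exact ⟨Or.inl (Or.inl hv), fun h => hp v hv _ h (hd v)⟩
    · exact ⟨Or.inr hv, fun h => ha v hv _ h (hd v)⟩

end RootPairing

/-! ### Folding by forgetting coordinates, and `B_ℓ` for `ℓ ≥ 3`. -/

theorem funLeft_single {N n : ℕ} {p : Fin n → Fin N} (hp : Function.Injective p) (i : Fin n)
    (c : ℝ) : LinearMap.funLeft ℝ ℝ p (Pi.single (p i) c) = Pi.single i c := by
  ext j
  rw [LinearMap.funLeft_apply, Pi.single_apply, Pi.single_apply]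
  exact if_congr hp.eq_iff rfl rfl

theorem funLeft_single_of_notMem {N n : ℕ} {p : Fin n → Fin N} {a : Fin N} (ha : ∀ i, p i ≠ a)
    (c : ℝ) : LinearMap.funLeft ℝ ℝ p (Pi.single a c) = 0 := by
  ext j
  rw [LinearMap.funLeft_apply, Pi.single_eq_of_ne (ha j), Pi.zero_apply]

theorem exists_int_single (n : ℕ) (a z : Fin n) (s : ℤˣ) :
    ∃ k : ℤ, (Pi.single a (sgnR s) : Fin n → ℝ) z = k := by
  rw [Pi.single_apply]
  split_ifs
  · exact ⟨s, rfl⟩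
  · exact ⟨0, by simp⟩

namespace RootPairing

section Drop

variable {ι V E : Type*} [AddCommGroup V] [Module ℝ V] [AddCommGroup E] [Module ℝ E]
  {P : RootPairing ι ℝ V E}

/-- The formula, if the folding forgets some coordinates. -/
theorem foldingFormula_drop {ω : P.weylGroup} {N n : ℕ} {f : V →ₗ[ℝ] (Fin N → ℝ)}
    {Φ : Set (Fin N → ℝ)} (hΦ : f '' Set.range P.root = Φ) (hn : 2 ≤ n)
    {p : Fin n → Fin N} (hp : Function.Injective p) {z : Fin N} (hz : ∀ i, p i ≠ z)
    (horder : orderOf ω = 2)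
    (hχ : ∀ χ : E, (∀ v, P.toLinearMap v χ = f v z) → IsCocycle ω χ 2)
    (hdual : ∀ φ : V →ₗ[ℝ] ℝ, ∃ x : E, ∀ v, P.toLinearMap v x = φ v)
    (hinv : ∀ v i, f (ω • v) (p i) = f v (p i))
    (hfaith : ∀ v, ω • v = v → (∀ i, f v (p i) = 0) → v = 0)
    (hpair : pairVectors N ⊆ Φ) (hroots : ∀ β ∈ Φ, β ∈ pairVectors N ∨ β ∈ axisVectors 1 N)
    (hzero : ∀ β ∈ Φ, LinearMap.funLeft ℝ ℝ p β = 0 → β z = 1 ∨ β z = -1)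
    (hzero' : ∃ β ∈ Φ, LinearMap.funLeft ℝ ℝ p β = 0 ∧ β z = 1)
    (haxis : ∀ i s, ∃ β ∈ Φ, LinearMap.funLeft ℝ ℝ p β = Pi.single i (sgnR s) ∧ β z = 0) :
    FoldingFormula P ω (rootsB n) (rootsC n) 1 := by
  rw [← rescale_rootsB hn]
  have hodd : ∀ k : ℤ, (1 : ℝ) ≠ (2 : ℕ) * k ∧ (-1 : ℝ) ≠ (2 : ℕ) * k := by
    intro k
    constructor
    · intro h
      have : (1 : ℤ) = 2 * k := by exact_mod_cast h
      omega
    · intro h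
      have : (-1 : ℤ) = 2 * k := by exact_mod_cast h
      omega
  have hpz : ∀ (i : Fin n) (c : ℝ), (Pi.single (p i) c : Fin N → ℝ) z = 0 := fun i c => by
    rw [Pi.single_eq_of_ne (hz i).symm]
  have hclass : ∀ a, (∃ i, a = p i) ∨ ∀ i, p i ≠ a := by
    intro a
    by_cases h : ∃ i, a = p i
    · exact Or.inl h
    · exact Or.inr fun i hi => h ⟨i, hi.symm⟩
  refine foldingFormula_rescale hΦ (LinearMap.funLeft ℝ ℝ p) (LinearMap.proj z) (by norm_num)
    (by norm_num) horder two_pos hχ hdual ?_ ?_ (zero_notMem_rootsB n) ?_ ?_ ?_ ?_ ?_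
  · intro v
    ext i
    exact hinv v i
  · intro v hv h0
    exact hfaith v hv fun i => congrFun h0 i
  · rintro β hβ h0 ⟨k, hk⟩
    rw [LinearMap.proj_apply] at hk
    rcases hzero β hβ h0 with h | h <;> rw [h] at hk
    exacts [(hodd k).1 hk, (hodd k).2 hk]
  · intro r hr1 hr2
    obtain ⟨β, hβ, h0, h1⟩ := hzero'
    refine ⟨β, hβ, h0, 0, ?_⟩
    have : r = 1 := by push_cast at hr2; omega
    rw [LinearMap.proj_apply, h1, this]
    simp
  · intro β hβ h0
    rcases hroots β hβ with ⟨a, a', haa, s, t, rfl⟩ | ⟨a, s, rfl⟩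
    · have hint : ∃ k : ℤ, (LinearMap.proj z : (Fin N → ℝ) →ₗ[ℝ] ℝ)
          (Pi.single a (sgnR s) + Pi.single a' (sgnR t)) = k := by
        obtain ⟨k, hk⟩ := exists_int_single N a z s
        obtain ⟨k', hk'⟩ := exists_int_single N a' z t
        exact ⟨k + k', by rw [LinearMap.proj_apply, Pi.add_apply, hk, hk', Int.cast_add]⟩
      rw [map_add] at h0 ⊢
      rcases hclass a with ⟨i, rfl⟩ | ha <;> rcases hclass a' with ⟨j, rfl⟩ | ha'
      · rw [funLeft_single hp, funLeft_single hp]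
        have hij : i ≠ j := fun h => haa (by rw [h])
        refine ⟨Or.inl (pair_mem hij s t), hint, fun _ => ⟨0, ?_⟩⟩
        rw [LinearMap.proj_apply, Pi.add_apply, hpz, hpz]
        simp
      · rw [funLeft_single hp, funLeft_single_of_notMem ha', add_zero]
        exact ⟨Or.inr (axis_one_mem i s), hint,
          fun h => absurd (isShort_rootsB_axis hn (axis_one_mem i s)) h⟩
      · rw [funLeft_single hp, funLeft_single_of_notMem ha, zero_add]
        exact ⟨Or.inr (axis_one_mem j t), hint,
          fun h => absurd (isShort_rootsB_axis hn (axis_one_mem j t)) h⟩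
      · rw [funLeft_single_of_notMem ha, funLeft_single_of_notMem ha', add_zero] at h0
        exact absurd rfl h0
    · rw [mul_one] at h0 ⊢
      rcases hclass a with ⟨i, rfl⟩ | ha
      · rw [funLeft_single hp]
        exact ⟨Or.inr (axis_one_mem i s), exists_int_single N _ z s,
          fun h => absurd (isShort_rootsB_axis hn (axis_one_mem i s)) h⟩
      · rw [funLeft_single_of_notMem ha] at h0
        exact absurd rfl h0
  · rintro _ (⟨i, j, hij, s, t, rfl⟩ | ⟨i, s, rfl⟩)
    · refine ⟨_, hpair (pair_mem (fun h => hij (hp h)) s t), ?_⟩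
      rw [map_add, funLeft_single hp, funLeft_single hp]
    · obtain ⟨β, hβ, h, -⟩ := haxis i s
      exact ⟨β, hβ, by rw [h, mul_one]⟩
  · rintro _ (hγ | ⟨i, s, rfl⟩) hs t
    · exact absurd hs (not_isShort_rootsB_pair hγ)
    -- The root `± e_i` has a lift with entry zero at `z` and another, obtained by adding `e_z`,
    -- with entry one; these cover both classes modulo two.
    · rcases Int.even_or_odd t with ⟨k, hk⟩ | ⟨k, hk⟩
      · obtain ⟨β, hβ, h, h0⟩ := haxis i s
        refine ⟨β, hβ, by rw [h, mul_one], -k, ?_⟩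
        rw [LinearMap.proj_apply, h0, hk]
        push_cast
        ring
      · refine ⟨_, hpair (pair_mem (hz i) s 1), ?_, -k, ?_⟩
        · rw [map_add, funLeft_single hp, funLeft_single_of_notMem hz, add_zero, mul_one]
        · rw [LinearMap.proj_apply, Pi.add_apply, hpz, Pi.single_eq_same, sgnR_one, hk]
          push_cast
          ring

end Drop

section TypeB

set_option linter.unusedSectionVars false

variable {ι V E : Type*} [Finite ι] [AddCommGroup V] [Module ℝ V] [AddCommGroup E] [Module ℝ E]
  {P : RootPairing ι ℝ V E} [P.IsRootSystem] [P.IsCrystallographic] [P.IsReduced] {b : P.Base}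
  {l : ℕ} {θ : ι} {e : Fin l ≃ b.support} {f : V →ₗ[ℝ] (Fin l → ℝ)}
  {ω : P.weylGroup} {π : Equiv.Perm (Fin (l + 1))}

/-- The first and the remaining coordinates of vectors of type `B_l`. -/
theorem eq_zero_or_exists_succ {l : ℕ} (hl : 2 ≤ l) (a : Fin l) :
    a = ⟨0, by omega⟩ ∨ ∃ i : Fin (l - 1), a = ⟨i + 1, by omega⟩ := by
  by_cases h : (a : ℕ) = 0
  · exact Or.inl (Fin.ext h)
  · exact Or.inr ⟨⟨a - 1, by omega⟩, Fin.ext (by simp; omega)⟩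

/-- Here `ω` negates the first coordinate, which the fold forgets. The roots with zero fold are `±
e_1`, of odd class. A vector `± e_i` has lifts of both classes, while `± e_i ± e_j` lifts only to
itself, of class zero. -/
theorem foldingFormula_typeB (hl : 3 ≤ l) (hf : Function.Injective f)
    (hΦ : f '' Set.range P.root = rootsB l) (horder : orderOf ω = 2)
    (hact : ∀ v a, f (ω • v) a = (if (a : ℕ) = 0 then -1 else 1) * f v a)
    (hχ : ∀ χ : E, (∀ v, P.toLinearMap v χ = f v ⟨0, by omega⟩) → IsCocycle ω χ 2) :
    FoldingFormula P ω (rootsB (l - 1)) (rootsC (l - 1)) 1 := by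
  have hz : ∀ i : Fin (l - 1), (⟨i + 1, by omega⟩ : Fin l) ≠ ⟨0, by omega⟩ := by
    intro i h
    simp at h
  have hp : Function.Injective fun i : Fin (l - 1) => (⟨i + 1, by omega⟩ : Fin l) := by
    intro i j h
    apply Fin.ext
    simpa using h
  have hfaith : ∀ v : V, ω • v = v → (∀ i : Fin (l - 1), f v ⟨i + 1, by omega⟩ = 0) → v = 0 := by
    intro v hv h0
    apply hf
    rw [map_zero]
    ext a
    rcases eq_zero_or_exists_succ (by omega) a with rfl | ⟨i, rfl⟩
    · have := hact v ⟨0, by omega⟩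
      rw [hv, if_pos rfl] at this
      rw [Pi.zero_apply]
      linarith
    · exact h0 i
  refine foldingFormula_drop hΦ (by omega) hp hz horder hχ exists_dual_point ?_ hfaith
    (fun _ h => Or.inl h) (fun _ h => h) ?_ ?_ ?_
  · intro v i
    rw [hact, if_neg (by simp), one_mul]
  · intro β hβ h0
    rcases hβ with ⟨a, a', haa, s, t, rfl⟩ | ⟨a, s, rfl⟩
    · exfalso
      rw [map_add] at h0
      rcases eq_zero_or_exists_succ (by omega) a with rfl | ⟨i, rfl⟩ <;>
        rcases eq_zero_or_exists_succ (by omega) a' with rfl | ⟨j, rfl⟩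
      · exact haa rfl
      · rw [funLeft_single_of_notMem hz, funLeft_single hp, zero_add,
          single_sgnR_eq_zero_iff] at h0
        exact h0
      · rw [funLeft_single_of_notMem hz, funLeft_single hp, add_zero,
          single_sgnR_eq_zero_iff] at h0
        exact h0
      · rw [funLeft_single hp, funLeft_single hp] at h0
        exact pair_ne_zero (fun h => haa (by rw [h])) s t h0
    · rw [mul_one] at h0 ⊢
      rcases eq_zero_or_exists_succ (by omega) a with rfl | ⟨i, rfl⟩
      · rw [Pi.single_eq_same]
        exact sgnR_eq s
      · rw [funLeft_single hp, single_sgnR_eq_zero_iff] at h0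
        exact h0.elim
  · refine ⟨_, Or.inr (axis_one_mem ⟨0, by omega⟩ 1), funLeft_single_of_notMem hz _, ?_⟩
    rw [Pi.single_eq_same, sgnR_one]
  · intro i s
    refine ⟨_, Or.inr (axis_one_mem ⟨i + 1, by omega⟩ s), funLeft_single hp i _, ?_⟩
    exact Pi.single_eq_of_ne (hz i).symm _

end TypeB

end RootPairing

/-! ### The case `B_2`. -/

theorem mem_rootsA_one {γ : Fin (1 + 1) → ℝ} :
    γ ∈ rootsA 1 ↔ ∃ s : ℤˣ, γ = ![sgnR s, -sgnR s] := by
  constructor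
  · rintro ⟨i, j, hij, rfl⟩
    fin_cases i <;> fin_cases j
    · exact absurd rfl hij
    · exact ⟨1, by ext a; fin_cases a <;> simp [sgnR]⟩
    · exact ⟨-1, by ext a; fin_cases a <;> simp [sgnR]⟩
    · exact absurd rfl hij
  · rintro ⟨s, rfl⟩
    rcases Int.units_eq_one_or s with rfl | rfl
    · exact ⟨0, 1, by simp, by ext a; fin_cases a <;> simp [sgnR]⟩
    · exact ⟨1, 0, by simp, by ext a; fin_cases a <;> simp [sgnR]⟩

/-- The roots of `B_2`, by their entries. -/
theorem mem_rootsB_two {β : Fin 2 → ℝ} (hβ : β ∈ rootsB 2) :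
    (∃ s : ℤˣ, β 0 = sgnR s ∧ β 1 = 0) ∨ ∃ s : ℤˣ, β 1 = sgnR s ∧ ∃ k : ℤ, β 0 = k := by
  rcases hβ with ⟨i, j, hij, s, t, rfl⟩ | ⟨i, s, rfl⟩
  · fin_cases i <;> fin_cases j
    · exact absurd rfl hij
    · exact Or.inr ⟨t, by simp, s, by simp [sgnR]⟩
    · exact Or.inr ⟨s, by simp, t, by simp [sgnR]⟩
    · exact absurd rfl hij
  · fin_cases i
    · exact Or.inl ⟨s, by simp, by simp⟩
    · exact Or.inr ⟨s, by simp, 0, by simp⟩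

namespace RootPairing

section TypeB

set_option linter.unusedSectionVars false

variable {ι V E : Type*} [Finite ι] [AddCommGroup V] [Module ℝ V] [AddCommGroup E] [Module ℝ E]
  {P : RootPairing ι ℝ V E} [P.IsRootSystem] [P.IsCrystallographic] [P.IsReduced] {b : P.Base}
  {l : ℕ} {θ : ι} {e : Fin l ≃ b.support}
  {ω : P.weylGroup} {π : Equiv.Perm (Fin (l + 1))}

/-- The folded roots `± e_2` are moved into the model of `A_1` by `v ↦ (v_2, -v_2)`. Over each of
them lie `± e_2` and its sums with `± e_1`, so both classes occur and the factor is two. -/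
theorem foldingFormula_typeB_two {f : V →ₗ[ℝ] (Fin 2 → ℝ)} (hf : Function.Injective f)
    (hΦ : f '' Set.range P.root = rootsB 2) (horder : orderOf ω = 2)
    (hact : ∀ v a, f (ω • v) a = (if (a : ℕ) = 0 then -1 else 1) * f v a)
    (hχ : ∀ χ : E, (∀ v, P.toLinearMap v χ = f v 0) → IsCocycle ω χ 2) :
    FoldingFormula P ω (rootsA 1) (rootsA 1) 2 := by
  have hH : ∀ v : Fin 2 → ℝ, (LinearMap.pi ![LinearMap.proj 1, -LinearMap.proj 1] :
      (Fin 2 → ℝ) →ₗ[ℝ] (Fin 2 → ℝ)) v = ![v 1, -v 1] := by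
    intro v
    ext i
    fin_cases i <;> simp
  refine foldingFormula_uniform hΦ (LinearMap.pi ![LinearMap.proj 1, -LinearMap.proj 1])
    (LinearMap.proj 0) horder two_pos hχ exists_dual_point ?_ ?_ ?_ ?_ ?_ ?_ ?_
  · intro v
    rw [hH, hH, hact]
    simp
  · intro v hv h0
    rw [hH] at h0
    apply hf
    rw [map_zero]
    ext a
    fin_cases a
    · have := hact v 0
      rw [hv] at this
      simp at this ⊢
      linarith
    · exact congrFun h0 0
  · rw [mem_rootsA_one]
    rintro ⟨s, hs⟩
    exact sgnR_ne_zero s (congrFun hs 0).symm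
  · rintro β hβ h0 ⟨k, hk⟩
    rw [LinearMap.proj_apply] at hk
    rw [hH] at h0
    have h1 : β 1 = 0 := congrFun h0 0
    rcases mem_rootsB_two hβ with ⟨s, h, -⟩ | ⟨s, h, -⟩
    · rw [hk, sgnR] at h
      have h' : 2 * k = s := by exact_mod_cast h
      rcases Int.units_eq_one_or s with rfl | rfl <;> simp at h' <;> omega
    · rw [h] at h1
      exact sgnR_ne_zero s h1
  · intro r hr1 hr2
    refine ⟨_, Or.inr (axis_one_mem 0 1), ?_, 0, ?_⟩
    · rw [hH]
      simp
    · have : r = 1 := by push_cast at hr2; omega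
      rw [this]
      simp [sgnR]
  · intro β hβ h0
    rw [hH] at h0 ⊢
    rcases mem_rootsB_two hβ with ⟨s, -, h⟩ | ⟨s, h, hk⟩
    · rw [h] at h0
      simp at h0
    · exact ⟨mem_rootsA_one.2 ⟨s, by rw [h]⟩, hk⟩
  · intro γ hγ t
    obtain ⟨s, rfl⟩ := mem_rootsA_one.1 hγ
    rcases Int.even_or_odd t with ⟨k, hk⟩ | ⟨k, hk⟩
    · refine ⟨_, Or.inr (axis_one_mem 1 s), ?_, -k, ?_⟩
      · rw [hH]
        simp
      · rw [hk]
        simp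
        ring
    · refine ⟨_, Or.inl (pair_mem (i := 1) (j := 0) (by simp) s 1), ?_, -k, ?_⟩
      · rw [hH]
        simp
      · rw [hk]
        simp [sgnR]

theorem exists_row_typeB {f : V →ₗ[ℝ] (Fin l → ℝ)} (hl : 2 ≤ l) (hf : Function.Injective f)
    (hθ : IsHighestRoot b θ) (hΦ : f '' Set.range P.root = rootsB l)
    (hS : ∀ k : Fin l, f (P.root (e k)) =
      if (k : ℕ) + 1 = l then stdE l l else stdE l (k + 1) - stdE l (k + 2))
    (hπ : ∀ i, P.weylGroupToPerm ω (node θ e i) = node θ e (π i)) (hπ0 : π 0 ≠ 0) :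
    ∃ (n : ℕ) (R R' : Set (Fin n → ℝ)) (d : ℕ), FoldingTable (.B l hl) (π 0) R R' d ∧
      FoldingFormula P ω R R' d := by
  obtain ⟨h0, horder, hact, hχ⟩ := exists_signs_typeB hl hf hθ hΦ hS simple_typeB hπ hπ0
  rw [h0]
  rcases Nat.lt_or_ge 2 l with h2 | h2
  · exact ⟨_, _, _, _, .B_ge_three l hl h2, foldingFormula_typeB h2 hf hΦ horder hact hχ⟩
  · obtain rfl : l = 2 := by omega
    exact ⟨_, _, _, _, .B_two hl, foldingFormula_typeB_two hf hΦ horder hact hχ⟩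

end TypeB

end RootPairing

/-! ### Folding by a reversal of coordinates with signs. -/

/-- Half the sum of the coordinates. -/
noncomputable def halfSum (N : ℕ) : (Fin N → ℝ) →ₗ[ℝ] ℝ :=
  (1 / 2 : ℝ) • ∑ a : Fin N, LinearMap.proj a

theorem halfSum_single (N : ℕ) (a : Fin N) (c : ℝ) : halfSum N (Pi.single a c) = c / 2 := by
  simp only [halfSum, LinearMap.smul_apply, LinearMap.sum_apply, LinearMap.proj_apply, smul_eq_mul]
  rw [Finset.sum_eq_single a]
  · rw [Pi.single_eq_same]
    ring
  · intro x _ hx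
    rw [Pi.single_eq_of_ne hx]
  · simp

/-- The difference of the coordinates indexed by `g i 1` and `g i (-1)`. -/
noncomputable def foldSigned {N n : ℕ} (g : Fin n → ℤˣ → Fin N) : (Fin N → ℝ) →ₗ[ℝ] (Fin n → ℝ) :=
  LinearMap.funLeft ℝ ℝ (fun i => g i 1) - LinearMap.funLeft ℝ ℝ (fun i => g i (-1))

theorem foldSigned_apply {N n : ℕ} (g : Fin n → ℤˣ → Fin N) (v : Fin N → ℝ) (i : Fin n) :
    foldSigned g v i = v (g i 1) - v (g i (-1)) := rfl

theorem foldSigned_single {N n : ℕ} {g : Fin n → ℤˣ → Fin N}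
    (hg : ∀ i i' η η', g i η = g i' η' → i = i' ∧ η = η') (i : Fin n) (η : ℤˣ) (c : ℝ) :
    foldSigned g (Pi.single (g i η) c) = Pi.single i (sgnR η * c) := by
  ext j
  rw [foldSigned_apply]
  by_cases hij : j = i
  · subst hij
    rw [Pi.single_eq_same]
    rcases Int.units_eq_one_or η with rfl | rfl
    · rw [Pi.single_eq_same, Pi.single_eq_of_ne fun h => absurd (hg _ _ _ _ h).2 (by decide),
        sgnR_one]
      ring
    · rw [Pi.single_eq_same, Pi.single_eq_of_ne fun h => absurd (hg _ _ _ _ h).2 (by decide),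
        sgnR_neg, sgnR_one]
      ring
  · rw [Pi.single_eq_of_ne hij, Pi.single_eq_of_ne fun h => hij (hg _ _ _ _ h).1,
      Pi.single_eq_of_ne fun h => hij (hg _ _ _ _ h).1, sub_zero]

theorem foldSigned_single_sgn {N n : ℕ} {g : Fin n → ℤˣ → Fin N}
    (hg : ∀ i i' η η', g i η = g i' η' → i = i' ∧ η = η') (i : Fin n) (η s : ℤˣ) :
    foldSigned g (Pi.single (g i η) (sgnR s)) = Pi.single i (sgnR (η * s)) := by
  rw [foldSigned_single hg, sgnR_mul]

theorem foldSigned_single_of_notMem {N n : ℕ} {g : Fin n → ℤˣ → Fin N} {a : Fin N}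
    (ha : ∀ i η, g i η ≠ a) (c : ℝ) : foldSigned g (Pi.single a c) = 0 := by
  ext j
  rw [foldSigned_apply, Pi.single_eq_of_ne (ha j 1), Pi.single_eq_of_ne (ha j _), sub_zero,
    Pi.zero_apply]

theorem units_eq_or_eq_neg (s t : ℤˣ) : t = s ∨ t = -s := by
  rcases Int.units_eq_one_or s with rfl | rfl <;> rcases Int.units_eq_one_or t with rfl | rfl <;>
    simp

theorem sgnR_ne_even (s : ℤˣ) (k : ℤ) : sgnR s ≠ (2 : ℕ) * k := by
  intro h
  have h' : (s : ℤ) = 2 * k := by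
    rw [sgnR] at h
    exact_mod_cast h
  rcases Int.units_eq_one_or s with rfl | rfl <;> simp at h' <;> omega

theorem exists_sgnR_eq_of_odd (s : ℤˣ) {t : ℤ} (ht : Odd t) :
    ∃ k : ℤ, sgnR s = t + (2 : ℕ) * k := by
  obtain ⟨m, rfl⟩ := ht
  rcases sgnR_eq s with h | h
  · exact ⟨-m, by rw [h]; push_cast; ring⟩
  · exact ⟨-m - 1, by rw [h]; push_cast; ring⟩

theorem exists_zero_eq_of_even {t : ℤ} (ht : Even t) : ∃ k : ℤ, (0 : ℝ) = t + (2 : ℕ) * k := by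
  obtain ⟨m, rfl⟩ := ht
  exact ⟨-m, by push_cast; ring⟩

theorem halfSum_pair (N : ℕ) (a a' : Fin N) (s t : ℤˣ) :
    (t = s ∧ halfSum N (Pi.single a (sgnR s) + Pi.single a' (sgnR t)) = sgnR s) ∨
      (t = -s ∧ halfSum N (Pi.single a (sgnR s) + Pi.single a' (sgnR t)) = 0) := by
  rw [map_add, halfSum_single, halfSum_single]
  rcases units_eq_or_eq_neg s t with rfl | rfl
  · exact Or.inl ⟨rfl, by ring⟩
  · exact Or.inr ⟨rfl, by rw [sgnR_neg]; ring⟩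

theorem exists_int_halfSum_pair (N : ℕ) (a a' : Fin N) (s t : ℤˣ) :
    ∃ k : ℤ, halfSum N (Pi.single a (sgnR s) + Pi.single a' (sgnR t)) = k := by
  rcases halfSum_pair N a a' s t with ⟨-, h⟩ | ⟨-, h⟩
  · exact ⟨s, h⟩
  · exact ⟨0, by rw [h, Int.cast_zero]⟩

theorem halfSum_axis (N : ℕ) (a : Fin N) (s : ℤˣ) :
    halfSum N (Pi.single a (sgnR s * 2)) = sgnR s := by
  rw [halfSum_single]
  ring

/-- The values of `foldSigned` at the vectors `± e_a ± e_a'`, for folded coordinates. -/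
theorem foldSigned_pair {N n : ℕ} {g : Fin n → ℤˣ → Fin N}
    (hg : ∀ i i' η η', g i η = g i' η' → i = i' ∧ η = η') {i j : Fin n} {η η' : ℤˣ}
    (h : g i η ≠ g j η') (s t : ℤˣ) :
    foldSigned g (Pi.single (g i η) (sgnR s) + Pi.single (g j η') (sgnR t)) ∈ pairVectors n ∨
      (i = j ∧ t = s ∧
        foldSigned g (Pi.single (g i η) (sgnR s) + Pi.single (g j η') (sgnR t)) = 0) ∨
      (i = j ∧ t = -s ∧
        foldSigned g (Pi.single (g i η) (sgnR s) + Pi.single (g j η') (sgnR t)) =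
          Pi.single i (sgnR (η * s) * 2)) := by
  rw [map_add, foldSigned_single_sgn hg, foldSigned_single_sgn hg]
  by_cases hij : i = j
  · subst hij
    obtain rfl : η' = -η := by
      rcases units_eq_or_eq_neg η η' with rfl | rfl
      · exact absurd rfl h
      · rfl
    right
    rcases units_eq_or_eq_neg s t with rfl | rfl
    · refine Or.inl ⟨rfl, rfl, ?_⟩
      rw [← Pi.single_add, neg_mul, sgnR_neg, add_neg_cancel, Pi.single_zero]
    · refine Or.inr ⟨rfl, rfl, ?_⟩
      rw [← Pi.single_add, neg_mul_neg, mul_two]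
  · exact Or.inl (pair_mem hij _ _)

/-- The coordinates `g i 1` and `g i (-1)` fold to `e_i` and `-e_i`. Choosing the second coordinate
of the lift suitably allows equal or opposite signs, with half-sum `± 1` or `0`. The last clause
confines the lift to the folded coordinates; it is used when the weight differs from the half-sum
elsewhere. -/
theorem exists_lift_pair {N n : ℕ} {g : Fin n → ℤˣ → Fin N}
    (hg : ∀ i i' η η', g i η = g i' η' → i = i' ∧ η = η') {γ : Fin n → ℝ}
    (hγ : γ ∈ pairVectors n) (u : ℤ) :
    ∃ β ∈ pairVectors N, foldSigned g β = γ ∧ (∃ k : ℤ, halfSum N β = u + (2 : ℕ) * k) ∧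
      ∀ a, (∀ i η, g i η ≠ a) → β a = 0 := by
  obtain ⟨i, j, hij, s, t, rfl⟩ := hγ
  have hsupp : ∀ (η η' : ℤˣ) (c c' : ℝ) (a : Fin N), (∀ i η, g i η ≠ a) →
      (Pi.single (g i η) c + Pi.single (g j η') c' : Fin N → ℝ) a = 0 := by
    intro η η' c c' a ha
    rw [Pi.add_apply, Pi.single_eq_of_ne (ha i η).symm, Pi.single_eq_of_ne (ha j η').symm, add_zero]
  rcases Int.even_or_odd u with hu | hu
  · refine ⟨_, pair_mem (i := g i 1) (j := g j (-(s * t))) (fun h => hij (hg _ _ _ _ h).1) s (-s),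
      ?_, ?_, hsupp _ _ _ _⟩
    · rw [map_add, foldSigned_single_sgn hg, foldSigned_single_sgn hg, one_mul, neg_mul_neg,
        mul_right_comm, Int.units_mul_self, one_mul]
    · rw [map_add, halfSum_single, halfSum_single, sgnR_neg, neg_div, add_neg_cancel]
      exact exists_zero_eq_of_even hu
  · refine ⟨_, pair_mem (i := g i 1) (j := g j (s * t)) (fun h => hij (hg _ _ _ _ h).1) s s,
      ?_, ?_, hsupp _ _ _ _⟩
    · rw [map_add, foldSigned_single_sgn hg, foldSigned_single_sgn hg, one_mul,
        mul_right_comm, Int.units_mul_self, one_mul]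
    · rw [map_add, halfSum_single, halfSum_single, add_halves]
      exact exists_sgnR_eq_of_odd s hu

/-- The vector `2 e_i` is the fold of `e_{g i 1} - e_{g i (-1)}`. -/
theorem exists_lift_axis_two {N n : ℕ} {g : Fin n → ℤˣ → Fin N}
    (hg : ∀ i i' η η', g i η = g i' η' → i = i' ∧ η = η') {γ : Fin n → ℝ}
    (hγ : γ ∈ axisVectors 2 n) :
    ∃ β ∈ pairVectors N, foldSigned g β = γ ∧ halfSum N β = 0 := by
  obtain ⟨i, s, rfl⟩ := hγ
  refine ⟨_, pair_mem (i := g i 1) (j := g i (-1))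
    (fun h => absurd (hg _ _ _ _ h).2 (by decide)) s (-s), ?_, ?_⟩
  · rw [map_add, foldSigned_single_sgn hg, foldSigned_single_sgn hg, one_mul, neg_mul_neg, one_mul,
      ← Pi.single_add, mul_two]
  · rw [map_add, halfSum_single, halfSum_single, sgnR_neg, neg_div, add_neg_cancel]

theorem exists_kernel_pair {N n : ℕ} {g : Fin n → ℤˣ → Fin N}
    (hg : ∀ i i' η η', g i η = g i' η' → i = i' ∧ η = η') (i : Fin n) :
    ∃ β ∈ pairVectors N, foldSigned g β = 0 ∧ halfSum N β = 1 := by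
  refine ⟨_, pair_mem (i := g i 1) (j := g i (-1))
    (fun h => absurd (hg _ _ _ _ h).2 (by decide)) 1 1, ?_, ?_⟩
  · rw [map_add, foldSigned_single_sgn hg, foldSigned_single_sgn hg, one_mul, neg_mul, sgnR_neg,
      one_mul, ← Pi.single_add, add_neg_cancel, Pi.single_zero]
  · rw [map_add, halfSum_single, halfSum_single, sgnR_one]
    norm_num

namespace RootPairing

section Signed

variable {ι V E : Type*} [AddCommGroup V] [Module ℝ V] [AddCommGroup E] [Module ℝ E]
  {P : RootPairing ι ℝ V E}

/-- In type `C` every fibre takes both classes. Over `± 2 e_i` lie a difference of two partner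
coordinates, of half-sum zero, and a root `± 2 e_a`, of odd half-sum. The vectors `± e_i` occur only
if there is a middle coordinate, whose free sign gives both classes. So the factor two applies to
all folded roots. -/
theorem foldingFormula_signed {ω : P.weylGroup} {N n : ℕ} {f : V →ₗ[ℝ] (Fin N → ℝ)}
    (hΦ : f '' Set.range P.root = rootsC N) (hn : 1 ≤ n) {g : Fin n → ℤˣ → Fin N}
    (hg : ∀ i i' η η', g i η = g i' η' → i = i' ∧ η = η')
    (horder : orderOf ω = 2)
    (hχ : ∀ χ : E, (∀ v, P.toLinearMap v χ = halfSum N (f v)) → IsCocycle ω χ 2)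
    (hdual : ∀ φ : V →ₗ[ℝ] ℝ, ∃ x : E, ∀ v, P.toLinearMap v x = φ v)
    (hinv : ∀ v, foldSigned g (f (ω • v)) = foldSigned g (f v))
    (hfaith : ∀ v, ω • v = v → foldSigned g (f v) = 0 → v = 0)
    (huniq : ∀ m m', (∀ i η, g i η ≠ m) → (∀ i η, g i η ≠ m') → m = m')
    {R : Set (Fin n → ℝ)} (hR0 : (0 : Fin n → ℝ) ∉ R) (hpair : pairVectors n ⊆ R)
    (haxis : axisVectors 2 n ⊆ R) (hmid : ∀ m, (∀ i η, g i η ≠ m) → axisVectors 1 n ⊆ R)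
    (hR : ∀ γ ∈ R, γ ∈ pairVectors n ∨ γ ∈ axisVectors 2 n ∨
      (γ ∈ axisVectors 1 n ∧ ∃ m, ∀ i η, g i η ≠ m)) :
    FoldingFormula P ω R R 2 := by
  have hclass : ∀ a, (∃ i η, a = g i η) ∨ ∀ i η, g i η ≠ a := by
    intro a
    by_cases h : ∃ i η, a = g i η
    · exact Or.inl h
    · exact Or.inr fun i η hi => h ⟨i, η, hi.symm⟩
  refine foldingFormula_uniform hΦ (foldSigned g) (halfSum N) horder two_pos hχ hdual hinv hfaith
    hR0 ?_ ?_ ?_ ?_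
  · rintro β hβ h0 ⟨k, hk⟩
    rcases hβ with ⟨a, a', haa, s, t, rfl⟩ | ⟨a, s, rfl⟩
    · have hts : t = s := by
        rcases hclass a with ⟨i, η, rfl⟩ | ha <;> rcases hclass a' with ⟨j, η', rfl⟩ | ha'
        · rcases foldSigned_pair hg haa s t with h | ⟨-, h, -⟩ | ⟨-, -, h⟩
          · rw [h0] at h
            exact absurd h (zero_notMem_pairVectors n)
          · exact h
          · rw [h0] at h
            exact absurd (h ▸ axis_mem i (η * s) 2) (zero_notMem_axisVectors two_ne_zero n)
        · rw [map_add, foldSigned_single_sgn hg, foldSigned_single_of_notMem ha', add_zero,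
            single_sgnR_eq_zero_iff] at h0
          exact h0.elim
        · rw [map_add, foldSigned_single_sgn hg, foldSigned_single_of_notMem ha, zero_add,
            single_sgnR_eq_zero_iff] at h0
          exact h0.elim
        · exact absurd (huniq a a' ha ha') haa
      subst hts
      rw [map_add, halfSum_single, halfSum_single, add_halves] at hk
      exact sgnR_ne_even _ k hk
    · rw [halfSum_axis] at hk
      exact sgnR_ne_even s k hk
  · intro r hr1 hr2
    obtain ⟨β, hβ, h0, h1⟩ := exists_kernel_pair hg ⟨0, hn⟩
    refine ⟨β, Or.inl hβ, h0, 0, ?_⟩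
    have : r = 1 := by push_cast at hr2; omega
    rw [h1, this]
    simp
  · intro β hβ h0
    rcases hβ with ⟨a, a', haa, s, t, rfl⟩ | ⟨a, s, rfl⟩
    · refine ⟨?_, exists_int_halfSum_pair N a a' s t⟩
      rcases hclass a with ⟨i, η, rfl⟩ | ha <;> rcases hclass a' with ⟨j, η', rfl⟩ | ha'
      · rcases foldSigned_pair hg haa s t with h | ⟨-, -, h⟩ | ⟨-, -, h⟩
        · exact hpair h
        · exact absurd h h0
        · rw [h]
          exact haxis (axis_mem i _ 2)
      · rw [map_add, foldSigned_single_sgn hg, foldSigned_single_of_notMem ha', add_zero]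
        exact hmid a' ha' (axis_one_mem i _)
      · rw [map_add, foldSigned_single_sgn hg, foldSigned_single_of_notMem ha, zero_add]
        exact hmid a ha (axis_one_mem j _)
      · exact absurd (huniq a a' ha ha') haa
    · refine ⟨?_, s, halfSum_axis N a s⟩
      rcases hclass a with ⟨i, η, rfl⟩ | ha
      · rw [foldSigned_single hg, ← mul_assoc, ← sgnR_mul]
        exact haxis (axis_mem i _ 2)
      · exact absurd (foldSigned_single_of_notMem ha _) h0
  · intro γ hγ u
    rcases hR γ hγ with h | h | ⟨⟨i, s, rfl⟩, m, hm⟩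
    · obtain ⟨β, hβ, h1, h2, -⟩ := exists_lift_pair hg h u
      exact ⟨β, Or.inl hβ, h1, h2⟩
    · rcases Int.even_or_odd u with hu | hu
      · obtain ⟨β, hβ, h1, h2⟩ := exists_lift_axis_two hg h
        exact ⟨β, Or.inl hβ, h1, by rw [h2]; exact exists_zero_eq_of_even hu⟩
      · obtain ⟨i, s, rfl⟩ := h
        refine ⟨_, Or.inr (axis_mem (g i 1) s 2), ?_, ?_⟩
        · rw [foldSigned_single hg, sgnR_one, one_mul]
        · rw [halfSum_axis]
          exact exists_sgnR_eq_of_odd s hu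
    · rcases Int.even_or_odd u with hu | hu
      · refine ⟨_, Or.inl (pair_mem (hm i 1) s (-s)), ?_, ?_⟩
        · rw [map_add, foldSigned_single_sgn hg, foldSigned_single_of_notMem hm, add_zero, one_mul,
            mul_one]
        · rw [map_add, halfSum_single, halfSum_single, sgnR_neg, neg_div, add_neg_cancel]
          exact exists_zero_eq_of_even hu
      · refine ⟨_, Or.inl (pair_mem (hm i 1) s s), ?_, ?_⟩
        · rw [map_add, foldSigned_single_sgn hg, foldSigned_single_of_notMem hm, add_zero, one_mul,
            mul_one]
        · rw [map_add, halfSum_single, halfSum_single, add_halves]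
          exact exists_sgnR_eq_of_odd s hu

/-- In type `D` the roots `± 2 e_a` are missing, so the fibre over the long root `± 2 e_i` has only
the class zero, whereas the short roots still take both. Long roots keep the factor one and short
ones get two, which is twice `B_n`. -/
theorem foldingFormula_signed_pair {ω : P.weylGroup} {N n : ℕ} {f : V →ₗ[ℝ] (Fin N → ℝ)}
    (hΦ : f '' Set.range P.root = rootsD N) (hn : 1 ≤ n) {g : Fin n → ℤˣ → Fin N}
    (hg : ∀ i i' η η', g i η = g i' η' → i = i' ∧ η = η')
    (horder : orderOf ω = 2)
    (hχ : ∀ χ : E, (∀ v, P.toLinearMap v χ = halfSum N (f v)) → IsCocycle ω χ 2)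
    (hdual : ∀ φ : V →ₗ[ℝ] ℝ, ∃ x : E, ∀ v, P.toLinearMap v x = φ v)
    (hinv : ∀ v, foldSigned g (f (ω • v)) = foldSigned g (f v))
    (hfaith : ∀ v, ω • v = v → foldSigned g (f v) = 0 → v = 0)
    (hsurj : ∀ a, ∃ i η, a = g i η) :
    FoldingFormula P ω (rootsC n) (rootsB n) 2 := by
  rw [← rescale_rootsC]
  refine foldingFormula_rescale hΦ (foldSigned g) (halfSum N) (by norm_num) (by norm_num) horder
    two_pos hχ hdual hinv hfaith (zero_notMem_rootsC n) ?_ ?_ ?_ ?_ ?_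
  · rintro _ ⟨a, a', haa, s, t, rfl⟩ h0 ⟨k, hk⟩
    obtain ⟨i, η, rfl⟩ := hsurj a
    obtain ⟨j, η', rfl⟩ := hsurj a'
    rcases foldSigned_pair hg haa s t with h | ⟨-, rfl, -⟩ | ⟨-, -, h⟩
    · rw [h0] at h
      exact zero_notMem_pairVectors n h
    · rw [map_add, halfSum_single, halfSum_single, add_halves] at hk
      exact sgnR_ne_even _ k hk
    · rw [h0] at h
      exact zero_notMem_axisVectors two_ne_zero n (h ▸ axis_mem i (η * s) 2)
  · intro r hr1 hr2
    obtain ⟨β, hβ, h0, h1⟩ := exists_kernel_pair hg ⟨0, hn⟩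
    refine ⟨β, hβ, h0, 0, ?_⟩
    have : r = 1 := by push_cast at hr2; omega
    rw [h1, this]
    simp
  · rintro _ ⟨a, a', haa, s, t, rfl⟩ h0
    obtain ⟨i, η, rfl⟩ := hsurj a
    obtain ⟨j, η', rfl⟩ := hsurj a'
    have hint := exists_int_halfSum_pair N (g i η) (g j η') s t
    rcases foldSigned_pair hg haa s t with h | ⟨-, -, h⟩ | ⟨-, rfl, h⟩
    · exact ⟨Or.inl h, hint, fun h' => absurd (isShort_rootsC_pair h) h'⟩
    · exact absurd h h0
    · refine ⟨?_, hint, fun _ => ⟨0, ?_⟩⟩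
      · rw [h]
        exact Or.inr (axis_mem i _ 2)
      · rw [map_add, halfSum_single, halfSum_single, sgnR_neg]
        push_cast
        ring
  · rintro γ (hγ | hγ)
    · obtain ⟨β, hβ, h, -⟩ := exists_lift_pair hg hγ 0
      exact ⟨β, hβ, h⟩
    · obtain ⟨β, hβ, h, -⟩ := exists_lift_axis_two hg hγ
      exact ⟨β, hβ, h⟩
  · rintro γ (hγ | hγ) hs t
    · obtain ⟨β, hβ, h1, h2, -⟩ := exists_lift_pair hg hγ t
      exact ⟨β, hβ, h1, h2⟩
    · exact absurd hs (not_isShort_rootsC_axis hγ)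

end Signed

end RootPairing

/-- The coordinates number `i + c` from the left and from the right. -/
def mirror {l n : ℕ} (c : ℕ) (h : 2 * (n + c) ≤ l) (i : Fin n) (η : ℤˣ) : Fin l :=
  if η = 1 then ⟨i + c, by omega⟩ else ⟨l - 1 - (i + c), by omega⟩

theorem mirror_one {l n : ℕ} (c : ℕ) (h : 2 * (n + c) ≤ l) (i : Fin n) :
    (mirror c h i 1 : ℕ) = i + c := rfl

theorem mirror_neg {l n : ℕ} (c : ℕ) (h : 2 * (n + c) ≤ l) (i : Fin n) :
    (mirror c h i (-1) : ℕ) = l - 1 - (i + c) := rfl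

theorem mirror_injective {l n : ℕ} (c : ℕ) (h : 2 * (n + c) ≤ l) (i i' : Fin n) (η η' : ℤˣ)
    (hi : mirror c h i η = mirror c h i' η') : i = i' ∧ η = η' := by
  have hv := congrArg Fin.val hi
  have := i.2
  have := i'.2
  rcases Int.units_eq_one_or η with rfl | rfl <;> rcases Int.units_eq_one_or η' with rfl | rfl
  · rw [mirror_one, mirror_one] at hv
    exact ⟨Fin.ext (by omega), rfl⟩
  · rw [mirror_one, mirror_neg] at hv
    omega
  · rw [mirror_one, mirror_neg] at hv
    omega
  · rw [mirror_neg, mirror_neg] at hv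
    exact ⟨Fin.ext (by omega), rfl⟩

/-- Locates the coordinates killed by the fold. With `c = 0` there is at most the middle one in the
cases at hand; with `c = 1`, for type `D` of odd rank, the two ends join it. -/
theorem mirror_ne_iff {l n : ℕ} (c : ℕ) (h : 2 * (n + c) ≤ l) (a : Fin l) :
    (∀ i η, mirror c h i η ≠ a) ↔
      (a : ℕ) < c ∨ (n + c ≤ (a : ℕ) ∧ (a : ℕ) + n + c < l) ∨ l ≤ a + c := by
  constructor
  · intro ha
    by_contra hc
    push Not at hc
    obtain ⟨h1, h2, h3⟩ := hc
    have := a.2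
    by_cases h4 : (a : ℕ) < n + c
    · exact ha ⟨a - c, by omega⟩ 1 (Fin.ext (by rw [mirror_one]; simp; omega))
    · have := h2 (by omega)
      refine ha ⟨l - 1 - a - c, by omega⟩ (-1) (Fin.ext ?_)
      rw [mirror_neg]
      simp
      omega
  · intro ha i η hi
    have hv := congrArg Fin.val hi
    have := i.2
    have := a.2
    rcases Int.units_eq_one_or η with rfl | rfl
    · rw [mirror_one] at hv
      omega
    · rw [mirror_neg] at hv
      omega

theorem rev_mirror {l n : ℕ} (c : ℕ) (h : 2 * (n + c) ≤ l) (i : Fin n) (η : ℤˣ) :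
    (mirror c h i η).rev = mirror c h i (-η) := by
  apply Fin.ext
  have := i.2
  rcases Int.units_eq_one_or η with rfl | rfl
  · rw [Fin.val_rev, mirror_one, mirror_neg]
    omega
  · rw [Fin.val_rev, mirror_neg, neg_neg, mirror_one]
    omega

theorem foldSigned_mirror_congr {l n : ℕ} {c : ℕ} {h : 2 * (n + c) ≤ l} {u v : Fin l → ℝ}
    (huv : ∀ i η, u (mirror c h i η).rev = -v (mirror c h i η)) :
    foldSigned (mirror c h) u = foldSigned (mirror c h) v := by
  ext i
  have h1 := huv i 1
  have h2 := huv i (-1)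
  rw [rev_mirror] at h1 h2
  rw [neg_neg] at h2
  rw [foldSigned_apply, foldSigned_apply, h1, h2]
  ring

theorem apply_mirror_eq_zero {l n : ℕ} {c : ℕ} {h : 2 * (n + c) ≤ l} {u : Fin l → ℝ}
    (hu : ∀ i η, u (mirror c h i η).rev = -u (mirror c h i η))
    (h0 : foldSigned (mirror c h) u = 0) (i : Fin n) (η : ℤˣ) : u (mirror c h i η) = 0 := by
  have h1 := hu i 1
  have h2 := congrFun h0 i
  rw [rev_mirror] at h1
  rw [foldSigned_apply, Pi.zero_apply] at h2
  rcases Int.units_eq_one_or η with rfl | rfl <;> linarith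

theorem stdE_eq_single {n k : ℕ} (hk : k < n) : stdE n (k + 1) = Pi.single ⟨k, hk⟩ 1 := by
  ext a
  rw [RootPairing.stdE_apply, Pi.single_apply]
  exact if_congr (by rw [Fin.ext_iff]; simp) rfl rfl

/-! ### Type `C`. -/

/-- The entry at `a` of the node `i` of the extended diagram of type `C`. -/
def nodeC (l i a : ℕ) : ℤ :=
  if i = 0 then (if a = 0 then -2 else 0) else if i = l then (if a + 1 = l then 2 else 0)
  else (if a + 1 = i then 1 else 0) - (if a = i then 1 else 0)

namespace RootPairing

section TypeC

set_option linter.unusedSectionVars false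

variable {ι V E : Type*} [Finite ι] [AddCommGroup V] [Module ℝ V] [AddCommGroup E] [Module ℝ E]
  {P : RootPairing ι ℝ V E} [P.IsRootSystem] [P.IsCrystallographic] [P.IsReduced] {b : P.Base}
  {l : ℕ} {θ : ι} {e : Fin l ≃ b.support} {f : V →ₗ[ℝ] (Fin l → ℝ)}
  {ω : P.weylGroup} {π : Equiv.Perm (Fin (l + 1))} {S : Fin l → Fin l → ℝ}

theorem simple_typeC (k a : Fin l) :
    (if (k : ℕ) + 1 = l then (2 : ℝ) • stdE l l else stdE l (k + 1) - stdE l (k + 2)) a =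
      (if (a : ℕ) = k then 1 else 0) - (if (a : ℕ) = k + 1 then 1 else 0) +
        (if (k : ℕ) + 1 = l then (if (a : ℕ) + 1 = l then 1 else 0) else 0) := by
  have := a.2
  have := k.2
  split_ifs <;> simp only [stdE_apply, Pi.sub_apply, Pi.smul_apply, smul_eq_mul] <;> grind

theorem halfSum_simple_typeC (k : Fin l) :
    halfSum l (if (k : ℕ) + 1 = l then (2 : ℝ) • stdE l l else stdE l (k + 1) - stdE l (k + 2)) =
      if (k : ℕ) + 1 = l then 1 else 0 := by
  have hk := k.2
  split_ifs with h
  · obtain ⟨m, rfl⟩ : ∃ m, l = m + 1 := ⟨l - 1, by omega⟩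
    rw [map_smul, stdE_eq_single (by omega), halfSum_single]
    norm_num
  · rw [map_sub, stdE_eq_single hk, show (k : ℕ) + 2 = (k + 1) + 1 from rfl,
      stdE_eq_single (by omega), halfSum_single, halfSum_single, sub_self]

theorem map_highestRoot_typeC (hl : 2 ≤ l) (hθ : IsHighestRoot b θ)
    (hΦ : f '' Set.range P.root = rootsC l) (hS : ∀ k, f (P.root (e k)) = S k)
    (hSv : ∀ k a : Fin l, S k a = (if (a : ℕ) = k then 1 else 0) -
      (if (a : ℕ) = k + 1 then 1 else 0) +
        (if (k : ℕ) + 1 = l then (if (a : ℕ) + 1 = l then 1 else 0) else 0)) (a : Fin l) :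
    f (P.root θ) a = if (a : ℕ) = 0 then 2 else 0 := by
  rw [map_highestRoot hθ hΦ hS (t := Pi.single ⟨0, by omega⟩ (sgnR 1 * 2))
    (Or.inr (axis_mem _ 1 2)) ?_ ?_]
  · simp only [Pi.single_apply, Fin.ext_iff, sgnR_one]
    grind
  · intro k
    rw [dotProduct_single, hSv, sgnR_one]
    grind
  · rintro _ (⟨i, j, hij, s, t, rfl⟩ | ⟨i, s, rfl⟩)
    · rw [pair_dotProduct_self hij, axis_dotProduct_self]
      norm_num
    · rw [axis_dotProduct_self, axis_dotProduct_self]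

theorem coef_typeC (hl : 2 ≤ l) (hf : Function.Injective f) (hθ : IsHighestRoot b θ)
    (hΦ : f '' Set.range P.root = rootsC l) (hS : ∀ k, f (P.root (e k)) = S k)
    (hSv : ∀ k a : Fin l, S k a = (if (a : ℕ) = k then 1 else 0) -
      (if (a : ℕ) = k + 1 then 1 else 0) +
        (if (k : ℕ) + 1 = l then (if (a : ℕ) + 1 = l then 1 else 0) else 0)) (k : Fin l) :
    coef b θ (e k) = if (k : ℕ) + 1 = l then 1 else 2 := by
  refine coef_highestRoot_of_model hf hS (c := fun k => if (k : ℕ) + 1 = l then 1 else 2) ?_ k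
  ext a
  rw [map_highestRoot_typeC hl hθ hΦ hS hSv, Finset.sum_apply]
  simp only [Pi.smul_apply, smul_eq_mul, hSv]
  have := sum_chain (l := l) (fun k => (((if k + 1 = l then 1 else 2 : ℤ)) : ℝ))
    (if (a : ℕ) + 1 = l then 1 else 0) a.2
  rw [this]
  push_cast
  have := a.2
  clear * - this hl
  grind

theorem map_node_typeC (hl : 2 ≤ l) (hθ : IsHighestRoot b θ)
    (hΦ : f '' Set.range P.root = rootsC l) (hS : ∀ k, f (P.root (e k)) = S k)
    (hSv : ∀ k a : Fin l, S k a = (if (a : ℕ) = k then 1 else 0) -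
      (if (a : ℕ) = k + 1 then 1 else 0) +
        (if (k : ℕ) + 1 = l then (if (a : ℕ) + 1 = l then 1 else 0) else 0))
    (i : Fin (l + 1)) (a : Fin l) : f (P.root (node θ e i)) a = nodeC l i a := by
  have := a.2
  induction i using Fin.cases with
  | zero =>
    rw [root_node_zero, map_neg, Pi.neg_apply, map_highestRoot_typeC hl hθ hΦ hS hSv, nodeC]
    simp only [Fin.val_zero, if_true]
    split_ifs <;> simp
  | succ k =>
    rw [node_succ, hS, hSv, nodeC, Fin.val_succ]
    push_cast
    clear * - this
    grind

/-- The end nodes are `-2 e_1` and `2 e_ℓ`, so moving the first to the last forces `e_1 ↦ -e_ℓ`.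
Along the chain of nodes `e_i - e_{i+1}` the remaining vectors follow: the coordinates are reversed
and negated. -/
theorem signs_typeC (hl : 2 ≤ l) {τ : Equiv.Perm (Fin l)} {δ : Fin l → ℤˣ}
    (hn : ∀ i a, nodeC l (π i) (τ a) = δ a * nodeC l i a) (h0 : (π 0 : ℕ) = l) (a : Fin l) :
    τ a = a.rev ∧ δ a = -1 := by
  have hd : ∀ a, (δ a : ℤ) = 1 ∨ (δ a : ℤ) = -1 := fun a => by
    rcases Int.units_eq_one_or (δ a) with h | h <;> simp [h]
  have key : ∀ k, ∀ hk : k < l, (τ ⟨k, hk⟩ : ℕ) = l - (k + 1) ∧ (δ ⟨k, hk⟩ : ℤ) = -1 := by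
    intro k
    induction k with
    | zero =>
      intro hk
      have e0 := hn 0 ⟨0, hk⟩
      rw [h0] at e0
      simp only [nodeC, Fin.val_zero] at e0
      rcases hd ⟨0, hk⟩ with h | h <;> rw [h] at e0 ⊢ <;> grind
    | succ k ih =>
      intro hk
      have hτne : (τ ⟨k + 1, hk⟩ : ℕ) ≠ τ ⟨k, by omega⟩ := by
        intro h
        have := congrArg Fin.val (τ.injective (Fin.ext h))
        simp at this
      obtain ⟨i1, i2⟩ := ih (by omega)
      have e1 := hn ⟨k + 1, by omega⟩ ⟨k, by omega⟩
      rw [i1, i2] at e1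
      have hπk : (π ⟨k + 1, by omega⟩ : ℕ) = l - (k + 1) := by
        simp only [nodeC] at e1
        grind
      have e2 := hn ⟨k + 1, by omega⟩ ⟨k + 1, hk⟩
      rw [hπk] at e2
      simp only [nodeC] at e2
      rcases hd ⟨k + 1, hk⟩ with h | h <;> rw [h] at e2 ⊢ <;> grind
  obtain ⟨k1, k2⟩ := key a a.2
  refine ⟨Fin.ext (by rw [k1, Fin.val_rev]), ?_⟩
  rw [← Units.val_inj, k2]
  rfl

/-- The marks are `1, 2, …, 2, 1`, so `π` exchanges the two end nodes and invariant functions have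
even weighted sum. The indicator of the ends corresponds to the half-sum of the coordinates, which
is one on `α_ℓ` and zero on the other simple roots. -/
theorem exists_signs_typeC (hl : 2 ≤ l) (hf : Function.Injective f) (hθ : IsHighestRoot b θ)
    (hΦ : f '' Set.range P.root = rootsC l)
    (hS : ∀ k : Fin l, f (P.root (e k)) =
      if (k : ℕ) + 1 = l then (2 : ℝ) • stdE l l else stdE l (k + 1) - stdE l (k + 2))
    (hπ : ∀ i, P.weylGroupToPerm ω (node θ e i) = node θ e (π i)) (hπ0 : π 0 ≠ 0) :
    (π 0 : ℕ) = l ∧ orderOf ω = 2 ∧ (∀ v a, f (ω • v) (Fin.rev a) = -f v a) ∧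
      ∀ χ : E, (∀ v, P.toLinearMap v χ = halfSum l (f v)) → IsCocycle ω χ 2 := by
  have hmark : ∀ i : Fin (l + 1), mark θ e i = if (i : ℕ) = 0 ∨ (i : ℕ) = l then 1 else 2 := by
    intro i
    induction i using Fin.cases with
    | zero => rw [mark_zero]; simp
    | succ k => rw [mark_succ, coef_typeC hl hf hθ hΦ hS simple_typeC, Fin.val_succ]; grind
  have hmp := fun i => mark_perm hθ hπ i
  simp only [hmark] at hmp
  have h0 : (π 0 : ℕ) = l := by
    have h := hmp 0
    have h' : (π 0 : ℕ) ≠ 0 := fun h => hπ0 (Fin.ext h)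
    simp only [Fin.val_zero] at h
    grind
  obtain ⟨τ, δ, hτ⟩ := exists_signed_perm_BC two_ne_zero hf hΦ ω
  have hsig := signs_typeC hl
    (nodeEntry_eq hτ hπ (map_node_typeC hl hθ hΦ hS simple_typeC)) h0
  refine ⟨h0, ?_, ?_, ?_⟩
  · refine orderOf_eq_two_of_signed hf hτ (ne_one_of_node_perm hθ hπ hπ0) ?_ ?_
    · intro a
      rw [(hsig a).1, (hsig _).1, Fin.rev_rev]
    · intro a
      rw [(hsig a).2, (hsig _).2, Int.units_mul_self]
  · intro v a
    have := hτ v a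
    rw [(hsig a).1, (hsig a).2] at this
    rw [this]
    simp [sgnR]
  · intro χ hχ
    have hlast : ((Fin.last l : Fin (l + 1)) : ℕ) = l := Fin.val_last l
    have hsum : ∀ y : Fin (l + 1) → ℤ, ∑ i, mark θ e i * y i =
        2 * ∑ i, y i - (y 0 + y (Fin.last l)) := by
      intro y
      have : ∀ i, mark θ e i * y i = 2 * y i -
          ((if i = 0 then y i else 0) + (if i = Fin.last l then y i else 0)) := by
        intro i
        rw [hmark]
        simp only [Fin.ext_iff, Fin.val_zero, Fin.val_last]
        clear * - hl
        grind
      rw [Finset.sum_congr rfl fun i _ => this i]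
      simp [Finset.sum_sub_distrib, Finset.sum_add_distrib, Finset.mul_sum]
    refine isCocycle_of_nodes hπ two_pos (fun i => if (i : ℕ) = 0 ∨ (i : ℕ) = l then 1 else 0)
      ?_ ?_ ?_ ?_
    · intro i
      have := hmp i
      clear * - this
      grind
    · have : ∀ i : Fin (l + 1), mark θ e i * (if (i : ℕ) = 0 ∨ (i : ℕ) = l then 1 else 0) =
          (if i = 0 then 1 else 0) + (if i = Fin.last l then 1 else 0) := by
        intro i
        rw [hmark]
        simp only [Fin.ext_iff, Fin.val_zero, Fin.val_last]
        clear * - hl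
        grind
      rw [Finset.sum_congr rfl fun i _ => this i]
      simp [Finset.sum_add_distrib]
    · intro y hy
      rw [hsum]
      have := hy 0
      rw [show π 0 = Fin.last l from Fin.ext h0] at this
      rw [this]
      exact ⟨∑ i, y i - y 0, by push_cast; ring⟩
    · intro k
      rw [hχ, hS, halfSum_simple_typeC, Fin.val_succ]
      push_cast
      clear * -
      grind

theorem exists_row_typeC (hl : 3 ≤ l) (hf : Function.Injective f)
    (hθ : IsHighestRoot b θ) (hΦ : f '' Set.range P.root = rootsC l)
    (hS : ∀ k : Fin l, f (P.root (e k)) =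
      if (k : ℕ) + 1 = l then (2 : ℝ) • stdE l l else stdE l (k + 1) - stdE l (k + 2))
    (hπ : ∀ i, P.weylGroupToPerm ω (node θ e i) = node θ e (π i)) (hπ0 : π 0 ≠ 0) :
    ∃ (n : ℕ) (R R' : Set (Fin n → ℝ)) (d : ℕ), FoldingTable (.C l hl) (π 0) R R' d ∧
      FoldingFormula P ω R R' d := by
  obtain ⟨h0, horder, hact, hχ⟩ := exists_signs_typeC (by omega) hf hθ hΦ hS hπ hπ0
  rw [h0]
  have hinv : ∀ (n : ℕ) (h : 2 * (n + 0) ≤ l) (v : V),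
      foldSigned (mirror 0 h) (f (ω • v)) = foldSigned (mirror 0 h) (f v) := fun n h v =>
    foldSigned_mirror_congr fun i η => hact v _
  have hfaith : ∀ (n : ℕ) (h : 2 * (n + 0) ≤ l), l ≤ 2 * n + 1 → ∀ v : V, ω • v = v →
      foldSigned (mirror 0 h) (f v) = 0 → v = 0 := by
    intro n h hn v hv hv0
    apply hf
    rw [map_zero]
    ext a
    rw [Pi.zero_apply]
    have hneg := fun a => hact v a
    rw [hv] at hneg
    by_cases ha : ∀ i η, mirror 0 h i η ≠ a
    · rw [mirror_ne_iff] at ha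
      have := a.2
      have e1 := hneg a
      -- A coordinate outside the mirrored pairs is the middle one; it is its own reverse, hence
      -- equal to its negative on a fixed vector.
      rw [show a.rev = a from Fin.ext (by rw [Fin.val_rev]; omega)] at e1
      linarith
    · push Not at ha
      obtain ⟨i, η, rfl⟩ := ha
      exact apply_mirror_eq_zero (fun i η => hneg _) hv0 i η
  rcases Nat.even_or_odd l with hpar | hpar
  · refine ⟨_, _, _, _, .C_even l hl hpar, ?_⟩
    obtain ⟨m, hm⟩ := hpar
    have h : 2 * (l / 2 + 0) ≤ l := by omega
    have hno : ∀ a, ¬ ∀ i η, mirror 0 h i η ≠ a := by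
      intro a
      rw [mirror_ne_iff]
      omega
    exact foldingFormula_signed hΦ (by omega) (mirror_injective 0 h) horder hχ exists_dual_point
      (hinv _ h) (hfaith _ h (by omega)) (fun m _ hm => absurd hm (hno m)) (zero_notMem_rootsC _)
      (fun _ h => Or.inl h) (fun _ h => Or.inr h) (fun m hm => absurd hm (hno m))
      (by rintro γ (h | h); exacts [Or.inl h, Or.inr (Or.inl h)])
  · refine ⟨_, _, _, _, .C_odd l hl hpar, ?_⟩
    obtain ⟨m, hm⟩ := hpar
    have h : 2 * ((l - 1) / 2 + 0) ≤ l := by omega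
    have hmid : ∀ i η, mirror 0 h i η ≠ (⟨m, by omega⟩ : Fin l) := by
      rw [mirror_ne_iff]
      simp
      omega
    refine foldingFormula_signed hΦ (by omega) (mirror_injective 0 h) horder hχ exists_dual_point
      (hinv _ h) (hfaith _ h (by omega)) ?_ (zero_notMem_rootsBC _)
      (fun _ h => Or.inl (Or.inl h)) (fun _ h => Or.inr h) (fun _ _ _ h => Or.inl (Or.inr h)) ?_
    · intro a a' ha ha'
      rw [mirror_ne_iff] at ha ha'
      have := a.2
      have := a'.2
      exact Fin.ext (by omega)
    · rintro γ ((h | h) | h)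
      exacts [Or.inl h, Or.inr (Or.inr ⟨h, _, hmid⟩), Or.inr (Or.inl h)]

end TypeC

end RootPairing

/-! ### Type `D`: determination of the signed permutations. -/

/-- The entry at `a` of the node `i` of the extended diagram of type `D`. -/
def nodeD (l i a : ℕ) : ℤ :=
  if i = 0 then (if a ≤ 1 then -1 else 0) else if i = l then (if a + 2 = l ∨ a + 1 = l then 1 else 0)
  else (if a + 1 = i then 1 else 0) - (if a = i then 1 else 0)

namespace RootPairing

section TypeD

set_option linter.unusedSectionVars false

variable {ι V E : Type*} [Finite ι] [AddCommGroup V] [Module ℝ V] [AddCommGroup E] [Module ℝ E]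
  {P : RootPairing ι ℝ V E} [P.IsRootSystem] [P.IsCrystallographic] [P.IsReduced] {b : P.Base}
  {l : ℕ} {θ : ι} {e : Fin l ≃ b.support} {f : V →ₗ[ℝ] (Fin l → ℝ)}
  {ω : P.weylGroup} {π : Equiv.Perm (Fin (l + 1))} {S : Fin l → Fin l → ℝ}

/-- The entries of the simple roots of type `D_l`. -/
def IsSimpleD (S : Fin l → Fin l → ℝ) : Prop :=
  ∀ k a : Fin l, S k a = (if (a : ℕ) = k then 1 else 0) - (if (a : ℕ) = k + 1 then 1 else 0) +
    (if (k : ℕ) + 1 = l then (if (a : ℕ) + 2 = l then 1 else 0) else 0)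

theorem simple_typeD (hl : 4 ≤ l) : IsSimpleD (l := l) fun k =>
    if (k : ℕ) + 1 = l then stdE l (l - 1) + stdE l l else stdE l (k + 1) - stdE l (k + 2) := by
  intro k a
  have := a.2
  have := k.2
  dsimp only
  split_ifs <;> simp only [stdE_apply, Pi.sub_apply, Pi.add_apply] <;> grind

theorem map_highestRoot_typeD (hl : 4 ≤ l) (hθ : IsHighestRoot b θ)
    (hΦ : f '' Set.range P.root = rootsD l) (hS : ∀ k, f (P.root (e k)) = S k)
    (hSv : IsSimpleD S) (a : Fin l) :
    f (P.root θ) a = if (a : ℕ) ≤ 1 then 1 else 0 := by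
  have h0 : (⟨0, by omega⟩ : Fin l) ≠ ⟨1, by omega⟩ := by simp
  rw [map_highestRoot hθ hΦ hS (t := Pi.single ⟨0, by omega⟩ (sgnR 1) +
    Pi.single ⟨1, by omega⟩ (sgnR 1)) (pair_mem h0 1 1) ?_ ?_]
  · simp only [Pi.add_apply, Pi.single_apply, Fin.ext_iff, sgnR_one]
    clear * -
    grind
  · intro k
    rw [pair_dotProduct, hSv, hSv, sgnR_one]
    have := k.2
    clear * - hl this
    grind
  · rintro _ ⟨i, j, hij, s, t, rfl⟩
    rw [pair_dotProduct_self hij, pair_dotProduct_self h0]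

theorem coef_typeD (hl : 4 ≤ l) (hf : Function.Injective f) (hθ : IsHighestRoot b θ)
    (hΦ : f '' Set.range P.root = rootsD l) (hS : ∀ k, f (P.root (e k)) = S k)
    (hSv : IsSimpleD S) (k : Fin l) :
    coef b θ (e k) = if (k : ℕ) = 0 ∨ l ≤ k + 2 then 1 else 2 := by
  refine coef_highestRoot_of_model hf hS
    (c := fun k => if (k : ℕ) = 0 ∨ l ≤ k + 2 then 1 else 2) ?_ k
  ext a
  rw [map_highestRoot_typeD hl hθ hΦ hS hSv, Finset.sum_apply]
  have hSv' := fun k a => hSv k a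
  simp only [Pi.smul_apply, smul_eq_mul, hSv']
  have := sum_chain (l := l) (fun k => (((if k = 0 ∨ l ≤ k + 2 then 1 else 2 : ℤ)) : ℝ))
    (if (a : ℕ) + 2 = l then 1 else 0) a.2
  rw [this]
  push_cast
  have := a.2
  clear * - this hl
  grind

theorem mark_typeD (hl : 4 ≤ l) (hf : Function.Injective f) (hθ : IsHighestRoot b θ)
    (hΦ : f '' Set.range P.root = rootsD l) (hS : ∀ k, f (P.root (e k)) = S k)
    (hSv : IsSimpleD S) (i : Fin (l + 1)) :
    mark θ e i = if (i : ℕ) ≤ 1 ∨ l ≤ i + 1 then 1 else 2 := by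
  induction i using Fin.cases with
  | zero => rw [mark_zero]; simp
  | succ k =>
    rw [mark_succ, coef_typeD hl hf hθ hΦ hS hSv, Fin.val_succ]
    clear * -
    grind

theorem sum_mark_typeD (hl : 4 ≤ l) (hf : Function.Injective f) (hθ : IsHighestRoot b θ)
    (hΦ : f '' Set.range P.root = rootsD l) (hS : ∀ k, f (P.root (e k)) = S k)
    (hSv : IsSimpleD S) (y : Fin (l + 1) → ℤ) :
    ∑ i, mark θ e i * y i = 2 * ∑ i, y i -
      ((y 0 + y ⟨1, by omega⟩) + (y ⟨l - 1, by omega⟩ + y (Fin.last l))) := by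
  have : ∀ i, mark θ e i * y i = 2 * y i -
      (((if i = 0 then y i else 0) + (if i = ⟨1, by omega⟩ then y i else 0)) +
      ((if i = ⟨l - 1, by omega⟩ then y i else 0) + (if i = Fin.last l then y i else 0))) := by
    intro i
    rw [mark_typeD hl hf hθ hΦ hS hSv]
    simp only [Fin.ext_iff, Fin.val_zero, Fin.val_last]
    have := i.2
    clear * - hl this
    grind
  rw [Finset.sum_congr rfl fun i _ => this i]
  simp [Finset.sum_sub_distrib, Finset.sum_add_distrib, Finset.mul_sum]

theorem map_node_typeD (hl : 4 ≤ l) (hθ : IsHighestRoot b θ)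
    (hΦ : f '' Set.range P.root = rootsD l) (hS : ∀ k, f (P.root (e k)) = S k)
    (hSv : IsSimpleD S) (i : Fin (l + 1)) (a : Fin l) :
    f (P.root (node θ e i)) a = nodeD l i a := by
  have := a.2
  induction i using Fin.cases with
  | zero =>
    rw [root_node_zero, map_neg, Pi.neg_apply, map_highestRoot_typeD hl hθ hΦ hS hSv, nodeD]
    simp only [Fin.val_zero, if_true]
    split_ifs <;> simp
  | succ k =>
    rw [node_succ, hS, hSv, nodeD, Fin.val_succ]
    push_cast
    clear * - this hl
    grind

variable {τ : Equiv.Perm (Fin l)} {δ : Fin l → ℤˣ}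

theorem units_val_eq (δ : ℤˣ) : (δ : ℤ) = 1 ∨ (δ : ℤ) = -1 := by
  rcases Int.units_eq_one_or δ with h | h <;> simp [h]

theorem prod_eq_mul_last {m : ℕ} (hlm : l = m + 1) (δ : Fin l → ℤˣ) :
    ∏ a, δ a = (∏ i : Fin m, δ ⟨i, by omega⟩) * δ ⟨l - 1, by omega⟩ := by
  subst hlm
  rw [Fin.prod_univ_castSucc]
  rfl

/-- The signed permutation belonging to the first node. -/
theorem signs_typeD_one (hl : 4 ≤ l) (hδ : ∏ a, δ a = 1)
    (hn : ∀ i a, nodeD l (π i) (τ a) = δ a * nodeD l i a) (h0 : (π 0 : ℕ) = 1) :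
    (∀ a, τ a = a ∧ δ a = if (a : ℕ) = 0 ∨ (a : ℕ) + 1 = l then -1 else 1) ∧
      (π ⟨1, by omega⟩ : ℕ) = 0 ∧ (π ⟨l - 1, by omega⟩ : ℕ) = l := by
  have hinj : ∀ a c : Fin l, (a : ℕ) ≠ c → (τ a : ℕ) ≠ τ c := fun a c hac h =>
    hac (congrArg Fin.val (τ.injective (Fin.ext h)))
  have key : ∀ k, ∀ hk : k + 1 < l, (τ ⟨k, by omega⟩ : ℕ) = k ∧
      (δ ⟨k, by omega⟩ : ℤ) = if k = 0 then -1 else 1 := by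
    -- The image of the node zero leaves two possibilities for `e_1` and `e_2`. The other one would
    -- send the node `e_1 - e_2` to `e_1 + e_2`, which is not a node since `4 ≤ l`.
    have h01 : ((τ ⟨0, by omega⟩ : ℕ) = 0 ∧ (δ ⟨0, by omega⟩ : ℤ) = -1) ∧
        ((τ ⟨1, by omega⟩ : ℕ) = 1 ∧ (δ ⟨1, by omega⟩ : ℤ) = 1) := by
      have e0 := hn 0 ⟨0, by omega⟩
      have e1 := hn 0 ⟨1, by omega⟩
      have e2 := hn ⟨1, by omega⟩ ⟨0, by omega⟩
      have e3 := hn ⟨1, by omega⟩ ⟨1, by omega⟩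
      have hne := hinj ⟨0, by omega⟩ ⟨1, by omega⟩ (by simp)
      rw [h0] at e0 e1
      simp only [nodeD, Fin.val_zero] at e0 e1 e2 e3
      generalize (τ ⟨0, by omega⟩ : ℕ) = x0 at *
      generalize (τ ⟨1, by omega⟩ : ℕ) = x1 at *
      generalize (π ⟨1, by omega⟩ : ℕ) = p1 at *
      rcases units_val_eq (δ ⟨0, by omega⟩) with h | h <;>
        rcases units_val_eq (δ ⟨1, by omega⟩) with h' | h' <;> rw [h] at e0 e2 ⊢ <;>
        rw [h'] at e1 e3 ⊢ <;> clear * - e0 e1 e2 e3 hne hl <;> grind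
    intro k
    induction k with
    | zero =>
      intro hk
      simpa using h01.1
    | succ k ih =>
      intro hk
      rcases Nat.eq_zero_or_pos k with rfl | hkpos
      · simpa using h01.2
      · have hτne := hinj ⟨k + 1, by omega⟩ ⟨k, by omega⟩ (by simp)
        obtain ⟨i1, i2⟩ := ih (by omega)
        have e1 := hn ⟨k + 1, by omega⟩ ⟨k, by omega⟩
        rw [i1, i2] at e1
        have hπk : (π ⟨k + 1, by omega⟩ : ℕ) = k + 1 := by
          simp only [nodeD] at e1
          clear * - e1 hkpos hk hl
          grind
        have e2 := hn ⟨k + 1, by omega⟩ ⟨k + 1, by omega⟩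
        rw [hπk] at e2
        rw [i1] at hτne
        simp only [nodeD] at e2
        rcases units_val_eq (δ ⟨k + 1, by omega⟩) with h | h <;> rw [h] at e2 ⊢ <;>
          clear * - e2 hkpos hk hl hτne <;> grind
  have hlt : l - 1 < l := by omega
  have hτlast : (τ ⟨l - 1, by omega⟩ : ℕ) = l - 1 := by
    by_contra hne
    have hlt : (τ ⟨l - 1, by omega⟩ : ℕ) + 1 < l := by
      have := (τ ⟨l - 1, by omega⟩).2
      omega
    have h1 := (key _ hlt).1
    exact hinj ⟨_, by omega⟩ ⟨l - 1, by omega⟩ (by simpa using hne) h1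
  -- The chain does not reach the last sign; it follows because the product of all signs is one and
  -- exactly one of the others is negative.
  have hδlast : δ ⟨l - 1, by omega⟩ = -1 := by
    obtain ⟨m, hm⟩ : ∃ m, l = m + 1 := ⟨l - 1, by omega⟩
    rw [prod_eq_mul_last hm] at hδ
    have h1 : ∏ i : Fin m, δ ⟨i, by omega⟩ = -1 := by
      rw [Finset.prod_eq_single (⟨0, by omega⟩ : Fin m)]
      · rw [← Units.val_inj, (key 0 (by omega)).2]
        rfl
      · intro i _ hi
        rw [← Units.val_inj, (key i (by omega)).2, if_neg fun h => hi (Fin.ext h)]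
        rfl
      · simp
    rw [h1] at hδ
    rwa [neg_one_mul, neg_eq_iff_eq_neg] at hδ
  refine ⟨?_, ?_, ?_⟩
  · intro a
    by_cases ha : (a : ℕ) + 1 < l
    · obtain ⟨k1, k2⟩ := key a ha
      refine ⟨Fin.ext k1, ?_⟩
      rw [← Units.val_inj, k2]
      by_cases ha0 : (a : ℕ) = 0
      · rw [if_pos ha0, if_pos (Or.inl ha0)]
        rfl
      · rw [if_neg ha0, if_neg (by omega)]
        rfl
    · obtain rfl : a = ⟨l - 1, hlt⟩ := Fin.ext (by have := a.2; simp; omega)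
      exact ⟨Fin.ext hτlast, by rw [hδlast, if_pos (Or.inr (by simp; omega))]⟩
  · have e2 := hn ⟨1, by omega⟩ ⟨0, by omega⟩
    have e3 := hn ⟨1, by omega⟩ ⟨1, by omega⟩
    rw [(key 0 (by omega)).1, (key 0 (by omega)).2] at e2
    rw [(key 1 (by omega)).1, (key 1 (by omega)).2] at e3
    simp only [nodeD] at e2 e3
    clear * - e2 e3 hl
    grind
  · have e2 := hn ⟨l - 1, by omega⟩ ⟨l - 2, by omega⟩
    have e3 := hn ⟨l - 1, by omega⟩ ⟨l - 1, by omega⟩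
    rw [(key (l - 2) (by omega)).1, (key (l - 2) (by omega)).2] at e2
    rw [hτlast, hδlast] at e3
    simp only [nodeD, Units.val_neg, Units.val_one] at e2 e3
    clear * - e2 e3 hl
    grind

/-- The signed permutation belonging to the last node. -/
theorem signs_typeD_last (hl : 4 ≤ l) (hδ : ∏ a, δ a = 1)
    (hn : ∀ i a, nodeD l (π i) (τ a) = δ a * nodeD l i a) (h0 : (π 0 : ℕ) = l) :
    (∀ a, τ a = a.rev ∧ δ a = if (a : ℕ) + 1 < l then -1 else (-1) ^ (l - 1)) ∧
      (π ⟨1, by omega⟩ : ℕ) = l - 1 ∧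
      (∀ i : Fin (l + 1), 2 ≤ (i : ℕ) → (i : ℕ) + 2 ≤ l → (π i : ℕ) = l - i) ∧
      (Odd l → (π (Fin.last l) : ℕ) = 1) := by
  have hinj : ∀ a c : Fin l, (a : ℕ) ≠ c → (τ a : ℕ) ≠ τ c := fun a c hac h =>
    hac (congrArg Fin.val (τ.injective (Fin.ext h)))
  -- The node `-e_1 - e_2` goes to `e_{ℓ-1} + e_ℓ`, so both signs are negative. The order of the two
  -- images is decided by the node `e_1 - e_2`, which must go to `e_{ℓ-1} - e_ℓ`, the opposite
  -- vector not being a node.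
  have h01 : ((τ ⟨0, by omega⟩ : ℕ) = l - 1 ∧ (δ ⟨0, by omega⟩ : ℤ) = -1) ∧
      ((τ ⟨1, by omega⟩ : ℕ) = l - 2 ∧ (δ ⟨1, by omega⟩ : ℤ) = -1) ∧
      (π ⟨1, by omega⟩ : ℕ) = l - 1 := by
    have e0 := hn 0 ⟨0, by omega⟩
    have e1 := hn 0 ⟨1, by omega⟩
    have e2 := hn ⟨1, by omega⟩ ⟨0, by omega⟩
    have e3 := hn ⟨1, by omega⟩ ⟨1, by omega⟩
    have hne := hinj ⟨0, by omega⟩ ⟨1, by omega⟩ (by simp)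
    rw [h0] at e0 e1
    simp only [nodeD, Fin.val_zero] at e0 e1 e2 e3
    generalize (τ ⟨0, by omega⟩ : ℕ) = x0 at *
    generalize (τ ⟨1, by omega⟩ : ℕ) = x1 at *
    generalize (π ⟨1, by omega⟩ : ℕ) = p1 at *
    rcases units_val_eq (δ ⟨0, by omega⟩) with h | h <;>
      rcases units_val_eq (δ ⟨1, by omega⟩) with h' | h' <;> rw [h] at e0 e2 ⊢ <;>
      rw [h'] at e1 e3 ⊢ <;> clear * - e0 e1 e2 e3 hne hl <;> grind
  have key : ∀ k, ∀ hk : k + 1 < l, (τ ⟨k, by omega⟩ : ℕ) = l - (k + 1) ∧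
      (δ ⟨k, by omega⟩ : ℤ) = -1 ∧ (2 ≤ k → (π ⟨k, by omega⟩ : ℕ) = l - k) := by
    intro k
    induction k with
    | zero =>
      intro hk
      exact ⟨h01.1.1, h01.1.2, fun h => by omega⟩
    | succ k ih =>
      intro hk
      rcases Nat.eq_zero_or_pos k with rfl | hkpos
      · exact ⟨h01.2.1.1, h01.2.1.2, fun h => by omega⟩
      · have hτne := hinj ⟨k + 1, by omega⟩ ⟨k, by omega⟩ (by simp)
        obtain ⟨i1, i2, -⟩ := ih (by omega)
        have e1 := hn ⟨k + 1, by omega⟩ ⟨k, by omega⟩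
        rw [i1, i2] at e1
        have hπk : (π ⟨k + 1, by omega⟩ : ℕ) = l - (k + 1) := by
          simp only [nodeD] at e1
          clear * - e1 hkpos hk hl
          grind
        have e2 := hn ⟨k + 1, by omega⟩ ⟨k + 1, by omega⟩
        rw [hπk] at e2
        rw [i1] at hτne
        simp only [nodeD] at e2
        refine ⟨?_, ?_, fun _ => hπk⟩ <;>
        rcases units_val_eq (δ ⟨k + 1, by omega⟩) with h | h <;> rw [h] at e2 <;> (try rw [h]) <;>
          clear * - e2 hkpos hk hl hτne <;> grind
  have hlt : l - 1 < l := by omega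
  have hτlast : (τ ⟨l - 1, by omega⟩ : ℕ) = 0 := by
    by_contra hne
    have hlt := (τ ⟨l - 1, by omega⟩).2
    have h1 := (key (l - 1 - (τ ⟨l - 1, by omega⟩ : ℕ)) (by omega)).1
    refine hinj ⟨l - 1 - (τ ⟨l - 1, by omega⟩ : ℕ), by omega⟩ ⟨l - 1, by omega⟩ ?_ ?_
    · simp
      omega
    · rw [h1]
      omega
  -- All other signs are negative and the total product is one. The parity of the rank therefore
  -- enters here, and with it the order of `ω`.
  have hδlast : δ ⟨l - 1, by omega⟩ = (-1) ^ (l - 1) := by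
    obtain ⟨m, hm⟩ : ∃ m, l = m + 1 := ⟨l - 1, by omega⟩
    rw [prod_eq_mul_last hm] at hδ
    have h1 : ∏ i : Fin m, δ ⟨i, by omega⟩ = (-1) ^ (l - 1) := by
      rw [Finset.prod_eq_pow_card (b := -1), Finset.card_univ, Fintype.card_fin, hm]
      · rfl
      · intro i _
        rw [← Units.val_inj, (key i (by omega)).2.1]
        rfl
    rw [h1] at hδ
    rw [eq_comm, ← mul_inv_eq_one, Int.units_inv_eq_self, hδ]
  refine ⟨?_, h01.2.2, ?_, ?_⟩
  · intro a
    by_cases ha : (a : ℕ) + 1 < l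
    · obtain ⟨k1, k2, -⟩ := key a ha
      refine ⟨Fin.ext (by rw [k1, Fin.val_rev]), ?_⟩
      rw [← Units.val_inj, k2, if_pos ha]
      rfl
    · obtain rfl : a = ⟨l - 1, hlt⟩ := Fin.ext (by have := a.2; simp; omega)
      refine ⟨Fin.ext ?_, by rw [hδlast, if_neg ha]⟩
      rw [hτlast, Fin.val_rev]
      simp
      omega
  · intro i hi1 hi2
    exact (key i (by omega)).2.2 hi1
  · intro hodd
    have e2 := hn (Fin.last l) ⟨l - 2, by omega⟩
    have e3 := hn (Fin.last l) ⟨l - 1, by omega⟩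
    rw [(key (l - 2) (by omega)).1, (key (l - 2) (by omega)).2.1] at e2
    rw [hτlast, hδlast, Even.neg_one_pow (by obtain ⟨m, hm⟩ := hodd; exact ⟨m, by omega⟩)] at e3
    simp only [nodeD, Fin.val_last, Units.val_one] at e2 e3
    clear * - e2 e3 hl
    grind

end TypeD

end RootPairing

/-- An even number of indices is reversed without fixed points, so the terms cancel in pairs modulo
two. -/
theorem even_sum_of_rev {l : ℕ} (hl : Odd l) {y : Fin (l + 1) → ℤ} (hy : ∀ i, y i.rev = y i) :
    (2 : ℤ) ∣ ∑ i, y i := by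
  refine (ZMod.intCast_zmod_eq_zero_iff_dvd (∑ i, y i) 2).1 ?_
  rw [Int.cast_sum]
  refine Finset.sum_involution (fun i _ => i.rev) ?_ ?_ (fun _ _ => Finset.mem_univ _)
    (fun i _ => Fin.rev_rev i)
  · intro i _
    rw [hy]
    exact CharTwo.add_self_eq_zero _
  · intro i _ _ h
    have := congrArg Fin.val h
    rw [Fin.val_rev] at this
    obtain ⟨m, hm⟩ := hl
    omega

namespace RootPairing

section TypeD

set_option linter.unusedSectionVars false

variable {ι V E : Type*} [Finite ι] [AddCommGroup V] [Module ℝ V] [AddCommGroup E] [Module ℝ E]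
  {P : RootPairing ι ℝ V E} [P.IsRootSystem] [P.IsCrystallographic] [P.IsReduced] {b : P.Base}
  {l : ℕ} {θ : ι} {e : Fin l ≃ b.support} {f : V →ₗ[ℝ] (Fin l → ℝ)}
  {ω : P.weylGroup} {π : Equiv.Perm (Fin (l + 1))} {S : Fin l → Fin l → ℝ}

theorem node_perm_involutive (hθ : IsHighestRoot b θ)
    (hπ : ∀ i, P.weylGroupToPerm ω (node θ e i) = node θ e (π i)) (hω : orderOf ω = 2)
    (i : Fin (l + 1)) : π (π i) = i := by
  apply node_injective (e := e) hθ
  rw [← hπ, ← hπ, ← Equiv.Perm.mul_apply, ← map_mul, ← pow_two, ← hω, pow_orderOf_eq_one, map_one,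
    Equiv.Perm.one_apply]

theorem indicator_swap {j : Fin (l + 1)} (h0 : π 0 = j) (hj : π j = 0) (i : Fin (l + 1)) :
    ((if π i = 0 then 1 else 0) + (if π i = j then 1 else 0) : ℤ) =
      (if i = 0 then 1 else 0) + (if i = j then 1 else 0) := by
  rw [add_comm]
  congr 1
  · exact if_congr (by rw [← h0, π.injective.eq_iff]) rfl rfl
  · exact if_congr (by rw [← hj, π.injective.eq_iff]) rfl rfl

/-- Here `ω` negates the first and the last coordinate, and the fold forgets both. The class is read
off from the first coordinate: the roots `± e_1 ± e_ℓ` with zero fold are odd, and `± e_i` lifts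
with `e_ℓ` to an even root and with `e_1` to an odd one. The four nodes of mark one are exchanged in
pairs, so invariant weighted sums are even. -/
theorem foldingFormula_typeD_one (hl : 4 ≤ l) (hf : Function.Injective f) (hθ : IsHighestRoot b θ)
    (hΦ : f '' Set.range P.root = rootsD l) (hS : ∀ k, f (P.root (e k)) = S k)
    (hSv : IsSimpleD S)
    (hπ : ∀ i, P.weylGroupToPerm ω (node θ e i) = node θ e (π i)) (h0 : (π 0 : ℕ) = 1) :
    FoldingFormula P ω (rootsB (l - 2)) (rootsC (l - 2)) 1 := by
  have hω : ω ≠ 1 := ne_one_of_node_perm hθ hπ fun h => by simp [h] at h0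
  obtain ⟨τ, δ, hδ, hτ⟩ := exists_signed_perm_D hf hΦ ω
  obtain ⟨hsig, h1, h2⟩ := signs_typeD_one hl hδ
    (nodeEntry_eq hτ hπ (map_node_typeD hl hθ hΦ hS hSv)) h0
  have hact : ∀ v a, f (ω • v) a =
      (if (a : ℕ) = 0 ∨ (a : ℕ) + 1 = l then -1 else 1) * f v a := by
    intro v a
    have := hτ v a
    rw [(hsig a).1, (hsig a).2] at this
    rw [this]
    split_ifs <;> simp [sgnR]
  have horder : orderOf ω = 2 := by
    refine orderOf_eq_two_of_signed hf hτ hω ?_ ?_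
    · intro a
      rw [(hsig a).1, (hsig a).1]
    · intro a
      rw [(hsig a).1, Int.units_mul_self]
  have h0' : π 0 = ⟨1, by omega⟩ := Fin.ext h0
  have h1' : π ⟨1, by omega⟩ = 0 := Fin.ext h1
  have h2' : π ⟨l - 1, by omega⟩ = Fin.last l := Fin.ext h2
  have hcoc : ∀ χ : E, (∀ v, P.toLinearMap v χ = f v ⟨0, by omega⟩) → IsCocycle ω χ 2 := by
    intro χ hχ
    refine isCocycle_of_nodes hπ two_pos
      (fun i => (if i = 0 then 1 else 0) + (if i = ⟨1, by omega⟩ then 1 else 0))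
      (indicator_swap h0' h1') ?_ ?_ ?_
    · rw [sum_mark_typeD hl hf hθ hΦ hS hSv]
      simp only [Finset.sum_add_distrib, Finset.sum_ite_eq', Finset.mem_univ, if_true]
      simp only [Fin.ext_iff, Fin.val_zero, Fin.val_last]
      rw [if_neg (by omega), if_neg (by omega), if_neg (by omega), if_neg (by omega),
        if_neg (by omega), if_neg (by omega)]
      norm_num
    · intro y hy
      rw [sum_mark_typeD hl hf hθ hΦ hS hSv]
      have e1 := hy 0
      have e2 := hy ⟨l - 1, by omega⟩
      rw [h0'] at e1
      rw [h2'] at e2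
      rw [e1, e2]
      exact ⟨∑ i, y i - y 0 - y ⟨l - 1, by omega⟩, by push_cast; ring⟩
    · intro k
      rw [hχ, hS, hSv]
      simp only [Fin.ext_iff, Fin.val_zero, Fin.val_succ]
      push_cast
      clear * - hl
      grind
  have hp : Function.Injective fun i : Fin (l - 2) => (⟨i + 1, by omega⟩ : Fin l) := by
    intro i j h
    apply Fin.ext
    simpa using h
  have hz : ∀ i : Fin (l - 2), (⟨i + 1, by omega⟩ : Fin l) ≠ ⟨0, by omega⟩ := by
    intro i h
    simp at h
  have hz' : ∀ i : Fin (l - 2), (⟨i + 1, by omega⟩ : Fin l) ≠ ⟨l - 1, by omega⟩ := by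
    intro i h
    have := i.2
    simp at h
    omega
  have hclass : ∀ a : Fin l, a = ⟨0, by omega⟩ ∨ a = ⟨l - 1, by omega⟩ ∨
      ∃ i : Fin (l - 2), a = ⟨i + 1, by omega⟩ := by
    intro a
    have := a.2
    by_cases ha : (a : ℕ) = 0
    · exact Or.inl (Fin.ext ha)
    · by_cases ha' : (a : ℕ) = l - 1
      · exact Or.inr (Or.inl (Fin.ext ha'))
      · exact Or.inr (Or.inr ⟨⟨a - 1, by omega⟩, Fin.ext (by simp; omega)⟩)
  have hlne : (⟨l - 1, by omega⟩ : Fin l) ≠ ⟨0, by omega⟩ := by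
    intro h
    simp at h
    omega
  refine foldingFormula_drop hΦ (by omega) hp hz horder hcoc exists_dual_point ?_ ?_
    (fun _ h => h) (fun _ h => Or.inl h) ?_ ?_ ?_
  · intro v i
    rw [hact, if_neg (by simp; omega), one_mul]
  · intro v hv h0
    apply hf
    rw [map_zero]
    ext a
    rcases hclass a with rfl | rfl | ⟨i, rfl⟩
    · have := hact v ⟨0, by omega⟩
      rw [hv, if_pos (Or.inl rfl)] at this
      rw [Pi.zero_apply]
      linarith
    · have := hact v ⟨l - 1, by omega⟩
      rw [hv, if_pos (Or.inr (by simp; omega))] at this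
      rw [Pi.zero_apply]
      linarith
    · exact h0 i
  · rintro _ ⟨a, a', haa, s, t, rfl⟩ h0
    rw [map_add] at h0
    rcases hclass a with rfl | rfl | ⟨i, rfl⟩ <;> rcases hclass a' with rfl | rfl | ⟨j, rfl⟩
    · exact absurd rfl haa
    · rw [Pi.add_apply, Pi.single_eq_same, Pi.single_eq_of_ne hlne.symm, add_zero]
      exact sgnR_eq s
    · rw [funLeft_single_of_notMem hz, funLeft_single hp, zero_add,
        single_sgnR_eq_zero_iff] at h0
      exact h0.elim
    · rw [Pi.add_apply, Pi.single_eq_same, Pi.single_eq_of_ne hlne.symm, zero_add]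
      exact sgnR_eq t
    · exact absurd rfl haa
    · rw [funLeft_single_of_notMem hz', funLeft_single hp, zero_add,
        single_sgnR_eq_zero_iff] at h0
      exact h0.elim
    · rw [funLeft_single_of_notMem hz, funLeft_single hp, add_zero,
        single_sgnR_eq_zero_iff] at h0
      exact h0.elim
    · rw [funLeft_single_of_notMem hz', funLeft_single hp, add_zero,
        single_sgnR_eq_zero_iff] at h0
      exact h0.elim
    · rw [funLeft_single hp, funLeft_single hp] at h0
      exact absurd h0 (pair_ne_zero (fun h => haa (by rw [h])) s t)
  · refine ⟨_, pair_mem hlne 1 1, ?_, ?_⟩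
    · rw [map_add, funLeft_single_of_notMem hz, funLeft_single_of_notMem hz', add_zero]
    · rw [Pi.add_apply, Pi.single_eq_same, Pi.single_eq_of_ne hlne.symm, zero_add, sgnR_one]
  · intro i s
    refine ⟨_, pair_mem (hz' i) s 1, ?_, ?_⟩
    · rw [map_add, funLeft_single_of_notMem hz', funLeft_single hp, add_zero]
    · rw [Pi.add_apply, Pi.single_eq_of_ne (hz i).symm, Pi.single_eq_of_ne hlne.symm, add_zero]

theorem halfSum_simple_typeD (hl : 4 ≤ l) (hSv : IsSimpleD S) (k : Fin l) :
    halfSum l (S k) = if (k : ℕ) + 1 = l then 1 else 0 := by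
  have h1 : ∀ m : ℕ, ∑ a : Fin l, (if (a : ℕ) = m then (1 : ℝ) else 0) = if m < l then 1 else 0 :=
    fun m => sum_fin_ite (fun _ => 1) m
  have h2 : ∑ a : Fin l, (if (a : ℕ) + 2 = l then (1 : ℝ) else 0) = 1 := by
    have := h1 (l - 2)
    rw [if_pos (by omega)] at this
    exact (Finset.sum_congr rfl fun a _ => if_congr (by omega) rfl rfl).trans this
  have hSv' := fun a => hSv k a
  simp only [halfSum, LinearMap.smul_apply, LinearMap.sum_apply, LinearMap.proj_apply,
    smul_eq_mul, hSv', Finset.sum_add_distrib, Finset.sum_sub_distrib, h1]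
  have := k.2
  by_cases hk : (k : ℕ) + 1 = l
  · simp only [if_pos hk, h2]
    rw [if_pos this, if_neg (by omega)]
    norm_num
  · simp only [if_neg hk, Finset.sum_const_zero]
    rw [if_pos this, if_pos (by omega)]
    norm_num

/-- For even rank all signs are negative, so `ω` is the negated reversal and there is no middle
coordinate. It exchanges the nodes `0` and `ℓ` as well as `1` and `ℓ - 1`, which makes invariant
weighted sums even; the cocycle is the half-sum. -/
theorem foldingFormula_typeD_even (hl : 4 ≤ l) (hpar : Even l) (hf : Function.Injective f)
    (hθ : IsHighestRoot b θ) (hΦ : f '' Set.range P.root = rootsD l)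
    (hS : ∀ k, f (P.root (e k)) = S k) (hSv : IsSimpleD S)
    (hπ : ∀ i, P.weylGroupToPerm ω (node θ e i) = node θ e (π i)) (h0 : (π 0 : ℕ) = l) :
    FoldingFormula P ω (rootsC (l / 2)) (rootsB (l / 2)) 2 := by
  have hω : ω ≠ 1 := ne_one_of_node_perm hθ hπ fun h => by simp [h] at h0; omega
  obtain ⟨τ, δ, hδ, hτ⟩ := exists_signed_perm_D hf hΦ ω
  obtain ⟨hsig, h1, -, -⟩ := signs_typeD_last hl hδ
    (nodeEntry_eq hτ hπ (map_node_typeD hl hθ hΦ hS hSv)) h0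
  have hsig' : ∀ a, δ a = -1 := by
    intro a
    obtain ⟨m, hm⟩ := hpar
    rw [(hsig a).2, Odd.neg_one_pow ⟨m - 1, by omega⟩, ite_self]
  have hact : ∀ v a, f (ω • v) a.rev = -f v a := by
    intro v a
    have := hτ v a
    rw [(hsig a).1, hsig'] at this
    rw [this]
    simp [sgnR]
  have horder : orderOf ω = 2 := by
    refine orderOf_eq_two_of_signed hf hτ hω ?_ ?_
    · intro a
      rw [(hsig a).1, (hsig _).1, Fin.rev_rev]
    · intro a
      rw [hsig', hsig', Int.units_mul_self]
  have h0' : π 0 = Fin.last l := Fin.ext h0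
  have h1' : π ⟨1, by omega⟩ = ⟨l - 1, by omega⟩ := Fin.ext h1
  have h2' : π (Fin.last l) = 0 := by rw [← h0', node_perm_involutive hθ hπ horder]
  have hcoc : ∀ χ : E, (∀ v, P.toLinearMap v χ = halfSum l (f v)) → IsCocycle ω χ 2 := by
    intro χ hχ
    refine isCocycle_of_nodes hπ two_pos
      (fun i => (if i = 0 then 1 else 0) + (if i = Fin.last l then 1 else 0))
      (indicator_swap h0' h2') ?_ ?_ ?_
    · rw [sum_mark_typeD hl hf hθ hΦ hS hSv]
      simp only [Finset.sum_add_distrib, Finset.sum_ite_eq', Finset.mem_univ, if_true]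
      simp only [Fin.ext_iff, Fin.val_zero, Fin.val_last]
      rw [if_neg (by omega), if_neg (by omega), if_neg (by omega), if_neg (by omega),
        if_neg (by omega), if_neg (by omega)]
      norm_num
    · intro y hy
      rw [sum_mark_typeD hl hf hθ hΦ hS hSv]
      have e1 := hy 0
      have e2 := hy ⟨1, by omega⟩
      rw [h0'] at e1
      rw [h1'] at e2
      rw [e1, e2]
      exact ⟨∑ i, y i - y 0 - y ⟨1, by omega⟩, by push_cast; ring⟩
    · intro k
      rw [hχ, hS, halfSum_simple_typeD hl hSv]
      simp only [Fin.ext_iff, Fin.val_zero, Fin.val_succ, Fin.val_last]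
      push_cast
      clear * -
      grind
  have h : 2 * (l / 2 + 0) ≤ l := by omega
  have hsurj : ∀ a, ∃ i η, a = mirror 0 h i η := by
    intro a
    by_contra hne
    push Not at hne
    have := (mirror_ne_iff 0 h a).1 fun i η hi => hne i η hi.symm
    obtain ⟨m, hm⟩ := hpar
    omega
  refine foldingFormula_signed_pair hΦ (by omega) (mirror_injective 0 h) horder hcoc
    exists_dual_point (fun v => foldSigned_mirror_congr fun i η => hact v _) ?_ hsurj
  intro v hv hv0
  apply hf
  rw [map_zero]
  ext a
  obtain ⟨i, η, rfl⟩ := hsurj a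
  refine apply_mirror_eq_zero (fun i η => ?_) hv0 i η
  conv_lhs => rw [← hv]
  exact hact v _

end TypeD

end RootPairing

/-! ### Type `D` of odd rank, the last node: order four. -/

/-- The weight `2, 1, …, 1, 0`. -/
noncomputable def spinWeight (l : ℕ) (hl : 4 ≤ l) : (Fin l → ℝ) →ₗ[ℝ] ℝ :=
  (2 : ℝ) • halfSum l + LinearMap.proj ⟨0, by omega⟩ - LinearMap.proj ⟨l - 1, by omega⟩

theorem spinWeight_apply {l : ℕ} (hl : 4 ≤ l) (v : Fin l → ℝ) :
    spinWeight l hl v = 2 * halfSum l v + v ⟨0, by omega⟩ - v ⟨l - 1, by omega⟩ := rfl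

theorem spinWeight_single {l : ℕ} (hl : 4 ≤ l) (a : Fin l) (c : ℝ) :
    spinWeight l hl (Pi.single a c) =
      ((if (a : ℕ) = 0 then 2 else if (a : ℕ) + 1 = l then 0 else 1 : ℤ) : ℝ) * c := by
  rw [spinWeight_apply, halfSum_single]
  simp only [Pi.single_apply, Fin.ext_iff]
  by_cases h0 : (a : ℕ) = 0
  · rw [if_pos h0.symm, if_neg (by omega), if_pos h0]
    push_cast
    ring
  · rw [if_neg fun h => h0 h.symm, if_neg h0]
    by_cases h1 : (a : ℕ) + 1 = l
    · rw [if_pos (by omega), if_pos h1]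
      push_cast
      ring
    · rw [if_neg (by omega), if_neg h1]
      push_cast
      ring

namespace RootPairing

section TypeD

set_option linter.unusedSectionVars false

variable {ι V E : Type*} [Finite ι] [AddCommGroup V] [Module ℝ V] [AddCommGroup E] [Module ℝ E]
  {P : RootPairing ι ℝ V E} [P.IsRootSystem] [P.IsCrystallographic] [P.IsReduced] {b : P.Base}
  {l : ℕ} {θ : ι} {e : Fin l ≃ b.support} {f : V →ₗ[ℝ] (Fin l → ℝ)}
  {ω : P.weylGroup} {π : Equiv.Perm (Fin (l + 1))} {S : Fin l → Fin l → ℝ}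

/-- The four nodes of mark one lie in one cycle, and `π` reverses the others. An invariant `y` is
thus symmetric under reversal and its weighted sum is `2 ∑ y_i - 4 y_0`, where `∑ y_i` is even by
`even_sum_of_rev`; so it is divisible by four. The weight is one on `α_1`, `α_{ℓ-1}` and `α_ℓ`, and
zero on the other simple roots. -/
theorem isCocycle_typeD_odd (hl : 4 ≤ l) (hpar : Odd l) (hf : Function.Injective f)
    (hθ : IsHighestRoot b θ) (hΦ : f '' Set.range P.root = rootsD l)
    (hS : ∀ k, f (P.root (e k)) = S k) (hSv : IsSimpleD S)
    (hπ : ∀ i, P.weylGroupToPerm ω (node θ e i) = node θ e (π i)) (h0 : (π 0 : ℕ) = l)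
    (h1 : (π ⟨1, by omega⟩ : ℕ) = l - 1)
    (hmid : ∀ i : Fin (l + 1), 2 ≤ (i : ℕ) → (i : ℕ) + 2 ≤ l → (π i : ℕ) = l - i)
    (hlast : (π (Fin.last l) : ℕ) = 1) (χ : E)
    (hχ : ∀ v, P.toLinearMap v χ = spinWeight l hl (f v)) : IsCocycle ω χ 4 := by
  have h0' : π 0 = Fin.last l := Fin.ext h0
  have h1' : π ⟨1, by omega⟩ = ⟨l - 1, by omega⟩ := Fin.ext h1
  have hlast' : π (Fin.last l) = ⟨1, by omega⟩ := Fin.ext hlast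
  have hmark := mark_typeD hl hf hθ hΦ hS hSv
  have hmp := fun i => mark_perm hθ hπ i
  simp only [hmark] at hmp
  refine isCocycle_of_nodes hπ (by norm_num) (fun i => if (i : ℕ) ≤ 1 ∨ l ≤ i + 1 then 1 else 0)
    ?_ ?_ ?_ ?_
  · intro i
    have := hmp i
    clear * - this
    grind
  · have : ∀ i : Fin (l + 1), mark θ e i * (if (i : ℕ) ≤ 1 ∨ l ≤ i + 1 then 1 else 0) =
        ((if i = 0 then 1 else 0) + (if i = ⟨1, by omega⟩ then 1 else 0)) +
        ((if i = ⟨l - 1, by omega⟩ then 1 else 0) + (if i = Fin.last l then 1 else 0)) := by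
      intro i
      rw [hmark]
      simp only [Fin.ext_iff, Fin.val_zero, Fin.val_last]
      have := i.2
      clear * - hl this
      grind
    rw [Finset.sum_congr rfl fun i _ => this i]
    simp only [Finset.sum_add_distrib, Finset.sum_ite_eq', Finset.mem_univ, if_true]
    norm_num
  · intro y hy
    rw [sum_mark_typeD hl hf hθ hΦ hS hSv]
    have e1 := hy 0
    have e2 := hy ⟨1, by omega⟩
    have e3 := hy (Fin.last l)
    rw [h0'] at e1
    rw [h1'] at e2
    rw [hlast'] at e3
    have hrev : ∀ i, y i.rev = y i := by
      intro i
      have hi := i.2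
      by_cases hm : 2 ≤ (i : ℕ) ∧ (i : ℕ) + 2 ≤ l
      · rw [← hy i]
        congr 1
        apply Fin.ext
        rw [Fin.val_rev, hmid i hm.1 hm.2]
        omega
      · have : i = 0 ∨ i = ⟨1, by omega⟩ ∨ i = ⟨l - 1, by omega⟩ ∨ i = Fin.last l := by
          simp only [Fin.ext_iff, Fin.val_zero, Fin.val_last]
          omega
        have hr : ∀ (x : ℕ) (hx : x < l + 1),
            (⟨x, hx⟩ : Fin (l + 1)).rev = ⟨l - x, by omega⟩ := by
          intro x hx
          apply Fin.ext
          rw [Fin.val_rev]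
          simp
        rcases this with h | h | h | h <;> rw [h]
        · rw [Fin.rev_zero, e1]
        · rw [hr, e2]
        · rw [hr, e2]
          congr 1
          apply Fin.ext
          simp
          omega
        · rw [Fin.rev_last, e1]
    obtain ⟨m, hm⟩ := even_sum_of_rev hpar hrev
    rw [hm, e2, e3, e1]
    exact ⟨m - y 0, by push_cast; ring⟩
  · intro k
    rw [hχ, hS, spinWeight_apply, halfSum_simple_typeD hl hSv, hSv, hSv, Fin.val_succ]
    push_cast
    have := k.2
    clear * - this hl
    grind

/-- The square of `ω` negates the first and the last coordinate and fixes the others, so it is an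
involution different from the identity. -/
theorem orderOf_typeD_odd (hl : 4 ≤ l) (hf : Function.Injective f)
    (hΦ : f '' Set.range P.root = rootsD l)
    (hact : ∀ v (a : Fin l), f (ω • v) a.rev = (if (a : ℕ) + 1 < l then -1 else 1) * f v a) :
    orderOf ω = 4 := by
  have hsq : ∀ v (a : Fin l), f (ω ^ 2 • v) a =
      (if (a : ℕ) + 1 < l then -1 else 1) * (if (a : ℕ) = 0 then 1 else -1) * f v a := by
    intro v a
    have h1 := hact (ω • v) a.rev
    rw [hact v a, Fin.rev_rev, Fin.val_rev] at h1
    rw [pow_two, mul_smul, h1]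
    have := a.2
    split_ifs <;> first | omega | ring
  have h2 : ¬ ω ^ 2 = 1 := by
    intro h
    have hr := pair_mem (n := l) (i := ⟨0, by omega⟩) (j := ⟨1, by omega⟩) (by simp) 1 1
    change _ ∈ rootsD l at hr
    rw [← hΦ] at hr
    obtain ⟨v, -, hv⟩ := hr
    have := hsq v ⟨0, by omega⟩
    rw [h, one_smul, hv, Pi.add_apply, Pi.single_eq_same, Pi.single_eq_of_ne (by simp), if_pos rfl,
      if_pos (by simp; omega), sgnR_one] at this
    norm_num at this
  have h4 : ω ^ 4 = 1 := by
    apply weylGroup_ext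
    intro v
    apply hf
    ext a
    rw [show 4 = 2 + 2 from rfl, pow_add, mul_smul, hsq, hsq, one_smul]
    split_ifs <;> ring
  exact orderOf_eq_prime_pow (p := 2) (n := 1) h2 h4

/-- The first, middle and last coordinates fold to zero and have the weights 2, 1 and 0; all others
have weight 1. Roots with zero fold are combinations of two of these three, or sums of two mirrored
coordinates up to sign. None has weight divisible by four, and the classes 1, 2 and 3 occur. Over `±
e_i ± e_j` the weights are even and take both even classes, so `s = 2`; over `± e_i` all classes
occur, so `s = 4`. The vectors `± 2 e_i` have only the class zero, but their condition is implied by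
that of `± 4 e_i`, which comes from `± e_i`. This leaves twice `C_n`, obtained from `BC_n` by
`dropHalf`. -/
theorem foldingFormula_typeD_odd (hl : 4 ≤ l) (hpar : Odd l) (hf : Function.Injective f)
    (hθ : IsHighestRoot b θ) (hΦ : f '' Set.range P.root = rootsD l)
    (hS : ∀ k, f (P.root (e k)) = S k) (hSv : IsSimpleD S)
    (hπ : ∀ i, P.weylGroupToPerm ω (node θ e i) = node θ e (π i)) (h0 : (π 0 : ℕ) = l) :
    FoldingFormula P ω (rootsBC ((l - 3) / 2)) (rootsC ((l - 3) / 2)) 2 := by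
  obtain ⟨τ, δ, hδ, hτ⟩ := exists_signed_perm_D hf hΦ ω
  obtain ⟨hsig, h1, hmid, hlast⟩ := signs_typeD_last hl hδ
    (nodeEntry_eq hτ hπ (map_node_typeD hl hθ hΦ hS hSv)) h0
  obtain ⟨m, hm⟩ := id hpar
  have hact : ∀ v (a : Fin l), f (ω • v) a.rev = (if (a : ℕ) + 1 < l then -1 else 1) * f v a := by
    intro v a
    have := hτ v a
    rw [(hsig a).1, (hsig a).2, Even.neg_one_pow ⟨m, by omega⟩] at this
    rw [this]
    split_ifs <;> simp [sgnR]
  have horder := orderOf_typeD_odd hl hf hΦ hact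
  have hcoc := isCocycle_typeD_odd hl hpar hf hθ hΦ hS hSv hπ h0 h1 hmid (hlast hpar)
  have h : 2 * ((l - 3) / 2 + 1) ≤ l := by omega
  have hg := mirror_injective 1 h
  have hout : ∀ a : Fin l, (∀ i η, mirror 1 h i η ≠ a) ↔
      (a : ℕ) = 0 ∨ (a : ℕ) = m ∨ (a : ℕ) + 1 = l := by
    intro a
    rw [mirror_ne_iff]
    have := a.2
    omega
  have hclass : ∀ a, (∃ i η, a = mirror 1 h i η) ∨ ∀ i η, mirror 1 h i η ≠ a := by
    intro a
    by_cases h' : ∃ i η, a = mirror 1 h i η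
    · exact Or.inl h'
    · exact Or.inr fun i η hi => h' ⟨i, η, hi.symm⟩
  have hmirror : ∀ i η, (mirror 1 h i η : ℕ) ≠ 0 ∧ (mirror 1 h i η : ℕ) + 1 ≠ l := by
    intro i η
    have := mt (hout (mirror 1 h i η)).2 fun h' => h' i η rfl
    tauto
  have hneg : ∀ v i η, f (ω • v) (mirror 1 h i η).rev = -f v (mirror 1 h i η) := by
    intro v i η
    have := (mirror 1 h i η).2
    have := (hmirror i η).2
    rw [hact, if_pos (by omega), neg_one_mul]
  have hXg : ∀ i η c, spinWeight l hl (Pi.single (mirror 1 h i η) c) = c := by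
    intro i η c
    rw [spinWeight_single, if_neg (hmirror i η).1, if_neg (hmirror i η).2, Int.cast_one, one_mul]
  have hXint : ∀ (a a' : Fin l) (s t : ℤˣ), ∃ k : ℤ,
      spinWeight l hl (Pi.single a (sgnR s) + Pi.single a' (sgnR t)) = k := by
    intro a a' s t
    rw [map_add, spinWeight_single, spinWeight_single, sgnR, sgnR, ← Int.cast_mul, ← Int.cast_mul,
      ← Int.cast_add]
    exact ⟨_, rfl⟩
  -- A killed coordinate with a sign has any prescribed weight modulo four: the last one gives 0,
  -- the middle one 1 or, negated, 3, and the first one 2.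
  have hpartner : ∀ c : ℤ, ∃ a : Fin l, (∀ i η, mirror 1 h i η ≠ a) ∧ ∃ t : ℤˣ, ∃ k : ℤ,
      spinWeight l hl (Pi.single a (sgnR t)) = c + 4 * k := by
    intro c
    have hc : c % 4 = 0 ∨ c % 4 = 1 ∨ c % 4 = 2 ∨ c % 4 = 3 := by omega
    have hc' := Int.mul_ediv_add_emod c 4
    rcases hc with hc | hc | hc | hc
    · refine ⟨⟨l - 1, by omega⟩, (hout _).2 (by simp; omega), 1, -(c / 4), ?_⟩
      rw [spinWeight_single, if_neg (by simp; omega), if_pos (by simp; omega), ← hc', hc]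
      push_cast
      ring_nf
      simp
    · refine ⟨⟨m, by omega⟩, (hout _).2 (by simp), 1, -(c / 4), ?_⟩
      rw [spinWeight_single, if_neg (by simp; omega), if_neg (by simp; omega), sgnR_one]
      have : (c : ℝ) = 4 * (c / 4 : ℤ) + 1 := by exact_mod_cast (show c = 4 * (c / 4) + 1 by omega)
      push_cast
      linarith
    · refine ⟨⟨0, by omega⟩, (hout _).2 (by simp), 1, -(c / 4), ?_⟩
      rw [spinWeight_single, if_pos (by simp), sgnR_one]
      have : (c : ℝ) = 4 * (c / 4 : ℤ) + 2 := by exact_mod_cast (show c = 4 * (c / 4) + 2 by omega)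
      push_cast
      linarith
    · refine ⟨⟨m, by omega⟩, (hout _).2 (by simp), -1, -(c / 4) - 1, ?_⟩
      rw [spinWeight_single, if_neg (by simp; omega), if_neg (by simp; omega), sgnR_neg, sgnR_one]
      have : (c : ℝ) = 4 * (c / 4 : ℤ) + 3 := by exact_mod_cast (show c = 4 * (c / 4) + 3 by omega)
      push_cast
      linarith
  have hHg : ∀ i η a s t, (∀ i η, mirror 1 h i η ≠ a) → foldSigned (mirror 1 h)
      (Pi.single (mirror 1 h i η) (sgnR s) + Pi.single a (sgnR t)) = Pi.single i (sgnR (η * s)) := by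
    intro i η a s t ha
    rw [map_add, foldSigned_single_sgn hg, foldSigned_single_of_notMem ha, add_zero]
  have hdet := determines_dropHalf (V := V) (rootsBC ((l - 3) / 2))
  rw [dropHalf_rootsBC] at hdet
  have hcomm : ∀ (a a' : Fin l) (s t : ℤˣ),
      (Pi.single a (sgnR s) + Pi.single a' (sgnR t) : Fin l → ℝ) =
      Pi.single a' (sgnR t) + Pi.single a (sgnR s) := fun a a' s t => add_comm _ _
  refine foldingFormula_of_model hΦ (foldSigned (mirror 1 h)) (spinWeight l hl) hdet horder
    (by norm_num) hcoc exists_dual_point (fun v => foldSigned_mirror_congr (hneg v)) ?_ ?_ ?_ ?_ ?_ ?_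
  · intro v hv hv0
    have hz := apply_mirror_eq_zero (u := f v) (fun i η => by
      have := hneg v i η
      rwa [hv] at this) hv0
    have hact' := hact v
    rw [hv] at hact'
    apply hf
    rw [map_zero]
    ext a
    rw [Pi.zero_apply]
    rcases hclass a with ⟨i, η, rfl⟩ | ha
    · exact hz i η
    · have hends : f v ⟨0, by omega⟩ = 0 ∧ f v ⟨l - 1, by omega⟩ = 0 := by
        have e1 := hact' ⟨0, by omega⟩
        have e2 := hact' ⟨l - 1, by omega⟩
        rw [if_pos (by simp; omega)] at e1
        rw [if_neg (by simp; omega)] at e2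
        have r1 : (⟨0, by omega⟩ : Fin l).rev = ⟨l - 1, by omega⟩ := by
          apply Fin.ext
          rw [Fin.val_rev]
        have r2 : (⟨l - 1, by omega⟩ : Fin l).rev = ⟨0, by omega⟩ := by
          rw [← r1, Fin.rev_rev]
        rw [r1] at e1
        rw [r2] at e2
        constructor <;> linarith
      rcases (hout a).1 ha with h' | h' | h'
      · rw [show a = ⟨0, by omega⟩ from Fin.ext h']
        exact hends.1
      · have e1 := hact' a
        rw [if_pos (by omega), show a.rev = a from Fin.ext (by rw [Fin.val_rev]; omega)] at e1
        linarith
      · rw [show a = ⟨l - 1, by omega⟩ from Fin.ext (by simp; omega)]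
        exact hends.2
  · intro r
    constructor
    · intro hr
      refine ⟨?_, fun h' => zero_notMem_rootsBC _ (h' ▸ hr)⟩
      rcases hr with (hr | ⟨i, s, rfl⟩) | hr
      · obtain ⟨β, hβ, h', -⟩ := exists_lift_pair hg hr 0
        exact ⟨β, hβ, h'⟩
      · obtain ⟨a, ha, -⟩ := hpartner 0
        exact ⟨_, pair_mem (ha i 1) s 1, by rw [hHg i 1 a s 1 ha, one_mul, mul_one]⟩
      · obtain ⟨β, hβ, h', -⟩ := exists_lift_axis_two hg hr
        exact ⟨β, hβ, h'⟩
    · rintro ⟨⟨_, ⟨a, a', haa, s, t, rfl⟩, rfl⟩, hr0⟩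
      rcases hclass a with ⟨i, η, rfl⟩ | ha <;> rcases hclass a' with ⟨j, η', rfl⟩ | ha'
      · rcases foldSigned_pair hg haa s t with h' | ⟨-, -, h'⟩ | ⟨-, -, h'⟩
        · exact Or.inl (Or.inl h')
        · exact absurd h' hr0
        · rw [h']
          exact Or.inr (axis_mem i _ 2)
      · rw [hHg i η a' s t ha']
        exact Or.inl (Or.inr (axis_one_mem i _))
      · rw [hcomm, hHg j η' a t s ha]
        exact Or.inl (Or.inr (axis_one_mem j _))
      · rw [map_add, foldSigned_single_of_notMem ha, foldSigned_single_of_notMem ha', add_zero] at hr0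
        exact absurd rfl hr0
  · rintro _ ⟨a, a', haa, s, t, rfl⟩ hβ0 ⟨k, hk⟩
    have hint : ∀ s : ℤˣ, sgnR s = ((s : ℤ) : ℝ) := fun s => rfl
    rcases hclass a with ⟨i, η, rfl⟩ | ha <;> rcases hclass a' with ⟨j, η', rfl⟩ | ha'
    · rcases foldSigned_pair hg haa s t with h' | ⟨-, rfl, -⟩ | ⟨-, -, h'⟩
      · rw [hβ0] at h'
        exact zero_notMem_pairVectors _ h'
      · rw [map_add, hXg, hXg, hint] at hk
        have hk' : ((t : ℤ) + t : ℤ) = 4 * k := by exact_mod_cast hk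
        rcases units_val_eq t with h' | h' <;> omega
      · rw [hβ0] at h'
        exact zero_notMem_axisVectors two_ne_zero _ (h' ▸ axis_mem i (η * s) 2)
    · rw [hHg i η a' s t ha', single_sgnR_eq_zero_iff] at hβ0
      exact hβ0
    · rw [hcomm, hHg j η' a t s ha, single_sgnR_eq_zero_iff] at hβ0
      exact hβ0
    · rw [map_add, spinWeight_single, spinWeight_single, hint, hint] at hk
      have hk' : ((if (a : ℕ) = 0 then 2 else if (a : ℕ) + 1 = l then 0 else 1) * (s : ℤ) +
          (if (a' : ℕ) = 0 then 2 else if (a' : ℕ) + 1 = l then 0 else 1) * (t : ℤ) : ℤ) = 4 * k := by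
        exact_mod_cast hk
      rw [hout] at ha ha'
      have haa' : (a : ℕ) ≠ a' := fun h' => haa (Fin.ext h')
      rcases units_val_eq s with h1 | h1 <;> rcases units_val_eq t with h2 | h2 <;>
        rw [h1, h2] at hk' <;> split_ifs at hk' <;> omega
  · intro r hr1 hr2
    push_cast at hr2
    have hn : ∀ x y : Fin l, (x : ℕ) ≠ y → (x : ℕ) = 0 ∨ (x : ℕ) = m ∨ (x : ℕ) + 1 = l →
        (y : ℕ) = 0 ∨ (y : ℕ) = m ∨ (y : ℕ) + 1 = l →
        ((if (x : ℕ) = 0 then 2 else if (x : ℕ) + 1 = l then 0 else 1) +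
        (if (y : ℕ) = 0 then 2 else if (y : ℕ) + 1 = l then 0 else 1) : ℤ) = r →
        ∃ β ∈ rootsD l, foldSigned (mirror 1 h) β = 0 ∧
          ∃ k : ℤ, spinWeight l hl β = r + (4 : ℕ) * k := by
      intro x y hxy hx hy hr
      refine ⟨_, pair_mem (fun h' => hxy (congrArg Fin.val h')) 1 1, ?_, 0, ?_⟩
      · rw [map_add, foldSigned_single_of_notMem ((hout x).2 hx),
          foldSigned_single_of_notMem ((hout y).2 hy), add_zero]
      · rw [map_add, spinWeight_single, spinWeight_single, ← hr, sgnR_one]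
        push_cast
        ring
    have hr : r = 1 ∨ r = 2 ∨ r = 3 := by omega
    rcases hr with rfl | rfl | rfl
    · exact hn ⟨m, by omega⟩ ⟨l - 1, by omega⟩ (by simp; omega) (by simp) (by simp; omega)
        (by simp; omega)
    · exact hn ⟨0, by omega⟩ ⟨l - 1, by omega⟩ (by simp; omega) (by simp) (by simp; omega)
        (by simp; omega)
    · exact hn ⟨0, by omega⟩ ⟨m, by omega⟩ (by simp; omega) (by simp) (by simp)
        (by simp; omega)
  · rintro γ (hγ | ⟨i, s, rfl⟩)
    -- On vectors supported in the folded coordinates the weight is twice the half-sum, so a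
    -- half-sum of arbitrary class modulo two gives the multiples of two modulo four.
    · obtain ⟨β₀, hβ₀, h₀, -⟩ := exists_lift_pair hg hγ 0
      refine ⟨β₀, hβ₀, 2, by norm_num, by rw [h₀], fun u => ?_⟩
      obtain ⟨β, hβ, h', ⟨k, hk⟩, hsupp⟩ := exists_lift_pair hg hγ u
      refine ⟨β, hβ, by rw [h', h₀], k, ?_⟩
      rw [spinWeight_apply, hk, hsupp _ ((hout _).2 (by simp)),
        hsupp _ ((hout _).2 (by simp; omega))]
      norm_num
      ring
    · obtain ⟨a, ha, -⟩ := hpartner 0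
      refine ⟨_, pair_mem (ha i 1) s 1, 4, dvd_rfl, ?_, fun u => ?_⟩
      · rw [hHg i 1 a s 1 ha, one_mul, ← Pi.single_smul, ← Pi.single_smul, smul_eq_mul, smul_eq_mul]
        congr 1
        push_cast
        ring
      · obtain ⟨a', ha', t, k, hk⟩ := hpartner (u - s)
        refine ⟨_, pair_mem (ha' i 1) s t, by rw [hHg i 1 a' s t ha', hHg i 1 a s 1 ha], k, ?_⟩
        rw [map_add, hXg, hk, sgnR]
        push_cast
        norm_num
        ring
  · rintro _ ⟨a, a', haa, s, t, rfl⟩ hβ0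
    obtain ⟨x, hx⟩ := hXint a a' s t
    have hfour : ∀ (i : Fin ((l - 3) / 2)) (σ : ℤˣ), foldSigned (mirror 1 h)
        (Pi.single a (sgnR s) + Pi.single a' (sgnR t)) = Pi.single i (sgnR σ) →
        ∃ γ ∈ rootsC ((l - 3) / 2), ∃ s_1 : ℤ, ((2 : ℕ) : ℝ) • γ = (s_1 : ℝ) •
          foldSigned (mirror 1 h) (Pi.single a (sgnR s) + Pi.single a' (sgnR t)) ∧
          ∃ k : ℤ, s_1 * spinWeight l hl (Pi.single a (sgnR s) + Pi.single a' (sgnR t)) =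
            (4 : ℕ) * k := by
      intro i σ hσ
      refine ⟨_, Or.inr (axis_mem i σ 2), 4, ?_, x, ?_⟩
      · rw [hσ, ← Pi.single_smul, ← Pi.single_smul, smul_eq_mul, smul_eq_mul]
        congr 1
        push_cast
        ring
      · rw [hx]
        norm_num
    rcases hclass a with ⟨i, η, rfl⟩ | ha <;> rcases hclass a' with ⟨j, η', rfl⟩ | ha'
    · have hts : t = s ∨ t = -s := units_eq_or_eq_neg s t
      rcases foldSigned_pair hg haa s t with h' | ⟨-, -, h'⟩ | ⟨-, ht, h'⟩
      · refine ⟨_, Or.inl h', 2, by push_cast; rfl, ?_⟩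
        rw [map_add, hXg, hXg]
        rcases hts with rfl | rfl
        · exact ⟨t, by rw [sgnR]; push_cast; ring⟩
        · exact ⟨0, by rw [sgnR_neg]; push_cast; ring⟩
      · exact absurd h' hβ0
      -- The fold is `± 2 e_i` with weight zero; taking it twice embeds its condition in that of the
      -- element `± 4 e_i` of the arrangement.
      · refine ⟨_, Or.inr (axis_mem i (η * s) 2), 2, ?_, 0, ?_⟩
        · rw [h']
          push_cast
          rfl
        · rw [map_add, hXg, hXg, ht, sgnR_neg]
          push_cast
          ring
    · exact hfour i _ (hHg i η a' s t ha')
    · exact hfour j _ (by rw [hcomm, hHg j η' a t s ha])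
    · rw [map_add, foldSigned_single_of_notMem ha, foldSigned_single_of_notMem ha', add_zero] at hβ0
      exact absurd rfl hβ0

end TypeD

end RootPairing

/-! ### Type `D`: both spin nodes, and the rows of the table. -/

namespace RootPairing

section TypeD

set_option linter.unusedSectionVars false

variable {ι V E : Type*} [Finite ι] [AddCommGroup V] [Module ℝ V] [AddCommGroup E] [Module ℝ E]
  {P : RootPairing ι ℝ V E} [P.IsRootSystem] [P.IsCrystallographic] [P.IsReduced] {b : P.Base}
  {l : ℕ} {θ : ι} {e : Fin l ≃ b.support} {f : V →ₗ[ℝ] (Fin l → ℝ)}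
  {ω : P.weylGroup} {π : Equiv.Perm (Fin (l + 1))} {S : Fin l → Fin l → ℝ}

/-- The change of the sign of the last coordinate. -/
def negLast (l : ℕ) : (Fin l → ℝ) →ₗ[ℝ] (Fin l → ℝ) :=
  LinearMap.pi fun a => (if (a : ℕ) + 1 = l then (-1 : ℝ) else 1) • LinearMap.proj a

theorem negLast_apply (v : Fin l → ℝ) (a : Fin l) :
    negLast l v a = (if (a : ℕ) + 1 = l then -1 else 1) * v a := rfl

theorem negLast_negLast (v : Fin l → ℝ) : negLast l (negLast l v) = v := by
  ext a
  rw [negLast_apply, negLast_apply]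
  split_ifs <;> ring

theorem negLast_mem {v : Fin l → ℝ} (hv : v ∈ rootsD l) : negLast l v ∈ rootsD l := by
  refine IsSignedImage.mem_pairVectors (τ := 1)
    (δ := fun a => if (a : ℕ) + 1 = l then -1 else 1) (fun a => ?_) hv
  rw [_root_.Equiv.Perm.one_apply, negLast_apply]
  split_ifs with h <;> simp [sgnR, h]

theorem negLast_image (hΦ : f '' Set.range P.root = rootsD l) :
    (negLast l ∘ₗ f) '' Set.range P.root = rootsD l := by
  rw [LinearMap.coe_comp, Set.image_comp, hΦ]
  exact Set.Subset.antisymm (Set.image_subset_iff.2 fun v hv => negLast_mem hv)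
    fun v hv => ⟨_, negLast_mem hv, negLast_negLast v⟩

/-- The diagram automorphism that exchanges the last two simple roots. -/
theorem isSimpleD_swap (hl : 4 ≤ l) (hSv : IsSimpleD S) :
    IsSimpleD fun k => negLast l
      (S (Equiv.swap (⟨l - 2, by omega⟩ : Fin l) ⟨l - 1, by omega⟩ k)) := by
  intro k a
  have hk := k.2
  have ha := a.2
  have h : ∀ x y : Fin l, ((Equiv.swap x y k : Fin l) : ℕ) =
      if (k : ℕ) = x then (y : ℕ) else if (k : ℕ) = y then (x : ℕ) else k := by
    intro x y
    simp only [_root_.Equiv.swap_apply_def, Fin.ext_iff]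
    split_ifs <;> rfl
  dsimp only
  rw [negLast_apply, hSv, h]
  clear * - hk ha hl
  grind

theorem node_swap (x y : Fin l) (i : Fin (l + 1)) :
    node θ ((_root_.Equiv.swap x y).trans e) i =
      node θ e (_root_.Equiv.swap x.succ y.succ i) := by
  induction i using Fin.cases with
  | zero =>
    rw [_root_.Equiv.swap_apply_of_ne_of_ne (Fin.succ_ne_zero x).symm (Fin.succ_ne_zero y).symm]
    rfl
  | succ k =>
    rw [node_succ, _root_.Equiv.trans_apply, ← node_succ (θ := θ)]
    congr 1
    simp only [_root_.Equiv.swap_apply_def, Fin.succ_inj]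
    split_ifs <;> rfl

/-- The node `ℓ - 1` becomes the node `ℓ` after exchanging the last two simple roots in the
numbering and changing the sign of the last coordinate in the model. The formula itself mentions
neither choice. -/
theorem foldingFormula_typeD_last (hl : 4 ≤ l) (hf : Function.Injective f)
    (hθ : IsHighestRoot b θ) (hΦ : f '' Set.range P.root = rootsD l)
    (hS : ∀ k, f (P.root (e k)) = S k) (hSv : IsSimpleD S)
    (hπ : ∀ i, P.weylGroupToPerm ω (node θ e i) = node θ e (π i))
    (h0 : (π 0 : ℕ) = l - 1 ∨ (π 0 : ℕ) = l) :
    (Even l → FoldingFormula P ω (rootsC (l / 2)) (rootsB (l / 2)) 2) ∧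
      (Odd l → FoldingFormula P ω (rootsBC ((l - 3) / 2)) (rootsC ((l - 3) / 2)) 2) := by
  rcases h0 with h0 | h0
  · have hinj : Function.Injective (negLast l ∘ₗ f) := fun v v' h => hf (by
      rw [← negLast_negLast (f v), ← negLast_negLast (f v')]
      exact congrArg (negLast l) h)
    let x : Fin l := ⟨l - 2, by omega⟩
    let y : Fin l := ⟨l - 1, by omega⟩
    have hS' : ∀ k, (negLast l ∘ₗ f) (P.root ((_root_.Equiv.swap x y).trans e k)) =
        negLast l (S (_root_.Equiv.swap x y k)) := fun k => congrArg (negLast l) (hS _)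
    let σ : Equiv.Perm (Fin (l + 1)) := _root_.Equiv.swap x.succ y.succ
    have hπ' : ∀ i, P.weylGroupToPerm ω (node θ ((_root_.Equiv.swap x y).trans e) i) =
        node θ ((_root_.Equiv.swap x y).trans e) ((σ * π * σ) i) := by
      intro i
      rw [node_swap, hπ, node_swap, _root_.Equiv.Perm.mul_apply, _root_.Equiv.Perm.mul_apply,
        _root_.Equiv.swap_apply_self]
    have h0' : (((σ * π * σ) 0 : Fin (l + 1)) : ℕ) = l := by
      rw [_root_.Equiv.Perm.mul_apply, _root_.Equiv.Perm.mul_apply,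
        _root_.Equiv.swap_apply_of_ne_of_ne (Fin.succ_ne_zero x).symm (Fin.succ_ne_zero y).symm,
        show π 0 = x.succ from Fin.ext (by rw [h0]; simp [x]; omega),
        _root_.Equiv.swap_apply_left]
      simp [y]
      omega
    exact ⟨fun hpar => foldingFormula_typeD_even hl hpar hinj hθ (negLast_image hΦ) hS'
        (isSimpleD_swap hl hSv) hπ' h0',
      fun hpar => foldingFormula_typeD_odd hl hpar hinj hθ (negLast_image hΦ) hS'
        (isSimpleD_swap hl hSv) hπ' h0'⟩
  · exact ⟨fun hpar => foldingFormula_typeD_even hl hpar hf hθ hΦ hS hSv hπ h0,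
      fun hpar => foldingFormula_typeD_odd hl hpar hf hθ hΦ hS hSv hπ h0⟩

theorem exists_row_typeD (hl : 4 ≤ l) (hf : Function.Injective f)
    (hθ : IsHighestRoot b θ) (hΦ : f '' Set.range P.root = rootsD l)
    (hS : ∀ k : Fin l, f (P.root (e k)) =
      if (k : ℕ) + 1 = l then stdE l (l - 1) + stdE l l else stdE l (k + 1) - stdE l (k + 2))
    (hπ : ∀ i, P.weylGroupToPerm ω (node θ e i) = node θ e (π i)) (hπ0 : π 0 ≠ 0) :
    ∃ (n : ℕ) (R R' : Set (Fin n → ℝ)) (d : ℕ), FoldingTable (.D l hl) (π 0) R R' d ∧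
      FoldingFormula P ω R R' d := by
  have hSv := simple_typeD hl
  have h0 : (π 0 : ℕ) = 1 ∨ (π 0 : ℕ) = l - 1 ∨ (π 0 : ℕ) = l := by
    have h := mark_perm hθ hπ 0
    rw [mark_typeD hl hf hθ hΦ hS hSv, mark_zero] at h
    have h1 : (π 0 : ℕ) ≠ 0 := fun h' => hπ0 (Fin.ext h')
    have := (π 0).2
    split_ifs at h
    · omega
    · norm_num at h
  rcases h0 with h0 | h0
  · rw [h0]
    exact ⟨_, _, _, _, .D_one l hl, foldingFormula_typeD_one hl hf hθ hΦ hS hSv hπ h0⟩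
  · obtain ⟨h1, h2⟩ := foldingFormula_typeD_last hl hf hθ hΦ hS hSv hπ h0
    rcases Nat.even_or_odd l with hpar | hpar
    · exact ⟨_, _, _, _, .D_even l _ hl hpar h0, h1 hpar⟩
    · exact ⟨_, _, _, _, .D_odd l _ hl hpar h0, h2 hpar⟩

end TypeD

end RootPairing

/-! ### Root systems given by lists of integral vectors -/

/-- A multiple of an integral vector. -/
def scaledVec {n : ℕ} (s : ℝ) (u : Fin n → ℤ) : Fin n → ℝ := fun a => s * u a

/-- The multiples of the vectors of a list. -/
def scaledSet {n : ℕ} (s : ℝ) (L : List (Fin n → ℤ)) : Set (Fin n → ℝ) :=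
  {v | ∃ u ∈ L, v = scaledVec s u}

section Scaled

variable {n N : ℕ} {s : ℝ}

theorem scaledVec_mem (s : ℝ) {L : List (Fin n → ℤ)} {u : Fin n → ℤ} (hu : u ∈ L) :
    scaledVec s u ∈ scaledSet s L := ⟨u, hu, rfl⟩

theorem scaledVec_injective (hs : s ≠ 0) : Function.Injective (scaledVec (n := n) s) := by
  intro u u' h
  ext a
  have := congrFun h a
  simpa [scaledVec, hs] using this

theorem scaledVec_mem_iff (hs : s ≠ 0) {L : List (Fin n → ℤ)} {u : Fin n → ℤ} :
    scaledVec s u ∈ scaledSet s L ↔ u ∈ L :=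
  ⟨fun ⟨_, hw, h⟩ => scaledVec_injective hs h ▸ hw, scaledVec_mem s⟩

theorem scaledVec_add (s : ℝ) (u w : Fin n → ℤ) :
    scaledVec s (u + w) = scaledVec s u + scaledVec s w := by
  ext a
  simp [scaledVec, mul_add]

theorem scaledVec_sub (s : ℝ) (u w : Fin n → ℤ) :
    scaledVec s (u - w) = scaledVec s u - scaledVec s w := by
  ext a
  simp [scaledVec, mul_sub]

theorem scaledVec_neg (s : ℝ) (u : Fin n → ℤ) : scaledVec s (-u) = -scaledVec s u := by
  ext a
  simp [scaledVec]

theorem scaledVec_zero (s : ℝ) : scaledVec s (0 : Fin n → ℤ) = 0 := by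
  ext a
  simp [scaledVec]

theorem scaledVec_zsmul (s : ℝ) (c : ℤ) (u : Fin n → ℤ) :
    scaledVec s (c • u) = (c : ℝ) • scaledVec s u := by
  ext a
  simp only [scaledVec, Pi.smul_apply, smul_eq_mul]
  push_cast
  ring

theorem scaledVec_sum {α : Type*} (t : Finset α) (s : ℝ) (u : α → Fin n → ℤ) :
    scaledVec s (∑ i ∈ t, u i) = ∑ i ∈ t, scaledVec s (u i) := by
  ext a
  simp [scaledVec, Finset.mul_sum]

theorem scaledVec_dotProduct (s : ℝ) (u w : Fin n → ℤ) :
    scaledVec s u ⬝ᵥ scaledVec s w = s ^ 2 * (u ⬝ᵥ w : ℤ) := by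
  simp only [scaledVec, dotProduct]
  push_cast
  rw [Finset.mul_sum]
  exact Finset.sum_congr rfl fun a _ => by ring

/-- The linear map defined by a matrix with integral entries. -/
def intLin (A : Matrix (Fin n) (Fin N) ℤ) : (Fin N → ℝ) →ₗ[ℝ] (Fin n → ℝ) :=
  (A.map fun z : ℤ => (z : ℝ)).mulVecLin

theorem intLin_scaledVec (A : Matrix (Fin n) (Fin N) ℤ) (s : ℝ) (u : Fin N → ℤ) :
    intLin A (scaledVec s u) = scaledVec s (A.mulVec u) := by
  ext a
  simp only [intLin, Matrix.mulVecLin_apply, Matrix.mulVec, dotProduct, scaledVec, Matrix.map_apply]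
  push_cast
  rw [Finset.mul_sum]
  exact Finset.sum_congr rfl fun a _ => by ring

/-- The linear form defined by an integral vector. -/
def intForm (x : Fin N → ℤ) : (Fin N → ℝ) →ₗ[ℝ] ℝ := ∑ a, (x a : ℝ) • LinearMap.proj a

theorem intForm_scaledVec (x : Fin N → ℤ) (s : ℝ) (u : Fin N → ℤ) :
    intForm x (scaledVec s u) = s * (x ⬝ᵥ u : ℤ) := by
  simp only [intForm, LinearMap.sum_apply, LinearMap.smul_apply, LinearMap.proj_apply, smul_eq_mul,
    dotProduct, scaledVec]
  push_cast
  rw [Finset.mul_sum]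
  exact Finset.sum_congr rfl fun a _ => by ring

end Scaled

/-- The vectors with two nonzero entries, equal to `± c`. -/
def pairList (c : ℤ) (n : ℕ) : List (Fin n → ℤ) :=
  (List.finRange n).flatMap fun i => (List.finRange n).flatMap fun j =>
    if j ≤ i then [] else [c, -c].flatMap fun s => [c, -c].map fun t a =>
      if a = i then s else if a = j then t else 0

/-- The vectors with one nonzero entry, equal to `± c`. -/
def axisList (c : ℤ) (n : ℕ) : List (Fin n → ℤ) :=
  (List.finRange n).flatMap fun i => [c, -c].map fun s a => if a = i then s else 0

/-- The lists with `n` entries, all equal to `± 1`. -/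
def signs : ℕ → List (List ℤ)
  | 0 => [[]]
  | n + 1 => (signs n).flatMap fun v => [1 :: v, -1 :: v]

/-- The vectors with all entries equal to `± 1`. -/
def signList (n : ℕ) : List (Fin n → ℤ) := (signs n).map fun v i => v.getD i 0

/-- Twice the roots of `E_8`. -/
def listE8 : List (Fin 8 → ℤ) := pairList 2 8 ++ (signList 8).filter fun u =>
  u 0 * u 1 * u 2 * u 3 * u 4 * u 5 * u 6 * u 7 = 1

/-- Twice the roots of `E_7`. -/
def listE7 : List (Fin 8 → ℤ) := listE8.filter fun u => u 6 = -u 7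

/-- Twice the roots of `E_6`. -/
def listE6 : List (Fin 8 → ℤ) := listE8.filter fun u => u 5 = u 6 ∧ u 6 = -u 7

/-- Twice the roots of `F_4`. -/
def listF4 : List (Fin 4 → ℤ) := pairList 2 4 ++ axisList 2 4 ++ signList 4

/-- The roots of `G_2`. -/
def listG2 : List (Fin 3 → ℤ) :=
  ((pairList 1 3).filter fun u => u 0 + u 1 + u 2 = 0) ++
    (List.finRange 3).flatMap fun i => [1, -1].map fun s a => if a = i then 2 * s else -s

theorem mem_two_iff {α : Type*} (g : ℤ → α) (c : ℤ) (x : α) :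
    x ∈ [c, -c].map g ↔ ∃ s : ℤˣ, x = g (s * c) := by
  simp only [List.map_cons, List.map_nil, List.mem_cons, List.not_mem_nil, or_false]
  constructor
  · rintro (rfl | rfl)
    · exact ⟨1, by simp⟩
    · exact ⟨-1, by simp⟩
  · rintro ⟨s, rfl⟩
    rcases Int.units_eq_one_or s with rfl | rfl
    · exact Or.inl (by simp)
    · exact Or.inr (by simp)

theorem mem_pairList {c : ℤ} {n : ℕ} {u : Fin n → ℤ} : u ∈ pairList c n ↔
    ∃ i j : Fin n, i < j ∧ ∃ s t : ℤˣ, u = fun a => if a = i then s * c else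
      if a = j then t * c else 0 := by
  unfold pairList
  simp only [List.mem_flatMap, List.mem_finRange, true_and]
  refine exists_congr fun i => exists_congr fun j => ?_
  by_cases hij : j ≤ i
  · simp [hij]
  · rw [if_neg hij, List.mem_flatMap]
    simp only [mem_two_iff, List.mem_cons, List.not_mem_nil, or_false, not_le.1 hij, true_and]
    constructor
    · rintro ⟨x, rfl | rfl, t, h⟩
      · exact ⟨1, t, by simpa using h⟩
      · exact ⟨-1, t, by simpa using h⟩
    · rintro ⟨s, t, h⟩
      rcases Int.units_eq_one_or s with rfl | rfl
      · exact ⟨c, Or.inl rfl, t, by simpa using h⟩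
      · exact ⟨-c, Or.inr rfl, t, by simpa using h⟩

theorem mem_axisList {c : ℤ} {n : ℕ} {u : Fin n → ℤ} : u ∈ axisList c n ↔
    ∃ i : Fin n, ∃ s : ℤˣ, u = fun a => if a = i then s * c else 0 := by
  unfold axisList
  simp only [List.mem_flatMap, List.mem_finRange, true_and, mem_two_iff]

theorem mem_signs {n : ℕ} {v : List ℤ} :
    v ∈ signs n ↔ ∃ ν : Fin n → ℤˣ, v = List.ofFn fun i => (ν i : ℤ) := by
  induction n generalizing v with
  | zero => simp [signs]
  | succ n ih =>
    simp only [signs, List.mem_flatMap, List.mem_cons, List.not_mem_nil, or_false]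
    constructor
    · rintro ⟨v, hv, h⟩
      obtain ⟨ν, rfl⟩ := ih.1 hv
      rcases h with rfl | rfl
      · exact ⟨Fin.cons 1 ν, by simp [List.ofFn_succ]⟩
      · exact ⟨Fin.cons (-1) ν, by simp [List.ofFn_succ]⟩
    · rintro ⟨ν, rfl⟩
      refine ⟨_, ih.2 ⟨fun i => ν i.succ, rfl⟩, ?_⟩
      rcases Int.units_eq_one_or (ν 0) with h | h <;> simp [List.ofFn_succ, h]

theorem mem_signList {n : ℕ} {u : Fin n → ℤ} : u ∈ signList n ↔
    ∃ ν : Fin n → ℤˣ, u = fun i => (ν i : ℤ) := by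
  simp only [signList, List.mem_map, mem_signs]
  constructor
  · rintro ⟨_, ⟨ν, rfl⟩, rfl⟩
    exact ⟨ν, by ext i; simp⟩
  · rintro ⟨ν, rfl⟩
    exact ⟨_, ⟨ν, rfl⟩, by ext i; simp⟩

theorem scaledSet_append {n : ℕ} {s : ℝ} {L L' : List (Fin n → ℤ)} :
    scaledSet s (L ++ L') = scaledSet s L ∪ scaledSet s L' := by
  ext v
  simp only [scaledSet, List.mem_append, Set.mem_union, Set.mem_ofPred_eq]
  constructor
  · rintro ⟨u, hu | hu, rfl⟩
    · exact Or.inl ⟨u, hu, rfl⟩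
    · exact Or.inr ⟨u, hu, rfl⟩
  · rintro (⟨u, hu, rfl⟩ | ⟨u, hu, rfl⟩)
    · exact ⟨u, Or.inl hu, rfl⟩
    · exact ⟨u, Or.inr hu, rfl⟩

theorem pairVectors_eq {s : ℝ} {c : ℤ} (hs : s * c = 1) (n : ℕ) :
    pairVectors n = scaledSet s (pairList c n) := by
  have key : ∀ (i j : Fin n), i ≠ j → ∀ σ τ : ℤˣ, Pi.single i (sgnR σ) + Pi.single j (sgnR τ) =
      scaledVec s fun a => if a = i then σ * c else if a = j then τ * c else 0 := by
    intro i j hij σ τ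
    have h : ∀ σ : ℤˣ, s * ((σ * c : ℤ) : ℝ) = sgnR σ := fun σ => by
      rw [sgnR]
      push_cast
      rw [mul_left_comm, hs, mul_one]
    ext a
    simp only [scaledVec, Pi.add_apply, Pi.single_apply]
    by_cases h1 : a = i
    · rw [if_pos h1, if_pos h1, if_neg fun h2 => hij (h1.symm.trans h2), h, add_zero]
    · rw [if_neg h1, if_neg h1, zero_add]
      split_ifs
      · rw [h]
      · simp
  ext v
  simp only [pairVectors, scaledSet, Set.mem_ofPred_eq, mem_pairList]
  constructor
  · rintro ⟨i, j, hij, σ, τ, rfl⟩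
    rcases lt_or_gt_of_ne hij with h | h
    · exact ⟨_, ⟨i, j, h, σ, τ, rfl⟩, key i j hij σ τ⟩
    · exact ⟨_, ⟨j, i, h, τ, σ, rfl⟩, (add_comm _ _).trans (key j i hij.symm τ σ)⟩
  · rintro ⟨_, ⟨i, j, hij, σ, τ, rfl⟩, rfl⟩
    exact ⟨i, j, hij.ne, σ, τ, (key i j hij.ne σ τ).symm⟩

theorem rootsE8_eq : rootsE8 = scaledSet (1 / 2) listE8 := by
  rw [rootsE8, listE8, scaledSet_append, pairVectors_eq (s := 1 / 2) (c := 2) (by norm_num)]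
  congr 1
  ext v
  simp only [scaledSet, Set.mem_ofPred_eq, List.mem_filter, mem_signList, decide_eq_true_eq,
    ← Fin.prod_univ_eight]
  constructor
  · rintro ⟨ν, h, rfl⟩
    refine ⟨_, ⟨⟨ν, rfl⟩, ?_⟩, ?_⟩
    · rw [← Units.coe_prod, h, Units.val_one]
    · ext i
      simp [scaledVec, sgnR]
      ring
  · rintro ⟨_, ⟨⟨ν, rfl⟩, h⟩, rfl⟩
    refine ⟨ν, ?_, ?_⟩
    · apply Units.ext
      push_cast
      exact h
    · ext i
      simp [scaledVec, sgnR]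
      ring

theorem scaledSet_filter {n : ℕ} {s : ℝ} {L : List (Fin n → ℤ)}
    {p : (Fin n → ℝ) → Prop} {q : (Fin n → ℤ) → Prop} [DecidablePred q]
    (h : ∀ u, p (scaledVec s u) ↔ q u) :
    {v | v ∈ scaledSet s L ∧ p v} = scaledSet s (L.filter fun u => q u) := by
  ext v
  simp only [scaledSet, Set.mem_ofPred_eq, List.mem_filter, decide_eq_true_eq]
  constructor
  · rintro ⟨⟨u, hu, rfl⟩, hp⟩
    exact ⟨u, ⟨hu, (h u).1 hp⟩, rfl⟩
  · rintro ⟨u, ⟨hu, hq⟩, rfl⟩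
    exact ⟨⟨u, hu, rfl⟩, (h u).2 hq⟩

theorem scaledVec_eq_iff {n : ℕ} {s : ℝ} (hs : s ≠ 0) (u : Fin n → ℤ) (i j : Fin n) :
    scaledVec s u i = scaledVec s u j ↔ u i = u j := by
  simp [scaledVec, hs]

theorem scaledVec_eq_neg_iff {n : ℕ} {s : ℝ} (hs : s ≠ 0) (u : Fin n → ℤ) (i j : Fin n) :
    scaledVec s u i = -scaledVec s u j ↔ u i = -u j := by
  rw [scaledVec, scaledVec, ← mul_neg, mul_right_inj' hs]
  exact_mod_cast Iff.rfl

theorem rootsE7_eq : rootsE7 = scaledSet (1 / 2) listE7 := by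
  rw [rootsE7, rootsE8_eq, listE7]
  exact scaledSet_filter fun u => scaledVec_eq_neg_iff (by norm_num) u 6 7

theorem rootsE6_eq : rootsE6 = scaledSet (1 / 2) listE6 := by
  rw [rootsE6, rootsE8_eq, listE6]
  exact scaledSet_filter fun u => and_congr (scaledVec_eq_iff (by norm_num) u 5 6)
    (scaledVec_eq_neg_iff (by norm_num) u 6 7)

theorem rootsF4_eq : rootsF4 = scaledSet (1 / 2) listF4 := by
  rw [rootsF4, listF4, scaledSet_append, scaledSet_append,
    pairVectors_eq (s := 1 / 2) (c := 2) (by norm_num)]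
  have key : ∀ (i : Fin 4) (s : ℤˣ), Pi.single i (sgnR s * 1) =
      scaledVec (1 / 2) fun a => if a = i then s * 2 else 0 := by
    intro i s
    ext a
    simp only [scaledVec, Pi.single_apply, sgnR]
    split_ifs <;> push_cast <;> ring
  congr 1
  · congr 1
    ext v
    simp only [axisVectors, scaledSet, Set.mem_ofPred_eq, mem_axisList]
    constructor
    · rintro ⟨i, s, rfl⟩
      exact ⟨_, ⟨i, s, rfl⟩, key i s⟩
    · rintro ⟨_, ⟨i, s, rfl⟩, rfl⟩
      exact ⟨i, s, (key i s).symm⟩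
  · ext v
    simp only [scaledSet, Set.mem_ofPred_eq, mem_signList]
    constructor
    · rintro ⟨ν, rfl⟩
      refine ⟨_, ⟨ν, rfl⟩, ?_⟩
      ext i
      simp [scaledVec, sgnR]
      ring
    · rintro ⟨_, ⟨ν, rfl⟩, rfl⟩
      refine ⟨ν, ?_⟩
      ext i
      simp [scaledVec, sgnR]
      ring

theorem rootsG2_eq : rootsG2 = scaledSet 1 listG2 := by
  rw [rootsG2, listG2, scaledSet_append]
  congr 1
  · ext v
    constructor
    · rintro ⟨i, j, hij, rfl⟩
      refine ⟨fun a => if a = i then 1 else if a = j then -1 else 0, ?_, ?_⟩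
      · revert i j
        decide
      · ext a
        fin_cases i <;> fin_cases j <;> fin_cases a <;> simp_all [scaledVec]
    · rintro ⟨u, hu, rfl⟩
      obtain ⟨hu, h0⟩ := List.mem_filter.1 hu
      obtain ⟨i, j, hij, s, t, rfl⟩ := mem_pairList.1 hu
      have hst : (s = 1 ∧ t = -1) ∨ (s = -1 ∧ t = 1) := by
        revert i j s t
        decide
      rcases hst with ⟨rfl, rfl⟩ | ⟨rfl, rfl⟩
      · refine ⟨i, j, hij.ne, ?_⟩
        ext a
        simp only [scaledVec, Pi.sub_apply, Pi.single_apply]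
        split_ifs <;> simp_all
      · refine ⟨j, i, hij.ne', ?_⟩
        ext a
        simp only [scaledVec, Pi.sub_apply, Pi.single_apply]
        split_ifs <;> simp_all
  · have key : ∀ (i : Fin 3) (s : ℤˣ), sgnR s • (Pi.single i 3 - fun _ => (1 : ℝ)) =
        scaledVec 1 fun a => if a = i then 2 * (s * 1 : ℤ) else -(s * 1 : ℤ) := by
      intro i s
      ext a
      simp only [scaledVec, Pi.smul_apply, Pi.sub_apply, Pi.single_apply, sgnR, smul_eq_mul]
      split_ifs <;> push_cast <;> ring
    ext v
    simp only [scaledSet, Set.mem_ofPred_eq, List.mem_flatMap, List.mem_finRange, true_and,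
      mem_two_iff]
    constructor
    · rintro ⟨i, s, rfl⟩
      exact ⟨_, ⟨i, s, rfl⟩, key i s⟩
    · rintro ⟨_, ⟨i, s, rfl⟩, rfl⟩
      exact ⟨i, s, (key i s).symm⟩

/-! ### Extended diagrams and foldings of systems given by lists. -/

namespace RootPairing

section ListModel

set_option linter.unusedSectionVars false

variable {ι V E : Type*} [Finite ι] [AddCommGroup V] [Module ℝ V] [AddCommGroup E] [Module ℝ E]
  {P : RootPairing ι ℝ V E} [P.IsRootSystem] [P.IsCrystallographic] [P.IsReduced] {b : P.Base}
  {l N : ℕ} {θ : ι} {e : Fin l ≃ b.support} {f : V →ₗ[ℝ] (Fin N → ℝ)}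
  {ω : P.weylGroup} {π : Equiv.Perm (Fin (l + 1))} {L : List (Fin N → ℤ)} {s : ℝ}
  {U : Fin (l + 1) → Fin N → ℤ} {m : Fin (l + 1) → ℤ}

/-- `U` lists the nodes of the extended diagram of the root system given by `L`, and `m` their
marks. -/
structure IsExtendedDiagram (L : List (Fin N → ℤ)) (U : Fin (l + 1) → Fin N → ℤ)
    (m : Fin (l + 1) → ℤ) : Prop where
  mem : -U 0 ∈ L
  dominant : ∀ k : Fin l, 0 ≤ U k.succ ⬝ᵥ -U 0
  maximal : ∀ u ∈ L, u ⬝ᵥ u ≤ U 0 ⬝ᵥ U 0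
  mark_zero : m 0 = 1
  sum_eq : ∑ i, m i • U i = 0

theorem map_node_of_list (hU : IsExtendedDiagram L U m) (hθ : IsHighestRoot b θ)
    (hΦ : f '' Set.range P.root = scaledSet s L)
    (hS : ∀ k, f (P.root (e k)) = scaledVec s (U k.succ)) (i : Fin (l + 1)) :
    f (P.root (node θ e i)) = scaledVec s (U i) := by
  induction i using Fin.cases with
  | zero =>
    rw [root_node_zero, map_neg, map_highestRoot hθ hΦ hS (scaledVec_mem s hU.mem),
      scaledVec_neg, neg_neg]
    · intro k
      rw [scaledVec_dotProduct]
      have := hU.dominant k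
      positivity
    · rintro _ ⟨u, hu, rfl⟩
      rw [scaledVec_dotProduct, scaledVec_dotProduct, neg_dotProduct_neg]
      have := hU.maximal u hu
      gcongr
  | succ k => rw [node_succ, hS]

theorem mark_of_list (hU : IsExtendedDiagram L U m) (hf : Function.Injective f)
    (hθ : IsHighestRoot b θ) (hΦ : f '' Set.range P.root = scaledSet s L)
    (hS : ∀ k, f (P.root (e k)) = scaledVec s (U k.succ)) (i : Fin (l + 1)) :
    mark θ e i = m i := by
  induction i using Fin.cases with
  | zero => rw [mark_zero, hU.mark_zero]
  | succ k =>
    rw [mark_succ, coef_highestRoot_of_model hf hS (c := fun k => m k.succ)]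
    have h0 := map_node_of_list hU hθ hΦ hS 0
    rw [root_node_zero, map_neg, neg_eq_iff_eq_neg] at h0
    have h1 := hU.sum_eq
    rw [Fin.sum_univ_succ, hU.mark_zero, one_smul, add_comm, add_eq_zero_iff_eq_neg] at h1
    rw [h0, ← scaledVec_neg, ← h1, scaledVec_sum]
    exact Finset.sum_congr rfl fun k _ => scaledVec_zsmul s _ _

/-- If no other mark is one, then only the identity stabilizes the alcove. -/
theorem perm_zero_of_list (hU : IsExtendedDiagram L U m) (hf : Function.Injective f)
    (hθ : IsHighestRoot b θ) (hΦ : f '' Set.range P.root = scaledSet s L)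
    (hS : ∀ k, f (P.root (e k)) = scaledVec s (U k.succ))
    (hπ : ∀ i, P.weylGroupToPerm ω (node θ e i) = node θ e (π i)) (hm : ∀ k : Fin l, m k.succ ≠ 1) :
    π 0 = 0 := by
  by_contra h
  obtain ⟨k, hk⟩ := Fin.exists_succ_eq_of_ne_zero h
  have h1 := mark_perm hθ hπ 0
  rw [← hk, mark_of_list hU hf hθ hΦ hS, mark_of_list hU hf hθ hΦ hS, hU.mark_zero] at h1
  exact hm k h1

/-- Adjacent nodes of the diagram go to adjacent ones. -/
theorem add_mem_of_list (hU : IsExtendedDiagram L U m) (hf : Function.Injective f) (hs : s ≠ 0)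
    (hθ : IsHighestRoot b θ) (hΦ : f '' Set.range P.root = scaledSet s L)
    (hS : ∀ k, f (P.root (e k)) = scaledVec s (U k.succ))
    (hπ : ∀ i, P.weylGroupToPerm ω (node θ e i) = node θ e (π i)) {i j : Fin (l + 1)}
    (h : U i + U j ∈ L) : U (π i) + U (π j) ∈ L := by
  have hn := map_node_of_list hU hθ hΦ hS
  rw [← scaledVec_mem_iff hs, ← hΦ, scaledVec_add, ← hn, ← hn] at h ⊢
  obtain ⟨_, ⟨k, rfl⟩, hk⟩ := h
  rw [← map_add] at hk
  refine ⟨_, ⟨P.weylGroupToPerm ω k, rfl⟩, ?_⟩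
  rw [← weylGroup_apply_root, hf hk, ← actLin_apply, map_add, actLin_apply, actLin_apply,
    weylGroup_apply_root, weylGroup_apply_root, hπ, hπ, map_add]

/-- An element of the Weyl group that fixes a regular linear form is trivial. -/
theorem eq_one_of_list (hU : IsExtendedDiagram L U m) (hs : s ≠ 0)
    (hθ : IsHighestRoot b θ) (hΦ : f '' Set.range P.root = scaledSet s L)
    (hS : ∀ k, f (P.root (e k)) = scaledVec s (U k.succ))
    (hπ : ∀ i, P.weylGroupToPerm ω (node θ e i) = node θ e (π i)) (x : Fin N → ℤ)
    (hx : ∀ i, x ⬝ᵥ U (π i) = x ⬝ᵥ U i) (hreg : ∀ u ∈ L, x ⬝ᵥ u ≠ 0) : ω = 1 := by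
  -- The vector representing the form is fixed by `ω`, because the form agrees on each node and its
  -- image, and no root vanishes on it. This excludes diagram symmetries that the Weyl group does
  -- not induce.
  obtain ⟨χ, hχ⟩ := exists_dual_point (P := P) (intForm x ∘ₗ f)
  have hn := map_node_of_list hU hθ hΦ hS
  have hval : ∀ i, P.toLinearMap (P.root (node θ e i)) χ = s * (x ⬝ᵥ U i : ℤ) := by
    intro i
    rw [hχ, LinearMap.comp_apply, hn, intForm_scaledVec]
  refine eq_one_of_coact_eq b (x := χ) ?_ ?_
  · intro i
    have hi : f (P.root i) ∈ scaledSet s L := by rw [← hΦ]; exact ⟨_, ⟨i, rfl⟩, rfl⟩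
    obtain ⟨u, hu, h⟩ := hi
    rw [hχ, LinearMap.comp_apply, h, intForm_scaledVec]
    exact mul_ne_zero hs (by exact_mod_cast hreg u hu)
  · apply point_ext (b := b)
    intro k
    obtain ⟨k, rfl⟩ := e.surjective k
    obtain ⟨i, hi⟩ := π.surjective k.succ
    rw [toLinearMap_coact, ← node_succ (θ := θ), ← hi, ← hπ, ← weylGroup_apply_root,
      inv_smul_smul, weylGroup_apply_root, hπ, hval, hval, hx]

theorem linearMap_ext_node {W : Type*} [AddCommGroup W] [Module ℝ W] {g g' : V →ₗ[ℝ] W}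
    (h : ∀ i, g (P.root (node θ e i)) = g' (P.root (node θ e i))) : g = g' := by
  apply b.toWeightBasis.ext
  intro k
  obtain ⟨k, rfl⟩ := e.surjective k
  rw [Base.toWeightBasis_apply]
  exact h k.succ

theorem pow_smul_node (hπ : ∀ i, P.weylGroupToPerm ω (node θ e i) = node θ e (π i)) (t : ℕ)
    (i : Fin (l + 1)) : ω ^ t • P.root (node θ e i) = P.root (node θ e ((π ^ t) i)) := by
  induction t generalizing i with
  | zero => simp
  | succ t ih =>
    rw [pow_succ, mul_smul, weylGroup_apply_root, hπ, ih, pow_succ, _root_.Equiv.Perm.mul_apply]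

theorem orderOf_of_perm {o : ℕ} (ho : o.Prime) (hω : ω ≠ 1)
    (hπ : ∀ i, P.weylGroupToPerm ω (node θ e i) = node θ e (π i)) (h : π ^ o = 1) :
    orderOf ω = o := by
  have := Fact.mk ho
  refine orderOf_eq_prime ?_ hω
  have : actLin (ω ^ o) = actLin (1 : P.weylGroup) := by
    refine linearMap_ext_node (θ := θ) (e := e) fun i => ?_
    rw [actLin_apply, actLin_apply, pow_smul_node hπ, h, one_smul]
    rfl
  exact weylGroup_ext fun v => by rw [← actLin_apply, this, actLin_apply]

end ListModel

section Folding

set_option linter.unusedSectionVars false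

variable {ι V E : Type*} [Finite ι] [AddCommGroup V] [Module ℝ V] [AddCommGroup E] [Module ℝ E]
  {P : RootPairing ι ℝ V E} [P.IsRootSystem] [P.IsCrystallographic] [P.IsReduced] {b : P.Base}
  {l N n : ℕ} {θ : ι} {e : Fin l ≃ b.support} {f : V →ₗ[ℝ] (Fin N → ℝ)}
  {ω : P.weylGroup} {π : Equiv.Perm (Fin (l + 1))} {L : List (Fin N → ℤ)} {s : ℝ}
  {U : Fin (l + 1) → Fin N → ℤ} {m : Fin (l + 1) → ℤ} {A : Matrix (Fin n) (Fin N) ℤ}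
  {x : Fin N → ℤ} {K : List (Fin n → ℤ)} {z p c : ℤ} {o : ℕ}

/-- The matrix `A` folds the roots in `L` onto `p` times the roots in `K`; the form `x` takes all
multiples of `z` modulo `z o` as values on the fibres over the short roots, that is, those of
squared length less than `c`. -/
structure IsListFolding (L : List (Fin N → ℤ)) (K : List (Fin n → ℤ))
    (A : Matrix (Fin n) (Fin N) ℤ) (x : Fin N → ℤ) (p z c : ℤ) (o : ℕ) : Prop where
  map : ∀ u ∈ L, A.mulVec u = 0 ∨ ∃ w ∈ K, A.mulVec u = p • w ∧ z ∣ x ⬝ᵥ u ∧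
    (w ⬝ᵥ w = c → z * o ∣ x ⬝ᵥ u)
  zero : ∀ u ∈ L, A.mulVec u = 0 → ¬ z * o ∣ x ⬝ᵥ u
  zero_lift : ∀ r : Fin o, (r : ℕ) ≠ 0 → ∃ u ∈ L, A.mulVec u = 0 ∧ z * o ∣ x ⬝ᵥ u - z * r
  lift : ∀ w ∈ K, ∃ u ∈ L, A.mulVec u = p • w
  short_lift : ∀ w ∈ K, w ⬝ᵥ w ≠ c → ∀ r : Fin o, ∃ u ∈ L, A.mulVec u = p • w ∧
    z * o ∣ x ⬝ᵥ u - z * r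
  short : ∀ w ∈ K, w ⬝ᵥ w ≠ c → ∃ y ∈ K, w + y ∈ K ∧ w - y ∈ K
  length : ∀ w ∈ K, w ⬝ᵥ w = c ∨ o * (w ⬝ᵥ w) = c
  pos : 0 < c

/-- Vectors of squared length `c` have maximal length and fail the test by `not_isShort_of_maximal`;
for the others a partner is part of the data. -/
theorem isShort_scaledVec_iff (h : IsListFolding L K A x p z c o) (ho : 0 < o) {ρ : ℝ} (hρ : ρ ≠ 0)
    {w : Fin n → ℤ} (hw : w ∈ K) : IsShort (scaledSet ρ K) (scaledVec ρ w) ↔ w ⬝ᵥ w ≠ c := by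
  have hle : ∀ y ∈ K, 0 < y ⬝ᵥ y ∧ y ⬝ᵥ y ≤ c := by
    intro y hy
    have hc := h.pos
    have : (1 : ℤ) ≤ o := by omega
    rcases h.length y hy with h1 | h1
    · omega
    · constructor <;> nlinarith
  constructor
  · rintro hs hwc
    refine not_isShort_of_maximal ?_ ?_ hs
    · rw [← scaledVec_zero ρ, scaledVec_mem_iff hρ]
      intro h0
      have := (hle _ h0).1
      simp at this
    · rintro _ ⟨y, hy, rfl⟩
      rw [scaledVec_dotProduct, scaledVec_dotProduct]
      have := (hle y hy).2
      rw [hwc]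
      gcongr
  · intro hwc
    obtain ⟨y, hy, h1, h2⟩ := h.short w hw hwc
    exact ⟨scaledVec ρ y, scaledVec_mem ρ hy, by rw [← scaledVec_add]; exact scaledVec_mem ρ h1,
      by rw [← scaledVec_sub]; exact scaledVec_mem ρ h2⟩

/-- Dualizing multiplies `w` by `c / (w · w)`, which is one for long roots and `o` for short ones,
because the ratio of squared lengths equals the order of `ω`. -/
theorem rescale_scaledSet (h : IsListFolding L K A x p z c o) (ho : 0 < o) {ρ : ℝ} (hρ : ρ ≠ 0) :
    rescale (scaledSet ρ K) 1 o = dualRoots (ρ ^ 2 * c) (scaledSet ρ K) := by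
  have key : ∀ w ∈ K, (ρ ^ 2 * c) / (scaledVec ρ w ⬝ᵥ scaledVec ρ w) =
      if w ⬝ᵥ w = c then (1 : ℝ) else o := by
    intro w hw
    rw [scaledVec_dotProduct, mul_div_mul_left _ _ (pow_ne_zero 2 hρ)]
    have hc := h.pos
    have hc' : (c : ℝ) ≠ 0 := by exact_mod_cast hc.ne'
    split_ifs with h1
    · rw [h1, div_self hc']
    · have h2 := (h.length w hw).resolve_left h1
      have h3 : (o : ℝ) * (w ⬝ᵥ w : ℤ) = c := by exact_mod_cast h2
      rw [div_eq_iff, h3]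
      intro h4
      rw [h4, mul_zero] at h3
      exact hc' h3.symm
  ext v
  constructor
  · rintro ⟨_, ⟨w, hw, rfl⟩, hv⟩
    refine ⟨_, scaledVec_mem ρ hw, ?_⟩
    rw [isShort_scaledVec_iff h ho hρ hw, not_not] at hv
    rw [key w hw]
    rcases hv with ⟨h1, rfl⟩ | ⟨h1, rfl⟩
    · rw [if_pos h1]
    · rw [if_neg h1]
  · rintro ⟨_, ⟨w, hw, rfl⟩, rfl⟩
    refine ⟨_, scaledVec_mem ρ hw, ?_⟩
    rw [isShort_scaledVec_iff h ho hρ hw, not_not, key w hw]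
    split_ifs with h1
    · exact Or.inl ⟨h1, rfl⟩
    · exact Or.inr ⟨h1, rfl⟩

/-- An instance of `foldingFormula_rescale` with `d = 1`, where long roots keep the factor one and
short roots get `o`. The constants `ρ / (s p)` and `1 / (s z)` undo the scalings that made the data
integral. The matrix `B` serves to show that the fold is faithful on fixed vectors. -/
theorem foldingFormula_of_list (hU : IsExtendedDiagram L U m) (hf : Function.Injective f)
    (hs : s ≠ 0) (hθ : IsHighestRoot b θ) (hΦ : f '' Set.range P.root = scaledSet s L)
    (hS : ∀ k, f (P.root (e k)) = scaledVec s (U k.succ))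
    (hπ : ∀ i, P.weylGroupToPerm ω (node θ e i) = node θ e (π i)) (hω : ω ≠ 1)
    (ho : o.Prime) (hπo : π ^ o = 1) (h : IsListFolding L K A x p z c o) (hp : p ≠ 0) (hz : z ≠ 0)
    (I : Fin (l + 1) → ℤ) (hI : ∀ i, I (π i) = I i) (hsum : ∑ i, m i * I i = o)
    (hdiv : ∀ y : Fin (l + 1) → ℤ, (∀ i, y (π i) = y i) → (o : ℤ) ∣ ∑ i, m i * y i)
    (hx : ∀ k : Fin l, x ⬝ᵥ U k.succ = z * I k.succ)
    (hinv : ∀ i, A.mulVec (U (π i)) = A.mulVec (U i)) {B : Matrix (Fin N) (Fin n) ℤ} {a : ℤ}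
    (hfaith : ∀ i, B.mulVec (A.mulVec (U i)) = a • ∑ t ∈ Finset.range o, U ((π ^ t) i))
    (ha : a ≠ 0) {ρ : ℝ} (hρ : ρ ≠ 0) :
    FoldingFormula P ω (scaledSet ρ K) (dualRoots (ρ ^ 2 * c) (scaledSet ρ K)) 1 := by
  have hn := map_node_of_list hU hθ hΦ hS
  have hmark := mark_of_list hU hf hθ hΦ hS
  have hp' : (p : ℝ) ≠ 0 := by exact_mod_cast hp
  have hz' : (z : ℝ) ≠ 0 := by exact_mod_cast hz
  have hH0 : ρ / (s * p) ≠ 0 := div_ne_zero hρ (mul_ne_zero hs hp')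
  have hH : ∀ u w, A.mulVec u = p • w →
      ((ρ / (s * p)) • intLin A) (scaledVec s u) = scaledVec ρ w := by
    intro u w huw
    rw [LinearMap.smul_apply, intLin_scaledVec, huw]
    ext i
    simp only [scaledVec, Pi.smul_apply, smul_eq_mul]
    push_cast
    field_simp
  have hHz : ∀ u, ((ρ / (s * p)) • intLin A) (scaledVec s u) = 0 ↔ A.mulVec u = 0 := by
    intro u
    rw [LinearMap.smul_apply, intLin_scaledVec, smul_eq_zero_iff_right hH0,
      ← scaledVec_zero s, (scaledVec_injective hs).eq_iff]
  have hX : ∀ u, ((1 / (s * z)) • intForm x) (scaledVec s u) = (x ⬝ᵥ u : ℤ) / z := by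
    intro u
    rw [LinearMap.smul_apply, intForm_scaledVec, smul_eq_mul]
    field_simp
  have hres : ∀ (u : Fin N → ℤ) (r : Fin o) (t : ℤ), t % o = r → z * o ∣ x ⬝ᵥ u - z * r →
      ∃ k : ℤ, ((1 / (s * z)) • intForm x) (scaledVec s u) = t + o * k := by
    rintro u r t htr ⟨k, hk⟩
    refine ⟨k - t / o, ?_⟩
    rw [hX, div_eq_iff hz']
    have h1 := Int.mul_ediv_add_emod t o
    rw [htr] at h1
    have h2 : x ⬝ᵥ u = (t + o * (k - t / o)) * z := by linear_combination hk + z * h1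
    rw [h2]
    push_cast
    ring
  have hfin : ∀ t : ℤ, ∃ r : Fin o, t % o = r := by
    intro t
    have h1 := Int.emod_nonneg t (b := (o : ℤ)) (by exact_mod_cast ho.ne_zero)
    have h2 := Int.emod_lt_of_pos t (b := (o : ℤ)) (by exact_mod_cast ho.pos)
    exact ⟨⟨(t % o).toNat, by omega⟩, by simp [h1]⟩
  rw [← rescale_scaledSet h ho.pos hρ]
  refine foldingFormula_rescale hΦ ((ρ / (s * p)) • intLin A) ((1 / (s * z)) • intForm x) (o := o)
    (by simp) (by simp) (orderOf_of_perm ho hω hπ hπo) ho.pos ?_ exists_dual_point ?_ ?_ ?_ ?_ ?_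
    ?_ ?_ ?_
  · intro χ hχ
    refine isCocycle_of_nodes hπ ho.pos I hI (by simpa only [hmark] using hsum)
      (by simpa only [hmark] using hdiv) fun k => ?_
    rw [hχ, hS, hX, hx]
    push_cast
    field_simp
  · intro v
    have : (((ρ / (s * p)) • intLin A) ∘ₗ f) ∘ₗ actLin ω = ((ρ / (s * p)) • intLin A) ∘ₗ f := by
      refine linearMap_ext_node (θ := θ) (e := e) fun i => ?_
      simp only [LinearMap.comp_apply, actLin_apply]
      rw [weylGroup_apply_root, hπ, hn, hn, LinearMap.smul_apply, LinearMap.smul_apply,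
        intLin_scaledVec, intLin_scaledVec, hinv]
    exact LinearMap.congr_fun this v
  · intro v hv hv0
    -- `B` turns the fold into `a` times the orbit sum. For a fixed vector that sum is `o` times the
    -- vector, so zero fold means zero.
    have key : intLin B ∘ₗ intLin A ∘ₗ f =
        (a : ℝ) • ∑ t ∈ Finset.range o, f ∘ₗ actLin (ω ^ t) := by
      refine linearMap_ext_node (θ := θ) (e := e) fun i => ?_
      simp only [LinearMap.comp_apply, LinearMap.smul_apply, LinearMap.sum_apply, actLin_apply,
        pow_smul_node hπ, hn]
      rw [intLin_scaledVec, intLin_scaledVec, hfaith, scaledVec_zsmul, scaledVec_sum]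
    have h1 := LinearMap.congr_fun key v
    rw [LinearMap.smul_apply, smul_eq_zero_iff_right hH0] at hv0
    have hfix : ∀ t : ℕ, ω ^ t • v = v := by
      intro t
      induction t with
      | zero => simp
      | succ t ih => rw [pow_succ, mul_smul, hv, ih]
    simp only [LinearMap.comp_apply, LinearMap.smul_apply, LinearMap.sum_apply, actLin_apply, hv0,
      map_zero, hfix, Finset.sum_const, Finset.card_range] at h1
    have h2 : f v = 0 := by
      have ha' : (a : ℝ) ≠ 0 := by exact_mod_cast ha
      have h3 := (smul_eq_zero_iff_right ha').1 h1.symm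
      exact (smul_eq_zero_iff_right ho.ne_zero).1 h3
    exact hf (h2.trans (map_zero f).symm)
  · rw [← scaledVec_zero ρ, scaledVec_mem_iff hρ]
    intro h0
    have h1 := h.length _ h0
    have h2 := h.pos
    simp at h1
    omega
  · rintro _ ⟨u, hu, rfl⟩ h0 ⟨k, hk⟩
    refine h.zero u hu ((hHz u).1 h0) ⟨k, ?_⟩
    rw [hX, div_eq_iff hz'] at hk
    have : x ⬝ᵥ u = o * k * z := by exact_mod_cast hk
    rw [this]
    ring
  · intro r hr0 hro
    obtain ⟨r', hr'⟩ := hfin r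
    rw [Int.emod_eq_of_lt hr0.le hro] at hr'
    obtain ⟨u, hu, h0, hd⟩ := h.zero_lift r' (by omega)
    exact ⟨_, scaledVec_mem s hu, (hHz u).2 h0,
      hres u r' r (by rw [Int.emod_eq_of_lt hr0.le hro, hr']) hd⟩
  · rintro _ ⟨u, hu, rfl⟩ h0
    obtain ⟨w, hw, h1, ⟨k, hk⟩, h3⟩ := (h.map u hu).resolve_left (mt (hHz u).2 h0)
    rw [hH u w h1]
    refine ⟨scaledVec_mem ρ hw, ⟨k, ?_⟩, fun hs => ?_⟩
    · rw [hX, hk]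
      push_cast
      field_simp
    · rw [isShort_scaledVec_iff h ho.pos hρ hw, not_not] at hs
      obtain ⟨k, hk⟩ := h3 hs
      refine ⟨k, ?_⟩
      rw [hX, hk]
      push_cast
      field_simp
  · rintro _ ⟨w, hw, rfl⟩
    obtain ⟨u, hu, h1⟩ := h.lift w hw
    exact ⟨_, scaledVec_mem s hu, hH u w h1⟩
  · rintro _ ⟨w, hw, rfl⟩ hs t
    rw [isShort_scaledVec_iff h ho.pos hρ hw] at hs
    obtain ⟨r, hr⟩ := hfin t
    obtain ⟨u, hu, h1, hd⟩ := h.short_lift w hw hs r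
    exact ⟨_, scaledVec_mem s hu, hH u w h1, hres u r t hr hd⟩

end Folding

end RootPairing

/-! ### Data for the exceptional types. -/

/-- Twice the simple roots of `E_8`. -/
def simpleTwice : Fin 8 → Fin 8 → ℤ :=
  ![![1, -1, -1, -1, -1, -1, -1, 1], ![2, 2, 0, 0, 0, 0, 0, 0], ![-2, 2, 0, 0, 0, 0, 0, 0],
    ![0, -2, 2, 0, 0, 0, 0, 0], ![0, 0, -2, 2, 0, 0, 0, 0], ![0, 0, 0, -2, 2, 0, 0, 0],
    ![0, 0, 0, 0, -2, 2, 0, 0], ![0, 0, 0, 0, 0, -2, 2, 0]]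

theorem simpleE_eq (k : Fin 8) :
    DynkinType.simpleE (k + 1) = scaledVec (1 / 2) (simpleTwice k) := by
  ext a
  fin_cases k <;> fin_cases a <;>
    norm_num [DynkinType.simpleE, simpleTwice, scaledVec, stdE]

/-- The nodes of the extended diagram of `E_6`. -/
def nodesE6 : Fin 7 → Fin 8 → ℤ :=
  Fin.cons ![-1, -1, -1, -1, -1, 1, 1, -1] fun k : Fin 6 => simpleTwice (k.castLE (by norm_num))

/-- The nodes of the extended diagram of `E_7`. -/
def nodesE7 : Fin 8 → Fin 8 → ℤ :=
  Fin.cons ![0, 0, 0, 0, 0, 0, 2, -2] fun k : Fin 7 => simpleTwice (k.castLE (by norm_num))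

/-- The nodes of the extended diagram of `E_8`. -/
def nodesE8 : Fin 9 → Fin 8 → ℤ := Fin.cons ![0, 0, 0, 0, 0, 0, -2, -2] simpleTwice

/-- The nodes of the extended diagram of `F_4`. -/
def nodesF4 : Fin 5 → Fin 4 → ℤ :=
  Fin.cons ![-2, -2, 0, 0] ![![0, 2, -2, 0], ![0, 0, 2, -2], ![0, 0, 0, 2], ![1, -1, -1, -1]]

/-- The nodes of the extended diagram of `G_2`. -/
def nodesG2 : Fin 3 → Fin 3 → ℤ := Fin.cons ![1, 1, -2] ![![1, -1, 0], ![-2, 1, 1]]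

/-- The marks of `E_6`. -/
def marksE6 : Fin 7 → ℤ := ![1, 1, 2, 2, 3, 2, 1]

/-- The marks of `E_7`. -/
def marksE7 : Fin 8 → ℤ := ![1, 2, 2, 3, 4, 3, 2, 1]

namespace RootPairing

/-- Doubled roots have squared length eight; equal lengths settle the maximality of the highest root
in `E_6`, `E_7` and `E_8` at once. -/
theorem listE8_dotProduct_self {u : Fin 8 → ℤ} (hu : u ∈ listE8) : u ⬝ᵥ u = 8 := by
  have : (listE8.all fun u => u 0 * u 0 + u 1 * u 1 + u 2 * u 2 + u 3 * u 3 + u 4 * u 4 +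
      u 5 * u 5 + u 6 * u 6 + u 7 * u 7 == 8) = true := by decide +kernel
  rw [List.all_eq_true] at this
  rw [dotProduct, Fin.sum_univ_eight]
  exact beq_iff_eq.1 (this u hu)

theorem isExtendedDiagram_E6 : IsExtendedDiagram listE6 nodesE6 marksE6 where
  mem := by decide +kernel
  dominant := by decide +kernel
  maximal u hu := by
    rw [listE8_dotProduct_self (List.mem_of_mem_filter hu)]
    decide +kernel
  mark_zero := rfl
  sum_eq := by decide +kernel

theorem isExtendedDiagram_E7 : IsExtendedDiagram listE7 nodesE7 marksE7 where
  mem := by decide +kernel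
  dominant := by decide +kernel
  maximal u hu := by
    rw [listE8_dotProduct_self (List.mem_of_mem_filter hu)]
    decide +kernel
  mark_zero := rfl
  sum_eq := by decide +kernel

theorem isExtendedDiagram_E8 : IsExtendedDiagram listE8 nodesE8 ![1, 2, 3, 4, 6, 5, 4, 3, 2] where
  mem := by decide +kernel
  dominant := by decide +kernel
  maximal u hu := by
    rw [listE8_dotProduct_self hu]
    decide +kernel
  mark_zero := rfl
  sum_eq := by decide +kernel

theorem isExtendedDiagram_F4 : IsExtendedDiagram listF4 nodesF4 ![1, 2, 3, 4, 2] where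
  mem := by decide +kernel
  dominant := by decide +kernel
  maximal := by decide +kernel
  mark_zero := rfl
  sum_eq := by decide +kernel

theorem isExtendedDiagram_G2 : IsExtendedDiagram listG2 nodesG2 ![1, 3, 2] where
  mem := by decide +kernel
  dominant := by decide +kernel
  maximal := by decide +kernel
  mark_zero := rfl
  sum_eq := by decide +kernel

/-- The folding of `E_6` onto `G_2`. -/
def foldE6 : Matrix (Fin 3) (Fin 8) ℤ :=
  ![![0, 1, -1, 0, 0, 0, 0, 0], ![0, -1, 0, -1, 0, 0, 0, 0], ![0, 0, 1, 1, 0, 0, 0, 0]]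

/-- The folding of `E_7` onto `F_4`. -/
def foldE7 : Matrix (Fin 4) (Fin 8) ℤ :=
  ![![0, 0, 0, 0, 1, -1, -1, 1], ![1, 1, 1, 1, 0, 0, 0, 0], ![-1, -1, 1, 1, 0, 0, 0, 0],
    ![-1, 1, -1, 1, 0, 0, 0, 0]]

/-- The folding conditions are rewritten in the entries of the vectors; in this form they become
finite arithmetic checks. -/
theorem foldE6_mulVec (u : Fin 8 → ℤ) :
    foldE6.mulVec u = ![u 1 - u 2, -u 1 - u 3, u 2 + u 3] := by
  ext i
  fin_cases i <;> simp [foldE6, Matrix.mulVec, dotProduct, Fin.sum_univ_succ] <;> ring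

theorem foldE7_mulVec (u : Fin 8 → ℤ) :
    foldE7.mulVec u = ![u 4 - u 5 - u 6 + u 7, u 0 + u 1 + u 2 + u 3, -u 0 - u 1 + u 2 + u 3,
      -u 0 + u 1 - u 2 + u 3] := by
  ext i
  fin_cases i <;> simp [foldE7, Matrix.mulVec, dotProduct, Fin.sum_univ_succ] <;> ring

theorem foldE6_eq_zero (u : Fin 8 → ℤ) :
    foldE6.mulVec u = 0 ↔ u 1 - u 2 = 0 ∧ -u 1 - u 3 = 0 ∧ u 2 + u 3 = 0 := by
  simp [foldE6_mulVec, funext_iff, Fin.forall_fin_succ]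

theorem foldE6_eq_smul (u : Fin 8 → ℤ) (w : Fin 3 → ℤ) : foldE6.mulVec u = (2 : ℤ) • w ↔
    u 1 - u 2 = 2 * w 0 ∧ -u 1 - u 3 = 2 * w 1 ∧ u 2 + u 3 = 2 * w 2 := by
  simp [foldE6_mulVec, funext_iff, Fin.forall_fin_succ]

theorem foldE7_eq_zero (u : Fin 8 → ℤ) : foldE7.mulVec u = 0 ↔
    u 4 - u 5 - u 6 + u 7 = 0 ∧ u 0 + u 1 + u 2 + u 3 = 0 ∧ -u 0 - u 1 + u 2 + u 3 = 0 ∧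
      -u 0 + u 1 - u 2 + u 3 = 0 := by
  simp [foldE7_mulVec, funext_iff, Fin.forall_fin_succ]

theorem foldE7_eq_smul (u : Fin 8 → ℤ) (w : Fin 4 → ℤ) : foldE7.mulVec u = (2 : ℤ) • w ↔
    u 4 - u 5 - u 6 + u 7 = 2 * w 0 ∧ u 0 + u 1 + u 2 + u 3 = 2 * w 1 ∧
      -u 0 - u 1 + u 2 + u 3 = 2 * w 2 ∧ -u 0 + u 1 - u 2 + u 3 = 2 * w 3 := by
  simp [foldE7_mulVec, funext_iff, Fin.forall_fin_succ]

/-- Twice the coweight that defines the cocycle for `E_6`. -/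
def weightE6 : Fin 8 → ℤ := ![0, 0, 0, 0, 1, -1, -1, 1]

/-- Twice the coweight that defines the cocycle for `E_7`. -/
def weightE7 : Fin 8 → ℤ := ![0, 0, 0, 0, 0, 2, -1, 1]

theorem weightE6_dotProduct (u : Fin 8 → ℤ) : weightE6 ⬝ᵥ u = u 4 - u 5 - u 6 + u 7 := by
  simp [weightE6, dotProduct, Fin.sum_univ_succ]
  ring

theorem weightE7_dotProduct (u : Fin 8 → ℤ) : weightE7 ⬝ᵥ u = 2 * u 5 - u 6 + u 7 := by
  simp [weightE7, dotProduct, Fin.sum_univ_succ]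
  ring

/-- The roots of `E_6` are doubled, hence `p = 2` and `z = 2`. In the model of `G_2` the squared
lengths are 6 and 2, with ratio the order three. -/
theorem isListFolding_E6 : IsListFolding listE6 listG2 foldE6 weightE6 2 2 6 3 := by
  constructor <;> (try simp only [foldE6_eq_zero, foldE6_eq_smul, weightE6_dotProduct]) <;>
    decide +kernel

/-- Both lists are doubled, and the matrix still contributes `p = 2`; the coweight is doubled as
well, hence `z = 4`. Doubled roots of `F_4` have squared lengths 8 and 4, with ratio the order two.
-/
theorem isListFolding_E7 : IsListFolding listE7 listF4 foldE7 weightE7 2 4 8 2 where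
  map u hu := by
    have : (listE7.all fun u => (u 4 - u 5 - u 6 + u 7 == 0 && u 0 + u 1 + u 2 + u 3 == 0 &&
        -u 0 - u 1 + u 2 + u 3 == 0 && -u 0 + u 1 - u 2 + u 3 == 0) ||
        listF4.any fun w => u 4 - u 5 - u 6 + u 7 == 2 * w 0 && u 0 + u 1 + u 2 + u 3 == 2 * w 1 &&
          -u 0 - u 1 + u 2 + u 3 == 2 * w 2 && -u 0 + u 1 - u 2 + u 3 == 2 * w 3 &&
          (2 * u 5 - u 6 + u 7) % 4 == 0 &&
          (w 0 * w 0 + w 1 * w 1 + w 2 * w 2 + w 3 * w 3 != 8 ||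
            (2 * u 5 - u 6 + u 7) % 8 == 0)) = true := by decide +kernel
    simp only [List.all_eq_true, List.any_eq_true, Bool.or_eq_true, Bool.and_eq_true, beq_iff_eq,
      bne_iff_ne] at this
    rw [foldE7_eq_zero]
    rcases this u hu with ⟨⟨⟨h1, h2⟩, h3⟩, h4⟩ | ⟨w, hw, ⟨⟨⟨⟨h1, h2⟩, h3⟩, h4⟩, h5⟩, h6⟩
    · exact Or.inl ⟨h1, h2, h3, h4⟩
    · refine Or.inr ⟨w, hw, (foldE7_eq_smul u w).2 ⟨h1, h2, h3, h4⟩, ?_⟩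
      clear this
      rw [weightE7_dotProduct, dotProduct, Fin.sum_univ_four]
      push_cast
      omega
  zero := by simp only [foldE7_eq_zero, weightE7_dotProduct]; decide +kernel
  zero_lift := by simp only [foldE7_eq_zero, weightE7_dotProduct]; decide +kernel
  lift := by simp only [foldE7_eq_smul]; decide +kernel
  short_lift w hw hs r := by
    have : (listF4.all fun w => w 0 * w 0 + w 1 * w 1 + w 2 * w 2 + w 3 * w 3 == 8 ||
        (List.finRange 2).all fun r => listE7.any fun u => u 4 - u 5 - u 6 + u 7 == 2 * w 0 &&
          u 0 + u 1 + u 2 + u 3 == 2 * w 1 && -u 0 - u 1 + u 2 + u 3 == 2 * w 2 &&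
          -u 0 + u 1 - u 2 + u 3 == 2 * w 3 &&
          (2 * u 5 - u 6 + u 7 - 4 * (r.val : ℤ)) % 8 == 0) = true := by decide +kernel
    simp only [List.all_eq_true, List.any_eq_true, Bool.or_eq_true, Bool.and_eq_true,
      beq_iff_eq] at this
    rw [dotProduct, Fin.sum_univ_four] at hs
    obtain ⟨u, hu, ⟨⟨⟨h1, h2⟩, h3⟩, h4⟩, h5⟩ :=
      (this w hw).resolve_left hs r (List.mem_finRange r)
    refine ⟨u, hu, (foldE7_eq_smul u w).2 ⟨h1, h2, h3, h4⟩, ?_⟩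
    rw [weightE7_dotProduct]
    exact Int.dvd_of_emod_eq_zero h5
  short w hw hs := by
    have : (listF4.all fun w => w 0 * w 0 + w 1 * w 1 + w 2 * w 2 + w 3 * w 3 == 8 ||
        listF4.any fun y => w 0 * y 0 + w 1 * y 1 + w 2 * y 2 + w 3 * y 3 == 0 &&
          (listF4.any fun z => z 0 == w 0 + y 0 && z 1 == w 1 + y 1 && z 2 == w 2 + y 2 &&
            z 3 == w 3 + y 3) &&
          (listF4.any fun z => z 0 == w 0 - y 0 && z 1 == w 1 - y 1 && z 2 == w 2 - y 2 &&
            z 3 == w 3 - y 3)) = true := by decide +kernel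
    simp only [List.all_eq_true, List.any_eq_true, Bool.or_eq_true, Bool.and_eq_true,
      beq_iff_eq] at this
    rw [dotProduct, Fin.sum_univ_four] at hs
    obtain ⟨y, hy, ⟨-, z, hz, h⟩, z', hz', h'⟩ := (this w hw).resolve_left hs
    refine ⟨y, hy, ?_, ?_⟩
    · convert hz using 1
      ext i
      fin_cases i <;> simp [h]
    · convert hz' using 1
      ext i
      fin_cases i <;> simp [h']
  length := by decide +kernel
  pos := by norm_num

end RootPairing

/-! ### Diagram symmetries and rows of the exceptional types. -/

namespace RootPairing

/-- Neighbours in the extended diagram of `E_6`. -/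
def adjE6 : Fin 7 → List (Fin 7) := ![[2], [3], [0, 4], [1, 4], [2, 3, 5], [4, 6], [5]]

/-- Neighbours in the extended diagram of `E_7`. -/
def adjE7 : Fin 8 → List (Fin 8) := ![[1], [0, 3], [4], [1, 4], [2, 3, 5], [4, 6], [5, 7], [6]]

/-- Adjacency is expressed by the sum of two nodes being a root, a property that the Weyl group
preserves. -/
theorem adjE6_iff (i j : Fin 7) : nodesE6 i + nodesE6 j ∈ listE6 ↔ j ∈ adjE6 i := by
  revert i j
  decide +kernel

theorem adjE7_iff (i j : Fin 8) : nodesE7 i + nodesE7 j ∈ listE7 ↔ j ∈ adjE7 i := by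
  revert i j
  decide +kernel

/-- The rotation of the extended diagram of `E_6`. -/
def rotE6 : Equiv.Perm (Fin 7) where
  toFun := ![1, 6, 3, 5, 4, 2, 0]
  invFun := ![6, 0, 5, 2, 4, 3, 1]
  left_inv := by decide
  right_inv := by decide

/-- The reflection of the extended diagram of `E_6` that exchanges the nodes `0` and `1`. -/
def reflE6 : Equiv.Perm (Fin 7) where
  toFun := ![1, 0, 3, 2, 4, 5, 6]
  invFun := ![1, 0, 3, 2, 4, 5, 6]
  left_inv := by decide
  right_inv := by decide

/-- The reflection of the extended diagram of `E_6` that exchanges the nodes `0` and `6`. -/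
def reflE6' : Equiv.Perm (Fin 7) where
  toFun := ![6, 1, 5, 3, 4, 2, 0]
  invFun := ![6, 1, 5, 3, 4, 2, 0]
  left_inv := by decide
  right_inv := by decide

/-- The symmetry of the extended diagram of `E_7`. -/
def reflE7 : Equiv.Perm (Fin 8) where
  toFun := ![7, 6, 2, 5, 4, 3, 1, 0]
  invFun := ![7, 6, 2, 5, 4, 3, 1, 0]
  left_inv := by decide
  right_inv := by decide

/-- The extended diagram has three arms of equal length, and the end of an arm determines its inner
node. -/
theorem arm_E6 : ∀ p q : Fin 7, marksE6 p = 1 → q ∈ adjE6 p →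
    (p = 0 ∧ q = 2) ∨ (p = 1 ∧ q = 3) ∨ (p = 6 ∧ q = 5) := by
  decide

/-- The centre is fixed and the arms are permuted. Of the six permutations, the two rotations and
two of the three reflections move the node zero. -/
theorem eq_of_diagram_E6 {π : Equiv.Perm (Fin 7)} (hm : ∀ i, marksE6 (π i) = marksE6 i)
    (hadj : ∀ i j, j ∈ adjE6 i → π j ∈ adjE6 (π i)) (h0 : π 0 ≠ 0) :
    π = rotE6 ∨ π = rotE6⁻¹ ∨ π = reflE6 ∨ π = reflE6' := by
  have h4 : π 4 = 4 := by
    have : ∀ p : Fin 7, marksE6 p = 3 → p = 4 := by decide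
    exact this _ (hm 4)
  have a0 := arm_E6 (π 0) (π 2) (hm 0) (hadj 0 2 (by decide))
  have a1 := arm_E6 (π 1) (π 3) (hm 1) (hadj 1 3 (by decide))
  have a6 := arm_E6 (π 6) (π 5) (hm 6) (hadj 6 5 (by decide))
  have n01 : π 0 ≠ π 1 := fun h => absurd (π.injective h) (by decide)
  have n06 : π 0 ≠ π 6 := fun h => absurd (π.injective h) (by decide)
  have n16 : π 1 ≠ π 6 := fun h => absurd (π.injective h) (by decide)
  have ext : ∀ σ : Equiv.Perm (Fin 7), π 0 = σ 0 → π 1 = σ 1 → π 2 = σ 2 → π 3 = σ 3 →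
      π 4 = σ 4 → π 5 = σ 5 → π 6 = σ 6 → π = σ := by
    intro σ g0 g1 g2 g3 g4 g5 g6
    ext i
    fin_cases i
    · exact congrArg Fin.val g0
    · exact congrArg Fin.val g1
    · exact congrArg Fin.val g2
    · exact congrArg Fin.val g3
    · exact congrArg Fin.val g4
    · exact congrArg Fin.val g5
    · exact congrArg Fin.val g6
  rcases a0 with ⟨b0, b2⟩ | ⟨b0, b2⟩ | ⟨b0, b2⟩
  · exact absurd b0 h0
  · rcases a1 with ⟨b1, b3⟩ | ⟨b1, b3⟩ | ⟨b1, b3⟩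
    · rcases a6 with ⟨b6, b5⟩ | ⟨b6, b5⟩ | ⟨b6, b5⟩
      · exact absurd (b1.trans b6.symm) n16
      · exact absurd (b0.trans b6.symm) n06
      · exact Or.inr (Or.inr (Or.inl (ext _ b0 b1 b2 b3 h4 b5 b6)))
    · exact absurd (b0.trans b1.symm) n01
    · rcases a6 with ⟨b6, b5⟩ | ⟨b6, b5⟩ | ⟨b6, b5⟩
      · exact Or.inl (ext _ b0 b1 b2 b3 h4 b5 b6)
      · exact absurd (b0.trans b6.symm) n06
      · exact absurd (b1.trans b6.symm) n16
  · rcases a1 with ⟨b1, b3⟩ | ⟨b1, b3⟩ | ⟨b1, b3⟩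
    · rcases a6 with ⟨b6, b5⟩ | ⟨b6, b5⟩ | ⟨b6, b5⟩
      · exact absurd (b1.trans b6.symm) n16
      · exact Or.inr (Or.inl (ext _ b0 b1 b2 b3 h4 b5 b6))
      · exact absurd (b0.trans b6.symm) n06
    · rcases a6 with ⟨b6, b5⟩ | ⟨b6, b5⟩ | ⟨b6, b5⟩
      · exact Or.inr (Or.inr (Or.inr (ext _ b0 b1 b2 b3 h4 b5 b6)))
      · exact absurd (b1.trans b6.symm) n16
      · exact absurd (b0.trans b6.symm) n06
    · exact absurd (b0.trans b1.symm) n01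

/-- Starting from an end of mark one, adjacency and the mark three determine the inner nodes of a
long arm. -/
theorem arm_E7 : ∀ p q r : Fin 8, marksE7 p = 1 → q ∈ adjE7 p → r ∈ adjE7 q → marksE7 r = 3 →
    (p = 0 ∧ q = 1 ∧ r = 3) ∨ (p = 7 ∧ q = 6 ∧ r = 5) := by
  decide

theorem eq_of_diagram_E7 {π : Equiv.Perm (Fin 8)} (hm : ∀ i, marksE7 (π i) = marksE7 i)
    (hadj : ∀ i j, j ∈ adjE7 i → π j ∈ adjE7 (π i)) (h0 : π 0 ≠ 0) : π = reflE7 := by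
  have h4 : π 4 = 4 := by
    have : ∀ p : Fin 8, marksE7 p = 4 → p = 4 := by decide
    exact this _ (hm 4)
  have h2 : π 2 = 2 := by
    have : ∀ p : Fin 8, marksE7 p = 2 → p ∈ adjE7 4 → p = 2 := by decide
    refine this _ (hm 2) ?_
    rw [← h4]
    exact hadj 4 2 (by decide)
  obtain ⟨b0, b1, b3⟩ := (arm_E7 (π 0) (π 1) (π 3) (hm 0) (hadj 0 1 (by decide))
    (hadj 1 3 (by decide)) (hm 3)).resolve_left fun h => h0 h.1
  obtain ⟨b7, b6, b5⟩ := (arm_E7 (π 7) (π 6) (π 5) (hm 7) (hadj 7 6 (by decide))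
    (hadj 6 5 (by decide)) (hm 5)).resolve_right fun h =>
      absurd (π.injective (b0.trans h.1.symm)) (by decide)
  ext i
  fin_cases i
  · exact congrArg Fin.val b0
  · exact congrArg Fin.val b1
  · exact congrArg Fin.val h2
  · exact congrArg Fin.val b3
  · exact congrArg Fin.val h4
  · exact congrArg Fin.val b5
  · exact congrArg Fin.val b6
  · exact congrArg Fin.val b7

section Rows

set_option linter.unusedSectionVars false

variable {ι V E : Type*} [Finite ι] [AddCommGroup V] [Module ℝ V] [AddCommGroup E] [Module ℝ E]
  {P : RootPairing ι ℝ V E} [P.IsRootSystem] [P.IsCrystallographic] [P.IsReduced] {b : P.Base}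
  {θ : ι} {ω : P.weylGroup}

/-- Common to the rotation and its inverse, which have the same orbits on the nodes. The function
`I` is the indicator of the three ends; the matrix in `hfaith` takes the fold to twice the orbit
sum. -/
theorem foldingFormula_E6 {e : Fin 6 ≃ b.support} {π : Equiv.Perm (Fin 7)}
    {f : V →ₗ[ℝ] (Fin 8 → ℝ)} (hf : Function.Injective f) (hθ : IsHighestRoot b θ)
    (hΦ : f '' Set.range P.root = scaledSet (1 / 2) listE6)
    (hS : ∀ k, f (P.root (e k)) = scaledVec (1 / 2) (nodesE6 k.succ))
    (hπ : ∀ i, P.weylGroupToPerm ω (node θ e i) = node θ e (π i)) (hω : ω ≠ 1)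
    (h3 : π ^ 3 = 1) (hinv : ∀ i, foldE6.mulVec (nodesE6 (π i)) = foldE6.mulVec (nodesE6 i))
    (hI : ∀ i, (![1, 1, 0, 0, 0, 0, 1] : Fin 7 → ℤ) (π i) = ![1, 1, 0, 0, 0, 0, 1] i)
    (hdiv : ∀ y : Fin 7 → ℤ, (∀ i, y (π i) = y i) → (3 : ℤ) ∣ ∑ i, marksE6 i * y i)
    (hfaith : ∀ i, Matrix.mulVec (![![0, 0, 0], ![2, -2, 0], ![-2, 0, 2], ![0, -2, 2], ![0, 0, 0],
      ![0, 0, 0], ![0, 0, 0], ![0, 0, 0]] : Matrix (Fin 8) (Fin 3) ℤ) (foldE6.mulVec (nodesE6 i)) =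
        (2 : ℤ) • ∑ t ∈ Finset.range 3, nodesE6 ((π ^ t) i)) :
    FoldingFormula P ω rootsG2 (dualRoots 6 rootsG2) 1 := by
  have := foldingFormula_of_list isExtendedDiagram_E6 hf (by norm_num) hθ hΦ hS hπ hω
    (by norm_num) h3 isListFolding_E6 (by norm_num) (by norm_num) ![1, 1, 0, 0, 0, 0, 1] hI
    (by decide) hdiv (by decide) hinv hfaith (by norm_num) (ρ := 1) (by norm_num)
  rw [← rootsG2_eq] at this
  convert this using 2
  norm_num

theorem exists_row_E6 {e : Fin 6 ≃ b.support} {π : Equiv.Perm (Fin 7)}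
    {f : V →ₗ[ℝ] (Fin 8 → ℝ)} (hf : Function.Injective f) (hθ : IsHighestRoot b θ)
    (hΦ : f '' Set.range P.root = rootsE6)
    (hS : ∀ k : Fin 6, f (P.root (e k)) = DynkinType.simpleE (k + 1))
    (hπ : ∀ i, P.weylGroupToPerm ω (node θ e i) = node θ e (π i)) (hπ0 : π 0 ≠ 0) :
    ∃ (n : ℕ) (R R' : Set (Fin n → ℝ)) (d : ℕ), FoldingTable .E6 (π 0) R R' d ∧
      FoldingFormula P ω R R' d := by
  have hS' : ∀ k, f (P.root (e k)) = scaledVec (1 / 2) (nodesE6 k.succ) := fun k =>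
    (hS k).trans (simpleE_eq (k.castLE (by norm_num)))
  have hs : (1 / 2 : ℝ) ≠ 0 := by norm_num
  rw [rootsE6_eq] at hΦ
  have hω := ne_one_of_node_perm hθ hπ hπ0
  have hm : ∀ i, marksE6 (π i) = marksE6 i := by
    intro i
    have := mark_perm hθ hπ i
    rwa [mark_of_list isExtendedDiagram_E6 hf hθ hΦ hS',
      mark_of_list isExtendedDiagram_E6 hf hθ hΦ hS'] at this
  have hadj : ∀ i j, j ∈ adjE6 i → π j ∈ adjE6 (π i) := by
    intro i j hij
    rw [← adjE6_iff] at hij ⊢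
    exact add_mem_of_list isExtendedDiagram_E6 hf hs hθ hΦ hS' hπ hij
  rcases eq_of_diagram_E6 hm hadj hπ0 with rfl | rfl | rfl | rfl
  · refine ⟨_, _, _, _, .E6 1 (Or.inl rfl), foldingFormula_E6 hf hθ hΦ hS' hπ hω (by decide)
      (by decide +kernel) (by decide) ?_ (by decide +kernel)⟩
    intro y hy
    have y0 : y 1 = y 0 := hy 0
    have y1 : y 6 = y 1 := hy 1
    have y2 : y 3 = y 2 := hy 2
    have y3 : y 5 = y 3 := hy 3
    rw [Fin.sum_univ_seven]
    simp [marksE6]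
    omega
  · refine ⟨_, _, _, _, .E6 6 (Or.inr rfl), foldingFormula_E6 hf hθ hΦ hS' hπ hω (by decide)
      (by decide +kernel) (by decide) ?_ (by decide +kernel)⟩
    intro y hy
    have y0 : y 6 = y 0 := hy 0
    have y1 : y 0 = y 1 := hy 1
    have y2 : y 5 = y 2 := hy 2
    have y3 : y 2 = y 3 := hy 3
    rw [Fin.sum_univ_seven]
    simp [marksE6]
    omega
  -- The reflections of the diagram preserve the values at the nodes of an explicit regular form, so
  -- an element of the Weyl group inducing one of them would be the identity.
  · exact absurd (eq_one_of_list isExtendedDiagram_E6 hs hθ hΦ hS' hπ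
      ![0, 1, 2, 3, -8, 0, 0, 0] (by decide +kernel) (by decide +kernel)) hω
  · exact absurd (eq_one_of_list isExtendedDiagram_E6 hs hθ hΦ hS' hπ
      ![0, 1, 2, 3, 4, 4, 4, -4] (by decide +kernel) (by decide +kernel)) hω

theorem exists_row_E7 {e : Fin 7 ≃ b.support} {π : Equiv.Perm (Fin 8)}
    {f : V →ₗ[ℝ] (Fin 8 → ℝ)} (hf : Function.Injective f) (hθ : IsHighestRoot b θ)
    (hΦ : f '' Set.range P.root = rootsE7)
    (hS : ∀ k : Fin 7, f (P.root (e k)) = DynkinType.simpleE (k + 1))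
    (hπ : ∀ i, P.weylGroupToPerm ω (node θ e i) = node θ e (π i)) (hπ0 : π 0 ≠ 0) :
    ∃ (n : ℕ) (R R' : Set (Fin n → ℝ)) (d : ℕ), FoldingTable .E7 (π 0) R R' d ∧
      FoldingFormula P ω R R' d := by
  have hS' : ∀ k, f (P.root (e k)) = scaledVec (1 / 2) (nodesE7 k.succ) := fun k =>
    (hS k).trans (simpleE_eq (k.castLE (by norm_num)))
  have hs : (1 / 2 : ℝ) ≠ 0 := by norm_num
  rw [rootsE7_eq] at hΦ
  have hω := ne_one_of_node_perm hθ hπ hπ0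
  have hm : ∀ i, marksE7 (π i) = marksE7 i := by
    intro i
    have := mark_perm hθ hπ i
    rwa [mark_of_list isExtendedDiagram_E7 hf hθ hΦ hS',
      mark_of_list isExtendedDiagram_E7 hf hθ hΦ hS'] at this
  have hadj : ∀ i j, j ∈ adjE7 i → π j ∈ adjE7 (π i) := by
    intro i j hij
    rw [← adjE7_iff] at hij ⊢
    exact add_mem_of_list isExtendedDiagram_E7 hf hs hθ hΦ hS' hπ hij
  obtain rfl := eq_of_diagram_E7 hm hadj hπ0
  refine ⟨_, _, _, _, .E7, ?_⟩
  have hdiv : ∀ y : Fin 8 → ℤ, (∀ i, y (reflE7 i) = y i) →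
      ((2 : ℕ) : ℤ) ∣ ∑ i, marksE7 i * y i := by
    intro y hy
    have y0 : y 7 = y 0 := hy 0
    have y1 : y 6 = y 1 := hy 1
    have y3 : y 5 = y 3 := hy 3
    rw [Fin.sum_univ_eight]
    simp [marksE7]
    omega
  -- `B` takes the fold to four times the orbit sum, and `I` is the indicator of the two ends of
  -- mark one. With `ρ = 1 / 2` the constant `ρ ^ 2 * 8` is the squared length 2 of the long roots
  -- of `F_4`.
  have := foldingFormula_of_list (B := ![![0, 2, -2, -2], ![0, 2, -2, 2], ![0, 2, 2, -2],
      ![0, 2, 2, 2], ![2, 0, 0, 0], ![-2, 0, 0, 0], ![-2, 0, 0, 0], ![2, 0, 0, 0]]) (a := 4)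
    isExtendedDiagram_E7 hf hs hθ hΦ hS' hπ hω
    (by norm_num) (by decide) isListFolding_E7 (by norm_num) (by norm_num) ![1, 0, 0, 0, 0, 0, 0, 1]
    (by decide) (by decide) hdiv (by decide) (by decide +kernel) (by decide +kernel) (by norm_num)
    (ρ := 1 / 2) (by norm_num)
  rw [← rootsF4_eq] at this
  convert this using 2
  norm_num

/-- The node zero is the only node of mark one, and marks are invariant; the same reason applies to
`F_4` and `G_2`. -/
theorem perm_zero_E8 {e : Fin 8 ≃ b.support} {π : Equiv.Perm (Fin 9)}
    {f : V →ₗ[ℝ] (Fin 8 → ℝ)} (hf : Function.Injective f) (hθ : IsHighestRoot b θ)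
    (hΦ : f '' Set.range P.root = rootsE8)
    (hS : ∀ k : Fin 8, f (P.root (e k)) = DynkinType.simpleE (k + 1))
    (hπ : ∀ i, P.weylGroupToPerm ω (node θ e i) = node θ e (π i)) : π 0 = 0 :=
  perm_zero_of_list isExtendedDiagram_E8 hf hθ (hΦ.trans rootsE8_eq)
    (fun k => (hS k).trans (simpleE_eq k)) hπ (by decide)

theorem perm_zero_F4 {e : Fin 4 ≃ b.support} {π : Equiv.Perm (Fin 5)}
    {f : V →ₗ[ℝ] (Fin 4 → ℝ)} (hf : Function.Injective f) (hθ : IsHighestRoot b θ)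
    (hΦ : f '' Set.range P.root = rootsF4)
    (hS : ∀ k, f (P.root (e k)) = (![![0, 1, -1, 0], ![0, 0, 1, -1], ![0, 0, 0, 1],
      ![1/2, -1/2, -1/2, -1/2]] : Fin 4 → Fin 4 → ℝ) k)
    (hπ : ∀ i, P.weylGroupToPerm ω (node θ e i) = node θ e (π i)) : π 0 = 0 := by
  refine perm_zero_of_list isExtendedDiagram_F4 hf hθ (hΦ.trans rootsF4_eq)
    (fun k => (hS k).trans ?_) hπ (by decide)
  ext a
  rw [nodesF4, Fin.cons_succ]
  fin_cases k <;> fin_cases a <;> norm_num [scaledVec]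

theorem perm_zero_G2 {e : Fin 2 ≃ b.support} {π : Equiv.Perm (Fin 3)}
    {f : V →ₗ[ℝ] (Fin 3 → ℝ)} (hf : Function.Injective f) (hθ : IsHighestRoot b θ)
    (hΦ : f '' Set.range P.root = rootsG2)
    (hS : ∀ k, f (P.root (e k)) = (![![1, -1, 0], ![-2, 1, 1]] : Fin 2 → Fin 3 → ℝ) k)
    (hπ : ∀ i, P.weylGroupToPerm ω (node θ e i) = node θ e (π i)) : π 0 = 0 := by
  refine perm_zero_of_list isExtendedDiagram_G2 hf hθ (hΦ.trans rootsG2_eq)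
    (fun k => (hS k).trans ?_) hπ (by decide)
  ext a
  rw [nodesG2, Fin.cons_succ]
  fin_cases k <;> fin_cases a <;> norm_num [scaledVec]

end Rows

end RootPairing

/-! ### The theorem. -/

theorem theorem5p6 {ι V E : Type*} [Finite ι] [AddCommGroup V] [Module ℝ V]
    [AddCommGroup E] [Module ℝ E] (P : RootPairing ι ℝ V E)
    [P.IsRootSystem] [P.IsCrystallographic] [P.IsReduced] [P.IsIrreducible]
    (b : P.Base) (θ : ι) (hθ : RootPairing.IsHighestRoot b θ)
    (X : DynkinType) (e : Fin X.rank ≃ b.support) (hX : RootPairing.IsOfType b X e)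
    (ω : P.weylGroup) (hω : ω ∈ RootPairing.alcoveStabilizer b θ) :
    ∃ j : ℕ, RootPairing.IsOmega b θ e j ω ∧
      ∃ (n : ℕ) (R R' : Set (Fin n → ℝ)) (d : ℕ), FoldingTable X j R R' d ∧
        (∃ ψ : (Fin n → ℝ) →ₗ[ℝ] V, IsRealization R (P.foldedRoots ω) ψ) ∧
        ∀ ψ : (Fin n → ℝ) →ₗ[ℝ] V, IsRealization R (P.foldedRoots ω) ψ →
          ∀ q : ℕ, 0 < q →
            P.equivChar q ω =
              cFun (orderOf ω) q *
                P.charQuasi ((fun β : V => (d : ℝ) • β) '' (ψ '' R'))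
                  (P.foldedCoweightLattice ω) q := by
  obtain ⟨f, hf, hΦ, hS⟩ := hX
  obtain ⟨π, hπ, hone, hmark⟩ := RootPairing.exists_node_perm hθ e hω
  -- The index `j` is the node to which `ω` takes the lowest root; if that node is fixed, `ω` is the
  -- identity.
  by_cases h0 : π 0 = 0
  · obtain rfl := hone h0
    exact ⟨0, Or.inl ⟨rfl, rfl⟩, _, _, _, 1, .one X, RootPairing.foldingFormula_one θ e hf hΦ⟩
  · obtain ⟨k, hk⟩ := Fin.exists_succ_eq_of_ne_zero h0
    refine ⟨(π 0 : ℕ), ?_, ?_⟩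
    · rw [← hk]
      exact RootPairing.isOmega_of_node_perm hθ hπ hk.symm (hmark k hk.symm)
    · cases X with
      | A l hl => exact RootPairing.exists_row_typeA hl hf hθ hΦ hS hπ h0
      | B l hl => exact RootPairing.exists_row_typeB hl hf hθ hΦ hS hπ h0
      | C l hl => exact RootPairing.exists_row_typeC hl hf hθ hΦ hS hπ h0
      | D l hl => exact RootPairing.exists_row_typeD hl hf hθ hΦ hS hπ h0
      | E6 => exact RootPairing.exists_row_E6 hf hθ hΦ hS hπ h0
      | E7 => exact RootPairing.exists_row_E7 hf hθ hΦ hS hπ h0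
      | E8 => exact absurd (RootPairing.perm_zero_E8 hf hθ hΦ hS hπ) h0
      | F4 => exact absurd (RootPairing.perm_zero_F4 hf hθ hΦ hS hπ) h0
      | G2 => exact absurd (RootPairing.perm_zero_G2 hf hθ hΦ hS hπ) h0
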